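/- **Setting.** Let $\mathcal S,\mathcal A$ be finite sets with $S$ and $A$ elements, $\tilde{\mathsf P}$ a (nominal) transition kernel, $r:\mathcal S\times\mathcal A\to[0,1]$ a reward, $\pi$ a stationary policy, and $\mathcal P=\bigotimes_{s,a}\mathcal P^a_s$ an uncertainty set of one of three types: contamination, $\mathcal P^a_s=\{(1-\delta)\tilde{\mathsf P}^a_s+\delta q: q\in\Delta(\mathcal S)\}$; total variation (TV), $\mathcal P^a_s=\{q:\frac12\|q-\tilde{\mathsf P}^a_s\|_1\le\delta\}$; Wasserstein, $\mathcal P^a_s=\{q: W_l(\tilde{\mathsf P}^a_s,q)\le\delta\}$ for a metric $d$ on $\mathcal S$ and $l\ge1$. For a kernel $\mathsf P$ let $\mathsf P^\pi(s,s')=\sum_a\pi(a|s)\mathsf P(s'|s,a)$. Assume that $\tilde{\mathsf P}^\pi$ is irreducible and aperiodic and that the radius condition holds: $0\le\delta<1$ (contamination); for some $k\ge1$ all entries of $(\tilde{\mathsf P}^\pi)^k$ are positive and, with $b$ the least of them, $0\le\delta<b/k$ (TV), respectively $0\le\delta<b\,\min_{x\ne y}d(x,y)/k$ (Wasserstein).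 Write $\sigma_{\mathcal P^a_s}(V)=\min_{p\in\mathcal P^a_s}p^\top V$, $\mathbf T_g(V)(s)=\sum_a\pi(a|s)[r(s,a)-g+\sigma_{\mathcal P^a_s}(V)]$, and let $t_{\rm mix}=\sup_{\mathsf P\in\mathcal P}\min\{t\ge1:\max_{\mu_0}\|\mu_0(\mathsf P^\pi)^t-\nu_{\mathsf P}\|_1\le\frac12\}$, where $\nu_{\mathsf P}$ is the stationary distribution of $\mathsf P^\pi$. The anchored robust value function $V^*$ for an anchor state $s_0$ is the function with $V^*(s_0)=0$ that equals, up to an additive constant, the relative value function $s\mapsto\mathbb E_{\pi,\mathsf P_V}[\sum_{t\ge0}(r_t-g)\mid S_0=s]$ of a kernel $\mathsf P_V\in\mathcal P$ that attains all $\sigma_{\mathcal P^a_s}(V^*)$ and the robust average reward $g=g^\pi_{\mathcal P}$, the least average reward over $\mathcal P$. **Algorithm (robust average-reward TD)**, from $V_0\in\mathbb R^{\mathcal S}$ and $g_0=0$. For $t=0,\dots,T-1$: for each $(s,a)$ draw an estimate $\hat\sigma_{s,a}(V_t)$ from fresh samples of $\tilde{\mathsf P}^a_s$; set $V'(s)=V_t(s)+\eta_t\big(\sum_a\pi(a|s)[r(s,a)-g_0+\hat\sigma_{s,a}(V_t)]-V_t(s)\big)$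 and $V_{t+1}(s)=V'(s)-V'(s_0)$. Then for $t=0,\dots,T-1$: draw fresh estimates $\hat\sigma_{s,a}(V_T)$, let $\bar\delta_t=\frac1S\sum_s\big(\sum_a\pi(a|s)[r(s,a)+\hat\sigma_{s,a}(V_T)]-V_T(s)\big)$, and set $g_{t+1}=g_t+\beta_t(\bar\delta_t-g_t)$. Output $(V_T,g_T)$. For contamination, $\hat\sigma_{s,a}(V)=(1-\delta)V(s')+\delta\min V$ with one sample $s'\sim\tilde{\mathsf P}^a_s$. For TV and Wasserstein (truncated multilevel Monte Carlo): with $\mathbb P(N=n)=2^{-(n+1)}$, $n\ge0$, put $N'=\min(N,N_{\max})$, draw $2^{N'+1}$ i.i.d. samples, and set $\hat\sigma_{s,a}(V)=\sigma_{1}(V)+\frac{1}{p'(N')}\big(\sigma_{\rm all}(V)-\frac12(\sigma_{\rm even}(V)+\sigma_{\rm odd}(V))\big)$, where $p'(n)=\mathbb P(N'=n)$ and the $\sigma$'s are the support functions of the uncertainty sets centred at the empirical distributions of the first sample, of all samples, and of the samples with even and odd number. The sample count is that of the whole run, both phases. **Constants.** For a set of matrices let $\hat\rho$ be its joint spectral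 radius, and let $Q_{\mathcal P}=\{\mathsf P^\pi-\mathbf e\nu_{\mathsf P}^\top:\mathsf P\in\mathcal P\}$. By *analysis data* we mean: a seminorm $\|\cdot\|_{\mathcal P}$ on $\mathbb R^{\mathcal S}$ with kernel $\mathbb R\mathbf e$ and $\gamma\in(0,1)$ with $\|\mathsf P^\pi x\|_{\mathcal P}\le\gamma\|x\|_{\mathcal P}$ for all $\mathsf P\in\mathcal P$ and $x$; constants $0<c_{\mathcal P}\le C_{\mathcal P}$ with $c_{\mathcal P}\|x\|_{\rm sp}\le\|x\|_{\mathcal P}\le C_{\mathcal P}\|x\|_{\rm sp}$, where $\|x\|_{\rm sp}=\max x-\min x$; a function $M=\frac12m^2$, $m$ a seminorm, with $c_lM\le\frac12\|\cdot\|_{\mathcal P}^2\le c_uM$ and $0<c_l\le c_u$, which is differentiable and satisfies $M(y)\le M(x)+\langle\nabla M(x),y-x\rangle+\frac L2\|y-x\|_s^2$ with $L>0$ for a seminorm $\|\cdot\|_s\le\rho_2\|\cdot\|_{\mathcal P}$, $\rho_2>0$; and $\alpha_2:=1-\gamma\sqrt{c_u/c_l}>0$. Put $\kappa=C_{\mathcal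 P}/c_{\mathcal P}$ and $\Lambda=c_u\rho_2^2L$. **Theorem.** There is an absolute constant $C_0\ge1$ such that the following hold. 1. $t_{\rm mix}<\infty$; $V^*$ exists, is unique, and solves $V^*=\mathbf T_g(V^*)$ for $g=g^\pi_{\mathcal P}$. Moreover $\hat\rho(Q_{\mathcal P})<1$, and for all $\alpha\in(\hat\rho(Q_{\mathcal P}),1)$ and $\epsilon'\in(0,1-\alpha)$ there are analysis data with $\gamma=\alpha+\epsilon'$, $\alpha_2\ge(1-\gamma)/2$ and $\|x\|_{\mathcal P}=\sup_{Q\in Q_{\mathcal P}}\|Qx\|_{\rm ext}+\epsilon'\inf_{c\in\mathbb R}\|x-c\mathbf e\|_{\rm ext}$, where $\|x\|_{\rm ext}=\sup_{k\ge0}\sup_{Q_1,\dots,Q_k\in Q_{\mathcal P}}\alpha^{-k}\|Q_k\cdots Q_1x\|_2$. For all analysis data, $\|\mathbf T_g(V_1)-\mathbf T_g(V_2)\|_{\mathcal P}\le\gamma\|V_1-V_2\|_{\mathcal P}$ for all $V_1,V_2,g$. 2. (Finite-time bounds.) For all analysis data, all $V_0$, $(\beta_t)$ and $T\ge0$, with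 $\eta_t=\frac{1}{\alpha_2(t+K)}$: for contamination sets, if $K\ge\max\{C_0\kappa^2\Lambda/\alpha_2^2,3\}$, $$\mathbb E\|V_T-V^*\|_\infty^2\le C_0\kappa^2\Big[\frac{c_u}{c_l}\frac{K^2}{(T+K)^2}\|V_0-V^*\|_\infty^2+\frac{\Lambda\,t_{\rm mix}^2}{(T+K)\alpha_2^2}\Big];$$ for TV and Wasserstein sets and every $N_{\max}\ge0$, if $K\ge\max\{C_0\kappa^2\Lambda S(N_{\max}+1)/\alpha_2^2,3\}$, $$\mathbb E\|V_T-V^*\|_\infty^2\le C_0\kappa^2\Big[\frac{c_u}{c_l}\frac{K^2}{(T+K)^2}\|V_0-V^*\|_\infty^2+\frac{\Lambda S(N_{\max}+1)t_{\rm mix}^2}{(T+K)\alpha_2^2}+\frac{c_u}{c_l}\frac{\sqrt S\,2^{-N_{\max}/2}\,t_{\rm mix}^2}{(1-\gamma)^2}\Big].$$ 3. (Sample complexity.) For every $H$ there is $C>0$, depending only on $H$, such that for every such robust MDP, all analysis data with $\kappa,\ c_u/c_l,\ \Lambda,\ (1-\gamma)/\alpha_2\le H$, every $V_0$ with $\|V_0\|_\infty\le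 H$ and every $\epsilon\in(0,1]$: with $\eta_t=\frac1{\alpha_2(t+K)}$, $K$ equal to the threshold in 2, there is a run length $T$ (and an $N_{\max}$, for TV and Wasserstein sets) with $\mathbb E\|V_T-V^*\|_\infty^2\le\epsilon^2$ whose expected number of samples is at most $$C\,\frac{SA\,t_{\rm mix}^2}{\epsilon^2(1-\gamma)^2}\ \text{ (contamination)},\qquad C\,\frac{SA\,t_{\rm mix}^2}{\epsilon^2(1-\gamma)^2}\Big(1+\log\frac{\sqrt S\,t_{\rm mix}}{\epsilon(1-\gamma)}\Big)^2\ \text{ (TV, Wasserstein)}.$$ 4. (Order-optimality in $\epsilon$.) Consider two states $s_1,s_2$ and one action, with nominal kernel $\Pr(s_1\to s_1)=p$, $\Pr(s_1\to s_2)=1-p$, $\Pr(s_2\to s_1)=\Pr(s_2\to s_2)=\frac12$, and $r(s_1)=1$, $r(s_2)=0$. For every uncertainty set type and radius for which the assumptions hold at $p=\frac12$, there are $c,\epsilon_0>0$ such that for every $\epsilon\in(0,\epsilon_0]$ and either anchor state: any (randomized, sequentially stopped, boundedly many rounds) estimator $\hat V$ based on rounds of one nominal next-state sample per state-action pair, with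 $\mathbb E_p\|\hat V-V^*_p\|_\infty^2\le\epsilon^2$ for all $p\in(0,1)$ for which the assumptions hold, uses in expectation at least $c/\epsilon^2$ rounds for some such $p$. -/

import Mathlib

open Filter Topology Matrix
open scoped Pointwise

universe u v

noncomputable section

/-! ### Elementary quantities on a finite state space -/

/-- The span semi-norm `max V - min V`. -/
def spanSeminorm {S : Type*} (V : S → ℝ) : ℝ := (⨆ s, V s) - ⨅ s, V s

/-- The Euclidean norm of a vector. -/
def euclNorm {S : Type*} [Fintype S] (x : S → ℝ) : ℝ := Real.sqrt (∑ s, x s ^ 2)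

/-- The Frobenius norm of a matrix. -/
def frobNorm {S : Type*} [Fintype S] (M : Matrix S S ℝ) : ℝ :=
  Real.sqrt (∑ i, ∑ j, M i j ^ 2)

/-- `ν` is a stationary distribution of the transition matrix `M`. -/
def IsStationaryDist {S : Type*} [Fintype S] (M : Matrix S S ℝ) (ν : S → ℝ) : Prop :=
  ν ∈ stdSimplex ℝ S ∧ ν ᵥ* M = ν

/-- Aperiodicity: at every state, the greatest common divisor of the return times is `1`. -/
def IsAperiodicChain {S : Type*} [Fintype S] [DecidableEq S] (M : Matrix S S ℝ) : Prop :=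
  ∀ i : S, ∀ k : ℕ, (∀ n : ℕ, 0 < n → 0 < (M ^ n) i i → k ∣ n) → k = 1

/-- The mixing time: the least `t ≥ 1` such that `‖μ₀ Mᵗ - ν‖₁ ≤ 1/2` for all initial
distributions `μ₀`, where `ν` is the invariant distribution. -/
def mixingTime {S : Type*} [Fintype S] [DecidableEq S] (M : Matrix S S ℝ) : ℕ :=
  sInf {t : ℕ | 1 ≤ t ∧ ∃ ν : S → ℝ, IsStationaryDist M ν ∧
    ∀ μ₀ ∈ stdSimplex ℝ S, ∑ s, |(μ₀ ᵥ* (M ^ t)) s - ν s| ≤ 1 / 2}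

/-! ### Uncertainty sets -/

/-- `μ` is a coupling of the distributions `p` and `q`. -/
def IsCoupling {S : Type*} [Fintype S] (p q : S → ℝ) (μ : S → S → ℝ) : Prop :=
  (∀ x y, 0 ≤ μ x y) ∧ (∀ x, ∑ y, μ x y = p x) ∧ (∀ y, ∑ x, μ x y = q y)

/-- The `l`-Wasserstein distance with ground metric `dist`. -/
def wassersteinDist {S : Type*} [Fintype S] (m : MetricSpace S) (l : ℝ) (p q : S → ℝ) : ℝ :=
  sInf {c : ℝ | ∃ μ : S → S → ℝ, IsCoupling p q μ ∧
    c = (∑ x, ∑ y, μ x y * (m.dist x y) ^ l) ^ (1 / l)}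

/-- The three families of uncertainty sets, with their parameters (`δ` is the radius). -/
inductive UncertaintySet (S : Type*) where
  | contamination (δ : ℝ) : UncertaintySet S
  | totalVariation (δ : ℝ) : UncertaintySet S
  | wasserstein (m : MetricSpace S) (l δ : ℝ) : UncertaintySet S

namespace UncertaintySet

variable {S : Type*} [Fintype S]

/-- The set of distributions on `S` that the model allows when it is centred at `p`. -/
def ball (U : UncertaintySet S) (p : S → ℝ) : Set (S → ℝ) :=
  match U with
  | contamination δ => {q | ∃ q' ∈ stdSimplex ℝ S, q = (1 - δ) • p + δ • q'}
  | totalVariation δ => {q | q ∈ stdSimplex ℝ S ∧ 1 / 2 * ∑ s, |q s - p s| ≤ δ}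
  | wasserstein m l δ => {q | q ∈ stdSimplex ℝ S ∧ wassersteinDist m l p q ≤ δ}

/-- The support function `V ↦ min {qᵀ V}` over the uncertainty set centred at `p`. -/
def support (U : UncertaintySet S) (p V : S → ℝ) : ℝ :=
  sInf ((fun q : S → ℝ => q ⬝ᵥ V) '' U.ball p)

/-- The radius conditions, for a nominal transition matrix `M`. For total variation,
`δ < b / k`, and for Wasserstein balls, `δ < δ_min b / k`, for some `k ≥ 1` such that `M ^ k` is
entrywise positive, where `b` is the least entry of `M ^ k` and `δ_min` is the least distance of
two distinct points. -/
def RadiusCondition [DecidableEq S] (U : UncertaintySet S) (M : Matrix S S ℝ) : Prop :=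
  match U with
  | contamination δ => 0 ≤ δ ∧ δ < 1
  | totalVariation δ => 0 ≤ δ ∧ ∃ k : ℕ, 1 ≤ k ∧
      (∀ i j, 0 < (M ^ k) i j) ∧ ∀ i j, δ < (M ^ k) i j / k
  | wasserstein m l δ => 1 ≤ l ∧ 0 ≤ δ ∧ ∃ k : ℕ, 1 ≤ k ∧
      (∀ i j, 0 < (M ^ k) i j) ∧ ∀ x y, x ≠ y → ∀ i j, δ < m.dist x y * (M ^ k) i j / k

/-- The model is a total variation or a Wasserstein model. -/
def IsTVOrWasserstein (U : UncertaintySet S) : Prop :=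
  (∃ δ, U = totalVariation δ) ∨ ∃ m l δ, U = wasserstein m l δ

end UncertaintySet

/-! ### Robust average-reward Markov decision processes with a fixed policy -/

/-- A robust MDP together with the policy to be evaluated: the nominal kernel (the centre of the
uncertainty set), the reward, the stationary policy and the uncertainty model. -/
structure RobustMDP (S A : Type*) where
  nominal : S → A → S → ℝ
  reward : S → A → ℝ
  policy : S → A → ℝ
  unc : UncertaintySet S

namespace RobustMDP

variable {S A : Type*} [Fintype S] [Fintype A] [DecidableEq S] (I : RobustMDP S A)

/-- The transition matrix `P^π` on states that the policy induces from the kernel `P`. -/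
def chain (P : S → A → S → ℝ) : Matrix S S ℝ :=
  Matrix.of fun s s' => ∑ a, I.policy s a * P s a s'

/-- The expected one-step reward of the policy. -/
def policyReward (s : S) : ℝ := ∑ a, I.policy s a * I.reward s a

/-- The `(s,a)`-rectangular uncertainty set of kernels. -/
def kernels : Set (S → A → S → ℝ) := {P | ∀ s a, P s a ∈ I.unc.ball (I.nominal s a)}

/-- The standing assumptions: the data are a genuine MDP and policy with rewards in `[0,1]`, the
nominal chain of the policy is irreducible and aperiodic, and the radius condition holds. -/
structure Admissible : Prop where
  nominal_mem : ∀ s a, I.nominal s a ∈ stdSimplex ℝ S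
  reward_mem : ∀ s a, I.reward s a ∈ Set.Icc (0 : ℝ) 1
  policy_mem : ∀ s, I.policy s ∈ stdSimplex ℝ A
  irreducible : (I.chain I.nominal).IsIrreducible
  aperiodic : IsAperiodicChain (I.chain I.nominal)
  radius : I.unc.RadiusCondition (I.chain I.nominal)

/-- The set of the mixing times of the chains of all kernels in the uncertainty set. -/
def mixingTimes : Set ℕ := (fun P => mixingTime (I.chain P)) '' I.kernels

/-- The worst mixing time over the uncertainty set. -/
def tMix : ℕ := sSup I.mixingTimes

/-- `g` is the average reward of the policy under the kernel `P`, from every initial state.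
The expected reward at time `t` from the initial state `s` is `((P^π)^t r^π)(s)`. -/
def HasAverageReward (P : S → A → S → ℝ) (g : ℝ) : Prop :=
  ∀ s, Tendsto (fun T : ℕ =>
    (∑ t ∈ Finset.range T, ((I.chain P) ^ t *ᵥ I.policyReward) s) / T) atTop (𝓝 g)

/-- `g` is the robust average reward: the least average reward over the uncertainty set. -/
def IsRobustAverageReward (g : ℝ) : Prop :=
  IsLeast {x | ∃ P ∈ I.kernels, I.HasAverageReward P x} g

/-- The support function of the uncertainty set at the pair `(s,a)`. -/
def sigma (s : S) (a : A) (V : S → ℝ) : ℝ := I.unc.support (I.nominal s a) V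

/-- The robust Bellman operator `T_g`. -/
def bellman (g : ℝ) (V : S → ℝ) (s : S) : ℝ :=
  ∑ a, I.policy s a * (I.reward s a - g + I.sigma s a V)

/-- `V` is the robust value function anchored at `s₀`: `V s₀ = 0` and, for a kernel `P` of the
uncertainty set which attains all support functions at `V` and the robust average reward `g`, `V`
is up to an additive constant `c` the relative value function
`s ↦ E[∑ₜ (rₜ - g) | S₀ = s]` under `P`. -/
def IsAnchoredRobustValue (s₀ : S) (V : S → ℝ) : Prop :=
  V s₀ = 0 ∧ ∃ P ∈ I.kernels, ∃ g c : ℝ,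
    (∀ s a, P s a ⬝ᵥ V = I.sigma s a V) ∧
    I.IsRobustAverageReward g ∧ I.HasAverageReward P g ∧
    ∀ s, HasSum (fun t : ℕ => ((I.chain P) ^ t *ᵥ I.policyReward) s - g) (V s - c)

/-! ### The contraction semi-norm -/

/-- The family of the matrices `P^π - E_P` for `P` in the uncertainty set, where all rows of `E_P`
are the stationary distribution of `P^π`. -/
def fluctuations : Set (Matrix S S ℝ) :=
  {Q | ∃ P ∈ I.kernels, ∃ ν, IsStationaryDist (I.chain P) ν ∧
    Q = I.chain P - Matrix.of fun _ s' => ν s'}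

/-- The joint spectral radius of the family; `𝒬 ^ k` is the set of all products of `k` members. -/
def jointSpectralRadius (𝒬 : Set (Matrix S S ℝ)) : ℝ :=
  limsup (fun k : ℕ => (sSup (frobNorm '' (𝒬 ^ k))) ^ ((1 : ℝ) / k)) atTop

/-- The extremal norm with rate `α`. -/
def extNorm (α : ℝ) (x : S → ℝ) : ℝ :=
  sSup {y | ∃ k : ℕ, ∃ M ∈ I.fluctuations ^ k, y = (α ^ k)⁻¹ * euclNorm (M *ᵥ x)}

/-- The semi-norm `sup_P ‖(P^π - E_P) x‖_ext + ε inf_c ‖x - c e‖_ext`. -/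
def robustSeminorm (α ε : ℝ) (x : S → ℝ) : ℝ :=
  sSup ((fun Q : Matrix S S ℝ => I.extNorm α (Q *ᵥ x)) '' I.fluctuations)
    + ε * ⨅ c : ℝ, I.extNorm α (fun s => x s - c)

end RobustMDP

/-- The quantities in the convergence analysis: a semi-norm `N` with contraction factor `γ`, its
equivalence constants `cP`, `CP` with the span semi-norm, the semi-norm `m` such that `½ m²` is the
smooth approximation (generalized Moreau envelope) of `½ N²`, with approximation constants `cl`,
`cu`, and the semi-norm `s` in which `½ m²` is `L`-smooth, with `s ≤ ρ N`. -/
structure AnalysisData (S : Type*) where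
  N : Seminorm ℝ (S → ℝ)
  m : Seminorm ℝ (S → ℝ)
  s : Seminorm ℝ (S → ℝ)
  γ : ℝ
  cP : ℝ
  CP : ℝ
  cl : ℝ
  cu : ℝ
  L : ℝ
  ρ : ℝ

namespace AnalysisData

variable {S A : Type*} [Fintype S] [Fintype A] [DecidableEq S]

/-- The ratio of the equivalence constants with the span semi-norm. -/
def κ (D : AnalysisData S) : ℝ := D.CP / D.cP

/-- The scale-invariant smoothness constant `c_u ρ² L`. -/
def Λ (D : AnalysisData S) : ℝ := D.cu * D.ρ ^ 2 * D.L

/-- `α₂ = 1 - γ √(c_u / c_l)`. -/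
def α₂ (D : AnalysisData S) : ℝ := 1 - D.γ * Real.sqrt (D.cu / D.cl)

/-- The smooth Lyapunov function `½ m²`. -/
def M (D : AnalysisData S) (x : S → ℝ) : ℝ := 1 / 2 * D.m x ^ 2

/-- `D` is analysis data for the robust MDP `I`. The contraction is that of all Bellman operators
`T_g^P` with `P` in the uncertainty set, that is, of all matrices `P^π`. -/
structure Valid (D : AnalysisData S) (I : RobustMDP S A) : Prop where
  γ_mem : D.γ ∈ Set.Ioo (0 : ℝ) 1
  kernel : ∀ x : S → ℝ, D.N x = 0 ↔ ∃ c : ℝ, x = fun _ => c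
  contraction : ∀ P ∈ I.kernels, ∀ x : S → ℝ, D.N (I.chain P *ᵥ x) ≤ D.γ * D.N x
  cP_pos : 0 < D.cP
  cP_le_CP : D.cP ≤ D.CP
  le_N : ∀ x, D.cP * spanSeminorm x ≤ D.N x
  N_le : ∀ x, D.N x ≤ D.CP * spanSeminorm x
  cl_pos : 0 < D.cl
  cl_le_cu : D.cl ≤ D.cu
  le_half_sq : ∀ x, D.cl * D.M x ≤ 1 / 2 * D.N x ^ 2
  half_sq_le : ∀ x, 1 / 2 * D.N x ^ 2 ≤ D.cu * D.M x
  L_pos : 0 < D.L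
  differentiable : Differentiable ℝ D.M
  smooth : ∀ x y, D.M y ≤ D.M x + fderiv ℝ D.M x (y - x) + D.L / 2 * D.s (y - x) ^ 2
  ρ_pos : 0 < D.ρ
  s_le : ∀ x, D.s x ≤ D.ρ * D.N x
  α₂_pos : 0 < D.α₂

/-- All the constants of the analysis that an `O(·)` may hide are at most `H`. -/
def BoundedBy (D : AnalysisData S) (H : ℝ) : Prop :=
  D.κ ≤ H ∧ D.cu / D.cl ≤ H ∧ D.Λ ≤ H ∧ (1 - D.γ) / D.α₂ ≤ H

end AnalysisData

/-! ### Estimators of the support functions -/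

/-- A randomized estimator of the support functions from samples of the nominal kernel, with
random outcomes in a finite type `Ξ`: `weight s a ξ` is the probability of the outcome `ξ` at the
pair `(s,a)`, `est s a ξ V` the resulting estimate of the support function at `V`, and `cost ξ` the
number of samples of the nominal kernel that were drawn. -/
structure Sampler (S A Ξ : Type*) where
  weight : S → A → Ξ → ℝ
  est : S → A → Ξ → (S → ℝ) → ℝ
  cost : Ξ → ℕ

/-- The one-sample estimator for contamination sets of radius `δ`; the outcome is the sampled
next state. -/
def contaminationSampler {S A : Type*} (I : RobustMDP S A) (δ : ℝ) : Sampler S A S where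
  weight s a s' := I.nominal s a s'
  est _ _ s' V := (1 - δ) * V s' + δ * ⨅ x, V x
  cost _ := 1

/-- The empirical distribution of a finite list of samples. -/
def empirical {S : Type*} [DecidableEq S] {k : ℕ} (x : Fin k → S) (s : S) : ℝ :=
  (Finset.univ.filter fun i => x i = s).card / k

/-- Outcomes of the truncated multilevel Monte Carlo estimator: the truncated level
`n = min N N_max` and `2 ^ (n + 1)` sampled next states. -/
abbrev MLMCDraw (S : Type*) (Nmax : ℕ) : Type _ :=
  Σ n : Fin (Nmax + 1), (Fin (2 ^ ((n : ℕ) + 1)) → S)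

/-- The probability that `min N N_max = n` if `P(N = k) = 2 ^ -(k + 1)` for all `k`. -/
def levelProb (Nmax n : ℕ) : ℝ := if n < Nmax then (1 / 2) ^ (n + 1) else (1 / 2) ^ Nmax

namespace MLMCDraw

variable {S : Type*} {Nmax : ℕ}

/-- The first sample. -/
def first (ξ : MLMCDraw S Nmax) : Fin 1 → S := fun _ => ξ.2 ⟨0, by positivity⟩

/-- The samples of odd number (first, third, and so on). -/
def odd (ξ : MLMCDraw S Nmax) : Fin (2 ^ (ξ.1 : ℕ)) → S :=
  fun i => ξ.2 ⟨2 * i, by have := i.2; rw [pow_succ]; omega⟩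

/-- The samples of even number (second, fourth, and so on). -/
def even (ξ : MLMCDraw S Nmax) : Fin (2 ^ (ξ.1 : ℕ)) → S :=
  fun i => ξ.2 ⟨2 * i + 1, by have := i.2; rw [pow_succ]; omega⟩

end MLMCDraw

/-- The truncated multilevel Monte Carlo estimator. -/
def mlmcSampler {S A : Type*} [Fintype S] [DecidableEq S] (I : RobustMDP S A) (Nmax : ℕ) :
    Sampler S A (MLMCDraw S Nmax) where
  weight s a ξ := levelProb Nmax ξ.1 * ∏ i, I.nominal s a (ξ.2 i)
  est _ _ ξ V :=
    I.unc.support (empirical ξ.first) V +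
      (I.unc.support (empirical ξ.2) V -
        1 / 2 * (I.unc.support (empirical ξ.even) V + I.unc.support (empirical ξ.odd) V)) /
      levelProb Nmax ξ.1
  cost ξ := 2 ^ ((ξ.1 : ℕ) + 1)

/-! ### Robust average-reward TD learning -/

namespace RobustTD

variable {S A Ξ : Type*} [Fintype S] [Fintype A] [DecidableEq S]
variable (I : RobustMDP S A) (E : Sampler S A Ξ)

/-- The sampled Bellman operator; `ξ` contains one outcome of the estimator for each pair. -/
def noisyBellman (g : ℝ) (ξ : S → A → Ξ) (V : S → ℝ) (s : S) : ℝ :=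
  ∑ a, I.policy s a * (I.reward s a - g + E.est s a (ξ s a) V)

/-- One iteration of the first phase, with step size `η`, `g₀ = 0` and anchor state `s₀`. -/
def valueStep (s₀ : S) (η : ℝ) (ξ : S → A → Ξ) (V : S → ℝ) : S → ℝ :=
  let V' : S → ℝ := fun s => V s + η * (noisyBellman I E 0 ξ V s - V s)
  fun s => V' s - V' s₀

/-- The iterate `V_T` of the first phase, along the outcomes `ω 0, …, ω (T - 1)`. -/
def valueIter (s₀ : S) (η : ℕ → ℝ) (V₀ : S → ℝ) : (T : ℕ) → (Fin T → S → A → Ξ) → S → ℝ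
  | 0, _ => V₀
  | T + 1, ω =>
      valueStep I E s₀ (η T) (ω (Fin.last T)) (valueIter s₀ η V₀ T fun i => ω i.castSucc)

/-- The iterate `g_T` of the second phase, started at `g₀ = 0`, for the value function `V`. -/
def rewardIter (β : ℕ → ℝ) (V : S → ℝ) : (T : ℕ) → (Fin T → S → A → Ξ) → ℝ
  | 0, _ => 0
  | T + 1, ω =>
      let g := rewardIter β V T fun i => ω i.castSucc
      g + β T * ((∑ s, (noisyBellman I E 0 (ω (Fin.last T)) V s - V s)) / Fintype.card S - g)

/-- The outcomes of a complete run: those of the first and those of the second phase. -/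
abbrev Run (S A Ξ : Type*) (T : ℕ) : Type _ := (Fin T → S → A → Ξ) × (Fin T → S → A → Ξ)

/-- The output `(V_T, g_T)` of the algorithm. -/
def output (s₀ : S) (η β : ℕ → ℝ) (V₀ : S → ℝ) (T : ℕ) (ω : Run S A Ξ T) : (S → ℝ) × ℝ :=
  let V := valueIter I E s₀ η V₀ T ω.1
  (V, rewardIter I E β V T ω.2)

/-- The number of samples of the nominal kernel that are drawn in a complete run. -/
def samples {T : ℕ} (ω : Run S A Ξ T) : ℝ :=
  ∑ t, ∑ s, ∑ a, ((E.cost (ω.1 t s a) : ℝ) + E.cost (ω.2 t s a))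

/-- The probability of a run: all outcomes are independent. -/
def runWeight {T : ℕ} (ω : Run S A Ξ T) : ℝ :=
  ∏ t, ∏ s, ∏ a, (E.weight s a (ω.1 t s a) * E.weight s a (ω.2 t s a))

/-- The expectation of a function of a run of length `T`. -/
def expectation [DecidableEq A] [Fintype Ξ] (T : ℕ) (f : Run S A Ξ T → ℝ) : ℝ :=
  ∑ ω, runWeight E ω * f ω

/-- The mean square error `E ‖V_T - V‖²` in the sup norm. -/
def meanSqError [DecidableEq A] [Fintype Ξ] (s₀ : S) (η β : ℕ → ℝ) (V₀ : S → ℝ) (T : ℕ)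
    (V : S → ℝ) : ℝ :=
  expectation E T fun ω => ‖(output I E s₀ η β V₀ T ω).1 - V‖ ^ 2

/-- The expected number of samples in a complete run. -/
def expectedSamples [DecidableEq A] [Fintype Ξ] (T : ℕ) : ℝ := expectation E T (samples E)

/-- The step size `η_t = 1 / (α (t + K))`. -/
def stepSize (α K : ℝ) (t : ℕ) : ℝ := 1 / (α * (t + K))

end RobustTD

/-! ### Sequential estimation from samples of the nominal kernel -/

/-- A sequential estimator of a value function. There are at most `n` rounds; a round consists of
one sampled next state for every state-action pair. The estimator may use a random seed in `Z`, it
stops after `rounds` rounds and then returns `est`; both depend only on the seed and on the rounds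
before the stopping time. -/
structure SequentialEstimator (S A Z : Type*) (n : ℕ) where
  rounds : Z → (Fin n → S → A → S) → ℕ
  est : Z → (Fin n → S → A → S) → S → ℝ
  rounds_le : ∀ z x, rounds z x ≤ n
  nonanticipating : ∀ z x y, (∀ i : Fin n, (i : ℕ) < rounds z x → x i = y i) →
    rounds z y = rounds z x ∧ est z y = est z x

/-- Expectation over a seed with law `w` and `n` independent rounds of samples of the nominal
kernel of `I`. -/
def dataExpectation {S A Z : Type*} [Fintype S] [Fintype A] [DecidableEq S] [DecidableEq A]
    [Fintype Z] (I : RobustMDP S A) (w : Z → ℝ) (n : ℕ)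
    (f : Z → (Fin n → S → A → S) → ℝ) : ℝ :=
  ∑ z, ∑ x : Fin n → S → A → S, w z * (∏ i, ∏ s, ∏ a, I.nominal s a (x i s a)) * f z x

/-- The two-state example with a single action: from state `0` the nominal next state is `0` with
probability `p` and `1` with probability `1 - p`, from state `1` it is uniform; the reward is `1` in
state `0` and `0` in state `1`. -/
def bernoulliMDP (U : UncertaintySet (Fin 2)) (p : ℝ) : RobustMDP (Fin 2) Unit where
  nominal s _ s' := if s = 0 then (if s' = 0 then p else 1 - p) else 1 / 2
  reward s _ := if s = 0 then 1 else 0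
  policy _ _ := 1
  unc := U

end

/-! Stability. The radius condition makes all products of some fixed number `k` of chains from the
uncertainty set entrywise bounded below by one positive constant (`exists_doeblin`). Hence arbitrary
products contract the span semi-norm at a uniform geometric rate (`exists_geometric`). This bounds
the mixing times, puts the joint spectral radius of the fluctuation matrices below one, and makes
the extremal norm finite. From it comes a semi-norm contracted by every chain of the set, and a
Moreau envelope smooths half its square (`exists_smooth_approximation`).

Bellman operators. By convexity of the balls, a difference of support functions is `q ⬝ᵥ (V₁ - V₂)`
for a member `q`, so a difference of Bellman images is a chain of the set applied to `V₁ - V₂`. This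
gives contraction and a fixed point modulo constants, which solves the Poisson equation of a worst
kernel. A Poisson solution has span at most `2 * tMix` (`spanSeminorm_le_tMix`).

Biased estimation. The multilevel estimator telescopes: its mean is the expected support function at
the empirical distribution of `2 ^ (N + 1)` samples. Total variation and Wasserstein balls are
transport balls, which are jointly convex in centre and member; therefore this mean is again a lower
envelope of members of the same uncertainty set (`mlmc_isEnvelopeFamily`). The algorithm is thus an
unbiased scheme for a Bellman-type operator with the same contraction factor and the same span
bound. The bias enters only through the distance of two fixed points, and it is free of the
dimension: `transportSupport_empirical_bias` thins out an optimal plan just enough for the empirical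
distribution to afford it with probability at least `3 / 4`.

Rates. The smooth Lyapunov function drops by the factor `1 - 2 * α₂ * η` per step up to second-order
noise, and `recursion_bound` turns this into a `1 / T` rate. For the sample complexity, the factor
`S` that multilevel noise costs is absorbed in the constant: smoothing something equivalent to the
span on many states is expensive, so bounded analysis constants bound the number of states
(`card_le`).

Lower bound. Near `p = 1 / 2` the support functions of the two-state example are affine in `p`, so
the values at `1 / 2` and `1 / 2 + Δ` differ by at least a multiple of `Δ`. One round has chi-square
divergence `4 * Δ ^ 2`, and Cauchy-Schwarz for the likelihood ratio of the first rounds shows that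
fewer than order `1 / ε ^ 2` rounds cannot separate the two. -/

set_option linter.unusedSectionVars false

/-! ### Finite weighted sums and product weights -/

/-- The product of the weights `w i` on functions. -/
def prodWeight {ι X : Type*} [Fintype ι] (w : ι → X → ℝ) (x : ι → X) : ℝ := ∏ i, w i (x i)

section ProdWeight

variable {ι κ X : Type*} [Fintype ι] [Fintype κ] [Fintype X] [DecidableEq ι] [DecidableEq κ]

/-- Marginals of product weights: the fibre of `x ↦ x ∘ e` is a product set, a single point on the
range of `e` and all of `X` elsewhere, so its weight factorizes. It serves both the subsamples of
the multilevel estimator and the change of measure. -/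
lemma sum_prodWeight_comp {w : ι → X → ℝ} (hw : ∀ i, ∑ a, w i a = 1) {e : κ → ι}
    (he : Function.Injective e) (f : (κ → X) → ℝ) :
    ∑ x, prodWeight w x * f (x ∘ e) = ∑ y, prodWeight (fun j => w (e j)) y * f y := by
  classical
  rw [← Finset.sum_fiberwise (Finset.univ : Finset (ι → X)) (fun x => x ∘ e)
    (fun x => prodWeight w x * f (x ∘ e))]
  refine Finset.sum_congr rfl fun y _ => ?_
  have h1 : ∑ x ∈ Finset.univ.filter (fun x : ι → X => x ∘ e = y), prodWeight w x * f (x ∘ e)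
      = (∑ x ∈ Finset.univ.filter (fun x : ι → X => x ∘ e = y), prodWeight w x) * f y := by
    rw [Finset.sum_mul]
    refine Finset.sum_congr rfl fun x hx => ?_
    rw [(Finset.mem_filter.1 hx).2]
  rw [h1]
  congr 1
  let t : ι → Finset X := fun i => Finset.univ.filter fun a => ∀ j, e j = i → y j = a
  have h2 : Finset.univ.filter (fun x : ι → X => x ∘ e = y) = Fintype.piFinset t := by
    ext x
    simp only [Finset.mem_filter, Finset.mem_univ, true_and, Fintype.mem_piFinset, t]
    constructor
    · rintro rfl i j rfl
      rfl
    · intro h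
      funext j
      exact (h (e j) j rfl).symm
  rw [h2]
  unfold prodWeight
  rw [← Finset.prod_univ_sum]
  have h3 : ∀ i, ∑ a ∈ t i, w i a = if h : ∃ j, e j = i then w i (y h.choose) else 1 := by
    intro i
    split_ifs with h
    · have : t i = {y h.choose} := by
        ext a
        simp only [Finset.mem_filter, Finset.mem_univ, true_and, t, Finset.mem_singleton]
        constructor
        · intro h'
          exact (h' _ h.choose_spec).symm
        · rintro rfl j hj
          exact congrArg y (he (hj.trans h.choose_spec.symm))
      rw [this, Finset.sum_singleton]
    · have : t i = Finset.univ := by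
        ext a
        simp only [Finset.mem_filter, Finset.mem_univ, true_and, t, iff_true]
        exact fun j hj => absurd ⟨j, hj⟩ h
      rw [this, hw]
  rw [Finset.prod_congr rfl fun i _ => h3 i]
  symm
  refine Finset.prod_of_injOn e he.injOn (by simp) ?_ ?_
  · intro i _ hi
    rw [dif_neg]
    rintro ⟨j, rfl⟩
    exact hi ⟨j, by simp, rfl⟩
  · intro j _
    have hj : ∃ j', e j' = e j := ⟨j, rfl⟩
    rw [dif_pos hj, he hj.choose_spec]

lemma prodWeight_mem {w : ι → X → ℝ} (hw : ∀ i, w i ∈ stdSimplex ℝ X) :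
    prodWeight w ∈ stdSimplex ℝ (ι → X) := by
  refine ⟨fun x => Finset.prod_nonneg fun i _ => (hw i).1 _, ?_⟩
  have := Finset.prod_univ_sum (fun _ : ι => (Finset.univ : Finset X)) w
  rw [Fintype.piFinset_univ] at this
  unfold prodWeight
  rw [← this]
  exact Finset.prod_eq_one fun i _ => (hw i).2

lemma sum_prodWeight_apply {w : ι → X → ℝ} (hw : ∀ i, ∑ a, w i a = 1) (i : ι) (f : X → ℝ) :
    ∑ x, prodWeight w x * f (x i) = ∑ a, w i a * f a := by
  have h := sum_prodWeight_comp hw (e := fun _ : Unit => i) (fun _ _ _ => rfl)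
    (fun y => f (y ()))
  simp only [Function.comp_def] at h
  rw [h]
  refine Fintype.sum_equiv (Equiv.funUnique Unit X) _ _ fun y => ?_
  simp [prodWeight, Equiv.funUnique]

lemma sum_prodWeight_snoc {k : ℕ} (w : Fin (k + 1) → X → ℝ) (f : (Fin (k + 1) → X) → ℝ) :
    ∑ x, prodWeight w x * f x = ∑ y : Fin k → X, prodWeight (fun i => w i.castSucc) y *
      ∑ a, w (Fin.last k) a * f (Fin.snoc (α := fun _ => X) y a) := by
  rw [← (Fin.snocEquiv (fun _ : Fin (k + 1) => X)).sum_comp, Fintype.sum_prod_type,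
    Finset.sum_comm]
  refine Finset.sum_congr rfl fun y _ => ?_
  rw [Finset.mul_sum]
  refine Finset.sum_congr rfl fun a _ => ?_
  simp [prodWeight, Fin.prod_univ_castSucc, Fin.snocEquiv, mul_assoc]

end ProdWeight

section Weighted

variable {Ω : Type*} [Fintype Ω] {W : Ω → ℝ}

lemma weighted_const (hW : W ∈ stdSimplex ℝ Ω) (c : ℝ) : ∑ x, W x * c = c := by
  rw [← Finset.sum_mul, hW.2, one_mul]

lemma weighted_mono (hW : W ∈ stdSimplex ℝ Ω) {f g : Ω → ℝ} (h : ∀ x, f x ≤ g x) :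
    ∑ x, W x * f x ≤ ∑ x, W x * g x :=
  Finset.sum_le_sum fun x _ => mul_le_mul_of_nonneg_left (h x) (hW.1 x)

lemma weighted_nonneg (hW : W ∈ stdSimplex ℝ Ω) {f : Ω → ℝ} (h : ∀ x, 0 ≤ f x) :
    0 ≤ ∑ x, W x * f x :=
  Finset.sum_nonneg fun x _ => mul_nonneg (hW.1 x) (h x)

lemma weighted_cauchy_schwarz (hW : W ∈ stdSimplex ℝ Ω) (f g : Ω → ℝ) :
    (∑ x, W x * (f x * g x)) ^ 2 ≤ (∑ x, W x * f x ^ 2) * ∑ x, W x * g x ^ 2 := by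
  refine Finset.sum_sq_le_sum_mul_sum_of_sq_le_mul _ (fun x _ => mul_nonneg (hW.1 x) (sq_nonneg _))
    (fun x _ => mul_nonneg (hW.1 x) (sq_nonneg _)) fun x _ => le_of_eq (by ring)

lemma weighted_sq_le (hW : W ∈ stdSimplex ℝ Ω) (f : Ω → ℝ) :
    (∑ x, W x * f x) ^ 2 ≤ ∑ x, W x * f x ^ 2 := by
  have := weighted_cauchy_schwarz hW f (fun _ => 1)
  simpa [hW.2] using this

lemma weighted_variance (hW : W ∈ stdSimplex ℝ Ω) (f : Ω → ℝ) (c : ℝ) :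
    ∑ x, W x * (f x - c) ^ 2 = ∑ x, W x * (f x - ∑ y, W y * f y) ^ 2
      + (∑ x, W x * f x - c) ^ 2 := by
  set m := ∑ y, W y * f y
  have h1 : ∀ x, W x * (f x - c) ^ 2 = W x * (f x - m) ^ 2 + 2 * (m - c) * (W x * f x)
      + W x * (c ^ 2 - m ^ 2) := fun x => by ring
  simp_rw [h1, Finset.sum_add_distrib]
  rw [weighted_const hW, ← Finset.mul_sum]
  change _ + 2 * (m - c) * m + _ = _
  ring

end Weighted

/-- A function with differences at most `c` in each coordinate has variance at most `k c²` under a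
product weight. -/
lemma variance_le_of_bounded_differences {X : Type*} [Fintype X] {w : X → ℝ}
    (hw : w ∈ stdSimplex ℝ X) {c : ℝ} : ∀ (k : ℕ) (f : (Fin k → X) → ℝ),
    (∀ i x y, (∀ j, j ≠ i → x j = y j) → |f x - f y| ≤ c) →
    ∑ x, prodWeight (fun _ => w) x *
      (f x - ∑ y, prodWeight (fun _ => w) y * f y) ^ 2 ≤ k * c ^ 2
  | 0, f, _ => by
    simp [prodWeight]
  | k + 1, f, hf => by
    -- Integrating out the last coordinate preserves the bounded differences of the others. Given
    -- these, the values differ from their conditional mean by at most `c`, so each coordinate adds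
    -- at most `c ^ 2` to the variance.
    set g : (Fin k → X) → ℝ := fun y => ∑ a, w a * f (Fin.snoc (α := fun _ => X) y a) with hg
    have hW : prodWeight (fun _ => w) ∈ stdSimplex ℝ (Fin k → X) := prodWeight_mem fun _ => hw
    have hmean : ∑ y, prodWeight (fun _ => w) y * f y =
        ∑ y, prodWeight (fun _ : Fin k => w) y * g y :=
      sum_prodWeight_snoc (fun _ => w) f
    have hgd : ∀ i x y, (∀ j, j ≠ i → x j = y j) → |g x - g y| ≤ c := by
      intro i x y hxy
      have : g x - g y = ∑ a, w a * (f (Fin.snoc (α := fun _ => X) x a) -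
          f (Fin.snoc (α := fun _ => X) y a)) := by
        simp only [hg, mul_sub, Finset.sum_sub_distrib]
      rw [this]
      refine (Finset.abs_sum_le_sum_abs _ _).trans ?_
      rw [← weighted_const hw c]
      refine Finset.sum_le_sum fun a _ => ?_
      rw [abs_mul, abs_of_nonneg (hw.1 a)]
      refine mul_le_mul_of_nonneg_left ?_ (hw.1 a)
      refine hf i.castSucc _ _ fun j => ?_
      refine Fin.lastCases (fun _ => by simp) (fun j hj => ?_) j
      simpa using hxy j (fun h => hj (by rw [h]))
    have ih := variance_le_of_bounded_differences hw k g hgd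
    rw [hmean, sum_prodWeight_snoc (fun _ => w) (fun x => (f x - _) ^ 2)]
    set m := ∑ y, prodWeight (fun _ : Fin k => w) y * g y
    have h1 : ∀ y : Fin k → X, ∑ a, w a * (f (Fin.snoc (α := fun _ => X) y a) - m) ^ 2
        ≤ c ^ 2 + (g y - m) ^ 2 := by
      intro y
      rw [weighted_variance hw]
      refine add_le_add ?_ le_rfl
      rw [← weighted_const hw (c ^ 2)]
      refine weighted_mono hw fun a => ?_
      rw [← sq_abs]
      refine pow_le_pow_left₀ (abs_nonneg _) ?_ 2
      have : f (Fin.snoc (α := fun _ => X) y a) - ∑ b, w b * f (Fin.snoc (α := fun _ => X) y b)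
          = ∑ b, w b * (f (Fin.snoc (α := fun _ => X) y a) -
            f (Fin.snoc (α := fun _ => X) y b)) := by
        simp only [mul_sub, Finset.sum_sub_distrib]
        rw [weighted_const hw]
      rw [this]
      refine (Finset.abs_sum_le_sum_abs _ _).trans ?_
      rw [← weighted_const hw c]
      refine Finset.sum_le_sum fun b _ => ?_
      rw [abs_mul, abs_of_nonneg (hw.1 b)]
      refine mul_le_mul_of_nonneg_left ?_ (hw.1 b)
      refine hf (Fin.last k) _ _ fun j => ?_
      refine Fin.lastCases (fun h => absurd rfl h) (fun j _ => ?_) j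
      simp
    calc _ ≤ ∑ y : Fin k → X, prodWeight (fun _ => w) y * (c ^ 2 + (g y - m) ^ 2) :=
          weighted_mono hW h1
      _ = c ^ 2 + ∑ y : Fin k → X, prodWeight (fun _ => w) y * (g y - m) ^ 2 := by
          simp_rw [mul_add, Finset.sum_add_distrib]
          rw [weighted_const hW]
      _ ≤ _ := by push_cast; linarith

/-! ### Span semi-norm -/

section Span

variable {S : Type*} [Finite S]

lemma le_iSup_finite (V : S → ℝ) (s : S) : V s ≤ ⨆ x, V x := le_ciSup (Set.finite_range V).bddAbove s

lemma iInf_finite_le (V : S → ℝ) (s : S) : ⨅ x, V x ≤ V s := ciInf_le (Set.finite_range V).bddBelow s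

lemma sub_le_spanSeminorm (V : S → ℝ) (s t : S) : V s - V t ≤ spanSeminorm V := by
  have := le_iSup_finite V s
  have := iInf_finite_le V t
  unfold spanSeminorm
  linarith

lemma abs_sub_le_spanSeminorm (V : S → ℝ) (s t : S) : |V s - V t| ≤ spanSeminorm V :=
  abs_le.2 ⟨by linarith [sub_le_spanSeminorm V t s], sub_le_spanSeminorm V s t⟩

lemma spanSeminorm_le [Nonempty S] {V : S → ℝ} {b : ℝ} (h : ∀ s t, V s - V t ≤ b) :
    spanSeminorm V ≤ b := by
  unfold spanSeminorm
  obtain ⟨s, hs⟩ := exists_eq_ciSup_of_finite (f := V)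
  obtain ⟨t, ht⟩ := exists_eq_ciInf_of_finite (f := V)
  rw [← hs, ← ht]
  exact h s t

lemma spanSeminorm_nonneg (V : S → ℝ) : 0 ≤ spanSeminorm V := by
  rcases isEmpty_or_nonempty S with h | ⟨⟨s⟩⟩
  · simp [spanSeminorm]
  · simpa using sub_le_spanSeminorm V s s

end Span

/-! ### Optimal transport balls -/

section Transport

variable {S : Type*} [Fintype S]

lemma IsCoupling.mem_stdSimplex {p q : S → ℝ} {μ : S → S → ℝ} (h : IsCoupling p q μ)
    (hp : p ∈ stdSimplex ℝ S) : q ∈ stdSimplex ℝ S := by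
  refine ⟨fun y => ?_, ?_⟩
  · rw [← h.2.2 y]
    exact Finset.sum_nonneg fun x _ => h.1 x y
  · simp_rw [← h.2.2]
    rw [Finset.sum_comm]
    simp_rw [h.2.1]
    exact hp.2

lemma IsCoupling.diagonal [DecidableEq S] {p : S → ℝ} (hp : ∀ x, 0 ≤ p x) :
    IsCoupling p p fun x y => if x = y then p x else 0 := by
  refine ⟨fun x y => ?_, fun x => by simp, fun y => by simp⟩
  dsimp only
  split_ifs
  · exact hp x
  · exact le_rfl

lemma IsCoupling.prod {p q : S → ℝ} (hp : p ∈ stdSimplex ℝ S) (hq : q ∈ stdSimplex ℝ S) :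
    IsCoupling p q fun x y => p x * q y :=
  ⟨fun x y => mul_nonneg (hp.1 x) (hq.1 y), fun x => by rw [← Finset.mul_sum, hq.2, mul_one],
    fun y => by rw [← Finset.sum_mul, hp.2, one_mul]⟩

/-- The distributions that can be reached from `p` by a transport plan with cost at most `r`. -/
def transportBall (c : S → S → ℝ) (r : ℝ) (p : S → ℝ) : Set (S → ℝ) :=
  {q | ∃ μ, IsCoupling p q μ ∧ ∑ x, ∑ y, μ x y * c x y ≤ r}

/-- Fixing only the first marginal leaves a closed part of the box `[0, p]`. Transport balls are
continuous images of closed parts of this set. -/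
lemma isCompact_couplings {p : S → ℝ} : IsCompact {μ : S → S → ℝ | ∃ q, IsCoupling p q μ} := by
  have h : {μ : S → S → ℝ | ∃ q, IsCoupling p q μ} =
      Set.Icc 0 (fun x _ => p x) ∩ ⋂ x, {μ | ∑ y, μ x y = p x} := by
    ext μ
    simp only [Set.mem_ofPred_eq, Set.mem_inter_iff, Set.mem_Icc, Set.mem_iInter]
    constructor
    · rintro ⟨q, h0, h1, -⟩
      refine ⟨⟨fun x y => h0 x y, fun x y => ?_⟩, h1⟩
      dsimp only
      rw [← h1 x]
      exact Finset.single_le_sum (f := μ x) (fun y _ => h0 x y) (Finset.mem_univ y)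
    · rintro ⟨⟨h0, -⟩, h1⟩
      exact ⟨fun y => ∑ x, μ x y, fun x y => h0 x y, h1, fun _ => rfl⟩
  rw [h]
  refine isCompact_Icc.inter_right (isClosed_iInter fun x => isClosed_eq ?_ continuous_const)
  fun_prop

lemma isCompact_transportBall (c : S → S → ℝ) (r : ℝ) (p : S → ℝ) :
    IsCompact (transportBall c r p) := by
  have h : transportBall c r p = (fun (μ : S → S → ℝ) y => ∑ x, μ x y) ''
      ({μ : S → S → ℝ | ∃ q, IsCoupling p q μ} ∩ {μ | ∑ x, ∑ y, μ x y * c x y ≤ r}) := by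
    ext q
    constructor
    · rintro ⟨μ, h, hr⟩
      exact ⟨μ, ⟨⟨q, h⟩, hr⟩, funext h.2.2⟩
    · rintro ⟨μ, ⟨⟨q, h⟩, hr⟩, rfl⟩
      exact ⟨μ, ⟨h.1, h.2.1, fun _ => rfl⟩, hr⟩
  rw [h]
  refine (isCompact_couplings.inter_right (isClosed_le ?_ continuous_const)).image ?_
  · fun_prop
  · fun_prop

lemma transportBall_subset {c : S → S → ℝ} {r : ℝ} {p : S → ℝ} (hp : p ∈ stdSimplex ℝ S) :
    transportBall c r p ⊆ stdSimplex ℝ S := fun _ ⟨_, h, _⟩ => h.mem_stdSimplex hp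

lemma self_mem_transportBall {c : S → S → ℝ} (hc : ∀ x, c x x = 0) {r : ℝ} (hr : 0 ≤ r)
    {p : S → ℝ} (hp : ∀ x, 0 ≤ p x) : p ∈ transportBall c r p := by
  classical
  refine ⟨_, IsCoupling.diagonal hp, ?_⟩
  simpa [hc] using hr

/-- Transport balls are jointly convex in the centre and the member. -/
lemma weighted_mem_transportBall {Ω : Type*} [Fintype Ω] {W : Ω → ℝ} (hW : W ∈ stdSimplex ℝ Ω)
    {c : S → S → ℝ} {r : ℝ} {p q : Ω → S → ℝ} (h : ∀ ω, q ω ∈ transportBall c r (p ω)) :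
    (fun s => ∑ ω, W ω * q ω s) ∈ transportBall c r (fun s => ∑ ω, W ω * p ω s) := by
  choose μ hμ hr using h
  refine ⟨fun x y => ∑ ω, W ω * μ ω x y, ⟨fun x y => ?_, fun x => ?_, fun y => ?_⟩, ?_⟩
  · exact weighted_nonneg hW fun ω => (hμ ω).1 x y
  · rw [Finset.sum_comm]
    simp_rw [← Finset.mul_sum, (hμ _).2.1]
  · rw [Finset.sum_comm]
    simp_rw [← Finset.mul_sum, (hμ _).2.2]
  · have : ∑ x, ∑ y, (∑ ω, W ω * μ ω x y) * c x y = ∑ ω, W ω * ∑ x, ∑ y, μ ω x y * c x y := by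
      simp_rw [Finset.sum_mul, Finset.mul_sum, mul_assoc]
      rw [Finset.sum_comm (γ := Ω)]
      refine Finset.sum_congr rfl fun x _ => Finset.sum_comm
    rw [this, ← weighted_const hW r]
    exact weighted_mono hW hr

lemma convex_transportBall (c : S → S → ℝ) (r : ℝ) (p : S → ℝ) :
    Convex ℝ (transportBall c r p) := by
  intro q₁ h₁ q₂ h₂ a b ha hb hab
  have hW : (![a, b] : Fin 2 → ℝ) ∈ stdSimplex ℝ (Fin 2) := by
    refine ⟨fun i => ?_, by simpa using hab⟩
    fin_cases i <;> simpa
  have := weighted_mem_transportBall hW (c := c) (r := r) (p := fun _ => p) (q := ![q₁, q₂])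
    (fun i => by fin_cases i <;> simpa)
  have hp : (fun s => ∑ ω, ![a, b] ω * p s) = p := funext fun s => weighted_const hW _
  rw [hp] at this
  convert this using 1
  ext s
  simp

/-- A coupling disintegrates into its first marginal and a stochastic kernel. -/
lemma IsCoupling.exists_kernel {p q : S → ℝ} {μ : S → S → ℝ} (h : IsCoupling p q μ) :
    ∃ K : S → S → ℝ, (∀ x, K x ∈ stdSimplex ℝ S) ∧ ∀ x y, μ x y = p x * K x y := by
  classical
  -- Where `p x = 0` the row of `μ` vanishes and conditioning is meaningless; a Dirac mass keeps `K
  -- x` a distribution.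
  refine ⟨fun x y => if p x = 0 then (if x = y then 1 else 0) else μ x y / p x, fun x => ?_,
    fun x y => ?_⟩
  · by_cases hx : p x = 0
    · simp only [hx, if_true]
      exact ite_eq_mem_stdSimplex ℝ x
    · simp only [hx, if_false]
      have hp : 0 ≤ p x := by rw [← h.2.1 x]; exact Finset.sum_nonneg fun y _ => h.1 x y
      refine ⟨fun y => div_nonneg (h.1 x y) hp, ?_⟩
      rw [← Finset.sum_div, h.2.1, div_self hx]
  · by_cases hx : p x = 0
    · have h0 := h.2.1 x
      rw [hx, Finset.sum_eq_zero_iff_of_nonneg fun y _ => h.1 x y] at h0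
      simp [hx, h0 y]
    · simp only [hx, if_false]
      field_simp

/-- The change at `s` is at most inflow plus outflow; the sum over `s` counts moved mass twice,
which the factor `1 / 2` undoes. -/
lemma IsCoupling.tv_le [DecidableEq S] {p q : S → ℝ} {μ : S → S → ℝ} (h : IsCoupling p q μ) :
    1 / 2 * ∑ s, |q s - p s| ≤ ∑ x, ∑ y, μ x y * (if x = y then 0 else 1) := by
  have h1 : ∀ s, |q s - p s| ≤ ∑ y, μ y s * (if y = s then 0 else 1)
      + ∑ y, μ s y * (if s = y then 0 else 1) := by
    intro s
    have e : q s - p s = ∑ y, μ y s * (if y = s then 0 else 1)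
        - ∑ y, μ s y * (if s = y then 0 else 1) := by
      rw [← h.2.2 s, ← h.2.1 s, ← Finset.sum_sub_distrib, ← Finset.sum_sub_distrib]
      refine Finset.sum_congr rfl fun y _ => ?_
      by_cases hy : y = s
      · subst hy; simp
      · simp [hy, Ne.symm hy]
    have a1 : 0 ≤ ∑ y, μ y s * (if y = s then (0 : ℝ) else 1) :=
      Finset.sum_nonneg fun y _ => mul_nonneg (h.1 _ _) (by split_ifs <;> norm_num)
    have a2 : 0 ≤ ∑ y, μ s y * (if s = y then (0 : ℝ) else 1) :=
      Finset.sum_nonneg fun y _ => mul_nonneg (h.1 _ _) (by split_ifs <;> norm_num)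
    rw [e, abs_le]
    constructor <;> linarith
  have h2 := Finset.sum_le_sum fun s (_ : s ∈ Finset.univ) => h1 s
  rw [Finset.sum_add_distrib, Finset.sum_comm] at h2
  linarith

/-- Leave the common mass `min p q` in place and spread the surplus of `p` over the deficits by the
normalized product; the moved mass is exactly the total variation `τ`. -/
lemma exists_maximal_coupling [DecidableEq S] {p q : S → ℝ} (hp : p ∈ stdSimplex ℝ S)
    (hq : q ∈ stdSimplex ℝ S) : ∃ μ, IsCoupling p q μ ∧
      ∑ x, ∑ y, μ x y * (if x = y then 0 else 1) ≤ 1 / 2 * ∑ s, |q s - p s| := by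
  set τ := 1 / 2 * ∑ s, |q s - p s| with hτ
  have hdiff : ∑ s, (q s - p s) = 0 := by rw [Finset.sum_sub_distrib, hp.2, hq.2, sub_self]
  have e1 : ∑ s, max (q s - p s) 0 = τ := by
    have : ∀ s, max (q s - p s) 0 = 1 / 2 * |q s - p s| + 1 / 2 * (q s - p s) := by
      intro s
      rcases le_total (q s - p s) 0 with h | h
      · rw [max_eq_right h, abs_of_nonpos h]; ring
      · rw [max_eq_left h, abs_of_nonneg h]; ring
    simp_rw [this, Finset.sum_add_distrib, ← Finset.mul_sum]
    rw [hdiff]; simp [hτ]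
  have e2 : ∑ s, max (p s - q s) 0 = τ := by
    have : ∀ s, max (p s - q s) 0 = max (q s - p s) 0 - (q s - p s) := by
      intro s
      rcases le_total (q s - p s) 0 with h | h
      · rw [max_eq_right h, max_eq_left (by linarith)]; ring
      · rw [max_eq_left h, max_eq_right (by linarith)]; ring
    simp_rw [this, Finset.sum_sub_distrib]
    rw [e1, hp.2, hq.2]; ring
  have hτ0 : 0 ≤ τ := by rw [← e1]; exact Finset.sum_nonneg fun s _ => le_max_right _ _
  -- For `τ = 0` the division returns `0`, which is correct since `f` then vanishes.
  have cancel : ∀ (f : S → ℝ), (∀ s, 0 ≤ f s) → ∑ s, f s = τ → ∀ s, f s * τ / τ = f s := by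
    intro f h0 hf s
    by_cases ht : τ = 0
    · rw [ht, Finset.sum_eq_zero_iff_of_nonneg fun s _ => h0 s] at hf
      simp [hf s]
    · field_simp
  have minp : ∀ s, min (p s) (q s) + max (p s - q s) 0 = p s := by
    intro s
    rcases le_total (p s) (q s) with h | h
    · rw [min_eq_left h, max_eq_right (by linarith)]; ring
    · rw [min_eq_right h, max_eq_left (by linarith)]; ring
  have minq : ∀ s, min (p s) (q s) + max (q s - p s) 0 = q s := by
    intro s
    rcases le_total (p s) (q s) with h | h
    · rw [min_eq_left h, max_eq_left (by linarith)]; ring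
    · rw [min_eq_right h, max_eq_right (by linarith)]; ring
  refine ⟨fun x y => (if x = y then min (p x) (q x) else 0)
    + max (p x - q x) 0 * max (q y - p y) 0 / τ, ⟨fun x y => ?_, fun x => ?_, fun y => ?_⟩, ?_⟩
  · refine add_nonneg ?_ (by positivity)
    split_ifs
    · exact le_min (hp.1 x) (hq.1 x)
    · exact le_rfl
  · rw [Finset.sum_add_distrib, ← Finset.sum_div, ← Finset.mul_sum, e1,
      cancel _ (fun s => le_max_right _ _) e2]
    simpa using minp x
  · rw [Finset.sum_add_distrib, ← Finset.sum_div, ← Finset.sum_mul, e2, mul_comm τ,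
      cancel _ (fun s => le_max_right _ _) e1]
    simpa using minq y
  · calc _ ≤ ∑ x, ∑ y, max (p x - q x) 0 * max (q y - p y) 0 / τ := by
          refine Finset.sum_le_sum fun x _ => Finset.sum_le_sum fun y _ => ?_
          by_cases hxy : x = y
          · simp only [hxy, if_true, mul_zero]; positivity
          · simp [hxy]
      _ = τ := by
          simp_rw [← Finset.sum_div, ← Finset.mul_sum, e1]
          rw [← Finset.sum_mul, e2]
          by_cases ht : τ = 0
          · simp [ht]
          · field_simp

lemma totalVariation_ball_eq [DecidableEq S] (δ : ℝ) {p : S → ℝ} (hp : p ∈ stdSimplex ℝ S) :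
    (UncertaintySet.totalVariation δ).ball p =
      transportBall (fun x y => if x = y then 0 else 1) δ p := by
  ext q
  constructor
  · rintro ⟨hq, h⟩
    obtain ⟨μ, hμ, hc⟩ := exists_maximal_coupling hp hq
    exact ⟨μ, hμ, hc.trans h⟩
  · rintro ⟨μ, hμ, hc⟩
    exact ⟨hμ.mem_stdSimplex hp, hμ.tv_le.trans hc⟩

/-- By compactness the infimum in `wassersteinDist` is attained, so a member of the ball has an
actual plan of cost at most `δ ^ l`. -/
lemma wasserstein_ball_eq (m : MetricSpace S) {l δ : ℝ} (hl : 1 ≤ l) (hδ : 0 ≤ δ) {p : S → ℝ}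
    (hp : p ∈ stdSimplex ℝ S) :
    (UncertaintySet.wasserstein m l δ).ball p =
      transportBall (fun x y => (m.dist x y) ^ l) (δ ^ l) p := by
  let _ := m
  have hl0 : 0 < l := by linarith
  have hcost : ∀ {q} {μ : S → S → ℝ}, IsCoupling p q μ →
      0 ≤ ∑ x, ∑ y, μ x y * (m.dist x y) ^ l := fun hμ =>
    Finset.sum_nonneg fun x _ => Finset.sum_nonneg fun y _ =>
      mul_nonneg (hμ.1 x y) (Real.rpow_nonneg (dist_nonneg (x := x) (y := y)) l)
  have key : ∀ {q} {μ : S → S → ℝ}, IsCoupling p q μ →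
      ((∑ x, ∑ y, μ x y * (m.dist x y) ^ l) ^ (1 / l) ≤ δ ↔
        ∑ x, ∑ y, μ x y * (m.dist x y) ^ l ≤ δ ^ l) := fun hμ => by
    rw [one_div]
    exact Real.rpow_inv_le_iff_of_pos (hcost hμ) hδ hl0
  ext q
  constructor
  · rintro ⟨hq, h⟩
    set C := {c : ℝ | ∃ μ : S → S → ℝ, IsCoupling p q μ ∧
      c = (∑ x, ∑ y, μ x y * (m.dist x y) ^ l) ^ (1 / l)} with hC
    have hCc : IsCompact C := by
      have : C = (fun μ : S → S → ℝ => (∑ x, ∑ y, μ x y * (m.dist x y) ^ l) ^ (1 / l)) ''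
          ({μ : S → S → ℝ | ∃ q, IsCoupling p q μ} ∩ ⋂ y, {μ | ∑ x, μ x y = q y}) := by
        ext c
        simp only [hC, Set.mem_ofPred_eq, Set.mem_image, Set.mem_inter_iff, Set.mem_iInter]
        constructor
        · rintro ⟨μ, hμ, rfl⟩
          exact ⟨μ, ⟨⟨q, hμ⟩, hμ.2.2⟩, rfl⟩
        · rintro ⟨μ, ⟨⟨q', hμ⟩, h'⟩, rfl⟩
          exact ⟨μ, ⟨hμ.1, hμ.2.1, h'⟩, rfl⟩
      rw [this]
      refine (isCompact_couplings.inter_right (isClosed_iInter fun y =>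
        isClosed_eq ?_ continuous_const)).image ?_
      · fun_prop
      · refine Continuous.rpow_const ?_ fun _ => Or.inr (by positivity)
        fun_prop
    have hne : C.Nonempty := ⟨_, _, IsCoupling.prod hp hq, rfl⟩
    obtain ⟨μ, hμ, hc⟩ := hCc.sInf_mem hne
    refine ⟨μ, hμ, (key hμ).1 ?_⟩
    rw [← hc]
    exact h
  · rintro ⟨μ, hμ, hc⟩
    refine ⟨hμ.mem_stdSimplex hp, ?_⟩
    refine (csInf_le (s := {c : ℝ | ∃ μ : S → S → ℝ, IsCoupling p q μ ∧
      c = (∑ x, ∑ y, μ x y * (m.dist x y) ^ l) ^ (1 / l)}) ?_ ⟨μ, hμ, rfl⟩).trans ((key hμ).2 hc)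
    refine ⟨0, ?_⟩
    rintro c ⟨μ, hμ, rfl⟩
    exact Real.rpow_nonneg (hcost hμ) _

end Transport

/-! ### General properties of the uncertainty sets -/

namespace UncertaintySet

variable {S : Type*} [Fintype S]

/-- The parameters lie in the range where all uncertainty sets are nonempty. -/
def Proper (U : UncertaintySet S) : Prop :=
  match U with
  | contamination δ => 0 ≤ δ ∧ δ < 1
  | totalVariation δ => 0 ≤ δ
  | wasserstein _ l δ => 1 ≤ l ∧ 0 ≤ δ

lemma RadiusCondition.proper [DecidableEq S] {U : UncertaintySet S} {M : Matrix S S ℝ}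
    (h : U.RadiusCondition M) : U.Proper := by
  cases U with
  | contamination δ => exact h
  | totalVariation δ => exact h.1
  | wasserstein m l δ => exact ⟨h.1, h.2.1⟩

/-- Total variation and Wasserstein sets are optimal transport balls. -/
lemma Proper.exists_transportBall {U : UncertaintySet S} (h : U.Proper)
    (hU : U.IsTVOrWasserstein) : ∃ (c : S → S → ℝ) (r : ℝ), (∀ x y, 0 ≤ c x y) ∧
      (∀ x, c x x = 0) ∧ 0 ≤ r ∧ ∀ p ∈ stdSimplex ℝ S, U.ball p = transportBall c r p := by
  classical
  rcases hU with ⟨δ, rfl⟩ | ⟨m, l, δ, rfl⟩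
  · exact ⟨fun x y => if x = y then 0 else 1, δ, fun x y => by positivity, by simp, h,
      fun p hp => totalVariation_ball_eq δ hp⟩
  · let _ := m
    have hl : l ≠ 0 := by have := h.1; linarith
    refine ⟨fun x y => (m.dist x y) ^ l, δ ^ l,
      fun x y => Real.rpow_nonneg (dist_nonneg (x := x) (y := y)) l, fun x => ?_,
      Real.rpow_nonneg h.2 l, fun p hp => wasserstein_ball_eq m h.1 h.2 hp⟩
    change (dist x x) ^ l = 0
    rw [dist_self, Real.zero_rpow hl]

lemma contamination_or {S : Type*} (U : UncertaintySet S) :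
    (∃ δ, U = contamination δ) ∨ U.IsTVOrWasserstein := by
  cases U with
  | contamination δ => exact Or.inl ⟨δ, rfl⟩
  | totalVariation δ => exact Or.inr (Or.inl ⟨δ, rfl⟩)
  | wasserstein m l δ => exact Or.inr (Or.inr ⟨m, l, δ, rfl⟩)

lemma contamination_ball_eq_image (δ : ℝ) (p : S → ℝ) :
    (contamination δ).ball p = (fun q' => (1 - δ) • p + δ • q') '' stdSimplex ℝ S := by
  ext q
  constructor
  · rintro ⟨q', h, rfl⟩
    exact ⟨q', h, rfl⟩
  · rintro ⟨q', h, rfl⟩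
    exact ⟨q', h, rfl⟩

variable {U : UncertaintySet S} {p : S → ℝ}

lemma isCompact_ball (h : U.Proper) (hp : p ∈ stdSimplex ℝ S) : IsCompact (U.ball p) := by
  rcases contamination_or U with ⟨δ, rfl⟩ | hU
  · rw [contamination_ball_eq_image]
    exact (isCompact_stdSimplex ℝ S).image (by fun_prop)
  · obtain ⟨c, r, -, -, -, hb⟩ := h.exists_transportBall hU
    rw [hb p hp]
    exact isCompact_transportBall c r p

lemma convex_ball (h : U.Proper) (hp : p ∈ stdSimplex ℝ S) : Convex ℝ (U.ball p) := by
  rcases contamination_or U with ⟨δ, rfl⟩ | hU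
  · rw [contamination_ball_eq_image]
    rintro _ ⟨q₁, h₁, rfl⟩ _ ⟨q₂, h₂, rfl⟩ a b ha hb hab
    refine ⟨a • q₁ + b • q₂, convex_stdSimplex ℝ S h₁ h₂ ha hb hab, ?_⟩
    ext s
    simp only [Pi.add_apply, Pi.smul_apply, smul_eq_mul]
    linear_combination (-(1 - δ) * p s) * hab
  · obtain ⟨c, r, -, -, -, hb⟩ := h.exists_transportBall hU
    rw [hb p hp]
    exact convex_transportBall c r p

lemma self_mem_ball (h : U.Proper) (hp : p ∈ stdSimplex ℝ S) : p ∈ U.ball p := by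
  rcases contamination_or U with ⟨δ, rfl⟩ | hU
  · refine ⟨p, hp, ?_⟩
    rw [← add_smul]
    simp
  · obtain ⟨c, r, -, hc, hr, hb⟩ := h.exists_transportBall hU
    rw [hb p hp]
    exact self_mem_transportBall hc hr hp.1

lemma ball_subset (h : U.Proper) (hp : p ∈ stdSimplex ℝ S) : U.ball p ⊆ stdSimplex ℝ S := by
  rcases contamination_or U with ⟨δ, rfl⟩ | hU
  · rintro q ⟨q', hq', rfl⟩
    exact convex_stdSimplex ℝ S hp hq' (by linarith [h.2]) h.1 (by ring)
  · obtain ⟨c, r, -, hc, hr, hb⟩ := h.exists_transportBall hU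
    rw [hb p hp]
    exact transportBall_subset hp

lemma dotProduct_image_bddBelow {B : Set (S → ℝ)} (hB : IsCompact B) (V : S → ℝ) :
    BddBelow ((fun q : S → ℝ => q ⬝ᵥ V) '' B) :=
  (hB.image (by fun_prop)).bddBelow

lemma support_le (h : U.Proper) (hp : p ∈ stdSimplex ℝ S) {q : S → ℝ} (hq : q ∈ U.ball p)
    (V : S → ℝ) : U.support p V ≤ q ⬝ᵥ V :=
  csInf_le (dotProduct_image_bddBelow (isCompact_ball h hp) V) ⟨q, hq, rfl⟩

lemma exists_support_eq (h : U.Proper) (hp : p ∈ stdSimplex ℝ S) (V : S → ℝ) :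
    ∃ q ∈ U.ball p, q ⬝ᵥ V = U.support p V :=
  ((isCompact_ball h hp).image (by fun_prop)).sInf_mem ⟨_, p, self_mem_ball h hp, rfl⟩

end UncertaintySet

/-! ### Support functions of transport balls around empirical distributions -/

section TransportSupport

variable {S : Type*} [Fintype S]

/-- The support function of a transport ball. -/
noncomputable def transportSupport (c : S → S → ℝ) (r : ℝ) (p V : S → ℝ) : ℝ :=
  sInf ((fun q : S → ℝ => q ⬝ᵥ V) '' transportBall c r p)

variable {c : S → S → ℝ} {r : ℝ} {p : S → ℝ}

lemma transportSupport_le {q : S → ℝ} (hq : q ∈ transportBall c r p) (V : S → ℝ) :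
    transportSupport c r p V ≤ q ⬝ᵥ V :=
  csInf_le (UncertaintySet.dotProduct_image_bddBelow (isCompact_transportBall c r p) V)
    ⟨q, hq, rfl⟩

lemma exists_transportSupport_eq (hc : ∀ x, c x x = 0) (hr : 0 ≤ r) (hp : p ∈ stdSimplex ℝ S)
    (V : S → ℝ) : ∃ q ∈ transportBall c r p, q ⬝ᵥ V = transportSupport c r p V :=
  ((isCompact_transportBall c r p).image (by fun_prop)).sInf_mem
    ⟨_, p, self_mem_transportBall hc hr hp.1, rfl⟩

lemma weighted_mem_Icc {q : S → ℝ} (hq : q ∈ stdSimplex ℝ S) (V : S → ℝ) :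
    ∑ x, q x * V x ∈ Set.Icc (⨅ x, V x) (⨆ x, V x) :=
  ⟨by rw [← weighted_const hq (⨅ x, V x)]; exact weighted_mono hq (iInf_finite_le V),
    by conv_rhs => rw [← weighted_const hq (⨆ x, V x)]
       exact weighted_mono hq (le_iSup_finite V)⟩

/-- The adversary at `p'` can copy the optimal plan of `p` on the common mass and leave the surplus
alone. Only the surplus, of total variation size, is then valued differently, by at most the span
per unit. -/
lemma transportSupport_sub_le (hc0 : ∀ x y, 0 ≤ c x y) (hc : ∀ x, c x x = 0) (hr : 0 ≤ r)
    {p' : S → ℝ} (hp : p ∈ stdSimplex ℝ S) (hp' : p' ∈ stdSimplex ℝ S) (V : S → ℝ) :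
    transportSupport c r p' V - transportSupport c r p V ≤
      (1 / 2 * ∑ s, |p' s - p s|) * spanSeminorm V := by
  classical
  obtain ⟨q, ⟨μ, hμ, hcost⟩, hqV⟩ := exists_transportSupport_eq hc hr hp V
  obtain ⟨K, hK, hμK⟩ := hμ.exists_kernel
  set m : S → ℝ := fun s => min (p s) (p' s) with hm
  set d : S → ℝ := fun s => p' s - m s with hd
  set e : S → ℝ := fun s => p s - m s with he
  have hm0 : ∀ s, 0 ≤ m s := fun s => le_min (hp.1 s) (hp'.1 s)
  have hd0 : ∀ s, 0 ≤ d s := fun s => sub_nonneg.2 (min_le_right _ _)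
  have he0 : ∀ s, 0 ≤ e s := fun s => sub_nonneg.2 (min_le_left _ _)
  have hde : ∑ s, d s = ∑ s, e s := by
    simp only [hd, he, Finset.sum_sub_distrib, hp.2, hp'.2]
  have habs : ∑ s, |p' s - p s| = ∑ s, d s + ∑ s, e s := by
    rw [← Finset.sum_add_distrib]
    refine Finset.sum_congr rfl fun s _ => ?_
    simp only [hd, he, hm]
    rcases le_total (p s) (p' s) with h | h
    · rw [min_eq_left h, abs_of_nonneg (by linarith)]; ring
    · rw [min_eq_right h, abs_of_nonpos (by linarith)]; ring
  set KV : S → ℝ := fun x => ∑ y, K x y * V y with hKV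
  -- The mass `m` follows the kernel `K` of the optimal plan and `d` stays, so the cost does not
  -- exceed that of the plan for `p`.
  have hq' : (fun y => ∑ x, (m x * K x y + if x = y then d x else 0)) ∈ transportBall c r p' := by
    refine ⟨fun x y => m x * K x y + if x = y then d x else 0,
      ⟨fun x y => ?_, fun x => ?_, fun y => rfl⟩, ?_⟩
    · refine add_nonneg (mul_nonneg (hm0 x) ((hK x).1 y)) ?_
      split_ifs
      exacts [hd0 x, le_rfl]
    · rw [Finset.sum_add_distrib, ← Finset.mul_sum, (hK x).2]
      simp [hd]
    · refine le_trans ?_ hcost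
      refine Finset.sum_le_sum fun x _ => Finset.sum_le_sum fun y _ => ?_
      rw [hμK]
      by_cases hxy : x = y
      · subst hxy; simp [hc]
      · simp only [hxy, if_false, add_zero]
        exact mul_le_mul_of_nonneg_right (mul_le_mul_of_nonneg_right (min_le_left _ _)
          ((hK x).1 y)) (hc0 x y)
  have h1 := transportSupport_le hq' V
  have e1 : (fun y => ∑ x, (m x * K x y + if x = y then d x else 0)) ⬝ᵥ V
      = ∑ x, m x * KV x + ∑ x, d x * V x := by
    simp only [dotProduct, Finset.sum_add_distrib, add_mul, Finset.sum_ite_eq', Finset.mem_univ,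
      if_true, hKV, Finset.sum_mul, Finset.mul_sum]
    rw [Finset.sum_comm]
    simp only [mul_assoc]
  have e2 : q ⬝ᵥ V = ∑ x, m x * KV x + ∑ x, e x * KV x := by
    rw [← Finset.sum_add_distrib]
    simp only [dotProduct, ← hμ.2.2, hμK, hKV, Finset.sum_mul]
    rw [Finset.sum_comm]
    refine Finset.sum_congr rfl fun x _ => ?_
    rw [← add_mul, Finset.mul_sum]
    refine Finset.sum_congr rfl fun y _ => ?_
    simp only [he]; ring
  have h2 : ∑ x, d x * V x ≤ (∑ x, d x) * ⨆ x, V x := by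
    rw [Finset.sum_mul]
    exact Finset.sum_le_sum fun x _ => mul_le_mul_of_nonneg_left (le_iSup_finite V x) (hd0 x)
  have h3 : (∑ x, e x) * ⨅ x, V x ≤ ∑ x, e x * KV x := by
    rw [Finset.sum_mul]
    exact Finset.sum_le_sum fun x _ => mul_le_mul_of_nonneg_left
      (weighted_mem_Icc (hK x) V).1 (he0 x)
  rw [habs, ← hde]
  rw [← hde] at h3
  have h4 : (1 / 2 * (∑ s, d s + ∑ s, d s)) * spanSeminorm V
      = (∑ x, d x) * (⨆ x, V x) - (∑ x, d x) * ⨅ x, V x := by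
    unfold spanSeminorm; ring
  rw [h4]
  linarith

/-- Only a part of a transport plan may be carried out when the budget is short. -/
lemma transportSupport_le_of_plan (hc : ∀ x, c x x = 0) {e : S → ℝ} (he : ∀ x, 0 ≤ e x)
    {K : S → S → ℝ} (hK : ∀ x, K x ∈ stdSimplex ℝ S) {ψ : S → ℝ} (hψ0 : ∀ x, 0 ≤ ψ x)
    (hψ1 : ∀ x, ψ x ≤ 1) (hcost : ∑ x, e x * ((∑ y, K x y * c x y) * (1 - ψ x)) ≤ r) (V : S → ℝ) :
    transportSupport c r e V ≤
      ∑ x, e x * ((∑ y, K x y * V y) + ψ x * (V x - ∑ y, K x y * V y)) := by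
  classical
  -- The fraction `ψ x` of the mass at `x` stays and the rest follows `K x`.
  have hq : (fun y => ∑ x, e x * ((1 - ψ x) * K x y + if x = y then ψ x else 0))
      ∈ transportBall c r e := by
    refine ⟨fun x y => e x * ((1 - ψ x) * K x y + if x = y then ψ x else 0),
      ⟨fun x y => ?_, fun x => ?_, fun y => rfl⟩, ?_⟩
    · refine mul_nonneg (he x) (add_nonneg (mul_nonneg (by linarith [hψ1 x]) ((hK x).1 y)) ?_)
      split_ifs
      exacts [hψ0 x, le_rfl]
    · rw [← Finset.mul_sum, Finset.sum_add_distrib, ← Finset.mul_sum, (hK x).2]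
      simp
    · refine le_trans (le_of_eq (Finset.sum_congr rfl fun x _ => ?_)) hcost
      rw [Finset.sum_mul, Finset.mul_sum]
      refine Finset.sum_congr rfl fun y _ => ?_
      by_cases hxy : x = y
      · subst hxy; simp [hc]
      · simp only [hxy, if_false, add_zero]; ring
  refine (transportSupport_le hq V).trans (le_of_eq ?_)
  simp only [dotProduct, Finset.sum_mul]
  rw [Finset.sum_comm]
  refine Finset.sum_congr rfl fun x _ => ?_
  simp only [mul_assoc, ← Finset.mul_sum, add_mul, ite_mul, zero_mul, Finset.sum_add_distrib,
    Finset.sum_ite_eq, Finset.mem_univ, if_true]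
  ring

end TransportSupport

/-! ### Empirical distributions: means, variances and support functions -/

section Empirical

variable {S : Type*} [Fintype S] [DecidableEq S]

lemma sum_empirical_mul {k : ℕ} (x : Fin k → S) (f : S → ℝ) :
    ∑ s, empirical x s * f s = (∑ i, f (x i)) / k := by
  simp only [empirical, Finset.card_filter, Nat.cast_sum, div_mul_eq_mul_div]
  rw [← Finset.sum_div]
  congr 1
  simp only [Finset.sum_mul]
  rw [Finset.sum_comm]
  refine Finset.sum_congr rfl fun i _ => ?_
  simp

lemma empirical_mem {k : ℕ} (hk : k ≠ 0) (x : Fin k → S) : empirical x ∈ stdSimplex ℝ S := by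
  refine ⟨fun s => by unfold empirical; positivity, ?_⟩
  have := sum_empirical_mul x (fun _ => (1 : ℝ))
  simp only [mul_one] at this
  rw [this]
  simp [hk]

lemma weighted_empirical_mul {k : ℕ} (hk : k ≠ 0) {p : S → ℝ} (hp : p ∈ stdSimplex ℝ S)
    (f : S → ℝ) :
    ∑ x : Fin k → S, prodWeight (fun _ => p) x * ∑ s, empirical x s * f s = ∑ s, p s * f s := by
  simp_rw [sum_empirical_mul, mul_div_assoc', Finset.mul_sum]
  rw [← Finset.sum_div, Finset.sum_comm]
  simp_rw [sum_prodWeight_apply (fun _ => hp.2)]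
  simp [hk]

lemma weighted_empirical {k : ℕ} (hk : k ≠ 0) {p : S → ℝ} (hp : p ∈ stdSimplex ℝ S) (s : S) :
    ∑ x : Fin k → S, prodWeight (fun _ => p) x * empirical x s = p s := by
  have := weighted_empirical_mul hk hp (fun t => if t = s then 1 else 0)
  simpa using this

lemma empirical_mul_variance {k : ℕ} (hk : k ≠ 0) {p : S → ℝ} (hp : p ∈ stdSimplex ℝ S)
    {f : S → ℝ} {b : ℝ} (hf : ∀ s t, |f s - f t| ≤ b) :
    ∑ x : Fin k → S, prodWeight (fun _ => p) x *
      (∑ s, empirical x s * f s - ∑ s, p s * f s) ^ 2 ≤ b ^ 2 / k := by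
  have hk' : (0 : ℝ) < k := by positivity
  have := variance_le_of_bounded_differences hp (c := b / k) k
    (fun x => ∑ s, empirical x s * f s) ?_
  · rw [weighted_empirical_mul hk hp f] at this
    refine this.trans (le_of_eq ?_)
    field_simp
  · intro i x y hxy
    simp only [sum_empirical_mul]
    rw [← sub_div, ← Finset.sum_sub_distrib, abs_div, abs_of_pos hk',
      Finset.sum_eq_single i (fun j _ hj => by rw [hxy j hj, sub_self]) (by simp)]
    gcongr
    exact hf _ _

lemma empirical_tv_le {k : ℕ} {x y : Fin k → S} {i : Fin k}
    (hxy : ∀ j, j ≠ i → x j = y j) :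
    1 / 2 * ∑ s, |empirical x s - empirical y s| ≤ 1 / k := by
  have h : ∀ s, |empirical x s - empirical y s| ≤
      (if x i = s then (1 : ℝ) else 0) / k + (if y i = s then 1 else 0) / k := by
    intro s
    have : empirical x s - empirical y s =
        (if x i = s then (1 : ℝ) else 0) / k - (if y i = s then 1 else 0) / k := by
      simp only [empirical, Finset.card_filter, Nat.cast_sum]
      rw [← sub_div, ← sub_div, ← Finset.sum_sub_distrib,
        Finset.sum_eq_single i (fun j _ hj => by rw [hxy j hj, sub_self]) (by simp)]
      simp
    rw [this, abs_le]
    have a1 : 0 ≤ (if x i = s then (1 : ℝ) else 0) / k := by positivity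
    have a2 : 0 ≤ (if y i = s then (1 : ℝ) else 0) / k := by positivity
    constructor <;> linarith
  have := Finset.sum_le_sum fun s (_ : s ∈ Finset.univ) => h s
  rw [Finset.sum_add_distrib, ← Finset.sum_div, ← Finset.sum_div] at this
  simp only [Finset.sum_ite_eq, Finset.mem_univ, if_true] at this
  linarith

variable {c : S → S → ℝ} {r : ℝ} {p : S → ℝ}

/-- Changing one of `k` samples moves the empirical distribution by `1 / k` in total variation,
hence the support function by `span / k`; bounded differences then give `k * (span / k) ^ 2`. -/
lemma transportSupport_empirical_variance (hc0 : ∀ x y, 0 ≤ c x y) (hc : ∀ x, c x x = 0)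
    (hr : 0 ≤ r) {k : ℕ} (hk : k ≠ 0) (hp : p ∈ stdSimplex ℝ S) (V : S → ℝ) :
    ∑ x : Fin k → S, prodWeight (fun _ => p) x * (transportSupport c r (empirical x) V -
      ∑ y : Fin k → S, prodWeight (fun _ => p) y * transportSupport c r (empirical y) V) ^ 2
      ≤ spanSeminorm V ^ 2 / k := by
  have hk' : (0 : ℝ) < k := by positivity
  have hd : ∀ i (x y : Fin k → S), (∀ j, j ≠ i → x j = y j) →
      transportSupport c r (empirical x) V - transportSupport c r (empirical y) V
        ≤ spanSeminorm V / k := by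
    intro i x y hxy
    refine (transportSupport_sub_le hc0 hc hr (empirical_mem hk y) (empirical_mem hk x) V).trans ?_
    refine (mul_le_mul_of_nonneg_right (empirical_tv_le hxy) (spanSeminorm_nonneg V)).trans ?_
    rw [one_div, inv_mul_eq_div]
  refine (variance_le_of_bounded_differences hp (c := spanSeminorm V / k) k
    (fun x => transportSupport c r (empirical x) V) fun i x y hxy => ?_).trans (le_of_eq ?_)
  · exact abs_le.2 ⟨by linarith [hd i y x fun j hj => (hxy j hj).symm], hd i x y hxy⟩
  · field_simp

/-- The mean of the support functions around empirical distributions is attained, at each `V`, by a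
member of the uncertainty set around the true distribution. -/
lemma exists_transportSupport_empirical (hc : ∀ x, c x x = 0) (hr : 0 ≤ r) {k : ℕ} (hk : k ≠ 0)
    (hp : p ∈ stdSimplex ℝ S) (V : S → ℝ) : ∃ q ∈ transportBall c r p,
      ∑ x : Fin k → S, prodWeight (fun _ => p) x * transportSupport c r (empirical x) V = q ⬝ᵥ V ∧
      ∀ V', ∑ x : Fin k → S, prodWeight (fun _ => p) x * transportSupport c r (empirical x) V'
        ≤ q ⬝ᵥ V' := by
  have hW : prodWeight (fun _ => p) ∈ stdSimplex ℝ (Fin k → S) := prodWeight_mem fun _ => hp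
  -- Average the optimal members over all samples. Joint convexity places the average in the ball
  -- around the mean of the empirical distributions, which is `p`.
  choose q hq hqV using fun x : Fin k → S =>
    exists_transportSupport_eq (c := c) hc hr (empirical_mem hk x) V
  have hmem := weighted_mem_transportBall hW hq
  have h1 : (fun s => ∑ x : Fin k → S, prodWeight (fun _ => p) x * empirical x s) = p :=
    funext fun s => weighted_empirical hk hp s
  rw [h1] at hmem
  have h2 : ∀ V' : S → ℝ, (fun s => ∑ x, prodWeight (fun _ => p) x * q x s) ⬝ᵥ V'
      = ∑ x, prodWeight (fun _ => p) x * (q x ⬝ᵥ V') := by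
    intro V'
    simp only [dotProduct, Finset.sum_mul, Finset.mul_sum]
    rw [Finset.sum_comm]
    simp only [mul_assoc]
  refine ⟨_, hmem, ?_, fun V' => ?_⟩
  · rw [h2]
    simp_rw [hqV]
  · rw [h2]
    exact weighted_mono hW fun x => transportSupport_le (hq x) V'

/-- An optimal plan, with no transport from the points where it does not decrease `V`. -/
lemma exists_optimal_plan (hc0 : ∀ x y, 0 ≤ c x y) (hc : ∀ x, c x x = 0) (hr : 0 ≤ r)
    (hp : p ∈ stdSimplex ℝ S) (V : S → ℝ) : ∃ K : S → S → ℝ, (∀ x, K x ∈ stdSimplex ℝ S) ∧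
      (∀ x, ∑ y, K x y * V y ≤ V x) ∧ ∑ x, p x * ∑ y, K x y * c x y ≤ r ∧
      ∑ x, p x * ∑ y, K x y * V y ≤ transportSupport c r p V := by
  obtain ⟨q, ⟨μ, hμ, hcost⟩, hqV⟩ := exists_transportSupport_eq (c := c) hc hr hp V
  obtain ⟨K, hK, hμK⟩ := hμ.exists_kernel
  -- Transport that raises the value at `x` is replaced by staying, which costs nothing and does not
  -- increase the value.
  set K' : S → S → ℝ := fun x => if ∑ y, K x y * V y ≤ V x then K x else fun y => if x = y then 1 else 0
    with hK'
  refine ⟨K', fun x => ?_, fun x => ?_, ?_, ?_⟩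
  · simp only [hK']
    split_ifs
    exacts [hK x, ite_eq_mem_stdSimplex ℝ x]
  · simp only [hK']
    split_ifs with h
    · exact h
    · simp
  · refine le_trans (Finset.sum_le_sum fun x _ => ?_) hcost
    simp only [hμK, mul_assoc, ← Finset.mul_sum]
    refine mul_le_mul_of_nonneg_left ?_ (hp.1 x)
    simp only [hK']
    split_ifs with h
    · exact le_rfl
    · simp only [ite_mul, one_mul, zero_mul, Finset.sum_ite_eq, Finset.mem_univ, if_true, hc]
      exact weighted_nonneg (hK x) (hc0 x)
  · have : q ⬝ᵥ V = ∑ x, p x * ∑ y, K x y * V y := by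
      simp only [dotProduct, ← hμ.2.2, hμK, Finset.sum_mul]
      rw [Finset.sum_comm]
      simp only [mul_assoc, Finset.mul_sum]
    rw [← hqV, this]
    refine weighted_mono hp fun x => ?_
    simp only [hK']
    split_ifs with h
    · exact le_rfl
    · simp only [ite_mul, one_mul, zero_mul, Finset.sum_ite_eq, Finset.mem_univ, if_true]
      exact le_of_not_ge h

end Empirical

/-! ### Dimension-free bias of empirical support functions -/

section EmpiricalBias

variable {S : Type*} [Fintype S]

/-- The threshold that reduces the value of a plan by at most `D`: either no transport is needed at
all, or the saved cost is `u D` while the cost at each point is at most `u w`. -/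
lemma exists_threshold {p w h : S → ℝ} (hp : ∀ x, 0 ≤ p x) (hw : ∀ x, 0 ≤ w x) (hh : ∀ x, 0 ≤ h x)
    {D : ℝ} (hD : 0 ≤ D) : ∃ u : ℝ, 0 ≤ u ∧ ∃ ψ : S → ℝ, (∀ x, 0 ≤ ψ x) ∧ (∀ x, ψ x ≤ 1) ∧
      (∀ x, h x * (1 - ψ x) ≤ u * w x) ∧ ∑ x, p x * (ψ x * w x) ≤ D ∧
      (u = 0 ∨ (∃ x, 0 < w x) ∧ 0 < u ∧ u * D ≤ ∑ x, p x * (h x * ψ x)) := by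
  -- At the price `u` per unit of value, so much transport from `x` is cancelled that a cost of at
  -- most `u * w x` remains. For `h x = 0` the quotient is `0`: free transport is kept.
  set ψ : ℝ → S → ℝ := fun u x => max (h x - u * w x) 0 / h x with hψ
  have h0 : ∀ u x, 0 ≤ ψ u x := fun u x => div_nonneg (le_max_right _ _) (hh x)
  have h1 : ∀ u, 0 ≤ u → ∀ x, ψ u x ≤ 1 := fun u hu x => by
    refine div_le_one_of_le₀ (max_le ?_ (hh x)) (hh x)
    linarith [mul_nonneg hu (hw x)]
  have hcancel : ∀ u, 0 ≤ u → ∀ x, h x * ψ u x = max (h x - u * w x) 0 := fun u hu x => by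
    simp only [hψ]
    by_cases hx : h x = 0
    · have : -(u * w x) ≤ 0 := by linarith [mul_nonneg hu (hw x)]
      simp [hx, this]
    · field_simp
  have h2 : ∀ u, 0 ≤ u → ∀ x, h x * (1 - ψ u x) ≤ u * w x := fun u hu x => by
    rw [mul_sub, hcancel u hu, mul_one]
    linarith [le_max_left (h x - u * w x) 0]
  by_cases hcase : ∑ x, p x * (ψ 0 x * w x) ≤ D
  · exact ⟨0, le_rfl, ψ 0, h0 0, h1 0 le_rfl, h2 0 le_rfl, hcase, Or.inl rfl⟩
  push Not at hcase
  -- At this price nothing is cancelled where `w > 0`, so no value is lost; by continuity some lower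
  -- price loses exactly `D`.
  set U := ∑ x, h x / w x with hU
  have hU0 : 0 ≤ U := Finset.sum_nonneg fun x _ => div_nonneg (hh x) (hw x)
  have hfU : ∑ x, p x * (ψ U x * w x) = 0 := by
    refine Finset.sum_eq_zero fun x _ => ?_
    rcases (hw x).eq_or_lt with hx | hx
    · rw [← hx]; simp
    · have : h x / w x ≤ U :=
        Finset.single_le_sum (f := fun x => h x / w x)
          (fun x _ => div_nonneg (hh x) (hw x)) (Finset.mem_univ x)
      rw [div_le_iff₀ hx] at this
      simp only [hψ]
      rw [max_eq_right (by linarith)]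
      simp
  have hcont : Continuous fun u => ∑ x, p x * (ψ u x * w x) := by
    simp only [hψ]
    refine continuous_finsetSum _ fun x _ => ?_
    refine continuous_const.mul (Continuous.mul (Continuous.div_const ?_ _) continuous_const)
    fun_prop
  obtain ⟨u, ⟨hu0, -⟩, hu⟩ := intermediate_value_Icc' hU0 hcont.continuousOn
    (show D ∈ Set.Icc (∑ x, p x * (ψ U x * w x)) (∑ x, p x * (ψ 0 x * w x)) from
      ⟨by rw [hfU]; exact hD, hcase.le⟩)
  dsimp only at hu
  have hupos : 0 < u := by
    refine hu0.lt_of_ne ?_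
    rintro rfl
    exact absurd hu hcase.ne'
  refine ⟨u, hu0, ψ u, h0 u, h1 u hu0, h2 u hu0, hu.le, Or.inr ⟨?_, hupos, ?_⟩⟩
  · by_contra hno
    push Not at hno
    have : ∑ x, p x * (ψ 0 x * w x) = 0 :=
      Finset.sum_eq_zero fun x _ => by rw [le_antisymm (hno x) (hw x)]; simp
    linarith
  · rw [← hu, Finset.mul_sum]
    refine Finset.sum_le_sum fun x _ => ?_
    -- Cancellation happens only where the cost `h` is at least `u * w`, so each unit of lost value
    -- saves at least `u` in cost.
    have : 0 ≤ (h x - u * w x) * ψ u x := by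
      rcases le_total (h x - u * w x) 0 with hx | hx
      · simp only [hψ]
        rw [max_eq_right hx]
        simp
      · exact mul_nonneg hx (h0 u x)
    nlinarith [mul_nonneg (hp x) this]

variable [DecidableEq S] {c : S → S → ℝ} {r : ℝ} {p : S → ℝ}

/-- The bias of the support function around empirical distributions is free of the dimension. -/
lemma transportSupport_empirical_bias (hc0 : ∀ x y, 0 ≤ c x y) (hc : ∀ x, c x x = 0) (hr : 0 ≤ r)
    {k : ℕ} (hk : k ≠ 0) (hp : p ∈ stdSimplex ℝ S) (V : S → ℝ) :
    ∑ x : Fin k → S, prodWeight (fun _ => p) x * transportSupport c r (empirical x) V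
      ≤ transportSupport c r p V + 5 * spanSeminorm V / √k := by
  have hk' : (0 : ℝ) < k := by positivity
  have hsk : 0 < √(k : ℝ) := Real.sqrt_pos.2 hk'
  have hsq : √(k : ℝ) ^ 2 = k := Real.sq_sqrt hk'.le
  set W : (Fin k → S) → ℝ := prodWeight (fun _ => p) with hWdef
  have hW : W ∈ stdSimplex ℝ (Fin k → S) := prodWeight_mem fun _ => hp
  set v := spanSeminorm V with hv
  have hv0 : 0 ≤ v := spanSeminorm_nonneg V
  obtain ⟨K, hK, hKV, hKc, hKp⟩ := exists_optimal_plan hc0 hc hr hp V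
  set h : S → ℝ := fun x => ∑ y, K x y * c x y with hh
  set KV : S → ℝ := fun x => ∑ y, K x y * V y with hKVd
  set w : S → ℝ := fun x => V x - KV x with hw
  have hw0 : ∀ x, 0 ≤ w x := fun x => sub_nonneg.2 (hKV x)
  have hwv : ∀ x, w x ≤ v := fun x => by
    have := (weighted_mem_Icc (hK x) V).1
    have := le_iSup_finite V x
    simp only [hw, hv, hKVd, spanSeminorm]
    linarith
  have hh0 : ∀ x, 0 ≤ h x := fun x => weighted_nonneg (hK x) (hc0 x)
  -- Giving up the value `D` creates a budget margin `u * D`, twice the bound `u * v / √k` on the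
  -- standard deviation of the empirical cost.
  set D := 2 * v / √k with hD
  have hD0 : 0 ≤ D := by positivity
  obtain ⟨u, hu0, ψ, hψ0, hψ1, hcost, hloss, hsave⟩ := exists_threshold hp.1 hw0 hh0 hD0
  set κ : S → ℝ := fun x => h x * (1 - ψ x) with hκ
  have hκ0 : ∀ x, 0 ≤ κ x := fun x => mul_nonneg (hh0 x) (by linarith [hψ1 x])
  set z : S → ℝ := fun x => KV x + ψ x * (V x - KV x) with hz
  have hzI : ∀ x, z x ∈ Set.Icc (⨅ x, V x) (⨆ x, V x) := fun x => by
    have h1 := weighted_mem_Icc (hK x) V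
    have h2 : V x ∈ Set.Icc (⨅ x, V x) (⨆ x, V x) := ⟨iInf_finite_le V x, le_iSup_finite V x⟩
    have := (convex_Icc (⨅ x, V x) (⨆ x, V x)) h1 h2
      (show 0 ≤ 1 - ψ x by linarith [hψ1 x]) (hψ0 x) (by ring)
    convert this using 1
    simp only [hz, hKVd, smul_eq_mul]
    ring
  have hzd : ∀ s t, |z s - z t| ≤ v := fun s t => by
    have h1 := hzI s
    have h2 := hzI t
    rw [abs_le]
    simp only [hv, spanSeminorm]
    constructor <;> linarith [h1.1, h1.2, h2.1, h2.2]
  set Y : (Fin k → S) → ℝ := fun x => transportSupport c r (empirical x) V with hY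
  set Z : (Fin k → S) → ℝ := fun x => ∑ s, empirical x s * z s with hZ
  set X : (Fin k → S) → ℝ := fun x => ∑ s, empirical x s * κ s with hX
  have hYZ : ∀ x, X x ≤ r → Y x ≤ Z x := fun x hx =>
    transportSupport_le_of_plan hc (empirical_mem hk x).1 hK hψ0 hψ1 hx V
  -- the probability that the reduced plan exceeds the budget
  have hbad : ∑ x, W x * (if X x ≤ r then (0 : ℝ) else 1) ≤ 1 / 4 := by
    rcases hsave with rfl | ⟨⟨x₀, hx₀⟩, hupos, hsave⟩
    · have hκz : ∀ x, κ x = 0 := fun x => le_antisymm (by simpa using hcost x) (hκ0 x)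
      have : ∀ x, X x ≤ r := fun x => by
        simp only [hX, hκz, mul_zero, Finset.sum_const_zero]
        exact hr
      simp [this]
    · have hvpos : 0 < v := hx₀.trans_le (hwv x₀)
      have hDpos : 0 < D := by positivity
      have hmean : ∑ s, p s * κ s ≤ r - u * D := by
        have : ∑ s, p s * κ s = ∑ s, p s * h s - ∑ s, p s * (h s * ψ s) := by
          rw [← Finset.sum_sub_distrib]
          exact Finset.sum_congr rfl fun s _ => by simp only [hκ]; ring
        linarith
      have hvar := empirical_mul_variance hk hp (f := κ) (b := u * v) fun s t => by
        have h1 := (hcost s).trans (mul_le_mul_of_nonneg_left (hwv s) hu0)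
        have h2 := (hcost t).trans (mul_le_mul_of_nonneg_left (hwv t) hu0)
        rw [abs_le]
        constructor <;> linarith [hκ0 s, hκ0 t]
      -- Chebyshev's inequality: exceeding the budget means a deviation of at least `u * D` from the
      -- mean cost.
      have h3 : (u * D) ^ 2 * ∑ x, W x * (if X x ≤ r then (0 : ℝ) else 1) ≤ (u * v) ^ 2 / k := by
        refine le_trans ?_ hvar
        rw [Finset.mul_sum]
        refine Finset.sum_le_sum fun x _ => ?_
        have hWx := hW.1 x
        split_ifs with hx
        · rw [mul_zero, mul_zero]
          exact mul_nonneg hWx (sq_nonneg _)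
        · rw [mul_one, mul_comm]
          refine mul_le_mul_of_nonneg_left ?_ hWx
          push Not at hx
          have : u * D ≤ X x - ∑ s, p s * κ s := by linarith
          exact pow_le_pow_left₀ (by positivity) this 2
      have h4 : (u * v) ^ 2 / k = (u * D) ^ 2 * (1 / 4) := by
        have hk2 : (k : ℝ) ≠ 0 := hk'.ne'
        rw [hD, mul_pow, mul_pow, div_pow, hsq]
        field_simp
        norm_num
      rw [h4] at h3
      exact le_of_mul_le_mul_left h3 (by positivity)
  have hEZ : ∑ x, W x * Z x ≤ transportSupport c r p V + D := by
    rw [weighted_empirical_mul hk hp z]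
    have : ∑ s, p s * z s = ∑ s, p s * KV s + ∑ s, p s * (ψ s * w s) := by
      rw [← Finset.sum_add_distrib]
      exact Finset.sum_congr rfl fun s _ => by simp only [hz, hw]; ring
    linarith
  set EY := ∑ x, W x * Y x with hEY
  set EZ := ∑ x, W x * Z x with hEZd
  have sd : ∀ (f : (Fin k → S) → ℝ) (m : ℝ), ∑ x, W x * (f x - m) ^ 2 ≤ v ^ 2 / k →
      ∑ x, W x * |f x - m| ≤ v / √k := by
    intro f m hf
    refine abs_le_of_sq_le_sq' ?_ (by positivity) |>.2
    refine (weighted_sq_le hW _).trans ?_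
    simp only [sq_abs]
    rwa [div_pow, hsq]
  have sY : ∑ x, W x * |Y x - EY| ≤ v / √k :=
    sd Y EY (transportSupport_empirical_variance hc0 hc hr hk hp V)
  have sZ : ∑ x, W x * |Z x - EZ| ≤ v / √k := by
    refine sd Z EZ ?_
    rw [hEZd, weighted_empirical_mul hk hp z]
    exact empirical_mul_variance hk hp hzd
  -- On the good event `Y ≤ Z`, so `EY - EZ` is at most the sum of the two deviations there. The
  -- event has probability at least `3 / 4`, so `EY - EZ` is at most `8 / 3` units of `v / √k`; with
  -- the `2` units of `D` this stays below `5`.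
  have hgood : ∑ x, W x * (if X x ≤ r then (1 : ℝ) else 0) * (EY - EZ)
      ≤ ∑ x, W x * |Y x - EY| + ∑ x, W x * |Z x - EZ| := by
    rw [← Finset.sum_add_distrib]
    refine Finset.sum_le_sum fun x _ => ?_
    rw [← mul_add, mul_assoc]
    refine mul_le_mul_of_nonneg_left ?_ (hW.1 x)
    split_ifs with hx
    · have h1 := hYZ x hx
      have h2 := neg_abs_le (Y x - EY)
      have h3 := le_abs_self (Z x - EZ)
      linarith
    · rw [zero_mul]
      positivity
  rw [← Finset.sum_mul] at hgood
  have hprob : ∑ x, W x * (if X x ≤ r then (1 : ℝ) else 0) ≥ 3 / 4 := by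
    have : ∑ x, W x * (if X x ≤ r then (1 : ℝ) else 0)
        + ∑ x, W x * (if X x ≤ r then (0 : ℝ) else 1) = 1 := by
      rw [← Finset.sum_add_distrib]
      refine Eq.trans (Finset.sum_congr rfl fun x _ => ?_) hW.2
      split_ifs <;> simp
    linarith
  have hvk : 0 ≤ v / √k := by positivity
  have hfin : EY - EZ ≤ 8 / 3 * (v / √k) := by
    rcases le_total (EY - EZ) 0 with h0 | h0
    · linarith
    · nlinarith
  have e1 : D = 2 * (v / √k) := by rw [hD]; ring
  have e2 : 5 * v / √k = 5 * (v / √k) := by ring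
  rw [e2]
  linarith

/-- The mean square error of the support function around empirical distributions. -/
lemma transportSupport_empirical_mse (hc0 : ∀ x y, 0 ≤ c x y) (hc : ∀ x, c x x = 0) (hr : 0 ≤ r)
    {k : ℕ} (hk : k ≠ 0) (hp : p ∈ stdSimplex ℝ S) (V : S → ℝ) :
    ∑ x : Fin k → S, prodWeight (fun _ => p) x *
      (transportSupport c r (empirical x) V - transportSupport c r p V) ^ 2
      ≤ 26 * spanSeminorm V ^ 2 / k := by
  have hk' : (0 : ℝ) < k := by positivity
  have hW : prodWeight (fun _ => p) ∈ stdSimplex ℝ (Fin k → S) := prodWeight_mem fun _ => hp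
  rw [weighted_variance hW]
  have h1 := transportSupport_empirical_variance hc0 hc hr hk hp V
  have h2 := transportSupport_empirical_bias hc0 hc hr hk hp V
  -- The mean is the value of a member of the true ball, so the bias is nonnegative. The constant is
  -- `26 = 1 + 5 ^ 2`, variance plus squared bias.
  obtain ⟨q, hq, hqV, -⟩ := exists_transportSupport_empirical hc hr hk hp V
  have h3 := transportSupport_le hq V
  rw [← hqV] at h3
  have h4 : (∑ x : Fin k → S, prodWeight (fun _ => p) x * transportSupport c r (empirical x) V
      - transportSupport c r p V) ^ 2 ≤ (5 * spanSeminorm V / √k) ^ 2 :=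
    pow_le_pow_left₀ (by linarith) (by linarith) 2
  rw [div_pow, Real.sq_sqrt hk'.le] at h4
  refine (add_le_add h1 h4).trans (le_of_eq ?_)
  ring

end EmpiricalBias

/-! ### Row-stochastic matrices and the span semi-norm -/

section Stochastic

variable {S : Type*} [Fintype S]

/-- Since `a` sums to zero, `x` may be recentred at its midrange, where its sup norm is half the
span. -/
lemma sum_mul_le_half_l1 {a : S → ℝ} (ha : ∑ s, a s = 0) (x : S → ℝ) :
    ∑ s, a s * x s ≤ 1 / 2 * (∑ s, |a s|) * spanSeminorm x := by
  set m := ((⨆ s, x s) + ⨅ s, x s) / 2 with hm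
  have h1 : ∑ s, a s * x s = ∑ s, a s * (x s - m) := by
    simp only [mul_sub, Finset.sum_sub_distrib]
    rw [← Finset.sum_mul, ha]
    ring
  rw [h1, mul_assoc, mul_comm (1 / 2 : ℝ), mul_assoc, Finset.sum_mul]
  refine Finset.sum_le_sum fun s _ => ?_
  refine (le_abs_self _).trans ?_
  rw [abs_mul]
  refine mul_le_mul_of_nonneg_left ?_ (abs_nonneg _)
  rw [abs_le]
  have := le_iSup_finite x s
  have := iInf_finite_le x s
  simp only [hm, spanSeminorm]
  constructor <;> linarith

lemma sum_abs_le_of_forall {a : S → ℝ} {b : ℝ}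
    (h : ∀ x : S → ℝ, (∀ s, |x s| ≤ 1) → ∑ s, a s * x s ≤ b) : ∑ s, |a s| ≤ b := by
  refine le_trans (le_of_eq ?_) (h (fun s => if 0 ≤ a s then 1 else -1) fun s => ?_)
  · refine Finset.sum_congr rfl fun s _ => ?_
    split_ifs with hs
    · rw [abs_of_nonneg hs, mul_one]
    · rw [abs_of_neg (not_le.1 hs)]; ring
  · split_ifs <;> simp

variable [DecidableEq S]

lemma row_mem_stdSimplex {M : Matrix S S ℝ} (hM : M ∈ rowStochastic ℝ S) (i : S) :
    M i ∈ stdSimplex ℝ S :=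
  ⟨fun _ => nonneg_of_mem_rowStochastic hM, sum_row_of_mem_rowStochastic hM i⟩

lemma mulVec_const_of_rowStochastic {M : Matrix S S ℝ} (hM : M ∈ rowStochastic ℝ S) (c : ℝ) :
    M *ᵥ (fun _ => c) = fun _ => c :=
  funext fun i => weighted_const (row_mem_stdSimplex hM i) c

lemma mulVec_sub_const {M : Matrix S S ℝ} (hM : M ∈ rowStochastic ℝ S) (x : S → ℝ) (c : ℝ) :
    M *ᵥ (fun s => x s - c) = fun s => (M *ᵥ x) s - c := by
  have : (fun s => x s - c) = x - fun _ => c := rfl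
  rw [this, mulVec_sub, mulVec_const_of_rowStochastic hM]
  rfl

lemma dotProduct_const_of_mem {μ : S → ℝ} (hμ : μ ∈ stdSimplex ℝ S) (c : ℝ) :
    μ ⬝ᵥ (fun _ => c) = c := weighted_const hμ c

lemma weighted_sub_le_spanSeminorm {μ ν : S → ℝ} (hμ : μ ∈ stdSimplex ℝ S)
    (hν : ν ∈ stdSimplex ℝ S) (x : S → ℝ) : μ ⬝ᵥ x - ν ⬝ᵥ x ≤ spanSeminorm x := by
  have h1 := (weighted_mem_Icc hμ x).2
  have h2 := (weighted_mem_Icc hν x).1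
  simp only [dotProduct, spanSeminorm]
  linarith

lemma spanSeminorm_mulVec_le [Nonempty S] {M : Matrix S S ℝ} (hM : M ∈ rowStochastic ℝ S)
    (x : S → ℝ) : spanSeminorm (M *ᵥ x) ≤ spanSeminorm x :=
  spanSeminorm_le fun s t =>
    weighted_sub_le_spanSeminorm (row_mem_stdSimplex hM s) (row_mem_stdSimplex hM t) x

/-- Doeblin contraction of the span semi-norm. -/
lemma spanSeminorm_mulVec_le_of_le [Nonempty S] {M : Matrix S S ℝ} (hM : M ∈ rowStochastic ℝ S)
    {c : ℝ} (hc : ∀ i j, c ≤ M i j) (x : S → ℝ) :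
    spanSeminorm (M *ᵥ x) ≤ (1 - c) * spanSeminorm x := by
  refine spanSeminorm_le fun s t => ?_
  obtain ⟨m, hm⟩ := exists_eq_ciInf_of_finite (f := x)
  have h2 : ⨅ s, x s ≤ (M *ᵥ x) t := (weighted_mem_Icc (row_mem_stdSimplex hM t) x).1
  -- Every row gives the minimizing state weight at least `c`, which keeps `(M *ᵥ x) s` below the
  -- maximum by `c` times the span.
  have h3 : ∑ j, M s j * ((⨆ s, x s) - x j) ≥ c * ((⨆ s, x s) - x m) := by
    have h0 : ∀ j, 0 ≤ (⨆ s, x s) - x j := fun j => sub_nonneg.2 (le_iSup_finite x j)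
    refine le_trans ?_ (Finset.single_le_sum (f := fun j => M s j * ((⨆ s, x s) - x j))
      (fun j _ => mul_nonneg (nonneg_of_mem_rowStochastic hM) (h0 j)) (Finset.mem_univ m))
    exact mul_le_mul_of_nonneg_right (hc s m) (h0 m)
  simp only [mul_sub, Finset.sum_sub_distrib] at h3
  rw [weighted_const (row_mem_stdSimplex hM s)] at h3
  have h4 : (M *ᵥ x) s = ∑ j, M s j * x j := rfl
  rw [hm] at h3
  simp only [spanSeminorm]
  linarith

/-- An irreducible aperiodic matrix has a positive power. -/
lemma exists_pow_pos_of_aperiodic {M : Matrix S S ℝ} (hM : M.IsIrreducible)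
    (ha : IsAperiodicChain M) : ∃ k : ℕ, 1 ≤ k ∧ ∀ i j, 0 < (M ^ k) i j := by
  have hpow : ∀ n i j, 0 ≤ (M ^ n) i j := by
    intro n
    induction n with
    | zero => intro i j; simp only [pow_zero, one_apply]; split_ifs <;> norm_num
    | succ n ih =>
      intro i j
      rw [pow_succ, mul_apply]
      exact Finset.sum_nonneg fun l _ => mul_nonneg (ih i l) (hM.nonneg l j)
  have hmul : ∀ {a b i j l}, 0 < (M ^ a) i j → 0 < (M ^ b) j l → 0 < (M ^ (a + b)) i l := by
    intro a b i j l h1 h2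
    rw [pow_add, mul_apply]
    exact Finset.sum_pos' (fun m _ => mul_nonneg (hpow a i m) (hpow b m l))
      ⟨j, Finset.mem_univ j, mul_pos h1 h2⟩
  have hret : ∀ i, ∃ N, ∀ n ≥ N, 0 < (M ^ n) i i := by
    intro i
    set R : Set ℕ := {n | 0 < n ∧ 0 < (M ^ n) i i} with hR
    -- The return times have greatest common divisor one, so the additive monoid they generate
    -- contains all large integers.
    have hg : Nat.setGcd R = 1 := ha i _ fun n hn hpos => Nat.setGcd_dvd_of_mem ⟨hn, hpos⟩
    obtain ⟨N, hN⟩ := Nat.exists_mem_closure_of_ge R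
    refine ⟨N, fun n hn => ?_⟩
    have hmem := hN n hn (by rw [hg]; exact one_dvd n)
    refine AddSubmonoid.closure_induction (motive := fun n _ => 0 < (M ^ n) i i) ?_ ?_ ?_ hmem
    · exact fun n hn => hn.2
    · simp
    · exact fun a b _ _ h1 h2 => hmul h1 h2
  have hconn := (isIrreducible_iff_exists_pow_pos hM.nonneg).1 hM
  choose N hN using hret
  choose d hd using hconn
  -- Loop at `i`, then walk to `j` in `d i j` steps; this length leaves at least `N i` steps for the
  -- loop whatever `i` and `j` are.
  refine ⟨∑ i, N i + ∑ i, ∑ j, d i j + 1, by omega, fun i j => ?_⟩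
  have h1 : N i ≤ ∑ i, N i := Finset.single_le_sum (fun _ _ => Nat.zero_le _) (Finset.mem_univ i)
  have h2 : d i j ≤ ∑ i, ∑ j, d i j :=
    (Finset.single_le_sum (f := d i) (fun _ _ => Nat.zero_le _) (Finset.mem_univ j)).trans
      (Finset.single_le_sum (f := fun i => ∑ j, d i j) (fun _ _ => Nat.zero_le _)
        (Finset.mem_univ i))
  have h3 := hmul (hN i (∑ i, N i + ∑ i, ∑ j, d i j + 1 - d i j) (by omega)) (hd i j).2
  rwa [Nat.sub_add_cancel (by omega)] at h3

end Stochastic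

/-! ### The chains of an admissible robust MDP -/

namespace RobustMDP

variable {S A : Type*} [Fintype S] [Fintype A] [DecidableEq S] {I : RobustMDP S A}

/-- The transition matrices of the policy for the kernels in the uncertainty set. -/
def chains (I : RobustMDP S A) : Set (Matrix S S ℝ) := I.chain '' I.kernels

lemma chain_mulVec (P : S → A → S → ℝ) (x : S → ℝ) (s : S) :
    (I.chain P *ᵥ x) s = ∑ a, I.policy s a * (P s a ⬝ᵥ x) := by
  simp only [mulVec, dotProduct, chain, of_apply, Finset.sum_mul, Finset.mul_sum]
  rw [Finset.sum_comm]
  simp only [mul_assoc]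

lemma chain_apply (P : S → A → S → ℝ) (s s' : S) :
    I.chain P s s' = ∑ a, I.policy s a * P s a s' := rfl

namespace Admissible

lemma proper (h : I.Admissible) : I.unc.Proper := h.radius.proper

lemma kernel_mem (h : I.Admissible) {P : S → A → S → ℝ} (hP : P ∈ I.kernels) (s : S) (a : A) :
    P s a ∈ stdSimplex ℝ S := UncertaintySet.ball_subset h.proper (h.nominal_mem s a) (hP s a)

lemma nominal_mem_kernels (h : I.Admissible) : I.nominal ∈ I.kernels :=
  fun s a => UncertaintySet.self_mem_ball h.proper (h.nominal_mem s a)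

lemma chain_mem_of_mem (h : I.Admissible) {P : S → A → S → ℝ}
    (hP : ∀ s a, P s a ∈ stdSimplex ℝ S) : I.chain P ∈ rowStochastic ℝ S := by
  rw [mem_rowStochastic_iff_sum]
  refine ⟨fun i j => weighted_nonneg (h.policy_mem i) fun a => (hP i a).1 j, fun i => ?_⟩
  simp only [chain_apply]
  rw [Finset.sum_comm]
  simp_rw [← Finset.mul_sum, (hP i _).2, mul_one]
  exact (h.policy_mem i).2

lemma chain_mem (h : I.Admissible) {P : S → A → S → ℝ} (hP : P ∈ I.kernels) :
    I.chain P ∈ rowStochastic ℝ S := h.chain_mem_of_mem (h.kernel_mem hP)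

lemma chains_subset (h : I.Admissible) : I.chains ⊆ rowStochastic ℝ S := by
  rintro _ ⟨P, hP, rfl⟩
  exact h.chain_mem hP

lemma pow_chains_subset (h : I.Admissible) (n : ℕ) : I.chains ^ n ⊆ rowStochastic ℝ S := by
  induction n with
  | zero =>
    rw [pow_zero]
    rintro _ rfl
    exact one_mem _
  | succ n ih =>
    rw [pow_succ]
    rintro _ ⟨M, hM, N, hN, rfl⟩
    exact mul_mem (ih hM) (h.chains_subset hN)

/-- In total variation and Wasserstein models the chains stay close to the nominal chain. -/
lemma exists_tv_radius (h : I.Admissible) (hU : I.unc.IsTVOrWasserstein) :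
    ∃ (τ : ℝ) (k : ℕ), 1 ≤ k ∧ (∀ i j, k * τ < (I.chain I.nominal ^ k) i j) ∧
      ∀ s a, ∀ q ∈ I.unc.ball (I.nominal s a), 1 / 2 * ∑ x, |q x - I.nominal s a x| ≤ τ := by
  have hr := h.radius
  rcases hU with ⟨δ, hδ⟩ | ⟨m, l, δ, hδ⟩
  · rw [hδ] at hr ⊢
    obtain ⟨-, k, hk, -, hlt⟩ := hr
    have hk' : (0 : ℝ) < k := by positivity
    refine ⟨δ, k, hk, fun i j => ?_, fun s a q hq => hq.2⟩
    have := hlt i j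
    rw [lt_div_iff₀ hk'] at this
    linarith
  · have hp := h.proper
    rw [hδ] at hr hp ⊢
    obtain ⟨hl, hδ0, k, hk, hpos, hlt⟩ := hr
    have hk' : (0 : ℝ) < k := by positivity
    let _ := m
    have hball : ∀ s a, ∀ q ∈ (UncertaintySet.wasserstein m l δ).ball (I.nominal s a),
        ∃ μ, IsCoupling (I.nominal s a) q μ ∧ ∑ x, ∑ y, μ x y * (dist x y) ^ l ≤ δ ^ l := by
      intro s a q hq
      rw [wasserstein_ball_eq m hl hδ0 (h.nominal_mem s a)] at hq
      exact hq
    by_cases hne : (Finset.univ : Finset S).offDiag.Nonempty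
    · obtain ⟨⟨x₀, y₀⟩, hxy, hmin⟩ := Finset.exists_min_image _ (fun z : S × S => dist z.1 z.2) hne
      have hxy' : x₀ ≠ y₀ := (Finset.mem_offDiag.1 hxy).2.2
      have hD : 0 < dist x₀ y₀ := dist_pos.2 hxy'
      have hM : I.chain I.nominal ^ k ∈ rowStochastic ℝ S :=
        pow_mem (h.chain_mem h.nominal_mem_kernels) k
      have hlt' : ∀ i j, k * (δ / dist x₀ y₀) < (I.chain I.nominal ^ k) i j := by
        intro i j
        have : δ < dist x₀ y₀ * (I.chain I.nominal ^ k) i j / k := hlt x₀ y₀ hxy' i j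
        rw [lt_div_iff₀ hk'] at this
        rw [← mul_div_assoc, div_lt_iff₀ hD]
        linarith
      refine ⟨δ / dist x₀ y₀, k, hk, hlt', fun s a q hq => ?_⟩
      obtain ⟨μ, hμ, hc⟩ := hball s a q hq
      refine hμ.tv_le.trans ?_
      set t := ∑ x, ∑ y, μ x y * (if x = y then (0 : ℝ) else 1)
      -- All moved mass travels at least the least distance.
      have h1 : t * dist x₀ y₀ ^ l ≤ δ ^ l := by
        refine le_trans ?_ hc
        rw [Finset.sum_mul]
        refine Finset.sum_le_sum fun x _ => ?_
        rw [Finset.sum_mul]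
        refine Finset.sum_le_sum fun y _ => ?_
        rw [mul_assoc]
        refine mul_le_mul_of_nonneg_left ?_ (hμ.1 x y)
        by_cases hxy : x = y
        · simp only [hxy, if_true, zero_mul]
          exact Real.rpow_nonneg dist_nonneg l
        · simp only [hxy, if_false, one_mul]
          exact Real.rpow_le_rpow hD.le (hmin (x, y) (by simpa using hxy)) (by linarith)
      -- A ratio at most `1` is needed to drop the exponent: `t ≤ (δ / dist) ^ l ≤ δ / dist` because
      -- `l ≥ 1`.
      have hx1 : δ / dist x₀ y₀ ≤ 1 := by
        have h2 := hlt' x₀ y₀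
        have h3 : (I.chain I.nominal ^ k) x₀ y₀ ≤ 1 := le_one_of_mem_rowStochastic hM
        have h4 : (1 : ℝ) ≤ k := by exact_mod_cast hk
        have h5 : 0 ≤ δ / dist x₀ y₀ := by positivity
        nlinarith
      have h2 : t ≤ (δ / dist x₀ y₀) ^ l := by
        rw [Real.div_rpow hδ0 hD.le, le_div_iff₀ (Real.rpow_pos_of_pos hD l)]
        exact h1
      refine h2.trans ?_
      have h5 : 0 ≤ δ / dist x₀ y₀ := by positivity
      simpa using Real.rpow_le_rpow_of_exponent_ge' h5 hx1 zero_le_one hl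
    -- No two distinct states exist, so no mass can move whatever the radius.
    · refine ⟨0, k, hk, fun i j => by simpa using hpos i j, fun s a q hq => ?_⟩
      obtain ⟨μ, hμ, hc⟩ := hball s a q hq
      refine hμ.tv_le.trans (le_of_eq ?_)
      refine Finset.sum_eq_zero fun x _ => Finset.sum_eq_zero fun y _ => ?_
      have : x = y := by
        by_contra hxy
        exact hne ⟨(x, y), by simpa using hxy⟩
      simp [this]

/-- The factors of the product are exchanged one at a time for the nominal chain. Each exchange
costs at most `τ`, because stochastic matrices never enlarge the span of the test vector. -/
lemma abs_mulVec_sub_nominal_le (h : I.Admissible) {τ : ℝ}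
    (hτ : ∀ s a, ∀ q ∈ I.unc.ball (I.nominal s a), 1 / 2 * ∑ x, |q x - I.nominal s a x| ≤ τ)
    (n : ℕ) : ∀ M ∈ I.chains ^ n, ∀ x : S → ℝ, spanSeminorm x ≤ 1 → ∀ s,
      ((I.chain I.nominal) ^ n *ᵥ x) s - (M *ᵥ x) s ≤ n * τ := by
  have hnom := h.chain_mem h.nominal_mem_kernels
  induction n with
  | zero =>
    rw [pow_zero]
    rintro _ rfl x - s
    simp
  | succ n ih =>
    rw [pow_succ]
    rintro _ ⟨M, hM, _, ⟨P, hP, rfl⟩, rfl⟩ x hx s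
    have : Nonempty S := ⟨s⟩
    have h1 := ih M hM (I.chain I.nominal *ᵥ x) ((spanSeminorm_mulVec_le hnom x).trans hx) s
    have h2 : ∀ t, (I.chain I.nominal *ᵥ x) t - (I.chain P *ᵥ x) t ≤ τ := by
      intro t
      rw [chain_mulVec, chain_mulVec, ← Finset.sum_sub_distrib,
        ← weighted_const (h.policy_mem t) τ]
      simp_rw [← mul_sub]
      refine weighted_mono (h.policy_mem t) fun a => ?_
      have h3 := sum_mul_le_half_l1 (a := fun y => I.nominal t a y - P t a y)
        (by rw [Finset.sum_sub_distrib, (h.nominal_mem t a).2, (h.kernel_mem hP t a).2, sub_self]) x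
      simp only [sub_mul, Finset.sum_sub_distrib] at h3
      refine h3.trans ?_
      have h4 := hτ t a _ (hP t a)
      simp_rw [abs_sub_comm (P t a _)] at h4
      have h5 : 0 ≤ 1 / 2 * ∑ y, |I.nominal t a y - P t a y| := by positivity
      nlinarith
    have h6 : (M *ᵥ (I.chain I.nominal *ᵥ x)) s - (M *ᵥ (I.chain P *ᵥ x)) s ≤ τ := by
      have hMs := row_mem_stdSimplex (h.pow_chains_subset n hM) s
      simp only [mulVec, dotProduct] at h2 ⊢
      rw [← Finset.sum_sub_distrib, ← weighted_const hMs τ]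
      simp_rw [← mul_sub]
      exact weighted_mono hMs h2
    rw [pow_succ, ← mulVec_mulVec, ← mulVec_mulVec]
    push_cast
    linarith

/-- Uniform Doeblin minorization of the products of sufficiently many chains. -/
lemma exists_doeblin (h : I.Admissible) : ∃ (k : ℕ) (c : ℝ), 1 ≤ k ∧ 0 < c ∧
    ∀ M ∈ I.chains ^ k, ∀ i j, c ≤ M i j := by
  rcases isEmpty_or_nonempty S with hS | hS
  · exact ⟨1, 1, le_rfl, one_pos, fun M _ i => (hS.false i).elim⟩
  have hfin : ∀ f : S → S → ℝ, (∀ i j, 0 < f i j) → ∃ c > 0, ∀ i j, c ≤ f i j := by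
    intro f hf
    obtain ⟨z, -, hz⟩ := Finset.exists_min_image Finset.univ (fun z : S × S => f z.1 z.2)
      Finset.univ_nonempty
    exact ⟨f z.1 z.2, hf _ _, fun i j => hz (i, j) (Finset.mem_univ _)⟩
  rcases UncertaintySet.contamination_or I.unc with ⟨δ, hδ⟩ | hU
  · obtain ⟨k, hk, hpos⟩ := exists_pow_pos_of_aperiodic h.irreducible h.aperiodic
    have hp := h.proper
    rw [hδ] at hp
    obtain ⟨hδ0, hδ1⟩ := hp
    have hδ1' : 0 < 1 - δ := by linarith
    -- A contaminated chain keeps the fraction `1 - δ` of the nominal one entrywise, and this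
    -- survives multiplication of nonnegative matrices.
    have key : ∀ n, ∀ M ∈ I.chains ^ n, ∀ i j,
        (1 - δ) ^ n * ((I.chain I.nominal) ^ n) i j ≤ M i j := by
      intro n
      induction n with
      | zero =>
        rw [pow_zero]
        rintro _ rfl i j
        simp
      | succ n ih =>
        rw [pow_succ]
        rintro _ ⟨M, hM, _, ⟨P, hP, rfl⟩, rfl⟩ i j
        have h1 : ∀ s t, (1 - δ) * I.chain I.nominal s t ≤ I.chain P s t := by
          intro s t
          rw [chain_apply, chain_apply, Finset.mul_sum]
          refine Finset.sum_le_sum fun a _ => ?_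
          have h3 := hP s a
          rw [hδ] at h3
          obtain ⟨q', hq', hq⟩ := h3
          rw [hq]
          simp only [Pi.add_apply, Pi.smul_apply, smul_eq_mul]
          have := mul_nonneg ((h.policy_mem s).1 a) (mul_nonneg hδ0 (hq'.1 t))
          linarith
        dsimp only
        rw [pow_succ (I.chain I.nominal), mul_apply, mul_apply, Finset.mul_sum]
        refine Finset.sum_le_sum fun l _ => ?_
        have h4 := nonneg_of_mem_rowStochastic (i := l) (j := j)
          (h.chain_mem h.nominal_mem_kernels)
        have h5 : 0 ≤ M i l := nonneg_of_mem_rowStochastic (h.pow_chains_subset n hM)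
        calc (1 - δ) ^ (n + 1) * ((I.chain I.nominal ^ n) i l * I.chain I.nominal l j)
            = ((1 - δ) ^ n * (I.chain I.nominal ^ n) i l) * ((1 - δ) * I.chain I.nominal l j) := by
              ring
          _ ≤ _ := mul_le_mul (ih M hM i l) (h1 l j) (by positivity) h5
    obtain ⟨c, hc, hcle⟩ := hfin _ hpos
    refine ⟨k, (1 - δ) ^ k * c, hk, by positivity, fun M hM i j => ?_⟩
    exact (mul_le_mul_of_nonneg_left (hcle i j) (by positivity)).trans (key k M hM i j)
  · obtain ⟨τ, k, hk, hlt, hτ⟩ := h.exists_tv_radius hU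
    obtain ⟨c, hc, hcle⟩ := hfin (fun i j => ((I.chain I.nominal) ^ k) i j - k * τ)
      fun i j => sub_pos.2 (hlt i j)
    refine ⟨k, c, hk, hc, fun M hM i j => ?_⟩
    -- The indicator of `j` has span at most one, and testing with it compares single entries.
    have h1 := h.abs_mulVec_sub_nominal_le hτ k M hM (Pi.single j 1) (spanSeminorm_le fun s t => by
      simp only [Pi.single_apply]
      split_ifs <;> norm_num) i
    simp only [mulVec_single_one, col_apply] at h1
    linarith [hcle i j]

/-- Uniform geometric contraction of the products of chains. -/
lemma exists_geometric [Nonempty S] (h : I.Admissible) : ∃ C ρ : ℝ, 0 < C ∧ 0 < ρ ∧ ρ < 1 ∧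
    ∀ n, ∀ M ∈ I.chains ^ n, ∀ x, spanSeminorm (M *ᵥ x) ≤ C * ρ ^ n * spanSeminorm x := by
  obtain ⟨k, c, hk, hc, hM⟩ := h.exists_doeblin
  -- The floor `1 / 2` keeps `b` positive even for `c ≥ 1`, so that its root and its inverse can be
  -- used.
  set b : ℝ := max (1 - c) (1 / 2) with hb
  have hb0 : 0 < b := lt_max_of_lt_right (by norm_num)
  have hb1 : b < 1 := max_lt (by linarith) (by norm_num)
  have hstep : ∀ q t, ∀ M ∈ I.chains ^ (k * q + t), ∀ x,
      spanSeminorm (M *ᵥ x) ≤ b ^ q * spanSeminorm x := by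
    intro q t
    induction q with
    | zero =>
      intro M hM x
      simpa using spanSeminorm_mulVec_le (h.pow_chains_subset _ hM) x
    | succ q ih =>
      have e : k * (q + 1) + t = k + (k * q + t) := by ring
      rw [e, pow_add]
      rintro _ ⟨M, hM', N, hN, rfl⟩ x
      rw [← mulVec_mulVec]
      refine (spanSeminorm_mulVec_le_of_le (h.pow_chains_subset k hM') (hM M hM') _).trans ?_
      have h1 := ih N hN x
      have h2 := spanSeminorm_nonneg (N *ᵥ x)
      calc (1 - c) * spanSeminorm (N *ᵥ x) ≤ b * spanSeminorm (N *ᵥ x) :=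
            mul_le_mul_of_nonneg_right (le_max_left _ _) h2
        _ ≤ b * (b ^ q * spanSeminorm x) := mul_le_mul_of_nonneg_left h1 hb0.le
        _ = _ := by ring
  have hk0 : k ≠ 0 := by omega
  set ρ : ℝ := b ^ ((k : ℝ)⁻¹) with hρ
  have hρ0 : 0 < ρ := Real.rpow_pos_of_pos hb0 _
  have hρ1 : ρ < 1 := Real.rpow_lt_one hb0.le hb1 (by positivity)
  have hρk : ρ ^ k = b := Real.rpow_inv_natCast_pow hb0.le hk0
  -- With `ρ ^ k = b`, the factor `b⁻¹` pays for the incomplete block of fewer than `k` matrices.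
  refine ⟨b⁻¹, ρ, by positivity, hρ0, hρ1, fun n M hMn x => ?_⟩
  rw [← Nat.div_add_mod n k] at hMn
  refine (hstep _ _ M hMn x).trans (mul_le_mul_of_nonneg_right ?_ (spanSeminorm_nonneg x))
  rw [inv_mul_eq_div, le_div_iff₀ hb0, ← pow_succ, ← hρk, ← pow_mul]
  refine pow_le_pow_of_le_one hρ0.le hρ1.le ?_
  have := Nat.div_add_mod n k
  have := Nat.mod_lt n (Nat.pos_of_ne_zero hk0)
  rw [mul_add]
  omega

end Admissible

end RobustMDP

/-! ### Stationary distributions and mixing times -/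

section Mixing

variable {S : Type*} [Fintype S] [DecidableEq S] {M : Matrix S S ℝ} {C ρ : ℝ}

lemma IsStationaryDist.vecMul_pow {ν : S → ℝ} (hν : IsStationaryDist M ν) (n : ℕ) :
    ν ᵥ* M ^ n = ν := by
  induction n with
  | zero => simp
  | succ n ih => rw [pow_succ, ← vecMul_vecMul, ih, hν.2]

lemma IsStationaryDist.dotProduct_pow_mulVec {ν : S → ℝ} (hν : IsStationaryDist M ν) (n : ℕ)
    (x : S → ℝ) : ν ⬝ᵥ (M ^ n *ᵥ x) = ν ⬝ᵥ x := by
  rw [dotProduct_mulVec, hν.vecMul_pow]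

/-- A row of `M ^ (n + 1)` minus the same row of `M ^ n` is a difference of two distributions
applied to `M ^ n *ᵥ e_j`, whose span decays geometrically. So the rows converge, and the limit is
invariant. -/
lemma exists_isStationaryDist [Nonempty S] (hM : M ∈ rowStochastic ℝ S) (hρ1 : ρ < 1)
    (hgeo : ∀ n x, spanSeminorm (M ^ n *ᵥ x) ≤ C * ρ ^ n * spanSeminorm x) :
    ∃ ν, IsStationaryDist M ν := by
  obtain ⟨s₀⟩ := ‹Nonempty S›
  have hmem : ∀ n, (M ^ n) s₀ ∈ stdSimplex ℝ S := fun n => row_mem_stdSimplex (pow_mem hM n) s₀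
  have hlim : ∀ j, ∃ l, Tendsto (fun n => (M ^ n) s₀ j) atTop (𝓝 l) := by
    intro j
    refine cauchySeq_tendsto_of_complete (cauchySeq_of_le_geometric ρ
      (C * spanSeminorm (Pi.single j 1 : S → ℝ)) hρ1 fun n => ?_)
    have h1 := weighted_sub_le_spanSeminorm (hmem 0) (hmem 1) (M ^ n *ᵥ Pi.single j 1)
    have h2 := weighted_sub_le_spanSeminorm (hmem 1) (hmem 0) (M ^ n *ᵥ Pi.single j 1)
    have e : ∀ m, (M ^ m) s₀ ⬝ᵥ (M ^ n *ᵥ Pi.single j 1) = (M ^ (m + n)) s₀ j := by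
      intro m
      rw [mulVec_single_one, pow_add, mul_apply]
      rfl
    rw [e, e, zero_add, add_comm 1 n] at h1 h2
    have h3 := hgeo n (Pi.single j 1)
    rw [Real.dist_eq, abs_le]
    constructor <;> nlinarith
  choose ν hν using hlim
  have hν' : Tendsto (fun n => (M ^ n) s₀) atTop (𝓝 ν) := tendsto_pi_nhds.2 hν
  refine ⟨ν, (isClosed_stdSimplex ℝ S).mem_of_tendsto hν' (Eventually.of_forall hmem), ?_⟩
  have h1 : Tendsto (fun n => (M ^ n) s₀ ᵥ* M) atTop (𝓝 (ν ᵥ* M)) :=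
    ((Continuous.matrix_vecMul continuous_id continuous_const).tendsto ν).comp hν'
  have h2 : (fun n => (M ^ n) s₀ ᵥ* M) = fun n => (M ^ (n + 1)) s₀ := by
    funext n
    rw [pow_succ]
    rfl
  rw [h2] at h1
  exact tendsto_nhds_unique h1 (hν'.comp (tendsto_add_atTop_nat 1))

lemma sum_abs_vecMul_pow_sub_le [Nonempty S] (hC : 0 ≤ C) (hρ : 0 ≤ ρ)
    (hgeo : ∀ n x, spanSeminorm (M ^ n *ᵥ x) ≤ C * ρ ^ n * spanSeminorm x) {ν μ : S → ℝ}
    (hν : IsStationaryDist M ν) (hμ : μ ∈ stdSimplex ℝ S) (n : ℕ) :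
    ∑ s, |(μ ᵥ* M ^ n) s - ν s| ≤ 2 * C * ρ ^ n := by
  refine sum_abs_le_of_forall fun x hx => ?_
  have h1 : ∑ s, ((μ ᵥ* M ^ n) s - ν s) * x s = μ ⬝ᵥ (M ^ n *ᵥ x) - ν ⬝ᵥ (M ^ n *ᵥ x) := by
    rw [hν.dotProduct_pow_mulVec, dotProduct_mulVec]
    simp only [dotProduct, sub_mul, Finset.sum_sub_distrib]
  have h2 : spanSeminorm x ≤ 2 :=
    spanSeminorm_le fun s t => by linarith [(abs_le.1 (hx s)).2, (abs_le.1 (hx t)).1]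
  rw [h1]
  have h3 := (weighted_sub_le_spanSeminorm hμ hν.1 (M ^ n *ᵥ x)).trans (hgeo n x)
  have : 0 ≤ C * ρ ^ n := by positivity
  nlinarith

lemma mixingTime_le [Nonempty S] (hC : 0 ≤ C) (hρ : 0 ≤ ρ)
    (hgeo : ∀ n x, spanSeminorm (M ^ n *ᵥ x) ≤ C * ρ ^ n * spanSeminorm x) {ν : S → ℝ}
    (hν : IsStationaryDist M ν) {t : ℕ} (ht1 : 1 ≤ t) (ht : 2 * C * ρ ^ t ≤ 1 / 2) :
    mixingTime M ≤ t :=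
  Nat.sInf_le ⟨ht1, ν, hν, fun _ hμ => (sum_abs_vecMul_pow_sub_le hC hρ hgeo hν hμ t).trans ht⟩

/-- At the mixing time any two rows are at `ℓ¹` distance at most one from each other; by
`sum_mul_le_half_l1` the span is then halved. -/
lemma mixingTime_spec [Nonempty S] (hM : M ∈ rowStochastic ℝ S) (hC : 0 ≤ C) (hρ : 0 ≤ ρ)
    (hgeo : ∀ n x, spanSeminorm (M ^ n *ᵥ x) ≤ C * ρ ^ n * spanSeminorm x) {ν : S → ℝ}
    (hν : IsStationaryDist M ν) {t : ℕ} (ht1 : 1 ≤ t) (ht : 2 * C * ρ ^ t ≤ 1 / 2) :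
    1 ≤ mixingTime M ∧ ∀ x, spanSeminorm (M ^ mixingTime M *ᵥ x) ≤ 1 / 2 * spanSeminorm x := by
  have hne : {t : ℕ | 1 ≤ t ∧ ∃ ν : S → ℝ, IsStationaryDist M ν ∧
      ∀ μ₀ ∈ stdSimplex ℝ S, ∑ s, |(μ₀ ᵥ* (M ^ t)) s - ν s| ≤ 1 / 2}.Nonempty :=
    ⟨t, ht1, ν, hν, fun _ hμ => (sum_abs_vecMul_pow_sub_le hC hρ hgeo hν hμ t).trans ht⟩
  obtain ⟨h1, ν', hν', hmix⟩ := Nat.sInf_mem hne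
  change 1 ≤ mixingTime M at h1
  change ∀ μ₀ ∈ stdSimplex ℝ S, ∑ s, |(μ₀ ᵥ* (M ^ mixingTime M)) s - ν' s| ≤ 1 / 2 at hmix
  refine ⟨h1, fun x => spanSeminorm_le fun s t => ?_⟩
  set N := M ^ mixingTime M
  have hrow : ∀ s, (Pi.single s 1 : S → ℝ) ᵥ* N = N s := fun s => by
    rw [single_one_vecMul]
    rfl
  have hs := hmix _ (single_mem_stdSimplex ℝ s)
  have ht := hmix _ (single_mem_stdSimplex ℝ t)
  have hmemrow : ∑ i, (N s i - N t i) = 0 := by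
    have e : ∀ s, ∑ i, N s i = 1 := sum_row_of_mem_rowStochastic (pow_mem hM _)
    rw [Finset.sum_sub_distrib, e, e, sub_self]
  have h2 := sum_mul_le_half_l1 hmemrow x
  simp only [sub_mul, Finset.sum_sub_distrib] at h2
  have h3 : ∑ i, |N s i - N t i| ≤ 1 := by
    rw [hrow] at hs ht
    have : ∑ i, |N s i - N t i| ≤ ∑ i, (|N s i - ν' i| + |N t i - ν' i|) :=
      Finset.sum_le_sum fun i _ => by
        rw [abs_sub_comm (N t i)]
        exact abs_sub_le _ _ _
    rw [Finset.sum_add_distrib] at this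
    linarith
  have h4 : (N *ᵥ x) s - (N *ᵥ x) t ≤ 1 / 2 * (∑ i, |N s i - N t i|) * spanSeminorm x := h2
  have := spanSeminorm_nonneg x
  nlinarith

end Mixing

namespace RobustMDP

variable {S A : Type*} [Fintype S] [Fintype A] [DecidableEq S] {I : RobustMDP S A}

lemma chain_pow_mem {P : S → A → S → ℝ} (hP : P ∈ I.kernels) (n : ℕ) :
    I.chain P ^ n ∈ I.chains ^ n := Set.pow_mem_pow ⟨P, hP, rfl⟩

namespace Admissible

lemma exists_stationary [Nonempty S] (h : I.Admissible) {P : S → A → S → ℝ} (hP : P ∈ I.kernels) :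
    ∃ ν, IsStationaryDist (I.chain P) ν := by
  obtain ⟨C, ρ, hC, hρ, hρ1, hgeo⟩ := h.exists_geometric
  exact exists_isStationaryDist (h.chain_mem hP) hρ1 fun n x => hgeo n _ (chain_pow_mem hP n) x

/-- The geometric rate is the same for all kernels, so one time `t` serves all. Without boundedness
`tMix` would take the default supremum `0`. -/
lemma bddAbove_mixingTimes_and [Nonempty S] (h : I.Admissible) : BddAbove I.mixingTimes ∧
    ∀ P ∈ I.kernels, 1 ≤ mixingTime (I.chain P) ∧ ∀ x,
      spanSeminorm (I.chain P ^ mixingTime (I.chain P) *ᵥ x) ≤ 1 / 2 * spanSeminorm x := by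
  obtain ⟨C, ρ, hC, hρ, hρ1, hgeo⟩ := h.exists_geometric
  obtain ⟨t, ht1, ht⟩ : ∃ t : ℕ, 1 ≤ t ∧ 2 * C * ρ ^ t ≤ 1 / 2 := by
    have : Tendsto (fun t : ℕ => 2 * C * ρ ^ t) atTop (𝓝 0) := by
      simpa using (tendsto_pow_atTop_nhds_zero_of_lt_one hρ.le hρ1).const_mul (2 * C)
    have h2 := (this.eventually (ge_mem_nhds (show (0 : ℝ) < 1 / 2 by norm_num))).and
      (eventually_ge_atTop 1)
    obtain ⟨t, ht⟩ := h2.exists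
    exact ⟨t, ht.2, ht.1⟩
  constructor
  · refine ⟨t, ?_⟩
    rintro _ ⟨P, hP, rfl⟩
    obtain ⟨ν, hν⟩ := h.exists_stationary hP
    exact mixingTime_le hC.le hρ.le (fun n x => hgeo n _ (chain_pow_mem hP n) x) hν ht1 ht
  · intro P hP
    obtain ⟨ν, hν⟩ := h.exists_stationary hP
    exact mixingTime_spec (h.chain_mem hP) hC.le hρ.le (fun n x => hgeo n _ (chain_pow_mem hP n) x) hν ht1 ht

lemma mixingTime_le_tMix [Nonempty S] (h : I.Admissible) {P : S → A → S → ℝ}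
    (hP : P ∈ I.kernels) : mixingTime (I.chain P) ≤ I.tMix :=
  le_csSup h.bddAbove_mixingTimes_and.1 ⟨P, hP, rfl⟩

lemma one_le_tMix [Nonempty S] (h : I.Admissible) : 1 ≤ I.tMix :=
  (h.bddAbove_mixingTimes_and.2 _ h.nominal_mem_kernels).1.trans
    (h.mixingTime_le_tMix h.nominal_mem_kernels)

/-! ### The fluctuation matrices -/

/-- Subtracting a stationary average changes a vector by a constant, and chains pass constants
through; so a product of fluctuations is a product of chains up to constants. -/
lemma exists_chain_of_fluctuation (h : I.Admissible) (n : ℕ) : ∀ Q ∈ I.fluctuations ^ n,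
    ∃ M ∈ I.chains ^ n, ∀ x, ∃ c, Q *ᵥ x = fun s => (M *ᵥ x) s - c := by
  induction n with
  | zero =>
    rw [pow_zero]
    rintro _ rfl
    exact ⟨1, by simp, fun x => ⟨0, by simp⟩⟩
  | succ n ih =>
    rw [pow_succ']
    rintro _ ⟨Q, ⟨P, hP, ν, hν, rfl⟩, Q', hQ', rfl⟩
    obtain ⟨M, hM, hMx⟩ := ih Q' hQ'
    refine ⟨I.chain P * M, by rw [pow_succ']; exact Set.mul_mem_mul ⟨P, hP, rfl⟩ hM, fun x => ?_⟩
    obtain ⟨c, hc⟩ := hMx x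
    refine ⟨c + ν ⬝ᵥ (Q' *ᵥ x), ?_⟩
    dsimp only
    rw [← mulVec_mulVec, sub_mulVec, ← mulVec_mulVec, hc, mulVec_sub_const (h.chain_mem hP)]
    funext s
    simp only [Pi.sub_apply, mulVec, dotProduct, of_apply]
    ring

/-- The outermost factor subtracts the `ν`-mean of the resulting vector `y`. This fixes the free
constant, and a deviation from a mean is at most the span. -/
lemma exists_chain_of_fluctuation_succ (h : I.Admissible) (n : ℕ) :
    ∀ Q ∈ I.fluctuations ^ (n + 1), ∃ M ∈ I.chains ^ (n + 1), ∀ x s,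
      |(Q *ᵥ x) s| ≤ spanSeminorm (M *ᵥ x) := by
  rw [pow_succ']
  rintro _ ⟨Q, ⟨P, hP, ν, hν, rfl⟩, Q', hQ', rfl⟩
  obtain ⟨M, hM, hMx⟩ := h.exists_chain_of_fluctuation n Q' hQ'
  refine ⟨I.chain P * M, by rw [pow_succ']; exact Set.mul_mem_mul ⟨P, hP, rfl⟩ hM, fun x s => ?_⟩
  obtain ⟨c, hc⟩ := hMx x
  set y := I.chain P *ᵥ (M *ᵥ x) with hy
  have e : ((I.chain P - of fun _ s' => ν s') *ᵥ (Q' *ᵥ x)) s = y s - ν ⬝ᵥ y := by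
    rw [sub_mulVec, Pi.sub_apply]
    have h1 : (of (fun (_ : S) s' => ν s') *ᵥ (Q' *ᵥ x)) s = ν ⬝ᵥ (I.chain P ^ 1 *ᵥ (Q' *ᵥ x)) := by
      rw [hν.dotProduct_pow_mulVec]
      rfl
    rw [h1, pow_one, hc, mulVec_sub_const (h.chain_mem hP)]
    have h2 : ν ⬝ᵥ (fun s => (I.chain P *ᵥ (M *ᵥ x)) s - c) = ν ⬝ᵥ y - c := by
      change ν ⬝ᵥ (y - fun _ => c) = _
      rw [dotProduct_sub, dotProduct_const_of_mem hν.1]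
    rw [h2]
    simp only [hy]
    ring
  dsimp only
  rw [← mulVec_mulVec, ← mulVec_mulVec, e, ← hy]
  have hs := single_mem_stdSimplex ℝ s
  have e2 : y s = (Pi.single s 1 : S → ℝ) ⬝ᵥ y := by simp
  rw [e2, abs_le]
  constructor
  · linarith [weighted_sub_le_spanSeminorm hν.1 hs y]
  · exact weighted_sub_le_spanSeminorm hs hν.1 y

lemma fluctuations_nonempty [Nonempty S] (h : I.Admissible) : I.fluctuations.Nonempty := by
  obtain ⟨ν, hν⟩ := h.exists_stationary h.nominal_mem_kernels
  exact ⟨_, I.nominal, h.nominal_mem_kernels, ν, hν, rfl⟩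

lemma exists_frobNorm_le [Nonempty S] (h : I.Admissible) : ∃ C ρ : ℝ, 0 < C ∧ 0 < ρ ∧ ρ < 1 ∧
    ∀ n, ∀ Q ∈ I.fluctuations ^ (n + 1), frobNorm Q ≤ C * ρ ^ (n + 1) := by
  obtain ⟨C, ρ, hC, hρ, hρ1, hgeo⟩ := h.exists_geometric
  have hcard : (0 : ℝ) < Fintype.card S := by
    exact_mod_cast Fintype.card_pos
  refine ⟨Fintype.card S * C, ρ, by positivity, hρ, hρ1, fun n Q hQ => ?_⟩
  obtain ⟨M, hM, hQM⟩ := h.exists_chain_of_fluctuation_succ n Q hQ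
  have hentry : ∀ i j, |Q i j| ≤ C * ρ ^ (n + 1) := by
    intro i j
    have h1 := hQM (Pi.single j 1) i
    rw [mulVec_single_one, col_apply] at h1
    refine h1.trans ((hgeo _ M hM _).trans ?_)
    have h2 : spanSeminorm (Pi.single j 1 : S → ℝ) ≤ 1 := spanSeminorm_le fun s t => by
      simp only [Pi.single_apply]
      split_ifs <;> norm_num
    exact mul_le_of_le_one_right (by positivity) h2
  refine Real.sqrt_le_iff.2 ⟨by positivity, ?_⟩
  calc ∑ i, ∑ j, Q i j ^ 2 ≤ ∑ _i : S, ∑ _j : S, (C * ρ ^ (n + 1)) ^ 2 := by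
        refine Finset.sum_le_sum fun i _ => Finset.sum_le_sum fun j _ => ?_
        rw [← sq_abs]
        exact pow_le_pow_left₀ (abs_nonneg _) (hentry i j) 2
    _ = _ := by
        simp only [Finset.sum_const, Finset.card_univ, nsmul_eq_mul]
        ring

lemma sSup_frobNorm_nonneg (𝒬 : Set (Matrix S S ℝ)) : 0 ≤ sSup (frobNorm '' 𝒬) :=
  Real.sSup_nonneg (by rintro _ ⟨Q, -, rfl⟩; exact Real.sqrt_nonneg _)

/-- Passing from `ρ` to a slightly larger `ρ'` below one absorbs the constant `C` for large `k`. -/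
lemma exists_root_bound [Nonempty S] (h : I.Admissible) : ∃ ρ : ℝ, 0 < ρ ∧ ρ < 1 ∧
    ∀ᶠ k : ℕ in atTop, (sSup (frobNorm '' (I.fluctuations ^ k))) ^ ((1 : ℝ) / k) ≤ ρ := by
  obtain ⟨C, ρ, hC, hρ, hρ1, hb⟩ := h.exists_frobNorm_le
  obtain ⟨ρ', h1, h2⟩ := exists_between hρ1
  have hρ' : 0 < ρ' := hρ.trans h1
  refine ⟨ρ', hρ', h2, ?_⟩
  have hlim : Tendsto (fun k : ℕ => C * (ρ / ρ') ^ k) atTop (𝓝 0) := by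
    simpa using (tendsto_pow_atTop_nhds_zero_of_lt_one (by positivity)
      ((div_lt_one hρ').2 h1)).const_mul C
  filter_upwards [hlim.eventually (ge_mem_nhds one_pos), eventually_ge_atTop 1] with k hk hk1
  obtain ⟨n, rfl⟩ : ∃ n, k = n + 1 := ⟨k - 1, by omega⟩
  have hs : sSup (frobNorm '' (I.fluctuations ^ (n + 1))) ≤ ρ' ^ (n + 1) := by
    refine Real.sSup_le ?_ (by positivity)
    rintro _ ⟨Q, hQ, rfl⟩
    refine (hb n Q hQ).trans ?_
    rw [div_pow, ← mul_div_assoc, div_le_one (by positivity)] at hk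
    exact hk
  rw [one_div]
  exact (Real.rpow_inv_le_iff_of_pos (sSup_frobNorm_nonneg _) hρ'.le (by positivity)).2
    (by rw [Real.rpow_natCast]; exact hs)

lemma isBoundedUnder_root [Nonempty S] (h : I.Admissible) : IsBoundedUnder (· ≤ ·) atTop
    (fun k : ℕ => (sSup (frobNorm '' (I.fluctuations ^ k))) ^ ((1 : ℝ) / k)) := by
  obtain ⟨ρ, -, -, hev⟩ := h.exists_root_bound
  exact isBoundedUnder_of_eventually_le hev

lemma root_nonneg (k : ℕ) : 0 ≤ (sSup (frobNorm '' (I.fluctuations ^ k))) ^ ((1 : ℝ) / k) :=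
  Real.rpow_nonneg (sSup_frobNorm_nonneg _) _

lemma jointSpectralRadius_lt_one [Nonempty S] (h : I.Admissible) :
    jointSpectralRadius I.fluctuations < 1 := by
  obtain ⟨ρ, -, hρ1, hev⟩ := h.exists_root_bound
  refine (limsup_le_of_le ?_ hev).trans_lt hρ1
  exact IsBoundedUnder.isCoboundedUnder_le (isBoundedUnder_of ⟨0, fun k => root_nonneg k⟩)

lemma jointSpectralRadius_nonneg [Nonempty S] (h : I.Admissible) :
    0 ≤ jointSpectralRadius I.fluctuations :=
  le_limsup_of_frequently_le (Frequently.of_forall fun k => root_nonneg k) h.isBoundedUnder_root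

/-- Above the joint spectral radius the products of fluctuation matrices are uniformly bounded. -/
lemma exists_frobNorm_le_pow [Nonempty S] (h : I.Admissible) {α : ℝ}
    (hα : jointSpectralRadius I.fluctuations < α) :
    ∃ B : ℝ, ∀ k, ∀ Q ∈ I.fluctuations ^ k, frobNorm Q ≤ B * α ^ k := by
  have hα0 : 0 < α := h.jointSpectralRadius_nonneg.trans_lt hα
  obtain ⟨C, ρ, hC, hρ, hρ1, hb⟩ := h.exists_frobNorm_le
  have hbdd : ∀ k, BddAbove (frobNorm '' (I.fluctuations ^ k)) := by
    intro k
    cases k with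
    | zero => rw [pow_zero]; exact (Set.finite_singleton (1 : Matrix S S ℝ)).image _ |>.bddAbove
    | succ n => exact ⟨_, by rintro _ ⟨Q, hQ, rfl⟩; exact hb n Q hQ⟩
  have hev := eventually_lt_of_limsup_lt hα h.isBoundedUnder_root
  obtain ⟨N, hN⟩ := eventually_atTop.1 (hev.and (eventually_ge_atTop 1))
  set f : ℕ → ℝ := fun k => sSup (frobNorm '' (I.fluctuations ^ k)) / α ^ k with hf
  have hf0 : ∀ k, 0 ≤ f k := fun k => div_nonneg (sSup_frobNorm_nonneg _) (by positivity)
  -- From `N` on the root bound gives `f k ≤ 1`; the finitely many earlier terms are simply added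
  -- up.
  refine ⟨1 + ∑ k ∈ Finset.range N, f k, fun k Q hQ => ?_⟩
  have hle : frobNorm Q ≤ f k * α ^ k := by
    simp only [hf]
    rw [div_mul_cancel₀ _ (by positivity)]
    exact le_csSup (hbdd k) ⟨Q, hQ, rfl⟩
  refine hle.trans (mul_le_mul_of_nonneg_right ?_ (by positivity))
  rcases lt_or_ge k N with hk | hk
  · have := Finset.single_le_sum (f := f) (fun k _ => hf0 k) (Finset.mem_range.2 hk)
    linarith
  · have hsum : 0 ≤ ∑ k ∈ Finset.range N, f k := Finset.sum_nonneg fun k _ => hf0 k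
    obtain ⟨h1, h2⟩ := hN k hk
    rw [one_div] at h1
    have hk0 : (0 : ℝ) < k := by exact_mod_cast h2
    have h3 := (Real.rpow_inv_le_iff_of_pos (sSup_frobNorm_nonneg _) hα0.le hk0).1 h1.le
    rw [Real.rpow_natCast] at h3
    have : f k ≤ 1 := (div_le_one (by positivity)).2 h3
    linarith

end Admissible

end RobustMDP

/-! ### The Euclidean norm -/

section Eucl

variable {S : Type*} [Fintype S]

lemma euclNorm_eq (x : S → ℝ) : euclNorm x = ‖WithLp.toLp 2 x‖ := by
  rw [EuclideanSpace.norm_eq, euclNorm]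
  simp

lemma euclNorm_nonneg (x : S → ℝ) : 0 ≤ euclNorm x := Real.sqrt_nonneg _

lemma euclNorm_add_le (x y : S → ℝ) : euclNorm (x + y) ≤ euclNorm x + euclNorm y := by
  simp only [euclNorm_eq, WithLp.toLp_add]
  exact norm_add_le _ _

lemma euclNorm_smul (c : ℝ) (x : S → ℝ) : euclNorm (c • x) = |c| * euclNorm x := by
  simp only [euclNorm_eq, WithLp.toLp_smul, norm_smul, Real.norm_eq_abs]

lemma abs_le_euclNorm (x : S → ℝ) (s : S) : |x s| ≤ euclNorm x := by
  rw [← Real.sqrt_sq_eq_abs]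
  exact Real.sqrt_le_sqrt (Finset.single_le_sum (f := fun s => x s ^ 2)
    (fun s _ => sq_nonneg _) (Finset.mem_univ s))

lemma euclNorm_le_of_abs_le {x : S → ℝ} {b : ℝ} (hb : 0 ≤ b) (h : ∀ s, |x s| ≤ b) :
    euclNorm x ≤ √(Fintype.card S) * b := by
  rw [euclNorm, ← Real.sqrt_sq hb, ← Real.sqrt_mul (by positivity)]
  refine Real.sqrt_le_sqrt ?_
  calc ∑ s, x s ^ 2 ≤ ∑ _s : S, b ^ 2 := Finset.sum_le_sum fun s _ => by
        rw [← sq_abs]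
        exact pow_le_pow_left₀ (abs_nonneg _) (h s) 2
    _ = _ := by simp

lemma euclNorm_mulVec_le (M : Matrix S S ℝ) (x : S → ℝ) :
    euclNorm (M *ᵥ x) ≤ frobNorm M * euclNorm x := by
  rw [euclNorm, euclNorm, frobNorm, ← Real.sqrt_mul (by positivity), Finset.sum_mul]
  refine Real.sqrt_le_sqrt (Finset.sum_le_sum fun i _ => ?_)
  exact Finset.sum_mul_sq_le_sq_mul_sq _ _ _

end Eucl

/-! ### The extremal norm and the contraction semi-norm -/

namespace RobustMDP

variable {S A : Type*} [Fintype S] [Fintype A] [DecidableEq S] {I : RobustMDP S A}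

lemma mulVec_const_of_fluctuation (h : I.Admissible) {Q : Matrix S S ℝ}
    (hQ : Q ∈ I.fluctuations) (c : ℝ) : Q *ᵥ (fun _ => c) = 0 := by
  obtain ⟨P, hP, ν, hν, rfl⟩ := hQ
  rw [sub_mulVec, mulVec_const_of_rowStochastic (h.chain_mem hP)]
  funext s
  simp only [Pi.sub_apply, mulVec, of_apply, dotProduct_const_of_mem hν.1, sub_self, Pi.zero_apply]

lemma mulVec_sub_const_of_fluctuation (h : I.Admissible) {Q : Matrix S S ℝ}
    (hQ : Q ∈ I.fluctuations) (x : S → ℝ) (c : ℝ) : Q *ᵥ (fun s => x s - c) = Q *ᵥ x := by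
  have : (fun s => x s - c) = x - fun _ => c := rfl
  rw [this, mulVec_sub, mulVec_const_of_fluctuation h hQ, sub_zero]

/-- The data of the extremal norm above the joint spectral radius: the rate `α` and a bound `B` for
the normalized products. -/
structure ExtremalBound (I : RobustMDP S A) (α B : ℝ) : Prop where
  admissible : I.Admissible
  nonempty : Nonempty S
  rate_pos : 0 < α
  bound_nonneg : 0 ≤ B
  le : ∀ k, ∀ Q ∈ I.fluctuations ^ k, frobNorm Q ≤ B * α ^ k

namespace ExtremalBound

variable {α B : ℝ}

lemma bddAbove (h : I.ExtremalBound α B) (x : S → ℝ) : ∀ y ∈ {y | ∃ k : ℕ,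
    ∃ M ∈ I.fluctuations ^ k, y = (α ^ k)⁻¹ * euclNorm (M *ᵥ x)}, y ≤ B * euclNorm x := by
  rintro _ ⟨k, M, hM, rfl⟩
  have hα := pow_pos h.rate_pos k
  rw [inv_mul_le_iff₀ hα]
  refine (euclNorm_mulVec_le M x).trans ?_
  have := mul_le_mul_of_nonneg_right (h.le k M hM) (euclNorm_nonneg x)
  linarith

lemma le_extNorm (h : I.ExtremalBound α B) {k : ℕ} {M : Matrix S S ℝ}
    (hM : M ∈ I.fluctuations ^ k) (x : S → ℝ) :
    (α ^ k)⁻¹ * euclNorm (M *ᵥ x) ≤ I.extNorm α x :=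
  le_csSup ⟨_, h.bddAbove x⟩ ⟨k, M, hM, rfl⟩

lemma extNorm_le (x : S → ℝ) {b : ℝ}
    (hb : ∀ k, ∀ M ∈ I.fluctuations ^ k, (α ^ k)⁻¹ * euclNorm (M *ᵥ x) ≤ b) :
    I.extNorm α x ≤ b := by
  refine csSup_le ⟨_, 0, 1, by simp, rfl⟩ ?_
  rintro _ ⟨k, M, hM, rfl⟩
  exact hb k M hM

lemma euclNorm_le (h : I.ExtremalBound α B) (x : S → ℝ) : euclNorm x ≤ I.extNorm α x := by
  simpa using h.le_extNorm (k := 0) (M := 1) (by simp) x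

lemma extNorm_le_euclNorm (h : I.ExtremalBound α B) (x : S → ℝ) :
    I.extNorm α x ≤ B * euclNorm x :=
  extNorm_le x fun k M hM => h.bddAbove x _ ⟨k, M, hM, rfl⟩

lemma extNorm_nonneg (h : I.ExtremalBound α B) (x : S → ℝ) : 0 ≤ I.extNorm α x :=
  (euclNorm_nonneg x).trans (h.euclNorm_le x)

lemma extNorm_add_le (h : I.ExtremalBound α B) (x y : S → ℝ) :
    I.extNorm α (x + y) ≤ I.extNorm α x + I.extNorm α y := by
  refine extNorm_le _ fun k M hM => ?_
  have hα := inv_nonneg.2 (pow_pos h.rate_pos k).le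
  rw [mulVec_add]
  have h1 := mul_le_mul_of_nonneg_left (euclNorm_add_le (M *ᵥ x) (M *ᵥ y)) hα
  linarith [h.le_extNorm hM x, h.le_extNorm hM y]

lemma extNorm_smul_le (h : I.ExtremalBound α B) (c : ℝ) (x : S → ℝ) :
    I.extNorm α (c • x) ≤ |c| * I.extNorm α x := by
  refine extNorm_le _ fun k M hM => ?_
  rw [mulVec_smul, euclNorm_smul, mul_left_comm]
  exact mul_le_mul_of_nonneg_left (h.le_extNorm hM x) (abs_nonneg c)

/-- Applying `Q` first turns products of length `k` into products of length `k + 1`; the shift in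
the weight is the factor `α`. -/
lemma extNorm_mulVec_le (h : I.ExtremalBound α B) {Q : Matrix S S ℝ} (hQ : Q ∈ I.fluctuations)
    (x : S → ℝ) : I.extNorm α (Q *ᵥ x) ≤ α * I.extNorm α x := by
  refine extNorm_le _ fun k M hM => ?_
  have hMQ : M * Q ∈ I.fluctuations ^ (k + 1) := by
    rw [pow_succ]
    exact Set.mul_mem_mul hM hQ
  have h1 := mul_le_mul_of_nonneg_left (h.le_extNorm hMQ x) h.rate_pos.le
  rw [mulVec_mulVec]
  refine le_trans (le_of_eq ?_) h1
  have := h.rate_pos.ne'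
  rw [pow_succ]
  field_simp

/-- The first summand of the contraction semi-norm. -/
lemma sup_le {x : S → ℝ} (h : I.ExtremalBound α B) {b : ℝ}
    (hb : ∀ Q ∈ I.fluctuations, I.extNorm α (Q *ᵥ x) ≤ b) :
    sSup ((fun Q : Matrix S S ℝ => I.extNorm α (Q *ᵥ x)) '' I.fluctuations) ≤ b := by
  have := h.nonempty
  refine csSup_le (h.admissible.fluctuations_nonempty.image _) ?_
  rintro _ ⟨Q, hQ, rfl⟩
  exact hb Q hQ

lemma le_sup (h : I.ExtremalBound α B) {Q : Matrix S S ℝ} (hQ : Q ∈ I.fluctuations) (x : S → ℝ) :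
    I.extNorm α (Q *ᵥ x) ≤
      sSup ((fun Q : Matrix S S ℝ => I.extNorm α (Q *ᵥ x)) '' I.fluctuations) := by
  refine le_csSup ⟨α * I.extNorm α x, ?_⟩ ⟨Q, hQ, rfl⟩
  rintro _ ⟨Q, hQ, rfl⟩
  exact h.extNorm_mulVec_le hQ x

lemma iInf_le (h : I.ExtremalBound α B) (x : S → ℝ) (c : ℝ) :
    ⨅ c : ℝ, I.extNorm α (fun s => x s - c) ≤ I.extNorm α (fun s => x s - c) :=
  ciInf_le ⟨0, by rintro _ ⟨c, rfl⟩; exact h.extNorm_nonneg _⟩ c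

/-- The contraction semi-norm, bundled. -/
noncomputable def seminorm (h : I.ExtremalBound α B) {ε : ℝ} (hε : 0 ≤ ε) :
    Seminorm ℝ (S → ℝ) :=
  Seminorm.ofSMulLE (I.robustSeminorm α ε)
    (by
      have h0 : I.extNorm α 0 = 0 := le_antisymm
        (by simpa using h.extNorm_smul_le 0 0) (h.extNorm_nonneg 0)
      have h1 : sSup ((fun Q : Matrix S S ℝ => I.extNorm α (Q *ᵥ 0)) '' I.fluctuations) ≤ 0 :=
        h.sup_le fun Q _ => by rw [mulVec_zero, h0]
      have h2 := h.iInf_le 0 0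
      have h3 : (fun s : S => (0 : S → ℝ) s - 0) = 0 := by funext s; simp
      rw [h3, h0] at h2
      have := h.nonempty
      obtain ⟨Q, hQ⟩ := h.admissible.fluctuations_nonempty
      have h4 := (h.extNorm_nonneg _).trans (h.le_sup hQ 0)
      have h5 : 0 ≤ ⨅ c : ℝ, I.extNorm α (fun s => (0 : S → ℝ) s - c) :=
        le_ciInf fun c => h.extNorm_nonneg _
      unfold robustSeminorm
      rw [le_antisymm h1 h4, le_antisymm h2 h5]
      ring)
    (fun x y => by
      have h1 : sSup ((fun Q : Matrix S S ℝ => I.extNorm α (Q *ᵥ (x + y))) '' I.fluctuations) ≤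
          sSup ((fun Q : Matrix S S ℝ => I.extNorm α (Q *ᵥ x)) '' I.fluctuations) +
          sSup ((fun Q : Matrix S S ℝ => I.extNorm α (Q *ᵥ y)) '' I.fluctuations) :=
        h.sup_le fun Q hQ => by
          rw [mulVec_add]
          exact (h.extNorm_add_le _ _).trans (add_le_add (h.le_sup hQ x) (h.le_sup hQ y))
      have h2 : ⨅ c : ℝ, I.extNorm α (fun s => (x + y) s - c) ≤
          (⨅ c : ℝ, I.extNorm α (fun s => x s - c)) + ⨅ c : ℝ, I.extNorm α (fun s => y s - c) :=
        le_ciInf_add_ciInf fun c d => by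
          refine (h.iInf_le (x + y) (c + d)).trans ?_
          refine le_trans (le_of_eq (congrArg _ ?_)) (h.extNorm_add_le _ _)
          funext s
          simp only [Pi.add_apply]
          ring
      unfold robustSeminorm
      nlinarith)
    (fun c x => by
      have h1 : sSup ((fun Q : Matrix S S ℝ => I.extNorm α (Q *ᵥ (c • x))) '' I.fluctuations) ≤
          |c| * sSup ((fun Q : Matrix S S ℝ => I.extNorm α (Q *ᵥ x)) '' I.fluctuations) :=
        h.sup_le fun Q hQ => by
          rw [mulVec_smul]
          exact (h.extNorm_smul_le c _).trans
            (mul_le_mul_of_nonneg_left (h.le_sup hQ x) (abs_nonneg c))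
      have h2 : ⨅ d : ℝ, I.extNorm α (fun s => (c • x) s - d) ≤
          |c| * ⨅ d : ℝ, I.extNorm α (fun s => x s - d) := by
        rw [Real.mul_iInf_of_nonneg (abs_nonneg c)]
        refine le_ciInf fun d => (h.iInf_le (c • x) (c * d)).trans ?_
        refine le_trans (le_of_eq (congrArg _ ?_)) (h.extNorm_smul_le c _)
        funext s
        simp only [Pi.smul_apply, smul_eq_mul]
        ring
      unfold robustSeminorm
      rw [Real.norm_eq_abs]
      nlinarith)

lemma seminorm_apply (h : I.ExtremalBound α B) {ε : ℝ} (hε : 0 ≤ ε) (x : S → ℝ) :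
    h.seminorm hε x = I.robustSeminorm α ε x := rfl

/-- Modulo constants `P^π x` is `Q' *ᵥ x`, of extremal norm at most `σ`, the first summand at `x`.
So the new first summand is at most `α * σ`, and the new infimum, tested at `c = ν ⬝ᵥ x`, is at most
`σ`. Together these give `(α + ε) * σ`. -/
lemma seminorm_contraction (h : I.ExtremalBound α B) {ε : ℝ} (hε : 0 ≤ ε) {P : S → A → S → ℝ}
    (hP : P ∈ I.kernels) (x : S → ℝ) :
    h.seminorm hε (I.chain P *ᵥ x) ≤ (α + ε) * h.seminorm hε x := by
  have := h.nonempty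
  obtain ⟨ν, hν⟩ := h.admissible.exists_stationary hP
  set Q' : Matrix S S ℝ := I.chain P - of fun _ s' => ν s' with hQ'
  have hQ'mem : Q' ∈ I.fluctuations := ⟨P, hP, ν, hν, rfl⟩
  have hPx : Q' *ᵥ x = fun s => (I.chain P *ᵥ x) s - ν ⬝ᵥ x := by
    rw [hQ', sub_mulVec]
    rfl
  set σ := sSup ((fun Q : Matrix S S ℝ => I.extNorm α (Q *ᵥ x)) '' I.fluctuations) with hσ
  have h0 : I.extNorm α (Q' *ᵥ x) ≤ σ := h.le_sup hQ'mem x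
  have hα := h.rate_pos
  have h1 : sSup ((fun Q : Matrix S S ℝ => I.extNorm α (Q *ᵥ (I.chain P *ᵥ x))) '' I.fluctuations)
      ≤ α * σ := h.sup_le fun Q hQ => by
    rw [← mulVec_sub_const_of_fluctuation h.admissible hQ (I.chain P *ᵥ x) (ν ⬝ᵥ x), ← hPx]
    exact (h.extNorm_mulVec_le hQ _).trans (mul_le_mul_of_nonneg_left h0 hα.le)
  have h2 := h.iInf_le (I.chain P *ᵥ x) (ν ⬝ᵥ x)
  rw [← hPx] at h2
  have h3 : 0 ≤ ⨅ c : ℝ, I.extNorm α (fun s => x s - c) := le_ciInf fun c => h.extNorm_nonneg _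
  rw [seminorm_apply, seminorm_apply]
  unfold robustSeminorm
  rw [← hσ]
  have h4 : (α + ε) * σ ≤ (α + ε) * (σ + ε * ⨅ c : ℝ, I.extNorm α (fun s => x s - c)) :=
    mul_le_mul_of_nonneg_left (by nlinarith) (by linarith)
  nlinarith

/-- The lower bound comes from the infimum term alone. This is the role of `ε > 0`: the supremum
over fluctuations could vanish on nonconstant vectors. -/
lemma le_seminorm (h : I.ExtremalBound α B) {ε : ℝ} (hε : 0 ≤ ε) (x : S → ℝ) :
    ε / 2 * spanSeminorm x ≤ h.seminorm hε x := by
  have := h.nonempty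
  obtain ⟨Q, hQ⟩ := h.admissible.fluctuations_nonempty
  have h1 := (h.extNorm_nonneg _).trans (h.le_sup hQ x)
  have h2 : spanSeminorm x / 2 ≤ ⨅ c : ℝ, I.extNorm α (fun s => x s - c) := by
    refine le_ciInf fun c => ?_
    have h3 : spanSeminorm x ≤ 2 * I.extNorm α (fun s => x s - c) := by
      refine spanSeminorm_le fun s t => ?_
      have hs := (abs_le_euclNorm (fun s => x s - c) s).trans (h.euclNorm_le _)
      have ht := (abs_le_euclNorm (fun s => x s - c) t).trans (h.euclNorm_le _)
      linarith [(abs_le.1 hs).2, (abs_le.1 ht).1]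
    linarith
  rw [seminorm_apply]
  unfold robustSeminorm
  nlinarith

lemma seminorm_le (h : I.ExtremalBound α B) {ε : ℝ} (hε : 0 ≤ ε) (x : S → ℝ) :
    h.seminorm hε x ≤ (α + ε) * (B * √(Fintype.card S)) * spanSeminorm x := by
  obtain ⟨s₀⟩ := h.nonempty
  set y : S → ℝ := fun s => x s - x s₀ with hy
  have hyx : I.extNorm α y ≤ B * √(Fintype.card S) * spanSeminorm x := by
    refine (h.extNorm_le_euclNorm y).trans ?_
    rw [mul_assoc]
    exact mul_le_mul_of_nonneg_left (euclNorm_le_of_abs_le (spanSeminorm_nonneg x)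
      fun s => abs_sub_le_spanSeminorm x s s₀) h.bound_nonneg
  have h1 : sSup ((fun Q : Matrix S S ℝ => I.extNorm α (Q *ᵥ x)) '' I.fluctuations)
      ≤ α * I.extNorm α y := h.sup_le fun Q hQ => by
    rw [← mulVec_sub_const_of_fluctuation h.admissible hQ x (x s₀)]
    exact h.extNorm_mulVec_le hQ y
  have h2 := h.iInf_le x (x s₀)
  have hα := h.rate_pos
  rw [seminorm_apply]
  unfold robustSeminorm
  have h3 : (α + ε) * I.extNorm α y ≤ (α + ε) * (B * √(Fintype.card S) * spanSeminorm x) :=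
    mul_le_mul_of_nonneg_left hyx (by linarith)
  have h4 := mul_le_mul_of_nonneg_left h2 hε
  rw [← hy] at h4
  linarith

end ExtremalBound

end RobustMDP

/-! ### Generalized Moreau envelopes of semi-norms -/

section Moreau

variable {S : Type*} [Fintype S]

/-- The centred vector, in the Euclidean space. -/
noncomputable def centred : (S → ℝ) →ₗ[ℝ] EuclideanSpace ℝ S where
  toFun x := WithLp.toLp 2 fun s => x s - (∑ t, x t) / Fintype.card S
  map_add' x y := by
    ext s
    simp only [Pi.add_apply, Finset.sum_add_distrib, PiLp.add_apply]
    ring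
  map_smul' c x := by
    ext s
    simp only [Pi.smul_apply, smul_eq_mul, ← Finset.mul_sum, PiLp.smul_apply, RingHom.id_apply]
    ring

lemma centred_apply (x : S → ℝ) (s : S) : centred x s = x s - (∑ t, x t) / Fintype.card S := rfl

lemma spanSeminorm_le_centred [Nonempty S] (x : S → ℝ) : spanSeminorm x ≤ 2 * ‖centred x‖ := by
  refine spanSeminorm_le fun s t => ?_
  have hs := (abs_le.1 ((Real.norm_eq_abs _).symm.trans_le (PiLp.norm_apply_le (centred x) s))).2
  have ht := (abs_le.1 ((Real.norm_eq_abs _).symm.trans_le (PiLp.norm_apply_le (centred x) t))).1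
  rw [centred_apply] at hs ht
  linarith

lemma norm_centred_le (x : S → ℝ) : ‖centred x‖ ≤ √(Fintype.card S) * spanSeminorm x := by
  rcases isEmpty_or_nonempty S with hS | hS
  · have : centred x = 0 := by ext s; exact (hS.false s).elim
    rw [this, norm_zero]
    exact mul_nonneg (Real.sqrt_nonneg _) (spanSeminorm_nonneg x)
  have hc : (Fintype.card S : ℝ) ≠ 0 := by positivity
  have h1 := euclNorm_le_of_abs_le (x := fun s => x s - (∑ t, x t) / Fintype.card S)
    (spanSeminorm_nonneg x) fun s => by
      have e : x s - (∑ t, x t) / Fintype.card S = (∑ t, (x s - x t)) / Fintype.card S := by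
        rw [Finset.sum_sub_distrib]
        simp only [Finset.sum_const, Finset.card_univ, nsmul_eq_mul]
        field_simp
      rw [e, abs_div, abs_of_pos (a := (Fintype.card S : ℝ)) (by positivity),
        div_le_iff₀ (by positivity)]
      refine (Finset.abs_sum_le_sum_abs _ _).trans ?_
      refine (Finset.sum_le_sum fun t _ => abs_sub_le_spanSeminorm x s t).trans (le_of_eq ?_)
      simp only [Finset.sum_const, Finset.card_univ, nsmul_eq_mul]
      ring
  rwa [euclNorm_eq] at h1

lemma sqrt_add_sq_le (a b c d : ℝ) :
    √((a + b) ^ 2 + (c + d) ^ 2) ≤ √(a ^ 2 + c ^ 2) + √(b ^ 2 + d ^ 2) := by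
  have h := norm_add_le (⟨a, c⟩ : ℂ) ⟨b, d⟩
  simp only [Complex.norm_def, Complex.normSq_apply, Complex.add_re, Complex.add_im] at h
  simpa only [sq] using h

variable (N : Seminorm ℝ (S → ℝ)) (θ : ℝ)

/-- The objective of the envelope, as a norm of the pair of the two arguments. -/
noncomputable def moreauObjective (x u : S → ℝ) : ℝ := √(N u ^ 2 + (θ⁻¹ * ‖centred (x - u)‖) ^ 2)

/-- The objective is a semi-norm in the pair `(x, u)`, so minimizing over `u` yields a semi-norm in
`x`. -/
lemma moreauObjective_add_le (hθ : 0 ≤ θ) (x y u v : S → ℝ) :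
    moreauObjective N θ (x + y) (u + v) ≤ moreauObjective N θ x u + moreauObjective N θ y v := by
  have hθ' := inv_nonneg.2 hθ
  refine le_trans (Real.sqrt_le_sqrt ?_) (sqrt_add_sq_le _ _ _ _)
  have e : x + y - (u + v) = (x - u) + (y - v) := by abel
  rw [e, map_add centred]
  have h1 := map_add_le_add N u v
  have h2 := mul_le_mul_of_nonneg_left (norm_add_le (centred (x - u)) (centred (y - v))) hθ'
  rw [mul_add] at h2
  have h3 := apply_nonneg N (u + v)
  exact add_le_add (pow_le_pow_left₀ h3 h1 2) (pow_le_pow_left₀ (by positivity) h2 2)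

lemma moreauObjective_smul (c : ℝ) (x u : S → ℝ) :
    moreauObjective N θ (c • x) (c • u) = |c| * moreauObjective N θ x u := by
  unfold moreauObjective
  rw [← smul_sub, map_smul centred, map_smul_eq_mul, norm_smul, Real.norm_eq_abs]
  have : (|c| * N u) ^ 2 + (θ⁻¹ * (|c| * ‖centred (x - u)‖)) ^ 2
      = |c| ^ 2 * (N u ^ 2 + (θ⁻¹ * ‖centred (x - u)‖) ^ 2) := by ring
  rw [this, Real.sqrt_mul (by positivity), Real.sqrt_sq (abs_nonneg c)]

variable {N θ}

/-- Constants in `u` do not matter, so `u` may be taken with sum zero. Outside the ball of radius `2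
* ‖centred x‖` the point `u = 0` is at least as good, and the rest is compactness. -/
lemma exists_moreau_minimizer [Nonempty S] (hθ : 0 < θ) {C : ℝ}
    (hN : ∀ x, N x ≤ C * spanSeminorm x) (x : S → ℝ) :
    ∃ u, ∀ v, moreauObjective N θ x u ≤ moreauObjective N θ x v := by
  have hconst : ∀ c : ℝ, N (fun _ => c) = 0 := fun c => by
    have h1 := hN fun _ => c
    have h2 : spanSeminorm (fun _ : S => c) = 0 := by simp [spanSeminorm]
    rw [h2, mul_zero] at h1
    exact le_antisymm h1 (apply_nonneg N _)
  have hcc : ∀ c : ℝ, centred (fun _ : S => c) = 0 := fun c => by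
    ext s
    have : (Fintype.card S : ℝ) ≠ 0 := by positivity
    rw [centred_apply]
    simp only [Finset.sum_const, Finset.card_univ, nsmul_eq_mul, PiLp.zero_apply]
    field_simp
    ring
  set K : Set (S → ℝ) := {u | ∑ s, u s = 0} ∩
    Metric.closedBall 0 (2 * ‖centred x‖) with hK
  have hKc : IsCompact K := by
    refine (isCompact_closedBall _ _).inter_left (isClosed_eq ?_ continuous_const)
    fun_prop
  have hcent : Continuous (centred : (S → ℝ) → EuclideanSpace ℝ S) :=
    LinearMap.continuous_of_finiteDimensional _
  have hNc : Continuous N := by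
    exact Seminorm.continuous_of_le (q := C.toNNReal • (2 : NNReal) • normSeminorm ℝ (S → ℝ))
      (by
        have : Continuous fun y : S → ℝ => C.toNNReal • (2 : NNReal) • ‖y‖ := by fun_prop
        exact this)
      (fun y => by
        have h2 : spanSeminorm y ≤ 2 * ‖y‖ := spanSeminorm_le fun s t => by
          have hs := (abs_le.1 ((Real.norm_eq_abs _).symm.trans_le (norm_le_pi_norm y s))).2
          have ht := (abs_le.1 ((Real.norm_eq_abs _).symm.trans_le (norm_le_pi_norm y t))).1
          linarith
        change N y ≤ (C.toNNReal : ℝ) * (2 * ‖y‖)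
        refine (hN y).trans ((mul_le_mul_of_nonneg_right (Real.le_coe_toNNReal C)
          (spanSeminorm_nonneg y)).trans (mul_le_mul_of_nonneg_left h2 (by positivity))))
  have hobj : Continuous fun u => moreauObjective N θ x u := by
    unfold moreauObjective
    exact ((hNc.pow 2).add ((continuous_const.mul
      (hcent.comp (continuous_const.sub continuous_id)).norm).pow 2)).sqrt
  have h0 : (0 : S → ℝ) ∈ K := ⟨by simp, by simp⟩
  obtain ⟨u, -, hu⟩ := hKc.exists_isMinOn ⟨0, h0⟩ hobj.continuousOn
  refine ⟨u, fun v => ?_⟩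
  set w : S → ℝ := fun s => v s - (∑ t, v t) / Fintype.card S with hw
  have hwv : w = v - fun _ => (∑ t, v t) / Fintype.card S := rfl
  have hwsum : ∑ s, w s = 0 := by
    have : (Fintype.card S : ℝ) ≠ 0 := by positivity
    simp only [hw, Finset.sum_sub_distrib, Finset.sum_const, Finset.card_univ, nsmul_eq_mul]
    field_simp
    ring
  have hcw : centred w = centred v := by rw [hwv, map_sub, hcc, sub_zero]
  have hNw : N w ≤ N v := by
    rw [hwv]
    have := map_sub_le_add N v (fun _ => (∑ t, v t) / Fintype.card S)
    rw [hconst, add_zero] at this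
    exact this
  have hval : moreauObjective N θ x w ≤ moreauObjective N θ x v := by
    unfold moreauObjective
    rw [map_sub, map_sub, hcw]
    exact Real.sqrt_le_sqrt (add_le_add_left (pow_le_pow_left₀ (apply_nonneg N _) hNw 2) _)
  refine le_trans ?_ hval
  by_cases hwK : w ∈ K
  · exact hu hwK
  · have hwn : 2 * ‖centred x‖ < ‖centred w‖ := by
      have h1 : 2 * ‖centred x‖ < ‖w‖ := by
        by_contra hle
        exact hwK ⟨hwsum, by simpa using hle⟩
      refine h1.trans_le ((pi_norm_le_iff_of_nonneg (norm_nonneg _)).2 fun s => ?_)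
      have := PiLp.norm_apply_le (centred w) s
      rwa [centred_apply, hwsum, zero_div, sub_zero] at this
    refine (hu h0).trans (Real.sqrt_le_sqrt ?_)
    rw [map_zero, sub_zero]
    have h2 : ‖centred x‖ ≤ ‖centred (x - w)‖ := by
      rw [map_sub]
      have := norm_sub_norm_le (centred w) (centred x)
      rw [norm_sub_rev] at this
      linarith
    have h3 : θ⁻¹ * ‖centred x‖ ≤ θ⁻¹ * ‖centred (x - w)‖ :=
      mul_le_mul_of_nonneg_left h2 (by positivity)
    have h4 : 0 ≤ θ⁻¹ * ‖centred x‖ := by positivity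
    have h5 := pow_le_pow_left₀ h4 h3 2
    have h6 := sq_nonneg (N w)
    linarith

/-- A semi-norm equivalent to the span semi-norm has smooth approximations of any precision. -/
lemma exists_smooth_approximation [Nonempty S] {c C : ℝ} (hc : 0 < c)
    (hcN : ∀ x, c * spanSeminorm x ≤ N x) (hN : ∀ x, N x ≤ C * spanSeminorm x)
    {cu : ℝ} (hcu : 1 < cu) :
    ∃ (m s : Seminorm ℝ (S → ℝ)) (L ρ : ℝ), 0 < L ∧ 0 < ρ ∧
      (∀ x, 1 / 2 * m x ^ 2 ≤ 1 / 2 * N x ^ 2) ∧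
      (∀ x, 1 / 2 * N x ^ 2 ≤ cu * (1 / 2 * m x ^ 2)) ∧
      Differentiable ℝ (fun x => 1 / 2 * m x ^ 2) ∧
      (∀ x y, 1 / 2 * m y ^ 2 ≤ 1 / 2 * m x ^ 2 +
        fderiv ℝ (fun x => 1 / 2 * m x ^ 2) x (y - x) + L / 2 * s (y - x) ^ 2) ∧
      ∀ x, s x ≤ ρ * N x := by
  set C' := 2 * max C 1 with hC'
  have hC'0 : 0 < C' := by positivity
  have hNC : ∀ x, N x ≤ C' * ‖centred x‖ := fun x => by
    have h1 := mul_le_mul_of_nonneg_right (le_max_left C 1) (spanSeminorm_nonneg x)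
    have h2 := mul_le_mul_of_nonneg_left (spanSeminorm_le_centred x)
      (show 0 ≤ max C 1 by positivity)
    have := hN x
    rw [hC']
    linarith
  -- The splitting `N x ≤ a + C' * θ * b` and Cauchy-Schwarz give `N x ^ 2 ≤ (1 + (C' * θ) ^ 2) * (a
  -- ^ 2 + b ^ 2)`; this choice of `θ` makes the factor equal to `cu`.
  set θ := √(cu - 1) / C' with hθdef
  have hθ : 0 < θ := div_pos (Real.sqrt_pos.2 (by linarith)) hC'0
  have hCθ : (C' * θ) ^ 2 = cu - 1 := by
    rw [hθdef, mul_div_cancel₀ _ hC'0.ne', Real.sq_sqrt (by linarith)]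
  choose U hU using exists_moreau_minimizer (N := N) hθ hN
  set f : (S → ℝ) → ℝ := fun x => moreauObjective N θ x (U x) with hf
  have hf0 : ∀ x, 0 ≤ f x := fun x => Real.sqrt_nonneg _
  have hfsq : ∀ x, f x ^ 2 = N (U x) ^ 2 + (θ⁻¹ * ‖centred (x - U x)‖) ^ 2 := fun x =>
    Real.sq_sqrt (by positivity)
  have hfadd : ∀ x y, f (x + y) ≤ f x + f y := fun x y =>
    (hU (x + y) (U x + U y)).trans (moreauObjective_add_le N θ hθ.le x y (U x) (U y))
  have hfsmul : ∀ (r : ℝ) x, f (r • x) ≤ ‖r‖ * f x := fun r x =>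
    (hU (r • x) (r • U x)).trans (moreauObjective_smul N θ r x (U x)).le
  have hfle : ∀ x, f x ≤ N x := fun x => by
    refine (hU x x).trans (le_of_eq ?_)
    simp [moreauObjective]
  have hfzero : f 0 = 0 := le_antisymm (by simpa using hfle 0) (hf0 0)
  set m : Seminorm ℝ (S → ℝ) := Seminorm.ofSMulLE f hfzero hfadd hfsmul with hm
  have hmf : ∀ x, m x = f x := fun x => rfl
  set s : Seminorm ℝ (S → ℝ) := (normSeminorm ℝ (EuclideanSpace ℝ S)).comp centred with hs
  have hsx : ∀ x, s x = ‖centred x‖ := fun x => rfl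
  set L := (θ⁻¹) ^ 2 with hL
  have hL0 : 0 < L := by positivity
  let q : (S → ℝ) → (S → ℝ) →L[ℝ] ℝ := fun x => LinearMap.toContinuousLinearMap
    ((L • (innerSL ℝ (centred (x - U x))).toLinearMap).comp centred)
  have hq : ∀ x h, q x h = L * inner ℝ (centred (x - U x)) (centred h) := fun x h => rfl
  -- The minimizer at `x` remains a candidate at `x + h`, where the Euclidean square is expanded.
  have hupper : ∀ x h, 1 / 2 * m (x + h) ^ 2 ≤ 1 / 2 * m x ^ 2 + q x h
      + L / 2 * ‖centred h‖ ^ 2 := by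
    intro x h
    have h1 := pow_le_pow_left₀ (hf0 (x + h)) (hU (x + h) (U x)) 2
    rw [moreauObjective, Real.sq_sqrt (by positivity)] at h1
    have e : x + h - U x = (x - U x) + h := by abel
    rw [e, map_add, mul_pow, norm_add_sq_real] at h1
    rw [hmf, hmf, hfsq x, hq, mul_pow]
    rw [← hL] at h1 ⊢
    linarith
  -- The matching lower bound is the upper bound at `-h` together with midpoint convexity of `m ^
  -- 2`. Quadratic bounds from both sides identify the derivative as `q x`.
  have hlower : ∀ x h, 1 / 2 * m x ^ 2 + q x h - L / 2 * ‖centred h‖ ^ 2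
      ≤ 1 / 2 * m (x + h) ^ 2 := by
    intro x h
    have h1 := hupper x (-h)
    rw [map_neg, map_neg, norm_neg] at h1
    have h2 : 2 * m x ≤ m (x + h) + m (x + -h) := by
      have h3 := map_add_le_add m (x + h) (x + -h)
      have e : x + h + (x + -h) = (2 : ℝ) • x := by rw [two_smul]; abel
      rw [e, map_smul_eq_mul, Real.norm_ofNat] at h3
      exact h3
    have h4 := apply_nonneg m x
    have h5 := pow_le_pow_left₀ (by positivity) h2 2
    nlinarith [sq_nonneg (m (x + h) - m (x + -h))]
  have hder : ∀ x, HasFDerivAt (fun x => 1 / 2 * m x ^ 2) (q x) x := by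
    intro x
    have hbig : (fun y => 1 / 2 * m y ^ 2 - (1 / 2 * m x ^ 2 + q x (y - x)))
        =O[𝓝 x] fun y => ‖y - x‖ ^ 2 := by
      set G := (centred : (S → ℝ) →ₗ[ℝ] EuclideanSpace ℝ S).toContinuousLinearMap with hG
      refine Asymptotics.IsBigO.of_bound (L / 2 * ‖G‖ ^ 2) (Eventually.of_forall fun y => ?_)
      have h1 := hupper x (y - x)
      have h2 := hlower x (y - x)
      rw [add_sub_cancel] at h1 h2
      have h3 : ‖centred (y - x)‖ ≤ ‖G‖ * ‖y - x‖ := G.le_opNorm (y - x)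
      have h4 := pow_le_pow_left₀ (norm_nonneg _) h3 2
      rw [norm_pow, norm_norm, Real.norm_eq_abs, abs_le]
      constructor <;> nlinarith
    have h1 := hbig.hasFDerivAt (𝕜 := ℝ) one_lt_two
    have h2 : HasFDerivAt (fun y => 1 / 2 * m x ^ 2 + q x (y - x)) (q x) x := by
      simp only [map_sub]
      exact ((q x).hasFDerivAt.sub_const _).const_add _
    have h3 := h1.add h2
    rw [zero_add] at h3
    refine h3.congr_of_eventuallyEq (Eventually.of_forall fun y => ?_)
    simp
  refine ⟨m, s, L, √(Fintype.card S) / c, hL0, by positivity, fun x => ?_, fun x => ?_,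
    fun x => (hder x).differentiableAt, fun x y => ?_, fun x => ?_⟩
  · have := pow_le_pow_left₀ (hf0 x) (hfle x) 2
    rw [hmf]
    linarith
  · set a := N (U x)
    set b := θ⁻¹ * ‖centred (x - U x)‖ with hb
    have h1 : N x ≤ a + (C' * θ) * b := by
      have h2 := map_add_le_add N (U x) (x - U x)
      rw [add_sub_cancel] at h2
      refine h2.trans (add_le_add le_rfl ((hNC _).trans (le_of_eq ?_)))
      rw [hb]
      field_simp
    have h2 := pow_le_pow_left₀ (apply_nonneg N x) h1 2
    have h3 : f x ^ 2 = a ^ 2 + b ^ 2 := hfsq x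
    rw [hmf, h3]
    have h4 : (a + C' * θ * b) ^ 2 ≤ cu * (a ^ 2 + b ^ 2) := by
      have : cu = 1 + (C' * θ) ^ 2 := by rw [hCθ]; ring
      rw [this]
      nlinarith [sq_nonneg (C' * θ * a - b)]
    linarith
  · rw [(hder x).fderiv]
    have := hupper x (y - x)
    rw [add_sub_cancel] at this
    exact this
  · rw [hsx]
    have h1 := norm_centred_le x
    have h2 : spanSeminorm x ≤ N x / c := by
      rw [le_div_iff₀ hc, mul_comm]
      exact hcN x
    calc ‖centred x‖ ≤ √(Fintype.card S) * (N x / c) :=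
          h1.trans (mul_le_mul_of_nonneg_left h2 (Real.sqrt_nonneg _))
      _ = _ := by ring

end Moreau

/-! ### Existence of analysis data -/

namespace RobustMDP

variable {S A : Type*} [Fintype S] [Fintype A] [DecidableEq S] {I : RobustMDP S A}

lemma Admissible.exists_analysisData [Nonempty S] (h : I.Admissible) {α ε : ℝ}
    (hα : α ∈ Set.Ioo (jointSpectralRadius I.fluctuations) 1) (hε : ε ∈ Set.Ioo 0 (1 - α)) :
    ∃ D : AnalysisData S, D.Valid I ∧ (∀ x, D.N x = I.robustSeminorm α ε x) ∧ D.γ = α + ε ∧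
      (1 - D.γ) / 2 ≤ D.α₂ := by
  obtain ⟨B, hB⟩ := h.exists_frobNorm_le_pow hα.1
  have hα0 : 0 < α := h.jointSpectralRadius_nonneg.trans_lt hα.1
  have hX : I.ExtremalBound α (max B 0) := ⟨h, inferInstance, hα0, le_max_right _ _,
    fun k Q hQ => (hB k Q hQ).trans
      (mul_le_mul_of_nonneg_right (le_max_left _ _) (by positivity))⟩
  obtain ⟨hε0, hε1⟩ := hε
  set γ := α + ε with hγ
  have hγ0 : 0 < γ := by linarith
  have hγ1 : γ < 1 := by linarith
  set N := hX.seminorm hε0.le with hN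
  -- With `cl = 1` this gives `γ * √cu = (1 + γ) / 2`, hence `α₂ = (1 - γ) / 2`.
  set cu := ((1 + γ) / (2 * γ)) ^ 2 with hcu
  have hq : 1 < (1 + γ) / (2 * γ) := by rw [lt_div_iff₀ (by positivity)]; linarith
  have hcu1 : 1 < cu := one_lt_pow₀ hq two_ne_zero
  -- The second entry only ensures that `CP` is not below `cP = ε / 2`.
  set CP := max ((α + ε) * (max B 0 * √(Fintype.card S))) (ε / 2) with hCP
  have hNle : ∀ x, N x ≤ CP * spanSeminorm x := fun x =>
    (hX.seminorm_le hε0.le x).trans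
      (mul_le_mul_of_nonneg_right (le_max_left _ _) (spanSeminorm_nonneg x))
  obtain ⟨m, s, L, ρ, hL, hρ, h1, h2, h3, h4, h5⟩ :=
    exists_smooth_approximation (N := N) (half_pos hε0) (hX.le_seminorm hε0.le) hNle hcu1
  have hα₂ : 1 - γ * √(cu / 1) = (1 - γ) / 2 := by
    rw [div_one, hcu, Real.sqrt_sq (by linarith)]
    field_simp
    ring
  refine ⟨⟨N, m, s, γ, ε / 2, CP, 1, cu, L, ρ⟩, ?_, fun x => rfl, rfl, hα₂.ge⟩
  refine ⟨⟨hγ0, hγ1⟩, fun x => ⟨fun hx => ?_, ?_⟩, fun P hP x => hX.seminorm_contraction hε0.le hP x,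
    half_pos hε0, le_max_right _ _, hX.le_seminorm hε0.le, hNle, one_pos, hcu1.le,
    fun x => (one_mul _).trans_le (h1 x), h2, hL, h3, h4, hρ, h5, ?_⟩
  · have h6 := hX.le_seminorm hε0.le x
    rw [← hN] at h6
    change N x = 0 at hx
    rw [hx] at h6
    have h7 : spanSeminorm x = 0 := le_antisymm (by nlinarith) (spanSeminorm_nonneg x)
    obtain ⟨s₀⟩ := ‹Nonempty S›
    refine ⟨x s₀, funext fun s => ?_⟩
    have := abs_sub_le_spanSeminorm x s s₀
    rw [h7] at this
    exact sub_eq_zero.1 (abs_nonpos_iff.1 this)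
  · rintro ⟨c, rfl⟩
    have h6 := hNle fun _ => c
    have h7 : spanSeminorm (fun _ : S => c) = 0 := by simp [spanSeminorm]
    rw [h7, mul_zero] at h6
    exact le_antisymm h6 (apply_nonneg N _)
  · change 0 < 1 - γ * √(cu / 1)
    rw [hα₂]
    linarith

lemma Admissible.exists_valid [Nonempty S] (h : I.Admissible) : ∃ D : AnalysisData S, D.Valid I := by
  obtain ⟨α, h1, h2⟩ := exists_between h.jointSpectralRadius_lt_one
  obtain ⟨ε, h3, h4⟩ := exists_between (sub_pos.2 h2)
  obtain ⟨D, hD, -⟩ := h.exists_analysisData ⟨h1, h2⟩ ⟨h3, h4⟩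
  exact ⟨D, hD⟩

end RobustMDP

/-! ### Bellman operators of lower envelopes -/

/-- `σ` is a lower envelope of the linear functionals of members of `B` which is, at each `V`,
attained. -/
def IsEnvelope {S : Type*} [Fintype S] (B : Set (S → ℝ)) (σ : (S → ℝ) → ℝ) : Prop :=
  ∀ V, ∃ q ∈ B, σ V = q ⬝ᵥ V ∧ ∀ V', σ V' ≤ q ⬝ᵥ V'

/-- A mean value theorem: the members attained at `V₁` and `V₂` give a lower and an upper bound for
the difference, and by convexity a mixture of them gives equality. -/
lemma IsEnvelope.exists_sub_eq {S : Type*} [Fintype S] {B : Set (S → ℝ)} {σ : (S → ℝ) → ℝ}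
    (h : IsEnvelope B σ) (hB : Convex ℝ B) (V₁ V₂ : S → ℝ) :
    ∃ q ∈ B, σ V₁ - σ V₂ = q ⬝ᵥ (V₁ - V₂) := by
  obtain ⟨q₁, hq₁, h1, h1'⟩ := h V₁
  obtain ⟨q₂, hq₂, h2, h2'⟩ := h V₂
  have hmem : σ V₁ - σ V₂ ∈ segment ℝ (q₁ ⬝ᵥ (V₁ - V₂)) (q₂ ⬝ᵥ (V₁ - V₂)) := by
    have a1 := h1' V₂
    have a2 := h2' V₁
    rw [segment_eq_Icc (by rw [dotProduct_sub, dotProduct_sub]; linarith), dotProduct_sub,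
      dotProduct_sub]
    constructor <;> linarith
  obtain ⟨a, b, ha, hb, hab, e⟩ := hmem
  refine ⟨a • q₁ + b • q₂, hB hq₁ hq₂ ha hb hab, ?_⟩
  rw [← e, add_dotProduct, smul_dotProduct, smul_dotProduct]

lemma AnalysisData.Valid.sub_const {S A : Type*} [Fintype S] [Fintype A] [DecidableEq S]
    {D : AnalysisData S} {I : RobustMDP S A} (h : D.Valid I) (x : S → ℝ) (c : ℝ) :
    D.N (fun s => x s - c) = D.N x := by
  have h0 : ∀ c : ℝ, D.N (fun _ => c) = 0 := fun c => (h.kernel _).2 ⟨c, rfl⟩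
  refine le_antisymm ?_ ?_
  · have := map_sub_le_add D.N x (fun _ => c)
    rw [h0, add_zero] at this
    exact this
  · have := map_add_le_add D.N (fun s => x s - c) (fun _ => c)
    rw [h0, add_zero] at this
    refine le_trans (le_of_eq (congrArg _ ?_)) this
    funext s
    simp

lemma spanSeminorm_const {S : Type*} [Finite S] (c : ℝ) : spanSeminorm (fun _ : S => c) = 0 := by
  rcases isEmpty_or_nonempty S with h | h
  · simp [spanSeminorm]
  · simp [spanSeminorm]

lemma norm_le_spanSeminorm {S : Type*} [Fintype S] {x : S → ℝ} {s₀ : S} (h : x s₀ = 0) :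
    ‖x‖ ≤ spanSeminorm x := by
  refine (pi_norm_le_iff_of_nonneg (spanSeminorm_nonneg x)).2 fun s => ?_
  simpa [h] using abs_sub_le_spanSeminorm x s s₀

lemma spanSeminorm_le_two_norm {S : Type*} [Fintype S] (x : S → ℝ) :
    spanSeminorm x ≤ 2 * ‖x‖ := by
  rcases isEmpty_or_nonempty S with h | h
  · simp [spanSeminorm]
  · refine spanSeminorm_le fun s t => ?_
    have hs := (abs_le.1 ((Real.norm_eq_abs _).symm.trans_le (norm_le_pi_norm x s))).2
    have ht := (abs_le.1 ((Real.norm_eq_abs _).symm.trans_le (norm_le_pi_norm x t))).1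
    linarith

lemma spanSeminorm_add_le {S : Type*} [Finite S] [Nonempty S] (x y : S → ℝ) :
    spanSeminorm (x + y) ≤ spanSeminorm x + spanSeminorm y :=
  spanSeminorm_le fun s t => by
    have := sub_le_spanSeminorm x s t
    have := sub_le_spanSeminorm y s t
    simp only [Pi.add_apply]
    linarith

namespace RobustMDP

variable {S A : Type*} [Fintype S] [Fintype A] [DecidableEq S] {I : RobustMDP S A}

/-- The Bellman operator for a family of envelopes. -/
def envelopeBellman (I : RobustMDP S A) (τ : S → A → (S → ℝ) → ℝ) (g : ℝ) (V : S → ℝ) (s : S) : ℝ :=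
  ∑ a, I.policy s a * (I.reward s a - g + τ s a V)

/-- A family of envelopes of the uncertainty sets. -/
def IsEnvelopeFamily (I : RobustMDP S A) (τ : S → A → (S → ℝ) → ℝ) : Prop :=
  ∀ s a, IsEnvelope (I.unc.ball (I.nominal s a)) (τ s a)

lemma Admissible.sigma_isEnvelopeFamily (h : I.Admissible) : I.IsEnvelopeFamily I.sigma := by
  intro s a V
  obtain ⟨q, hq, hqV⟩ := UncertaintySet.exists_support_eq h.proper (h.nominal_mem s a) V
  exact ⟨q, hq, hqV.symm, fun V' => UncertaintySet.support_le h.proper (h.nominal_mem s a) hq V'⟩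

variable {τ : S → A → (S → ℝ) → ℝ}

lemma envelopeBellman_eq (h : I.Admissible) (g : ℝ) (V : S → ℝ) (s : S) :
    I.envelopeBellman τ g V s = I.policyReward s - g + ∑ a, I.policy s a * τ s a V := by
  have := weighted_const (h.policy_mem s) g
  simp only [envelopeBellman, policyReward, mul_add, mul_sub, Finset.sum_add_distrib,
    Finset.sum_sub_distrib]
  rw [this]

/-- Rectangularity lets the members found separately for each pair `(s, a)` form one kernel of the
uncertainty set. -/
lemma envelopeBellman_sub (h : I.Admissible) (hτ : I.IsEnvelopeFamily τ) (g : ℝ)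
    (V₁ V₂ : S → ℝ) : ∃ P ∈ I.kernels,
      I.envelopeBellman τ g V₁ - I.envelopeBellman τ g V₂ = I.chain P *ᵥ (V₁ - V₂) := by
  choose P hP hPV using fun s a => (hτ s a).exists_sub_eq
    (UncertaintySet.convex_ball h.proper (h.nominal_mem s a)) V₁ V₂
  refine ⟨P, hP, ?_⟩
  funext s
  rw [chain_mulVec, Pi.sub_apply, envelopeBellman, envelopeBellman, ← Finset.sum_sub_distrib]
  refine Finset.sum_congr rfl fun a _ => ?_
  rw [← hPV]
  ring

lemma envelopeBellman_contraction (h : I.Admissible) (hτ : I.IsEnvelopeFamily τ)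
    {D : AnalysisData S} (hD : D.Valid I) (g : ℝ) (V₁ V₂ : S → ℝ) :
    D.N (I.envelopeBellman τ g V₁ - I.envelopeBellman τ g V₂) ≤ D.γ * D.N (V₁ - V₂) := by
  obtain ⟨P, hP, e⟩ := envelopeBellman_sub h hτ g V₁ V₂
  rw [e]
  exact hD.contraction P hP _

/-- Envelope Bellman operators have anchored fixed points. -/
lemma exists_envelope_fixedPoint (h : I.Admissible) (hτ : I.IsEnvelopeFamily τ)
    (s₀ : S) : ∃ (V : S → ℝ) (g : ℝ), V s₀ = 0 ∧ V = I.envelopeBellman τ g V := by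
  have : Nonempty S := ⟨s₀⟩
  obtain ⟨D, hD⟩ := h.exists_valid
  obtain ⟨hγ0, hγ1⟩ := hD.γ_mem
  -- Subtracting the value at `s₀` is invisible to `D.N`, so `T` contracts; on vectors that vanish
  -- at `s₀` the semi-norm dominates the sup norm, which makes the iterates Cauchy.
  set T : (S → ℝ) → S → ℝ := fun V s =>
    I.envelopeBellman τ 0 V s - I.envelopeBellman τ 0 V s₀ with hT
  have hTN : ∀ V₁ V₂, D.N (T V₁ - T V₂) ≤ D.γ * D.N (V₁ - V₂) := by
    intro V₁ V₂
    have e : T V₁ - T V₂ = fun s => (I.envelopeBellman τ 0 V₁ - I.envelopeBellman τ 0 V₂) s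
        - (I.envelopeBellman τ 0 V₁ s₀ - I.envelopeBellman τ 0 V₂ s₀) := by
      funext s
      simp only [hT, Pi.sub_apply]
      ring
    rw [e, hD.sub_const]
    exact envelopeBellman_contraction h hτ hD 0 V₁ V₂
  have hnorm : ∀ x : S → ℝ, x s₀ = 0 → ‖x‖ ≤ D.N x / D.cP := fun x hx => by
    rw [le_div_iff₀ hD.cP_pos, mul_comm]
    exact (mul_le_mul_of_nonneg_left (norm_le_spanSeminorm hx) hD.cP_pos.le).trans (hD.le_N x)
  set W : ℕ → S → ℝ := fun n => T^[n] 0 with hW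
  have hW0 : ∀ n, W n s₀ = 0 := fun n => by
    cases n with
    | zero => rfl
    | succ n => simp only [hW, Function.iterate_succ_apply']; simp [hT]
  have hWs : ∀ n, W (n + 1) = T (W n) := fun n => Function.iterate_succ_apply' _ _ _
  have hgeo : ∀ n, D.N (W n - W (n + 1)) ≤ D.γ ^ n * D.N (W 0 - W 1) := by
    intro n
    induction n with
    | zero => simp
    | succ n ih =>
      have h1 := hTN (W n) (W (n + 1))
      rw [← hWs, ← hWs] at h1
      refine h1.trans ?_
      rw [pow_succ']
      linarith [mul_le_mul_of_nonneg_left ih hγ0.le]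
  obtain ⟨V, hV⟩ := cauchySeq_tendsto_of_complete (cauchySeq_of_le_geometric (f := W) D.γ
    (D.N (W 0 - W 1) / D.cP) hγ1 fun n => by
      rw [dist_eq_norm]
      refine (hnorm _ (by simp [hW0])).trans ?_
      rw [div_mul_eq_mul_div]
      have := hD.cP_pos
      gcongr
      linarith [hgeo n])
  have hV0 : V s₀ = 0 := by
    have h1 := (tendsto_pi_nhds.1 hV) s₀
    simp only [hW0] at h1
    exact (tendsto_nhds_unique h1 tendsto_const_nhds)
  have hfix : V = T V := by
    have h1 : Tendsto (fun n => W (n + 1) - T V) atTop (𝓝 0) := by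
      have h2 : Tendsto (fun n => D.γ * (D.CP * (2 * ‖W n - V‖)) / D.cP) atTop (𝓝 0) := by
        have h3 : Tendsto (fun n => ‖W n - V‖) atTop (𝓝 0) := by
          rw [← tendsto_iff_norm_sub_tendsto_zero]
          exact hV
        have h4 := ((h3.const_mul 2).const_mul D.CP).const_mul D.γ |>.div_const D.cP
        simpa using h4
      refine squeeze_zero_norm (fun n => ?_) h2
      refine (hnorm _ (by simp [hW0, hT])).trans ?_
      have := hD.cP_pos
      gcongr
      rw [hWs]
      have hCP : 0 ≤ D.CP := hD.cP_pos.le.trans hD.cP_le_CP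
      refine (hTN _ _).trans (mul_le_mul_of_nonneg_left ((hD.N_le _).trans ?_) hγ0.le)
      exact mul_le_mul_of_nonneg_left (spanSeminorm_le_two_norm _) hCP
    have h5 : Tendsto (fun n => W (n + 1) - T V) atTop (𝓝 (V - T V)) :=
      (hV.comp (tendsto_add_atTop_nat 1)).sub_const _
    exact sub_eq_zero.1 (tendsto_nhds_unique h5 h1)
  -- The gain `g` is the amount that anchoring subtracts at the fixed point.
  refine ⟨V, I.envelopeBellman τ 0 V s₀, hV0, ?_⟩
  conv_lhs => rw [hfix]
  funext s
  simp only [hT]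
  rw [envelopeBellman_eq h, envelopeBellman_eq h _ V s]
  ring

/-- A fixed point of an envelope Bellman operator solves the Poisson equation of some kernel. -/
lemma exists_poisson (h : I.Admissible) (hτ : I.IsEnvelopeFamily τ) {V : S → ℝ} {g : ℝ}
    (hV : V = I.envelopeBellman τ g V) : ∃ P ∈ I.kernels, (∀ s a, P s a ⬝ᵥ V = τ s a V) ∧
      ∀ s, V s = I.policyReward s - g + (I.chain P *ᵥ V) s := by
  choose P hP hPV _ using fun s a => hτ s a V
  refine ⟨P, hP, fun s a => (hPV s a).symm, fun s => ?_⟩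
  conv_lhs => rw [hV]
  rw [envelopeBellman_eq h, chain_mulVec]
  simp_rw [hPV]

/-- Since `y = W - M *ᵥ W + g`, the sum telescopes. The reward `y` is left general because the
optimality proof needs a reward other than that of the policy. -/
lemma sum_pow_mulVec_eq {M : Matrix S S ℝ} (hM : M ∈ rowStochastic ℝ S) {y W : S → ℝ} {g : ℝ}
    (hy : ∀ s, W s = y s - g + (M *ᵥ W) s) (T : ℕ) (s : S) :
    ∑ t ∈ Finset.range T, (M ^ t *ᵥ y) s = W s - (M ^ T *ᵥ W) s + T * g := by
  have hstep : ∀ t, (M ^ t *ᵥ y) s = (M ^ t *ᵥ W) s - (M ^ (t + 1) *ᵥ W) s + g := by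
    intro t
    have e : y = W - M *ᵥ W + fun _ => g := by
      funext s
      simp only [Pi.add_apply, Pi.sub_apply]
      linarith [hy s]
    rw [e, mulVec_add, mulVec_sub, mulVec_mulVec, ← pow_succ,
      mulVec_const_of_rowStochastic (pow_mem hM t)]
    rfl
  induction T with
  | zero => simp
  | succ T ih =>
    rw [Finset.sum_range_succ, ih, hstep]
    push_cast
    ring

lemma policyReward_span_le [Nonempty S] (h : I.Admissible) : spanSeminorm I.policyReward ≤ 1 := by
  have h01 : ∀ s, I.policyReward s ∈ Set.Icc (0 : ℝ) 1 := fun s => by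
    refine ⟨weighted_nonneg (h.policy_mem s) fun a => (h.reward_mem s a).1, ?_⟩
    rw [← weighted_const (h.policy_mem s) 1]
    exact weighted_mono (h.policy_mem s) fun a => (h.reward_mem s a).2
  exact spanSeminorm_le fun s t => by linarith [(h01 s).2, (h01 t).1]

/-- Unroll the Poisson equation over the mixing time `n`: the rewards contribute span at most `n`
and the remainder `M ^ n *ᵥ V` at most half the span of `V`. -/
lemma spanSeminorm_le_tMix [Nonempty S] (h : I.Admissible) {P : S → A → S → ℝ}
    (hP : P ∈ I.kernels) {V : S → ℝ} {g : ℝ}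
    (hV : ∀ s, V s = I.policyReward s - g + (I.chain P *ᵥ V) s) :
    spanSeminorm V ≤ 2 * I.tMix := by
  set M := I.chain P with hM
  have hMs := h.chain_mem hP
  set n := mixingTime M with hn
  have hmix := (h.bddAbove_mixingTimes_and.2 P hP).2 V
  rw [← hM, ← hn] at hmix
  have hle : (n : ℝ) ≤ I.tMix := by exact_mod_cast h.mixingTime_le_tMix hP
  have h1 : spanSeminorm V ≤ n + 1 / 2 * spanSeminorm V := by
    refine spanSeminorm_le fun s t => ?_
    have es := sum_pow_mulVec_eq hMs hV n s
    have et := sum_pow_mulVec_eq hMs hV n t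
    have h2 : ∑ j ∈ Finset.range n, (M ^ j *ᵥ I.policyReward) s
        - ∑ j ∈ Finset.range n, (M ^ j *ᵥ I.policyReward) t ≤ n := by
      rw [← Finset.sum_sub_distrib]
      refine (Finset.sum_le_sum fun j _ => (sub_le_spanSeminorm _ s t).trans
        ((spanSeminorm_mulVec_le (pow_mem hMs j) _).trans (policyReward_span_le h))).trans ?_
      simp
    have h3 := sub_le_spanSeminorm (M ^ n *ᵥ V) s t
    linarith
  linarith

lemma tendsto_cesaro {M : Matrix S S ℝ} (hM : M ∈ rowStochastic ℝ S) (W : S → ℝ) (g : ℝ) (s : S) :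
    Tendsto (fun T : ℕ => (W s - (M ^ T *ᵥ W) s + T * g) / T) atTop (𝓝 g) := by
  have h1 : Tendsto (fun T : ℕ => (W s - (M ^ T *ᵥ W) s) / T) atTop (𝓝 0) := by
    refine squeeze_zero_norm (a := fun T : ℕ => spanSeminorm W / T) (fun T => ?_)
      (tendsto_const_div_atTop_nhds_zero_nat _)
    rw [norm_div, Real.norm_natCast]
    refine div_le_div_of_nonneg_right ?_ (Nat.cast_nonneg T)
    have hs := single_mem_stdSimplex ℝ s
    have hrow := row_mem_stdSimplex (pow_mem hM T) s
    have e : W s = (Pi.single s 1 : S → ℝ) ⬝ᵥ W := by simp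
    rw [Real.norm_eq_abs, e, abs_le]
    constructor
    · have := weighted_sub_le_spanSeminorm hrow hs W
      simp only [mulVec]
      linarith
    · exact weighted_sub_le_spanSeminorm hs hrow W
  have h2 : Tendsto (fun T : ℕ => (W s - (M ^ T *ᵥ W) s) / T + g) atTop (𝓝 g) := by
    simpa using h1.add_const g
  refine h2.congr' ?_
  filter_upwards [eventually_ge_atTop 1] with T hT
  have : (T : ℝ) ≠ 0 := by positivity
  field_simp

lemma hasAverageReward_of_poisson (h : I.Admissible) {P : S → A → S → ℝ} (hP : P ∈ I.kernels)
    {V : S → ℝ} {g : ℝ} (hV : ∀ s, V s = I.policyReward s - g + (I.chain P *ᵥ V) s) :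
    I.HasAverageReward P g := by
  intro s
  simp_rw [sum_pow_mulVec_eq (h.chain_mem hP) hV]
  exact tendsto_cesaro (h.chain_mem hP) V g s

/-- Under another kernel `P'`, `V` solves the Poisson equation with gain `g` for the reward `y`. As
support functions lie below the values of `P'`, `y` is at most the true reward, so the average
reward of `P'` is at least `g`. -/
lemma isRobustAverageReward_of_fixedPoint (h : I.Admissible) [Nonempty S] {V : S → ℝ} {g : ℝ}
    (hV : V = I.bellman g V) : I.IsRobustAverageReward g := by
  obtain ⟨P, hP, -, hPV⟩ := exists_poisson h h.sigma_isEnvelopeFamily hV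
  refine ⟨⟨P, hP, hasAverageReward_of_poisson h hP hPV⟩, ?_⟩
  rintro x ⟨P', hP', hx⟩
  obtain ⟨s⟩ := ‹Nonempty S›
  have hM := h.chain_mem hP'
  set y : S → ℝ := fun s => V s + g - (I.chain P' *ᵥ V) s with hy
  have hyr : ∀ s, y s ≤ I.policyReward s := by
    intro s
    have h1 : V s = I.policyReward s - g + ∑ a, I.policy s a * I.sigma s a V :=
      (congrFun hV s).trans (envelopeBellman_eq h g V s)
    have h2 : ∑ a, I.policy s a * I.sigma s a V ≤ (I.chain P' *ᵥ V) s := by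
      rw [chain_mulVec]
      exact weighted_mono (h.policy_mem s) fun a =>
        UncertaintySet.support_le h.proper (h.nominal_mem s a) (hP' s a) V
    simp only [hy]
    linarith
  refine le_of_tendsto_of_tendsto' (tendsto_cesaro hM V g s) (hx s) fun T => ?_
  refine div_le_div_of_nonneg_right ?_ (Nat.cast_nonneg T)
  rw [← sum_pow_mulVec_eq hM (y := y) (g := g) (fun s => by simp only [hy]; ring)]
  refine Finset.sum_le_sum fun t _ => ?_
  exact Finset.sum_le_sum fun s' _ => mul_le_mul_of_nonneg_left (hyr s')
    (nonneg_of_mem_rowStochastic (pow_mem hM t))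

/-- The partial sums are `V s - (M ^ T *ᵥ V) s`, and the second term tends geometrically to the
stationary mean; so the additive constant is `ν ⬝ᵥ V`. -/
lemma isAnchoredRobustValue_of_fixedPoint (h : I.Admissible) {s₀ : S} {V : S → ℝ} {g : ℝ}
    (hV0 : V s₀ = 0) (hV : V = I.bellman g V) : I.IsAnchoredRobustValue s₀ V := by
  have : Nonempty S := ⟨s₀⟩
  obtain ⟨P, hP, hPσ, hPV⟩ := exists_poisson h h.sigma_isEnvelopeFamily hV
  obtain ⟨ν, hν⟩ := h.exists_stationary hP
  obtain ⟨C, ρ, hC, hρ, hρ1, hgeo⟩ := h.exists_geometric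
  have hM := h.chain_mem hP
  set M := I.chain P with hMdef
  refine ⟨hV0, P, hP, g, ν ⬝ᵥ V, hPσ, isRobustAverageReward_of_fixedPoint h hV,
    hasAverageReward_of_poisson h hP hPV, fun s => ?_⟩
  have hpart : ∀ T, ∑ t ∈ Finset.range T, ((M ^ t *ᵥ I.policyReward) s - g)
      = V s - (M ^ T *ᵥ V) s := by
    intro T
    rw [Finset.sum_sub_distrib, sum_pow_mulVec_eq hM hPV]
    simp
  have hdist : ∀ T, |(M ^ T *ᵥ V) s - ν ⬝ᵥ V| ≤ C * ρ ^ T * spanSeminorm V := by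
    intro T
    have hs := single_mem_stdSimplex ℝ s
    have e : (M ^ T *ᵥ V) s = (Pi.single s 1 : S → ℝ) ⬝ᵥ (M ^ T *ᵥ V) := by simp
    refine le_trans ?_ (hgeo T _ (chain_pow_mem hP T) V)
    rw [e, ← hν.dotProduct_pow_mulVec T, abs_le]
    constructor
    · linarith [weighted_sub_le_spanSeminorm hν.1 hs (M ^ T *ᵥ V)]
    · exact weighted_sub_le_spanSeminorm hs hν.1 (M ^ T *ᵥ V)
  have hlim0 : Tendsto (fun T : ℕ => C * ρ ^ T * spanSeminorm V) atTop (𝓝 0) := by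
    simpa using ((tendsto_pow_atTop_nhds_zero_of_lt_one hρ.le hρ1).const_mul C).mul_const
      (spanSeminorm V)
  have hlim : Tendsto (fun T => (M ^ T *ᵥ V) s) atTop (𝓝 (ν ⬝ᵥ V)) := by
    rw [tendsto_iff_norm_sub_tendsto_zero]
    exact squeeze_zero (fun _ => norm_nonneg _) hdist hlim0
  have hsum : Summable fun t => (M ^ t *ᵥ I.policyReward) s - g := by
    refine Summable.of_norm_bounded (g := fun t : ℕ => C * ρ ^ t * spanSeminorm V
      + C * ρ ^ (t + 1) * spanSeminorm V) ?_ fun t => ?_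
    · have hg := summable_geometric_of_lt_one hρ.le hρ1
      have h1 := (hg.mul_left C).mul_right (spanSeminorm V)
      exact h1.add ((summable_nat_add_iff 1).2 h1)
    · have e := hpart (t + 1)
      rw [Finset.sum_range_succ, hpart t] at e
      have h1 := hdist t
      have h2 := hdist (t + 1)
      rw [abs_le] at h1 h2
      rw [Real.norm_eq_abs, abs_le]
      constructor <;> linarith [h1.1, h1.2, h2.1, h2.2]
  rw [hsum.hasSum_iff_tendsto_nat]
  simp_rw [hpart]
  exact hlim.const_sub _

/-- Dropping the first term of the relative value series is the same as applying the chain to its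
sum; this is the Poisson equation, and the kernel attains the support functions. -/
lemma fixedPoint_of_isAnchoredRobustValue (h : I.Admissible) {s₀ : S} {V : S → ℝ}
    (hV : I.IsAnchoredRobustValue s₀ V) :
    ∃ g, I.IsRobustAverageReward g ∧ V = I.bellman g V := by
  obtain ⟨-, P, hP, g, c, hσ, hg, -, hsum⟩ := hV
  refine ⟨g, hg, funext fun s => ?_⟩
  have hM := h.chain_mem hP
  set M := I.chain P with hMdef
  have h1 := (hasSum_nat_add_iff' 1).2 (hsum s)
  have h2 : HasSum (fun t => ∑ s', M s s' * ((M ^ t *ᵥ I.policyReward) s' - g))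
      (∑ s', M s s' * (V s' - c)) := hasSum_sum fun s' _ => (hsum s').mul_left (M s s')
  have e : (fun t => ∑ s', M s s' * ((M ^ t *ᵥ I.policyReward) s' - g))
      = fun t => (M ^ (t + 1) *ᵥ I.policyReward) s - g := by
    funext t
    have := congrFun (mulVec_sub_const hM (M ^ t *ᵥ I.policyReward) g) s
    rw [mulVec_mulVec, ← pow_succ'] at this
    exact this
  rw [e] at h2
  have h3 := h1.unique h2
  have h4 : ∑ s', M s s' * (V s' - c) = (M *ᵥ V) s - c := congrFun (mulVec_sub_const hM V c) s
  rw [h4] at h3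
  simp only [Finset.range_one, Finset.sum_singleton, pow_zero, one_mulVec] at h3
  have h5 : I.bellman g V s = I.policyReward s - g + ∑ a, I.policy s a * I.sigma s a V :=
    envelopeBellman_eq h g V s
  rw [h5]
  have h6 : (M *ᵥ V) s = ∑ a, I.policy s a * I.sigma s a V := by
    rw [hMdef, chain_mulVec]
    simp_rw [hσ]
  linarith

/-- The gain is determined as a least element. Two fixed points with the same gain differ by a
constant by contraction, and the anchor makes it zero. -/
lemma existsUnique_isAnchoredRobustValue (h : I.Admissible) (s₀ : S) :
    ∃! V : S → ℝ, I.IsAnchoredRobustValue s₀ V := by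
  have : Nonempty S := ⟨s₀⟩
  obtain ⟨V, g, hV0, hV⟩ := exists_envelope_fixedPoint h h.sigma_isEnvelopeFamily s₀
  refine ⟨V, isAnchoredRobustValue_of_fixedPoint h hV0 hV, fun V' hV' => ?_⟩
  obtain ⟨g', hg', hfix'⟩ := fixedPoint_of_isAnchoredRobustValue h hV'
  have hgg : g' = g := hg'.unique (isRobustAverageReward_of_fixedPoint h hV)
  subst hgg
  obtain ⟨D, hD⟩ := h.exists_valid
  have h1 := envelopeBellman_contraction h h.sigma_isEnvelopeFamily hD g' V' V
  rw [← hV] at h1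
  have h2 : I.envelopeBellman I.sigma g' V' = V' := hfix'.symm
  rw [h2] at h1
  have h3 : D.N (V' - V) = 0 := by
    have := hD.γ_mem.2
    exact le_antisymm (by nlinarith [apply_nonneg D.N (V' - V)]) (apply_nonneg _ _)
  obtain ⟨c, hc⟩ := (hD.kernel _).1 h3
  have h4 : c = 0 := by
    have := congrFun hc s₀
    simp only [Pi.sub_apply, hV'.1, hV0] at this
    linarith
  rw [h4] at hc
  exact sub_eq_zero.1 hc

lemma spanSeminorm_anchored_le (h : I.Admissible) {s₀ : S} {V : S → ℝ}
    (hV : I.IsAnchoredRobustValue s₀ V) : spanSeminorm V ≤ 2 * I.tMix := by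
  have : Nonempty S := ⟨s₀⟩
  obtain ⟨g, -, hfix⟩ := fixedPoint_of_isAnchoredRobustValue h hV
  obtain ⟨P, hP, -, hPV⟩ := exists_poisson h h.sigma_isEnvelopeFamily hfix
  exact spanSeminorm_le_tMix h hP hPV

end RobustMDP

/-! ### A recursion with step sizes of order `1 / t` -/

/-- For `u = t + K` the weight `(u - 1) * (u - 2)` cancels `1 - 2 / u` exactly, since `u * (u - 1) *
(1 - 2 / u) = (u - 1) * (u - 2)`. The perturbation of order `K / u ^ 2` is summable, and the slowly
growing factor `φ` absorbs it. -/
lemma recursion_bound {a : ℕ → ℝ} {K d : ℝ} (ha : ∀ t, 0 ≤ a t) (hK : 3 ≤ K) (hd : 0 ≤ d)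
    (h : ∀ t : ℕ, a (t + 1) ≤ (1 - 2 / (t + K) + K / (6 * (t + K) ^ 2)) * a t + d / (t + K) ^ 2)
    (T : ℕ) : a T ≤ 18 * (K ^ 2 / (T + K) ^ 2 * a 0 + d / (T + K)) := by
  -- The increments of `φ` are `K / (u * (u - 1))`; as `K ≥ 3`, its values stay between `1 / 2` and
  -- `2`.
  set φ : ℕ → ℝ := fun t => 2 - K / (t + K - 1) with hφ
  have hφ1 : ∀ t, 1 / 2 ≤ φ t := fun t => by
    have ht : (0 : ℝ) ≤ t := Nat.cast_nonneg t
    have : K / (t + K - 1) ≤ 3 / 2 := by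
      rw [div_le_iff₀ (by linarith)]
      linarith
    simp only [hφ]
    linarith
  have hφ2 : ∀ t, φ t ≤ 2 := fun t => by
    have ht : (0 : ℝ) ≤ t := Nat.cast_nonneg t
    have : 0 ≤ K / (t + K - 1) := div_nonneg (by linarith) (by linarith)
    simp only [hφ]
    linarith
  set P := (K - 1) * (K - 2) * a 0 with hP
  have hP0 : 0 ≤ P := mul_nonneg (mul_nonneg (by linarith) (by linarith)) (ha 0)
  have key : ∀ t : ℕ, (t + K - 1) * (t + K - 2) * a t ≤ φ t * (2 * P + 2 * d * t) := by
    intro t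
    induction t with
    | zero =>
      have := hφ1 0
      simp only [Nat.cast_zero, zero_add, mul_zero, add_zero]
      nlinarith
    | succ t ih =>
      have ht : (0 : ℝ) ≤ t := Nat.cast_nonneg t
      set u : ℝ := t + K with hu
      have hu3 : 3 ≤ u := by linarith
      have hY : 0 ≤ 2 * P + 2 * d * t := by positivity
      have e1 : ((t + 1 : ℕ) : ℝ) + K = u + 1 := by push_cast; ring
      have hstep := h t
      rw [← hu] at hstep
      rw [e1]
      have h1 : (u + 1 - 1) * (u + 1 - 2) * a (t + 1) ≤
          (u - 1) * (u - 2) * a t + K * (u - 1) / (6 * u) * a t + d := by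
        have h2 : (u + 1 - 1) * (u + 1 - 2) * a (t + 1) ≤ (u + 1 - 1) * (u + 1 - 2) *
            ((1 - 2 / u + K / (6 * u ^ 2)) * a t + d / u ^ 2) :=
          mul_le_mul_of_nonneg_left hstep (mul_nonneg (by linarith) (by linarith))
        refine h2.trans ?_
        have e2 : (u + 1 - 1) * (u + 1 - 2) * ((1 - 2 / u + K / (6 * u ^ 2)) * a t + d / u ^ 2)
            = (u - 1) * (u - 2) * a t + K * (u - 1) / (6 * u) * a t + d * ((u - 1) / u) := by
          have : u ≠ 0 := by linarith
          field_simp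
          ring
        rw [e2]
        have : (u - 1) / u ≤ 1 := by rw [div_le_one (by linarith)]; linarith
        nlinarith
      -- The `6` in the hypothesis is used here: `3 * (u - 2) / u ≥ 1` for `u ≥ 3`.
      have h3 : K * (u - 1) / (6 * u) * a t ≤ K / (2 * u ^ 2) * ((u - 1) * (u - 2) * a t) := by
        have e : K / (2 * u ^ 2) * ((u - 1) * (u - 2) * a t)
            = K * (u - 1) / (6 * u) * a t * (3 * (u - 2) / u) := by
          have : u ≠ 0 := by linarith
          field_simp
          ring
        rw [e]
        refine le_mul_of_one_le_right ?_ ?_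
        · exact mul_nonneg (div_nonneg (mul_nonneg (by linarith) (by linarith)) (by linarith)) (ha t)
        · rw [le_div_iff₀ (by linarith)]
          linarith
      have h4 : φ t * (1 + K / (2 * u ^ 2)) ≤ φ (t + 1) := by
        have e3 : φ (t + 1) = φ t + K / (u * (u - 1)) := by
          have a1 : u ≠ 0 := by linarith
          have a2 : u - 1 ≠ 0 := by linarith
          simp only [hφ]
          rw [e1, ← hu]
          rw [add_sub_cancel_right]
          field_simp
          ring
        rw [e3]
        have h5 : φ t * (K / (2 * u ^ 2)) ≤ 2 * (K / (2 * u ^ 2)) :=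
          mul_le_mul_of_nonneg_right (hφ2 t) (by positivity)
        have h6 : 2 * (K / (2 * u ^ 2)) ≤ K / (u * (u - 1)) := by
          have e4 : 2 * (K / (2 * u ^ 2)) = K / u ^ 2 := by field_simp
          rw [e4]
          refine div_le_div_of_nonneg_left (by linarith) (mul_pos (by linarith) (by linarith)) ?_
          nlinarith
        linarith
      have h7 := hφ1 (t + 1)
      have h8 : (1 + K / (2 * u ^ 2)) * ((u - 1) * (u - 2) * a t) ≤
          (1 + K / (2 * u ^ 2)) * (φ t * (2 * P + 2 * d * t)) :=
        mul_le_mul_of_nonneg_left ih (by positivity)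
      have h9 := mul_le_mul_of_nonneg_right h4 hY
      have h10 : φ (t + 1) * (2 * P + 2 * d * ((t + 1 : ℕ) : ℝ)) =
          φ (t + 1) * (2 * P + 2 * d * t) + φ (t + 1) * (2 * d) := by push_cast; ring
      have h11 : d ≤ φ (t + 1) * (2 * d) := by nlinarith
      rw [h10]
      linarith
  have hT : (0 : ℝ) ≤ T := Nat.cast_nonneg T
  set u : ℝ := T + K with hu
  have hu3 : 3 ≤ u := by linarith
  have h1 := key T
  rw [← hu] at h1
  have hY : 0 ≤ 2 * P + 2 * d * T := by positivity
  -- For `u ≥ 3`, `(u - 1) * (u - 2) ≥ 2 * u ^ 2 / 9`, with equality at `3`. The `18` is `9 / 2`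
  -- times the bound `2` on `φ` times the `2` in `key`.
  have h2 : 2 * u ^ 2 / 9 * a T ≤ (u - 1) * (u - 2) * a T :=
    mul_le_mul_of_nonneg_right (by nlinarith) (ha T)
  have h3 := mul_le_mul_of_nonneg_right (hφ2 T) hY
  have h4 : a T ≤ 18 * (P + d * T) / u ^ 2 := by
    rw [le_div_iff₀ (by positivity)]
    linarith
  refine h4.trans ?_
  have h5 : P ≤ K ^ 2 * a 0 := mul_le_mul_of_nonneg_right (by nlinarith) (ha 0)
  have h6 : d * T ≤ d * u := mul_le_mul_of_nonneg_left (by linarith) hd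
  have e : 18 * (K ^ 2 / u ^ 2 * a 0 + d / u) = 18 * (K ^ 2 * a 0 + d * u) / u ^ 2 := by
    have : u ≠ 0 := by linarith
    field_simp
  rw [e]
  gcongr

/-! ### The Lyapunov function -/

namespace AnalysisData.Valid

variable {S A : Type*} [Fintype S] [Fintype A] [DecidableEq S] {D : AnalysisData S}
  {I : RobustMDP S A}

lemma cu_pos (h : D.Valid I) : 0 < D.cu := h.cl_pos.trans_le h.cl_le_cu

lemma CP_pos (h : D.Valid I) : 0 < D.CP := h.cP_pos.trans_le h.cP_le_CP

lemma one_le_κ (h : D.Valid I) : 1 ≤ D.κ := (one_le_div h.cP_pos).2 h.cP_le_CP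

lemma Λ_pos (h : D.Valid I) : 0 < D.Λ :=
  mul_pos (mul_pos h.cu_pos (pow_pos h.ρ_pos 2)) h.L_pos

lemma M_nonneg (D : AnalysisData S) (x : S → ℝ) : 0 ≤ D.M x := by
  unfold AnalysisData.M
  positivity

lemma m_const (h : D.Valid I) (c : ℝ) : D.m (fun _ => c) = 0 := by
  have h1 := h.le_half_sq fun _ => c
  have h2 : D.N (fun _ => c) = 0 := (h.kernel _).2 ⟨c, rfl⟩
  rw [h2, AnalysisData.M] at h1
  have h3 := h.cl_pos
  have h4 : D.m (fun _ => c) ^ 2 ≤ 0 := by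
    by_contra h5
    push Not at h5
    nlinarith [mul_pos h3 h5]
  exact pow_eq_zero_iff two_ne_zero |>.1 (le_antisymm h4 (sq_nonneg _))

lemma M_sub_const (h : D.Valid I) (x : S → ℝ) (c : ℝ) : D.M (fun s => x s - c) = D.M x := by
  unfold AnalysisData.M
  congr 2
  refine le_antisymm ?_ ?_
  · have := map_sub_le_add D.m x (fun _ => c)
    rw [h.m_const, add_zero] at this
    exact this
  · have := map_add_le_add D.m (fun s => x s - c) (fun _ => c)
    rw [h.m_const, add_zero] at this
    refine le_trans (le_of_eq (congrArg _ ?_)) this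
    funext s
    simp

lemma N_sq_le (h : D.Valid I) (x : S → ℝ) : D.N x ^ 2 ≤ 2 * D.cu * D.M x := by
  linarith [h.half_sq_le x]

lemma M_le (h : D.Valid I) (x : S → ℝ) : D.M x ≤ D.N x ^ 2 / (2 * D.cl) := by
  rw [le_div_iff₀ (by linarith [h.cl_pos])]
  linarith [h.le_half_sq x]

lemma span_sq_le (h : D.Valid I) (x : S → ℝ) : spanSeminorm x ^ 2 ≤ D.N x ^ 2 / D.cP ^ 2 := by
  rw [le_div_iff₀ (pow_pos h.cP_pos 2), ← mul_pow, mul_comm]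
  exact pow_le_pow_left₀ (mul_nonneg h.cP_pos.le (spanSeminorm_nonneg x)) (h.le_N x) 2

lemma N_sq_le_span (h : D.Valid I) (x : S → ℝ) : D.N x ^ 2 ≤ D.CP ^ 2 * spanSeminorm x ^ 2 := by
  rw [← mul_pow]
  exact pow_le_pow_left₀ (apply_nonneg _ _) (h.N_le x) 2

/-- The drift of the Lyapunov function towards a point where the semi-norm is smaller. -/
lemma fderiv_le (h : D.Valid I) {x y : S → ℝ} (hy : D.N y ≤ D.γ * D.N x) :
    fderiv ℝ D.M x (y - x) ≤ -(2 * D.α₂ * D.M x) := by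
  have hγ := h.γ_mem.1
  have hcl := h.cl_pos
  have hcu := h.cu_pos
  set a := D.m x with ha
  set b := D.m y with hb
  have ha0 : 0 ≤ a := apply_nonneg _ _
  have hb0 : 0 ≤ b := apply_nonneg _ _
  have hMx : D.M x = 1 / 2 * a ^ 2 := rfl
  -- the smaller semi-norm
  have hab : b ≤ D.γ * √(D.cu / D.cl) * a := by
    have h1 : D.cl * b ^ 2 ≤ D.N y ^ 2 := by
      have := h.le_half_sq y
      unfold AnalysisData.M at this
      linarith
    have h2 : D.N x ^ 2 ≤ D.cu * a ^ 2 := by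
      have := h.half_sq_le x
      unfold AnalysisData.M at this
      linarith
    have h3 := pow_le_pow_left₀ (apply_nonneg D.N y) hy 2
    refine abs_le_of_sq_le_sq' ?_ (by positivity) |>.2
    rw [mul_pow, mul_pow, Real.sq_sqrt (by positivity)]
    have h4 : D.γ ^ 2 * (D.cu / D.cl) * a ^ 2 = D.γ ^ 2 * (D.cu * a ^ 2) / D.cl := by ring
    rw [h4, le_div_iff₀ hcl]
    nlinarith [mul_le_mul_of_nonneg_left h2 (sq_nonneg D.γ)]
  have hder := ((h.differentiable x).hasFDerivAt.comp_hasDerivAt_of_eq (0 : ℝ)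
    (((hasDerivAt_id (0 : ℝ)).smul_const (y - x)).const_add x) (by simp))
  have hslope := hder.hasDerivWithinAt (s := Set.Ioi 0)
  rw [hasDerivWithinAt_iff_tendsto_slope' (by simp)] at hslope
  have hlim : Tendsto (fun t : ℝ => a * (b - a) + t * (1 / 2 * (b - a) ^ 2)) (𝓝[>] 0)
      (𝓝 (a * (b - a))) := by
    have : Tendsto (fun t : ℝ => a * (b - a) + t * (1 / 2 * (b - a) ^ 2)) (𝓝 0)
        (𝓝 (a * (b - a) + 0 * (1 / 2 * (b - a) ^ 2))) := by
      exact (tendsto_id.mul_const _).const_add _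
    rw [zero_mul, add_zero] at this
    exact this.mono_left nhdsWithin_le_nhds
  -- By convexity of `m` along the segment, `m` is at most `(1 - t) * a + t * b`; half the square of
  -- this has derivative `a * (b - a)` at `t = 0`.
  have hle : fderiv ℝ D.M x ((1 : ℝ) • (y - x)) ≤ a * (b - a) := by
    refine le_of_tendsto_of_tendsto hslope hlim ?_
    filter_upwards [Ioo_mem_nhdsGT (show (0 : ℝ) < 1 by norm_num)] with t ht
    rw [slope_def_field]
    simp only [Function.comp_apply, id_eq, zero_smul, add_zero, sub_zero]
    rw [div_le_iff₀ ht.1]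
    have e : x + t • (y - x) = (1 - t) • x + t • y := by
      rw [smul_sub, sub_smul, one_smul]
      abel
    have h1 : D.m (x + t • (y - x)) ≤ (1 - t) * a + t * b := by
      rw [e]
      refine (map_add_le_add _ _ _).trans ?_
      rw [map_smul_eq_mul, map_smul_eq_mul, Real.norm_of_nonneg (by linarith [ht.2]),
        Real.norm_of_nonneg ht.1.le]
    have h2 := pow_le_pow_left₀ (apply_nonneg D.m _) h1 2
    rw [hMx]
    unfold AnalysisData.M
    nlinarith
  rw [one_smul] at hle
  refine hle.trans ?_
  rw [hMx]
  unfold AnalysisData.α₂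
  nlinarith [mul_le_mul_of_nonneg_left hab ha0]

end AnalysisData.Valid

/-! ### Robust TD with an unbiased estimator of a family of envelopes -/

namespace Sampler

variable {S A Ξ : Type*} [Fintype S] [Fintype A] [DecidableEq S] [DecidableEq A] [Fintype Ξ]

/-- The joint probability of the outcomes at all state-action pairs. -/
noncomputable def jointWeight (E : Sampler S A Ξ) : (S → A → Ξ) → ℝ :=
  prodWeight fun s => prodWeight (E.weight s)

/-- The weighted error of an estimate of `τ`. -/
def noise (I : RobustMDP S A) (E : Sampler S A Ξ) (τ : S → A → (S → ℝ) → ℝ) (ξ : S → A → Ξ)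
    (V : S → ℝ) (s : S) : ℝ :=
  ∑ a, I.policy s a * (E.est s a (ξ s a) V - τ s a V)

/-- `E` is an unbiased estimator of `τ` with error of relative size `G`. -/
structure IsUnbiased (E : Sampler S A Ξ) (I : RobustMDP S A) (τ : S → A → (S → ℝ) → ℝ)
    (G : ℝ) : Prop where
  weight_mem : ∀ s a, E.weight s a ∈ stdSimplex ℝ Ξ
  mean : ∀ s a V, ∑ ξ, E.weight s a ξ * E.est s a ξ V = τ s a V
  noise_le : ∀ V, ∑ ξ, E.jointWeight ξ * spanSeminorm (E.noise I τ ξ V) ^ 2 ≤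
    G * spanSeminorm V ^ 2

lemma jointWeight_mem {E : Sampler S A Ξ} (h : ∀ s a, E.weight s a ∈ stdSimplex ℝ Ξ) :
    E.jointWeight ∈ stdSimplex ℝ (S → A → Ξ) :=
  prodWeight_mem fun s => prodWeight_mem (h s)

lemma sum_jointWeight_apply {E : Sampler S A Ξ} (h : ∀ s a, E.weight s a ∈ stdSimplex ℝ Ξ) (s : S)
    (a : A) (f : Ξ → ℝ) : ∑ ξ, E.jointWeight ξ * f (ξ s a) = ∑ x, E.weight s a x * f x := by
  unfold jointWeight
  rw [sum_prodWeight_apply (fun s => (prodWeight_mem (h s)).2) s fun y => f (y a),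
    sum_prodWeight_apply (fun a => (h s a).2) a f]

lemma sum_jointWeight_noise {E : Sampler S A Ξ} {I : RobustMDP S A} {τ : S → A → (S → ℝ) → ℝ}
    (h : ∀ s a, E.weight s a ∈ stdSimplex ℝ Ξ)
    (hm : ∀ s a V, ∑ ξ, E.weight s a ξ * E.est s a ξ V = τ s a V) (V : S → ℝ) :
    ∑ ξ, E.jointWeight ξ • E.noise I τ ξ V = 0 := by
  funext s
  simp only [Finset.sum_apply, Pi.smul_apply, smul_eq_mul, Pi.zero_apply, noise, Finset.mul_sum]
  rw [Finset.sum_comm]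
  refine Finset.sum_eq_zero fun a _ => ?_
  have h1 := sum_jointWeight_apply h s a fun x => I.policy s a * (E.est s a x V - τ s a V)
  rw [h1]
  have h2 := hm s a V
  have h3 := weighted_const (h s a) (τ s a V)
  have e : ∀ x, E.weight s a x * (I.policy s a * (E.est s a x V - τ s a V)) =
    I.policy s a * (E.weight s a x * E.est s a x V - E.weight s a x * τ s a V) := fun x => by ring
  simp_rw [e]
  rw [← Finset.mul_sum, Finset.sum_sub_distrib, h2, h3, sub_self, mul_zero]

end Sampler

namespace RobustTD

variable {S A Ξ : Type*} [Fintype S] [Fintype A] [DecidableEq S] [DecidableEq A] [Fintype Ξ]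
  {I : RobustMDP S A} {E : Sampler S A Ξ}

lemma noisyBellman_eq (τ : S → A → (S → ℝ) → ℝ) (g : ℝ) (ξ : S → A → Ξ) (V : S → ℝ) (s : S) :
    noisyBellman I E g ξ V s = I.envelopeBellman τ g V s + E.noise I τ ξ V s := by
  simp only [noisyBellman, RobustMDP.envelopeBellman, Sampler.noise, ← Finset.sum_add_distrib]
  refine Finset.sum_congr rfl fun a _ => by ring

/-- The mean square error depends on the first phase only. -/
lemma expectation_first (hE : ∀ s a, E.weight s a ∈ stdSimplex ℝ Ξ) (T : ℕ)
    (f : (Fin T → S → A → Ξ) → ℝ) :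
    expectation E T (fun ω => f ω.1) = ∑ ω, prodWeight (fun _ : Fin T => E.jointWeight) ω * f ω := by
  have e : ∀ ω : Run S A Ξ T, runWeight E ω = prodWeight (fun _ : Fin T => E.jointWeight) ω.1 *
      prodWeight (fun _ : Fin T => E.jointWeight) ω.2 := fun ω => by
    simp only [runWeight, prodWeight, Sampler.jointWeight, Finset.prod_mul_distrib]
  have h2 := (prodWeight_mem fun _ : Fin T => Sampler.jointWeight_mem hE).2
  unfold expectation
  simp_rw [e]
  rw [Fintype.sum_prod_type]
  refine Finset.sum_congr rfl fun x _ => ?_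
  have : ∀ y, prodWeight (fun _ : Fin T => E.jointWeight) x *
      prodWeight (fun _ : Fin T => E.jointWeight) y * f x =
      prodWeight (fun _ : Fin T => E.jointWeight) x * f x *
      prodWeight (fun _ : Fin T => E.jointWeight) y := fun y => by ring
  simp_rw [this]
  rw [← Finset.mul_sum, h2, mul_one]

variable {τ : S → A → (S → ℝ) → ℝ} {D : AnalysisData S} {G : ℝ}

/-- The Lyapunov function decreases in one step, up to the noise. -/
lemma sum_M_valueStep_le (h : I.Admissible) (hτ : I.IsEnvelopeFamily τ) (hD : D.Valid I)
    (hE : E.IsUnbiased I τ G) (hG : 1 ≤ G) {s₀ : S} {W : S → ℝ} {g : ℝ}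
    (hW : W = I.envelopeBellman τ g W) (η : ℝ) (hη : 0 ≤ η) (V : S → ℝ) :
    ∑ ξ, E.jointWeight ξ * D.M (valueStep I E s₀ η ξ V - W) ≤
      (1 - 2 * D.α₂ * η + 12 * D.κ ^ 2 * D.Λ * G * η ^ 2) * D.M (V - W) +
        2 * D.L * D.ρ ^ 2 * D.CP ^ 2 * G * spanSeminorm W ^ 2 * η ^ 2 := by
  have : Nonempty S := ⟨s₀⟩
  have hJ := Sampler.jointWeight_mem hE.weight_mem
  set x := V - W with hx
  set y := I.envelopeBellman τ g V - W with hy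
  have hyx : D.N y ≤ D.γ * D.N x := by
    have := RobustMDP.envelopeBellman_contraction h hτ hD g V W
    rwa [← hW] at this
  have hdrift := hD.fderiv_le hyx
  -- Up to constants, which `M` ignores, a step moves `x` towards the Bellman image `y` and adds
  -- noise. So neither the anchoring nor the choice `g₀ = 0` matters.
  have hform : ∀ ξ, D.M (valueStep I E s₀ η ξ V - W) =
      D.M (x + η • (y - x + E.noise I τ ξ V)) := by
    intro ξ
    rw [← hD.M_sub_const (x + η • (y - x + E.noise I τ ξ V))
      ((V s₀ + η * (noisyBellman I E 0 ξ V s₀ - V s₀)) - η * g)]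
    congr 1
    funext s
    simp only [valueStep, Pi.sub_apply, Pi.add_apply, Pi.smul_apply, smul_eq_mul, hx, hy,
      noisyBellman_eq τ, RobustMDP.envelopeBellman_eq h]
    ring
  set φ := fderiv ℝ D.M x with hφ
  have hρ := hD.ρ_pos
  have hL := hD.L_pos
  have hsq : ∀ w : S → ℝ, D.s (y - x + w) ^ 2 ≤
      D.ρ ^ 2 * (16 * D.cu * D.M x + 2 * D.CP ^ 2 * spanSeminorm w ^ 2) := by
    intro w
    have h1 : D.N (y - x + w) ≤ 2 * D.N x + D.N w := by
      have a1 := map_add_le_add D.N (y - x) w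
      have a2 := map_sub_le_add D.N y x
      have a3 : D.γ * D.N x ≤ 1 * D.N x :=
        mul_le_mul_of_nonneg_right hD.γ_mem.2.le (apply_nonneg _ _)
      linarith
    have h2 : D.s (y - x + w) ≤ D.ρ * (2 * D.N x + D.N w) :=
      (hD.s_le _).trans (mul_le_mul_of_nonneg_left h1 hρ.le)
    have h3 := pow_le_pow_left₀ (apply_nonneg D.s _) h2 2
    rw [mul_pow] at h3
    refine h3.trans (mul_le_mul_of_nonneg_left ?_ (sq_nonneg _))
    have h4 := hD.N_sq_le x
    have h5 := hD.N_sq_le_span w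
    nlinarith [sq_nonneg (2 * D.N x - D.N w)]
  have hpt : ∀ ξ, D.M (valueStep I E s₀ η ξ V - W) ≤
      D.M x + η * φ (y - x) + η * φ (E.noise I τ ξ V) + D.L / 2 * η ^ 2 * (D.ρ ^ 2 *
        (16 * D.cu * D.M x + 2 * D.CP ^ 2 * spanSeminorm (E.noise I τ ξ V) ^ 2)) := by
    intro ξ
    rw [hform]
    have h1 := hD.smooth x (x + η • (y - x + E.noise I τ ξ V))
    rw [add_sub_cancel_left, map_smul, map_add, map_smul_eq_mul, mul_pow, Real.norm_eq_abs, sq_abs,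
      smul_eq_mul] at h1
    have h2 := mul_le_mul_of_nonneg_left (hsq (E.noise I τ ξ V))
      (show 0 ≤ D.L / 2 * η ^ 2 by positivity)
    rw [← hφ] at h1
    linarith
  -- Unbiasedness removes the first-order noise term.
  have hzero : ∑ ξ, E.jointWeight ξ * φ (E.noise I τ ξ V) = 0 := by
    have := congrArg φ (Sampler.sum_jointWeight_noise (I := I) hE.weight_mem hE.mean V)
    rw [map_sum, map_zero] at this
    simpa [map_smul] using this
  refine (weighted_mono hJ hpt).trans ?_
  have hexp : ∑ ξ, E.jointWeight ξ * (D.M x + η * φ (y - x) + η * φ (E.noise I τ ξ V) +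
        D.L / 2 * η ^ 2 * (D.ρ ^ 2 *
        (16 * D.cu * D.M x + 2 * D.CP ^ 2 * spanSeminorm (E.noise I τ ξ V) ^ 2))) =
      D.M x + η * φ (y - x) + D.L / 2 * η ^ 2 * D.ρ ^ 2 * (16 * D.cu * D.M x) +
      η * (∑ ξ, E.jointWeight ξ * φ (E.noise I τ ξ V)) + D.L * η ^ 2 * D.ρ ^ 2 * D.CP ^ 2 *
        ∑ ξ, E.jointWeight ξ * spanSeminorm (E.noise I τ ξ V) ^ 2 := by
    rw [← weighted_const hJ (D.M x + η * φ (y - x) + D.L / 2 * η ^ 2 * D.ρ ^ 2 *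
      (16 * D.cu * D.M x)), Finset.mul_sum, Finset.mul_sum, ← Finset.sum_add_distrib,
      ← Finset.sum_add_distrib]
    refine Finset.sum_congr rfl fun ξ _ => by ring
  rw [hexp, hzero, mul_zero, add_zero]
  -- The noise scales with the span of the iterate, which has no a priori bound. Its part in `x = V
  -- - W` joins the drift coefficient at order `η ^ 2`; only the span of `W` remains as a source
  -- term.
  have hsV : spanSeminorm V ^ 2 ≤ 4 * D.cu * D.M x / D.cP ^ 2 + 2 * spanSeminorm W ^ 2 := by
    have h1 : spanSeminorm V ≤ spanSeminorm x + spanSeminorm W := by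
      have := spanSeminorm_add_le x W
      rwa [hx, sub_add_cancel] at this
    have h2 : spanSeminorm x ^ 2 ≤ 2 * D.cu * D.M x / D.cP ^ 2 :=
      (hD.span_sq_le x).trans (div_le_div_of_nonneg_right (hD.N_sq_le x) (sq_nonneg _))
    have h3 := pow_le_pow_left₀ (spanSeminorm_nonneg V) h1 2
    have e : 4 * D.cu * D.M x / D.cP ^ 2 = 2 * (2 * D.cu * D.M x / D.cP ^ 2) := by ring
    rw [e]
    nlinarith [sq_nonneg (spanSeminorm x - spanSeminorm W)]
  have hcP := hD.cP_pos
  have hnoise : D.L * η ^ 2 * D.ρ ^ 2 * D.CP ^ 2 *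
      ∑ ξ, E.jointWeight ξ * spanSeminorm (E.noise I τ ξ V) ^ 2 ≤ D.L * η ^ 2 * D.ρ ^ 2 * D.CP ^ 2 *
        (G * (4 * D.cu * D.M x / D.cP ^ 2 + 2 * spanSeminorm W ^ 2)) :=
    mul_le_mul_of_nonneg_left ((hE.noise_le V).trans
      (mul_le_mul_of_nonneg_left hsV (by linarith))) (by positivity)
  have e2 : D.L * η ^ 2 * D.ρ ^ 2 * D.CP ^ 2 *
        (G * (4 * D.cu * D.M x / D.cP ^ 2 + 2 * spanSeminorm W ^ 2)) =
      4 * D.κ ^ 2 * D.Λ * G * η ^ 2 * D.M x +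
        2 * D.L * D.ρ ^ 2 * D.CP ^ 2 * G * spanSeminorm W ^ 2 * η ^ 2 := by
    unfold AnalysisData.κ AnalysisData.Λ
    field_simp
  rw [e2] at hnoise
  have h8 : D.L / 2 * η ^ 2 * D.ρ ^ 2 * (16 * D.cu * D.M x) = 8 * D.Λ * η ^ 2 * D.M x := by
    unfold AnalysisData.Λ
    ring
  have hM := AnalysisData.Valid.M_nonneg D x
  have h9 : 8 * D.Λ * η ^ 2 * D.M x ≤ 8 * D.κ ^ 2 * D.Λ * G * η ^ 2 * D.M x := by
    have hk : 1 ≤ D.κ ^ 2 * G := one_le_mul_of_one_le_of_one_le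
      (one_le_pow₀ hD.one_le_κ) hG
    have hn : 0 ≤ 8 * D.Λ * η ^ 2 * D.M x := by
      have := hD.Λ_pos
      positivity
    nlinarith [mul_le_mul_of_nonneg_left hk hn]
  have h10 := mul_le_mul_of_nonneg_left hdrift hη
  rw [h8]
  linarith

lemma valueIter_apply_anchor {s₀ : S} {η : ℕ → ℝ} {V₀ : S → ℝ} {T : ℕ} (hT : T ≠ 0)
    (ω : Fin T → S → A → Ξ) : valueIter I E s₀ η V₀ T ω s₀ = 0 := by
  obtain ⟨T, rfl⟩ := Nat.exists_eq_succ_of_ne_zero hT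
  simp [valueIter, valueStep]

/-- The finite-time bound for unbiased estimators, around the fixed point of the mean operator. -/
lemma sum_sq_valueIter_le (h : I.Admissible) (hτ : I.IsEnvelopeFamily τ) (hD : D.Valid I)
    (hE : E.IsUnbiased I τ G) (hG : 1 ≤ G) {s₀ : S} {W : S → ℝ} {g : ℝ}
    (hW0 : W s₀ = 0) (hW : W = I.envelopeBellman τ g W) {K : ℝ} (hK3 : 3 ≤ K)
    (hK : 72 * D.κ ^ 2 * D.Λ * G / D.α₂ ^ 2 ≤ K) (V₀ : S → ℝ) {T : ℕ} (hT : T ≠ 0) :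
    ∑ ω, prodWeight (fun _ : Fin T => E.jointWeight) ω *
        ‖valueIter I E s₀ (stepSize D.α₂ K) V₀ T ω - W‖ ^ 2 ≤
      18 * (D.cu / D.cl) / D.cP ^ 2 * (K ^ 2 / (T + K) ^ 2) * D.N (V₀ - W) ^ 2 +
      72 * D.κ ^ 2 * D.Λ * G * spanSeminorm W ^ 2 / (D.α₂ ^ 2 * (T + K)) := by
  have hJ := Sampler.jointWeight_mem hE.weight_mem
  have hα := hD.α₂_pos
  have hL := hD.L_pos
  have hcP := hD.cP_pos
  have hcl := hD.cl_pos
  have hcu := hD.cu_pos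
  set a : ℕ → ℝ := fun t => ∑ ω, prodWeight (fun _ : Fin t => E.jointWeight) ω *
    D.M (valueIter I E s₀ (stepSize D.α₂ K) V₀ t ω - W) with ha
  have ha0 : ∀ t, 0 ≤ a t := fun t => weighted_nonneg (prodWeight_mem fun _ => hJ)
    fun ω => AnalysisData.Valid.M_nonneg D _
  set d : ℝ := 2 * D.L * D.ρ ^ 2 * D.CP ^ 2 * G * spanSeminorm W ^ 2 / D.α₂ ^ 2 with hd
  have hd0 : 0 ≤ d := by positivity
  have hrec : ∀ t : ℕ, a (t + 1) ≤
      (1 - 2 / (t + K) + K / (6 * (t + K) ^ 2)) * a t + d / (t + K) ^ 2 := by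
    intro t
    have ht : (0 : ℝ) ≤ t := Nat.cast_nonneg t
    set u : ℝ := t + K with hu
    have hu0 : 0 < u := by linarith
    set η := stepSize D.α₂ K t with hη
    have hηe : η = 1 / (D.α₂ * u) := rfl
    have hη0 : 0 ≤ η := by rw [hηe]; positivity
    have hstep : ∀ y : Fin t → S → A → Ξ, ∑ ξ, E.jointWeight ξ *
        D.M (valueIter I E s₀ (stepSize D.α₂ K) V₀ (t + 1)
          (Fin.snoc (α := fun _ => S → A → Ξ) y ξ) - W) ≤
        (1 - 2 / u + K / (6 * u ^ 2)) *
          D.M (valueIter I E s₀ (stepSize D.α₂ K) V₀ t y - W) + d / u ^ 2 := by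
      intro y
      simp only [valueIter, Fin.snoc_last, Fin.snoc_castSucc]
      refine (sum_M_valueStep_le h hτ hD hE hG hW η hη0 _).trans ?_
      have e1 : 2 * D.α₂ * η = 2 / u := by rw [hηe]; field_simp
      -- The threshold constant `72 = 6 * 12` fits the coefficient `K / (6 * u ^ 2)` of
      -- `recursion_bound`.
      have e2 : 12 * D.κ ^ 2 * D.Λ * G * η ^ 2 =
          72 * D.κ ^ 2 * D.Λ * G / D.α₂ ^ 2 / (6 * u ^ 2) := by
        rw [hηe]; field_simp; ring
      have e3 : 2 * D.L * D.ρ ^ 2 * D.CP ^ 2 * G * spanSeminorm W ^ 2 * η ^ 2 = d / u ^ 2 := by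
        rw [hηe, hd]; field_simp
      rw [e1, e2, e3]
      have h1 : 72 * D.κ ^ 2 * D.Λ * G / D.α₂ ^ 2 / (6 * u ^ 2) ≤ K / (6 * u ^ 2) := by gcongr
      have h2 := AnalysisData.Valid.M_nonneg D (valueIter I E s₀ (stepSize D.α₂ K) V₀ t y - W)
      nlinarith [mul_le_mul_of_nonneg_right h1 h2]
    simp only [ha]
    rw [sum_prodWeight_snoc]
    refine (weighted_mono (prodWeight_mem fun _ => hJ) hstep).trans (le_of_eq ?_)
    simp_rw [mul_add]
    rw [Finset.sum_add_distrib, weighted_const (prodWeight_mem fun _ : Fin t => hJ) (d / u ^ 2),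
      Finset.mul_sum]
    congr 1
    refine Finset.sum_congr rfl fun y _ => by ring
  have hmain := recursion_bound ha0 hK3 hd0 hrec T
  have hpt : ∀ ω : Fin T → S → A → Ξ,
      ‖valueIter I E s₀ (stepSize D.α₂ K) V₀ T ω - W‖ ^ 2 ≤
      2 * D.cu / D.cP ^ 2 * D.M (valueIter I E s₀ (stepSize D.α₂ K) V₀ T ω - W) := by
    intro ω
    set x := valueIter I E s₀ (stepSize D.α₂ K) V₀ T ω - W with hx
    -- After at least one step the iterate is anchored like `W`, so the span bounds the sup norm.
    -- The initial vector `V₀` need not be anchored, which is why `T ≠ 0` is required.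
    have hx0 : x s₀ = 0 := by
      rw [hx, Pi.sub_apply, hW0, valueIter_apply_anchor hT, sub_zero]
    refine (pow_le_pow_left₀ (norm_nonneg _) (norm_le_spanSeminorm hx0) 2).trans ?_
    refine (hD.span_sq_le x).trans ?_
    rw [div_mul_eq_mul_div]
    exact div_le_div_of_nonneg_right (hD.N_sq_le x) (sq_nonneg _)
  have ha00 : a 0 = D.M (V₀ - W) := by
    simp [ha, prodWeight, valueIter]
  have hM0 := hD.M_le (V₀ - W)
  rw [ha00] at hmain
  have hTK : (0 : ℝ) < T + K := by positivity
  calc _ ≤ ∑ ω, prodWeight (fun _ : Fin T => E.jointWeight) ω *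
        (2 * D.cu / D.cP ^ 2 * D.M (valueIter I E s₀ (stepSize D.α₂ K) V₀ T ω - W)) :=
        weighted_mono (prodWeight_mem fun _ => hJ) hpt
    _ = 2 * D.cu / D.cP ^ 2 * a T := by
        rw [ha, Finset.mul_sum]
        refine Finset.sum_congr rfl fun ω _ => by ring
    _ ≤ 2 * D.cu / D.cP ^ 2 * (18 * (K ^ 2 / (T + K) ^ 2 * (D.N (V₀ - W) ^ 2 / (2 * D.cl)) +
          d / (T + K))) := by
        refine mul_le_mul_of_nonneg_left (hmain.trans ?_) (by positivity)
        gcongr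
    _ = _ := by
        rw [hd]
        unfold AnalysisData.κ AnalysisData.Λ
        field_simp
        ring

end RobustTD

lemma sq_le_of_le_add {x a b : ℝ} (hx : 0 ≤ x) (h : x ≤ a + b) :
    x ^ 2 ≤ 2 * a ^ 2 + 2 * b ^ 2 := by
  nlinarith [sq_nonneg (a - b), pow_le_pow_left₀ hx h 2]

/-! ### From the mean fixed point to the robust value function -/

namespace RobustTD

variable {S A Ξ : Type*} [Fintype S] [Fintype A] [DecidableEq S] [DecidableEq A] [Fintype Ξ]
  {I : RobustMDP S A} {E : Sampler S A Ξ} {τ : S → A → (S → ℝ) → ℝ} {D : AnalysisData S} {G b : ℝ}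

/-- The distance of the fixed points of two envelope Bellman operators. -/
lemma N_fixedPoint_sub_le (h : I.Admissible) (hτ : I.IsEnvelopeFamily τ) (hD : D.Valid I)
    {V W : S → ℝ} {g g' : ℝ} (hV : V = I.bellman g V) (hW : W = I.envelopeBellman τ g' W)
    (hb : spanSeminorm (I.envelopeBellman τ 0 V - I.bellman 0 V) ≤ b) :
    D.N (W - V) ≤ D.CP * b / (1 - D.γ) := by
  have hγ := hD.γ_mem.2
  rw [le_div_iff₀ (by linarith)]
  -- Up to the constant `g' - g`, the difference of the fixed points is a contraction term plus the
  -- perturbation of the operator at `V`; the first goes to the left-hand side.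
  have e : W - V = fun s => ((I.envelopeBellman τ g' W - I.envelopeBellman τ g' V) +
      (I.envelopeBellman τ 0 V - I.bellman 0 V)) s - (g' - g) := by
    funext s
    have h1 := congrFun hW s
    have h2 := congrFun hV s
    have e1 : ∀ g, I.bellman g V s = I.envelopeBellman I.sigma g V s := fun _ => rfl
    simp only [Pi.sub_apply, Pi.add_apply, e1] at h2 ⊢
    rw [RobustMDP.envelopeBellman_eq h] at h1 h2
    simp only [RobustMDP.envelopeBellman_eq h]
    linarith
  have h1 : D.N (W - V) ≤ D.N (I.envelopeBellman τ g' W - I.envelopeBellman τ g' V) +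
      D.N (I.envelopeBellman τ 0 V - I.bellman 0 V) := by
    conv_lhs => rw [e, hD.sub_const]
    exact map_add_le_add _ _ _
  have h2 := RobustMDP.envelopeBellman_contraction h hτ hD g' W V
  have h3 := (hD.N_le (I.envelopeBellman τ 0 V - I.bellman 0 V)).trans
    (mul_le_mul_of_nonneg_left hb hD.CP_pos.le)
  linarith

set_option maxHeartbeats 400000 in
/-- The finite-time bound for unbiased estimators of perturbed support functions. -/
lemma meanSqError_le (h : I.Admissible) (hτ : I.IsEnvelopeFamily τ) (hD : D.Valid I)
    (hE : E.IsUnbiased I τ G) (hG : 1 ≤ G) {s₀ : S} {V : S → ℝ} (hV : I.IsAnchoredRobustValue s₀ V)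
    (hb : spanSeminorm (I.envelopeBellman τ 0 V - I.bellman 0 V) ≤ b) {K : ℝ} (hK3 : 3 ≤ K)
    (hK : 72 * D.κ ^ 2 * D.Λ * G / D.α₂ ^ 2 ≤ K) (β : ℕ → ℝ) (V₀ : S → ℝ) (T : ℕ) :
    meanSqError I E s₀ (stepSize D.α₂ K) β V₀ T V ≤
      D.κ ^ 2 * (288 * (D.cu / D.cl) * (K ^ 2 / (T + K) ^ 2) * ‖V₀ - V‖ ^ 2 +
        576 * D.Λ * G * I.tMix ^ 2 / (D.α₂ ^ 2 * (T + K)) +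
        74 * (D.cu / D.cl) * b ^ 2 / (1 - D.γ) ^ 2) := by
  have : Nonempty S := ⟨s₀⟩
  have hJ := Sampler.jointWeight_mem hE.weight_mem
  have hα := hD.α₂_pos
  have hL := hD.L_pos
  have hcP := hD.cP_pos
  have hcl := hD.cl_pos
  have hcu := hD.cu_pos
  have hΛ := hD.Λ_pos
  have hκ := hD.one_le_κ
  have hγ : 0 < 1 - D.γ := by linarith [hD.γ_mem.2]
  have hr1 : 1 ≤ D.cu / D.cl := (one_le_div hcl).2 hD.cl_le_cu
  have hTK : (0 : ℝ) < T + K := by positivity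
  unfold meanSqError
  simp only [output]
  rw [expectation_first hE.weight_mem T fun ω => ‖valueIter I E s₀ (stepSize D.α₂ K) V₀ T ω - V‖ ^ 2]
  have hb1 : 0 ≤ 576 * D.Λ * G * I.tMix ^ 2 / (D.α₂ ^ 2 * (T + K)) := by positivity
  have hb2 : 0 ≤ 74 * (D.cu / D.cl) * b ^ 2 / (1 - D.γ) ^ 2 := by positivity
  -- At `T = 0` the iterate is not anchored; the claim is trivial there since `κ` and `cu / cl` are
  -- at least one.
  rcases eq_or_ne T 0 with rfl | hT
  · simp only [valueIter]
    rw [weighted_const (prodWeight_mem fun _ => hJ)]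
    have hK0 : K ≠ 0 := by linarith
    have e : K ^ 2 / ((0 : ℕ) + K) ^ 2 = 1 := by
      rw [Nat.cast_zero, zero_add]
      field_simp
    rw [e, mul_one]
    have h1 : 1 ≤ D.κ ^ 2 * (D.cu / D.cl) := one_le_mul_of_one_le_of_one_le (one_le_pow₀ hκ) hr1
    have h2 := mul_le_mul_of_nonneg_right h1 (sq_nonneg ‖V₀ - V‖)
    have h3 : 0 ≤ D.κ ^ 2 * (576 * D.Λ * G * I.tMix ^ 2 / (D.α₂ ^ 2 * ((0 : ℕ) + K)) +
        74 * (D.cu / D.cl) * b ^ 2 / (1 - D.γ) ^ 2) :=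
      mul_nonneg (by positivity) (add_nonneg hb1 hb2)
    rw [one_mul] at h2
    have h4 : 0 ≤ D.κ ^ 2 * (D.cu / D.cl) * ‖V₀ - V‖ ^ 2 := by positivity
    linarith only [h2, h3, h4]
  -- The iterates converge to the fixed point `W` of the mean operator. It also solves the Poisson
  -- equation of a kernel in the uncertainty set, so its span is at most `2 * tMix`; its distance to
  -- `V` is the bias term.
  obtain ⟨W, g', hW0, hW⟩ := RobustMDP.exists_envelope_fixedPoint h hτ s₀
  obtain ⟨g, -, hVfix⟩ := RobustMDP.fixedPoint_of_isAnchoredRobustValue h hV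
  obtain ⟨P, hP, -, hPW⟩ := RobustMDP.exists_poisson h hτ hW
  have hWspan := RobustMDP.spanSeminorm_le_tMix h hP hPW
  have hNWV := N_fixedPoint_sub_le h hτ hD hVfix hW hb
  have hV0 : V s₀ = 0 := hV.1
  have hmain := sum_sq_valueIter_le h hτ hD hE hG hW0 hW hK3 hK V₀ hT
  set y := D.N (W - V) with hy
  have hy0 : 0 ≤ y := apply_nonneg _ _
  have hysq : y ^ 2 ≤ D.CP ^ 2 * b ^ 2 / (1 - D.γ) ^ 2 := by
    refine (pow_le_pow_left₀ hy0 hNWV 2).trans (le_of_eq ?_)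
    rw [div_pow, mul_pow]
  have hnWV : ‖W - V‖ ^ 2 ≤ y ^ 2 / D.cP ^ 2 := by
    refine (pow_le_pow_left₀ (norm_nonneg _) (norm_le_spanSeminorm (s₀ := s₀) ?_) 2).trans
      (hD.span_sq_le _)
    rw [Pi.sub_apply, hW0, hV0, sub_zero]
  have hpt : ∀ ω : Fin T → S → A → Ξ, ‖valueIter I E s₀ (stepSize D.α₂ K) V₀ T ω - V‖ ^ 2 ≤
      2 * ‖valueIter I E s₀ (stepSize D.α₂ K) V₀ T ω - W‖ ^ 2 + 2 * (y ^ 2 / D.cP ^ 2) := by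
    intro ω
    have h1 := norm_add_le (valueIter I E s₀ (stepSize D.α₂ K) V₀ T ω - W) (W - V)
    rw [sub_add_sub_cancel] at h1
    have h2 := sq_le_of_le_add (norm_nonneg _) h1
    linarith only [h2, hnWV]
  refine (weighted_mono (prodWeight_mem fun _ => hJ) hpt).trans ?_
  have e1 : ∑ ω : Fin T → S → A → Ξ, prodWeight (fun _ : Fin T => E.jointWeight) ω *
      (2 * ‖valueIter I E s₀ (stepSize D.α₂ K) V₀ T ω - W‖ ^ 2 + 2 * (y ^ 2 / D.cP ^ 2)) =
      2 * ∑ ω, prodWeight (fun _ : Fin T => E.jointWeight) ω *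
        ‖valueIter I E s₀ (stepSize D.α₂ K) V₀ T ω - W‖ ^ 2 + 2 * (y ^ 2 / D.cP ^ 2) := by
    conv_rhs => rw [← weighted_const (prodWeight_mem fun _ : Fin T => hJ) (2 * (y ^ 2 / D.cP ^ 2)),
      Finset.mul_sum, ← Finset.sum_add_distrib]
    refine Finset.sum_congr rfl fun ω _ => by ring
  rw [e1]
  have hN0 : D.N (V₀ - W) ^ 2 ≤ 8 * D.CP ^ 2 * ‖V₀ - V‖ ^ 2 + 2 * y ^ 2 := by
    have h1 : D.N (V₀ - W) ≤ D.N (V₀ - V) + y := by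
      have := map_sub_le_add D.N (V₀ - V) (W - V)
      rwa [sub_sub_sub_cancel_right] at this
    have h2 := sq_le_of_le_add (apply_nonneg D.N _) h1
    have h3 := hD.N_sq_le_span (V₀ - V)
    have h4 := pow_le_pow_left₀ (spanSeminorm_nonneg _) (spanSeminorm_le_two_norm (V₀ - V)) 2
    have h5 := mul_le_mul_of_nonneg_left h4 (sq_nonneg D.CP)
    linarith only [h2, h3, h5]
  have hK1 : K ^ 2 / (T + K) ^ 2 ≤ 1 := by
    rw [div_le_one (by positivity)]
    exact pow_le_pow_left₀ (by linarith) (by linarith [Nat.cast_nonneg (α := ℝ) T]) 2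
  have hWsq := pow_le_pow_left₀ (spanSeminorm_nonneg _) hWspan 2
  have hcoef : 0 ≤ 18 * (D.cu / D.cl) / D.cP ^ 2 * (K ^ 2 / (T + K) ^ 2) := by positivity
  have a1 := mul_le_mul_of_nonneg_left hN0 hcoef
  have a2 : 18 * (D.cu / D.cl) / D.cP ^ 2 * (K ^ 2 / (T + K) ^ 2) * (2 * y ^ 2) ≤
      36 * (D.cu / D.cl) * (y ^ 2 / D.cP ^ 2) := by
    calc _ = 36 * (D.cu / D.cl) * (y ^ 2 / D.cP ^ 2) * (K ^ 2 / (T + K) ^ 2) := by ring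
      _ ≤ _ := mul_le_of_le_one_right (by positivity) hK1
  have a3 : 2 * (y ^ 2 / D.cP ^ 2) ≤ 2 * (D.cu / D.cl) * (y ^ 2 / D.cP ^ 2) := by
    refine mul_le_mul_of_nonneg_right ?_ (by positivity)
    linarith only [hr1]
  have a4 : 74 * (D.cu / D.cl) * (y ^ 2 / D.cP ^ 2) ≤
      D.κ ^ 2 * (74 * (D.cu / D.cl) * b ^ 2 / (1 - D.γ) ^ 2) := by
    calc _ ≤ 74 * (D.cu / D.cl) * (D.CP ^ 2 * b ^ 2 / (1 - D.γ) ^ 2 / D.cP ^ 2) := by gcongr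
      _ = _ := by
        unfold AnalysisData.κ
        field_simp
  have a5 : 72 * D.κ ^ 2 * D.Λ * G * spanSeminorm W ^ 2 / (D.α₂ ^ 2 * (T + K)) ≤
      72 * D.κ ^ 2 * D.Λ * G * (2 * I.tMix) ^ 2 / (D.α₂ ^ 2 * (T + K)) := by gcongr
  have e2 : 72 * D.κ ^ 2 * D.Λ * G * (2 * I.tMix) ^ 2 / (D.α₂ ^ 2 * (T + K)) =
      1 / 2 * (D.κ ^ 2 * (576 * D.Λ * G * I.tMix ^ 2 / (D.α₂ ^ 2 * (T + K)))) := by ring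
  have e3 : 18 * (D.cu / D.cl) / D.cP ^ 2 * (K ^ 2 / (T + K) ^ 2) *
      (8 * D.CP ^ 2 * ‖V₀ - V‖ ^ 2) =
      1 / 2 * (D.κ ^ 2 * (288 * (D.cu / D.cl) * (K ^ 2 / (T + K) ^ 2) * ‖V₀ - V‖ ^ 2)) := by
    unfold AnalysisData.κ
    field_simp
    ring
  rw [mul_add, e3] at a1
  rw [e2] at a5
  linarith only [hmain, a1, a2, a3, a4, a5]

end RobustTD

/-! ### The estimator for contamination sets -/

lemma contamination_support_eq {S : Type*} [Fintype S] [Nonempty S] {δ : ℝ} (h0 : 0 ≤ δ)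
    (h1 : δ < 1) {p : S → ℝ} (hp : p ∈ stdSimplex ℝ S) (V : S → ℝ) :
    (UncertaintySet.contamination δ).support p V = (1 - δ) * (p ⬝ᵥ V) + δ * ⨅ x, V x := by
  classical
  have hU : (UncertaintySet.contamination δ : UncertaintySet S).Proper := ⟨h0, h1⟩
  have hform : ∀ q' : S → ℝ, ((1 - δ) • p + δ • q') ⬝ᵥ V = (1 - δ) * (p ⬝ᵥ V) + δ * (q' ⬝ᵥ V) :=
    fun q' => by rw [add_dotProduct, smul_dotProduct, smul_dotProduct]; rfl
  refine le_antisymm ?_ ?_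
  · obtain ⟨x, hx⟩ := exists_eq_ciInf_of_finite (f := V)
    have := UncertaintySet.support_le hU hp ⟨_, single_mem_stdSimplex ℝ x, rfl⟩ V
    rwa [hform, single_dotProduct, one_mul, hx] at this
  · obtain ⟨q, ⟨q', hq', rfl⟩, e⟩ := UncertaintySet.exists_support_eq hU hp V
    rw [← e, hform]
    have : ⨅ x, V x ≤ q' ⬝ᵥ V := by
      rw [← weighted_const hq' (⨅ x, V x)]
      exact weighted_mono hq' fun x => iInf_finite_le V x
    have := mul_le_mul_of_nonneg_left this h0
    linarith

section Samplers

variable {S A : Type*} [Fintype S] [Fintype A] [DecidableEq S] [DecidableEq A] {I : RobustMDP S A}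

/-- The estimate is affine in the indicator of the sample, hence unbiased. Every coordinate of the
noise is at most the span of `V`, so the span of the noise is at most twice that, and `4 = 2 ^ 2`.
-/
lemma contaminationSampler_isUnbiased [Nonempty S] (h : I.Admissible) {δ : ℝ}
    (hU : I.unc = UncertaintySet.contamination δ) :
    (contaminationSampler I δ).IsUnbiased I I.sigma 4 := by
  have hP := h.proper
  rw [hU] at hP
  obtain ⟨h0, h1⟩ : 0 ≤ δ ∧ δ < 1 := hP
  have hσ : ∀ s a V, I.sigma s a V = (1 - δ) * (I.nominal s a ⬝ᵥ V) + δ * ⨅ x, V x := by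
    intro s a V
    unfold RobustMDP.sigma
    rw [hU, contamination_support_eq h0 h1 (h.nominal_mem s a)]
  have hw : ∀ s a, (contaminationSampler I δ).weight s a ∈ stdSimplex ℝ S := h.nominal_mem
  refine ⟨hw, fun s a V => ?_, fun V => ?_⟩
  · rw [hσ]
    simp only [contaminationSampler, mul_add, Finset.sum_add_distrib]
    rw [weighted_const (h.nominal_mem s a), dotProduct, Finset.mul_sum]
    congr 1
    refine Finset.sum_congr rfl fun x _ => by ring
  · have hJ := Sampler.jointWeight_mem hw
    have hb : ∀ ξ s, |(contaminationSampler I δ).noise I I.sigma ξ V s| ≤ spanSeminorm V := by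
      intro ξ s
      have hsp := spanSeminorm_nonneg V
      have hab : ∀ a, |(contaminationSampler I δ).est s a (ξ s a) V - I.sigma s a V| ≤
          spanSeminorm V := fun a => by
        rw [hσ]
        have e : (contaminationSampler I δ).est s a (ξ s a) V -
            ((1 - δ) * (I.nominal s a ⬝ᵥ V) + δ * ⨅ x, V x) =
            (1 - δ) * ∑ x, I.nominal s a x * (V (ξ s a) - V x) := by
          simp only [contaminationSampler, mul_sub, Finset.sum_sub_distrib]
          rw [weighted_const (h.nominal_mem s a), dotProduct]
          ring
        rw [e, abs_mul, abs_of_nonneg (by linarith : 0 ≤ 1 - δ)]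
        have h2 : |∑ x, I.nominal s a x * (V (ξ s a) - V x)| ≤ spanSeminorm V := by
          refine abs_le.2 ⟨?_, ?_⟩
          · rw [← weighted_const (h.nominal_mem s a) (-spanSeminorm V)]
            exact weighted_mono (h.nominal_mem s a) fun x => (abs_le.1 (abs_sub_le_spanSeminorm V _ _)).1
          · rw [← weighted_const (h.nominal_mem s a) (spanSeminorm V)]
            exact weighted_mono (h.nominal_mem s a) fun x => (abs_le.1 (abs_sub_le_spanSeminorm V _ _)).2
        have h3 := abs_nonneg (∑ x, I.nominal s a x * (V (ξ s a) - V x))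
        nlinarith
      unfold Sampler.noise
      refine abs_le.2 ⟨?_, ?_⟩
      · rw [← weighted_const (h.policy_mem s) (-spanSeminorm V)]
        exact weighted_mono (h.policy_mem s) fun a => (abs_le.1 (hab a)).1
      · rw [← weighted_const (h.policy_mem s) (spanSeminorm V)]
        exact weighted_mono (h.policy_mem s) fun a => (abs_le.1 (hab a)).2
    rw [← weighted_const hJ (4 * spanSeminorm V ^ 2)]
    refine weighted_mono hJ fun ξ => ?_
    have h2 : spanSeminorm ((contaminationSampler I δ).noise I I.sigma ξ V) ≤ 2 * spanSeminorm V :=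
      spanSeminorm_le fun s t => by
        have := (abs_le.1 (hb ξ s)).2
        have := (abs_le.1 (hb ξ t)).1
        linarith
    refine (pow_le_pow_left₀ (spanSeminorm_nonneg _) h2 2).trans (le_of_eq (by ring))

end Samplers

/-! ### The truncated multilevel Monte Carlo estimator -/

lemma levelProb_pos (N n : ℕ) : 0 < levelProb N n := by
  unfold levelProb
  positivity

lemma inv_levelProb_le {N n : ℕ} (hn : n ≤ N) : (levelProb N n)⁻¹ ≤ 2 ^ (n + 1) := by
  rcases hn.lt_or_eq with h | rfl
  · simp [levelProb, h]
  · simp only [levelProb, lt_irrefl, if_false, one_div, inv_pow, inv_inv]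
    exact pow_le_pow_right₀ (by norm_num) (Nat.le_succ _)

lemma sum_levelProb (N : ℕ) : ∑ n : Fin (N + 1), levelProb N n = 1 := by
  have h : ∀ N : ℕ, ∑ n ∈ Finset.range N, (1 / 2 : ℝ) ^ (n + 1) + (1 / 2) ^ N = 1 := by
    intro N
    induction N with
    | zero => simp
    | succ N ih =>
      rw [Finset.sum_range_succ, pow_succ]
      linarith
  rw [Fin.sum_univ_eq_sum_range (levelProb N), Finset.sum_range_succ, ← h N]
  congr 1
  · refine Finset.sum_congr rfl fun n hn => ?_
    simp [levelProb, Finset.mem_range.1 hn]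
  · simp [levelProb]

section MLMC

variable {S A : Type*} [Fintype S] [Fintype A] [DecidableEq S] [DecidableEq A] {I : RobustMDP S A}

/-- The mean of the support function at the empirical distribution of `k` samples. -/
noncomputable def empiricalSupport (U : UncertaintySet S) (k : ℕ) (p V : S → ℝ) : ℝ :=
  ∑ x : Fin k → S, prodWeight (fun _ => p) x * U.support (empirical x) V

lemma sum_mlmc (N : ℕ) (s : S) (a : A) (f : MLMCDraw S N → ℝ) :
    ∑ ξ, (mlmcSampler I N).weight s a ξ * f ξ = ∑ n : Fin (N + 1), levelProb N n *
      ∑ x : Fin (2 ^ ((n : ℕ) + 1)) → S, prodWeight (fun _ => I.nominal s a) x * f ⟨n, x⟩ := by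
  rw [Fintype.sum_sigma]
  refine Finset.sum_congr rfl fun n _ => ?_
  rw [Finset.mul_sum]
  refine Finset.sum_congr rfl fun x _ => ?_
  simp only [mlmcSampler, prodWeight]
  ring

lemma mlmcSampler_weight_mem (h : I.Admissible) (N : ℕ) (s : S) (a : A) :
    (mlmcSampler I N).weight s a ∈ stdSimplex ℝ (MLMCDraw S N) := by
  refine ⟨fun ξ => mul_nonneg (levelProb_pos _ _).le
    (Finset.prod_nonneg fun i _ => (h.nominal_mem s a).1 _), ?_⟩
  have h1 := sum_mlmc (I := I) N s a fun _ => 1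
  have h2 : ∀ n : ℕ, ∑ x : Fin (2 ^ (n + 1)) → S, prodWeight (fun _ => I.nominal s a) x = 1 :=
    fun n => (prodWeight_mem fun _ => h.nominal_mem s a).2
  simp only [mul_one, h2, sum_levelProb] at h1
  exact h1

lemma sum_prodWeight_first {p : S → ℝ} (hp : p ∈ stdSimplex ℝ S) {N : ℕ} (n : Fin (N + 1))
    (f : (Fin 1 → S) → ℝ) :
    ∑ x : Fin (2 ^ ((n : ℕ) + 1)) → S, prodWeight (fun _ => p) x *
      f (MLMCDraw.first (⟨n, x⟩ : MLMCDraw S N)) =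
    ∑ y : Fin 1 → S, prodWeight (fun _ => p) y * f y :=
  sum_prodWeight_comp (fun _ => hp.2) (e := fun _ : Fin 1 => (⟨0, by positivity⟩ : Fin _))
    (fun _ _ _ => Subsingleton.elim _ _) f

lemma sum_prodWeight_odd {p : S → ℝ} (hp : p ∈ stdSimplex ℝ S) {N : ℕ} (n : Fin (N + 1))
    (f : (Fin (2 ^ (n : ℕ)) → S) → ℝ) :
    ∑ x : Fin (2 ^ ((n : ℕ) + 1)) → S, prodWeight (fun _ => p) x *
      f (MLMCDraw.odd (⟨n, x⟩ : MLMCDraw S N)) =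
    ∑ y : Fin (2 ^ (n : ℕ)) → S, prodWeight (fun _ => p) y * f y :=
  sum_prodWeight_comp (fun _ => hp.2)
    (e := fun i : Fin (2 ^ (n : ℕ)) => (⟨2 * i, by have := i.2; rw [pow_succ]; omega⟩ :
      Fin (2 ^ ((n : ℕ) + 1))))
    (fun i j hij => by have := congrArg Fin.val hij; ext; simpa using this) f

lemma sum_prodWeight_even {p : S → ℝ} (hp : p ∈ stdSimplex ℝ S) {N : ℕ} (n : Fin (N + 1))
    (f : (Fin (2 ^ (n : ℕ)) → S) → ℝ) :
    ∑ x : Fin (2 ^ ((n : ℕ) + 1)) → S, prodWeight (fun _ => p) x *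
      f (MLMCDraw.even (⟨n, x⟩ : MLMCDraw S N)) =
    ∑ y : Fin (2 ^ (n : ℕ)) → S, prodWeight (fun _ => p) y * f y :=
  sum_prodWeight_comp (fun _ => hp.2)
    (e := fun i : Fin (2 ^ (n : ℕ)) => (⟨2 * i + 1, by have := i.2; rw [pow_succ]; omega⟩ :
      Fin (2 ^ ((n : ℕ) + 1))))
    (fun i j hij => by have := congrArg Fin.val hij; ext; simpa using this) f

/-- The estimator is unbiased for the support function at the finest empirical distribution. -/
lemma mlmc_mean (h : I.Admissible) (N : ℕ) (s : S) (a : A) (V : S → ℝ) :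
    ∑ ξ, (mlmcSampler I N).weight s a ξ * (mlmcSampler I N).est s a ξ V =
      empiricalSupport I.unc (2 ^ (N + 1)) (I.nominal s a) V := by
  set p := I.nominal s a with hp
  have hpm : p ∈ stdSimplex ℝ S := h.nominal_mem s a
  rw [sum_mlmc]
  set m : ℕ → ℝ := fun k => empiricalSupport I.unc k p V with hm
  -- Dividing by the level probability cancels its weight, and both half samples have mean `m (2 ^
  -- n)`. The corrections therefore telescope from `m 1` to `m (2 ^ (N + 1))`.
  have hlev : ∀ n : Fin (N + 1), levelProb N n * ∑ x : Fin (2 ^ ((n : ℕ) + 1)) → S,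
      prodWeight (fun _ => I.nominal s a) x * (mlmcSampler I N).est s a ⟨n, x⟩ V =
      levelProb N n * m 1 + (m (2 ^ ((n : ℕ) + 1)) - m (2 ^ (n : ℕ))) := by
    intro n
    have h1 := sum_prodWeight_first hpm n fun y => I.unc.support (empirical y) V
    have h2 := sum_prodWeight_odd hpm n fun y => I.unc.support (empirical y) V
    have h3 := sum_prodWeight_even hpm n fun y => I.unc.support (empirical y) V
    have hl := (levelProb_pos N n).ne'
    have e : ∑ x : Fin (2 ^ ((n : ℕ) + 1)) → S,
        prodWeight (fun _ => I.nominal s a) x * (mlmcSampler I N).est s a ⟨n, x⟩ V =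
        m 1 + (m (2 ^ ((n : ℕ) + 1)) - 1 / 2 * (m (2 ^ (n : ℕ)) + m (2 ^ (n : ℕ)))) /
          levelProb N n := by
      have e1 : ∀ x : Fin (2 ^ ((n : ℕ) + 1)) → S,
          prodWeight (fun _ => p) x * (mlmcSampler I N).est s a ⟨n, x⟩ V =
          prodWeight (fun _ => p) x *
            I.unc.support (empirical (MLMCDraw.first (⟨n, x⟩ : MLMCDraw S N))) V +
          (prodWeight (fun _ => p) x * I.unc.support (empirical x) V - 1 / 2 *
            (prodWeight (fun _ => p) x *
              I.unc.support (empirical (MLMCDraw.even (⟨n, x⟩ : MLMCDraw S N))) V +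
            prodWeight (fun _ => p) x *
              I.unc.support (empirical (MLMCDraw.odd (⟨n, x⟩ : MLMCDraw S N))) V)) /
            levelProb N n := fun x => by
        simp only [mlmcSampler]
        ring
      rw [Finset.sum_congr rfl fun x _ => e1 x, Finset.sum_add_distrib, ← Finset.sum_div,
        Finset.sum_sub_distrib, ← Finset.mul_sum, Finset.sum_add_distrib, h1, h2, h3]
      rfl
    rw [e]
    field_simp
    ring
  rw [Finset.sum_congr rfl fun n _ => hlev n, Finset.sum_add_distrib, ← Finset.sum_mul,
    sum_levelProb, one_mul, Fin.sum_univ_eq_sum_range (fun n => m (2 ^ (n + 1)) - m (2 ^ n)),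
    Finset.sum_range_sub (fun n => m (2 ^ n)), pow_zero]
  simp only [hm]
  ring


/-- This keeps the biased estimator within the theory: its mean operator obeys the same contraction
as the robust Bellman operator, without any error term. -/
lemma mlmc_isEnvelopeFamily (h : I.Admissible) (hU : I.unc.IsTVOrWasserstein) {k : ℕ} (hk : k ≠ 0) :
    I.IsEnvelopeFamily fun s a V => empiricalSupport I.unc k (I.nominal s a) V := by
  intro s a V
  obtain ⟨c, r, -, hc, hr, hb⟩ := h.proper.exists_transportBall hU
  have hp := h.nominal_mem s a
  obtain ⟨q, hq, h1, h2⟩ := exists_transportSupport_empirical hc hr hk hp V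
  have e : ∀ V, empiricalSupport I.unc k (I.nominal s a) V =
      ∑ x : Fin k → S, prodWeight (fun _ => I.nominal s a) x *
        transportSupport c r (empirical x) V := fun V => by
    refine Finset.sum_congr rfl fun x _ => ?_
    unfold UncertaintySet.support transportSupport
    rw [hb _ (empirical_mem hk x)]
  refine ⟨q, by rwa [hb _ hp], ?_, fun V' => ?_⟩
  · exact (e V).trans h1
  · exact (e V').le.trans (h2 V')

lemma empiricalSupport_bias (h : I.Admissible) (hU : I.unc.IsTVOrWasserstein) {k : ℕ} (hk : k ≠ 0)
    (s : S) (a : A) (V : S → ℝ) :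
    empiricalSupport I.unc k (I.nominal s a) V ≤ I.sigma s a V + 5 * spanSeminorm V / √k := by
  obtain ⟨c, r, hc0, hc, hr, hb⟩ := h.proper.exists_transportBall hU
  have hp := h.nominal_mem s a
  have h1 := transportSupport_empirical_bias hc0 hc hr hk hp V
  have e : ∀ q ∈ stdSimplex ℝ S, I.unc.support q V = transportSupport c r q V := fun q hq => by
    unfold UncertaintySet.support transportSupport
    rw [hb _ hq]
  unfold empiricalSupport RobustMDP.sigma
  rw [e _ hp, Finset.sum_congr rfl fun x _ => by rw [e _ (empirical_mem hk x)]]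
  exact h1

/-- The perturbation lies between zero and the bias in every state, being nonnegative by the
envelope property; so the span needs no factor two. -/
lemma spanSeminorm_empiricalSupport_sub_le [Nonempty S] (h : I.Admissible)
    (hU : I.unc.IsTVOrWasserstein) {k : ℕ} (hk : k ≠ 0) (V : S → ℝ) :
    spanSeminorm (I.envelopeBellman (fun s a V => empiricalSupport I.unc k (I.nominal s a) V) 0 V -
      I.bellman 0 V) ≤ 5 * spanSeminorm V / √k := by
  have hlow : ∀ s a, I.sigma s a V ≤ empiricalSupport I.unc k (I.nominal s a) V := fun s a => by
    obtain ⟨q, hq, h1, -⟩ := mlmc_isEnvelopeFamily h hU hk s a V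
    simp only at h1
    rw [h1]
    exact UncertaintySet.support_le h.proper (h.nominal_mem s a) hq V
  have hup := fun s a => empiricalSupport_bias h hU hk s a V
  have e : ∀ s, (I.envelopeBellman (fun s a V => empiricalSupport I.unc k (I.nominal s a) V) 0 V -
      I.bellman 0 V) s = ∑ a, I.policy s a *
        (empiricalSupport I.unc k (I.nominal s a) V - I.sigma s a V) := fun s => by
    rw [Pi.sub_apply, RobustMDP.envelopeBellman, RobustMDP.bellman, ← Finset.sum_sub_distrib]
    refine Finset.sum_congr rfl fun a _ => by ring
  refine spanSeminorm_le fun s t => ?_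
  rw [e, e]
  have h1 : ∑ a, I.policy s a * (empiricalSupport I.unc k (I.nominal s a) V - I.sigma s a V) ≤
      5 * spanSeminorm V / √k := by
    rw [← weighted_const (h.policy_mem s) (5 * spanSeminorm V / √k)]
    exact weighted_mono (h.policy_mem s) fun a => by linarith [hup s a]
  have h2 : 0 ≤ ∑ a, I.policy t a *
      (empiricalSupport I.unc k (I.nominal t a) V - I.sigma t a V) :=
    weighted_nonneg (h.policy_mem t) fun a => sub_nonneg.2 (hlow t a)
  linarith

lemma support_empirical_mse (h : I.Admissible) (hU : I.unc.IsTVOrWasserstein) {k : ℕ} (hk : k ≠ 0)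
    (s : S) (a : A) (V : S → ℝ) :
    ∑ x : Fin k → S, prodWeight (fun _ => I.nominal s a) x *
      (I.unc.support (empirical x) V - I.sigma s a V) ^ 2 ≤ 26 * spanSeminorm V ^ 2 / k := by
  obtain ⟨c, r, hc0, hc, hr, hb⟩ := h.proper.exists_transportBall hU
  have hp := h.nominal_mem s a
  have h1 := transportSupport_empirical_mse hc0 hc hr hk hp V
  have e : ∀ q ∈ stdSimplex ℝ S, I.unc.support q V = transportSupport c r q V := fun q hq => by
    unfold UncertaintySet.support transportSupport
    rw [hb _ hq]
  unfold RobustMDP.sigma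
  rw [e _ hp, Finset.sum_congr rfl fun x _ => by rw [e _ (empirical_mem hk x)]]
  exact h1

/-- The mean square error of the estimator grows linearly with the truncation level. -/
lemma mlmc_mse (h : I.Admissible) (hU : I.unc.IsTVOrWasserstein) (N : ℕ) (s : S) (a : A)
    (V : S → ℝ) :
    ∑ ξ, (mlmcSampler I N).weight s a ξ * ((mlmcSampler I N).est s a ξ V - I.sigma s a V) ^ 2 ≤
      364 * (N + 1) * spanSeminorm V ^ 2 := by
  set p := I.nominal s a with hp
  have hpm : p ∈ stdSimplex ℝ S := h.nominal_mem s a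
  set σ := I.sigma s a V with hσ
  set B := 26 * spanSeminorm V ^ 2 with hB
  have hB0 : 0 ≤ B := by positivity
  rw [sum_mlmc]
  -- At level `n` the squared correction is of order `B / 2 ^ n`; division by the level probability,
  -- at least `2 ^ -(n + 1)`, leaves at most `12 * B` per level. In total `364 = 14 * 26`.
  have hlev : ∀ n : Fin (N + 1), levelProb N n * ∑ x : Fin (2 ^ ((n : ℕ) + 1)) → S,
      prodWeight (fun _ => I.nominal s a) x * ((mlmcSampler I N).est s a ⟨n, x⟩ V - σ) ^ 2 ≤
      levelProb N n * (2 * B) + 12 * B := by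
    intro n
    set l := levelProb N n with hl
    have hl0 : 0 < l := levelProb_pos N n
    have h1 := sum_prodWeight_first hpm n fun y => (I.unc.support (empirical y) V - σ) ^ 2
    have h2 := sum_prodWeight_odd hpm n fun y => (I.unc.support (empirical y) V - σ) ^ 2
    have h3 := sum_prodWeight_even hpm n fun y => (I.unc.support (empirical y) V - σ) ^ 2
    have m1 := support_empirical_mse h hU one_ne_zero s a V
    have m2 := support_empirical_mse h hU (pow_ne_zero (n : ℕ) two_ne_zero) s a V
    have m3 := support_empirical_mse h hU (pow_ne_zero ((n : ℕ) + 1) two_ne_zero) s a V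
    have hpt : ∀ x : Fin (2 ^ ((n : ℕ) + 1)) → S,
        prodWeight (fun _ => p) x * ((mlmcSampler I N).est s a ⟨n, x⟩ V - σ) ^ 2 ≤
        2 * (prodWeight (fun _ => p) x *
          (I.unc.support (empirical (MLMCDraw.first (⟨n, x⟩ : MLMCDraw S N))) V - σ) ^ 2) +
        2 / l ^ 2 * (2 * (prodWeight (fun _ => p) x * (I.unc.support (empirical x) V - σ) ^ 2) +
          (prodWeight (fun _ => p) x *
            (I.unc.support (empirical (MLMCDraw.even (⟨n, x⟩ : MLMCDraw S N))) V - σ) ^ 2 +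
          prodWeight (fun _ => p) x *
            (I.unc.support (empirical (MLMCDraw.odd (⟨n, x⟩ : MLMCDraw S N))) V - σ) ^ 2)) := by
      intro x
      have hw : 0 ≤ prodWeight (fun _ => p) x := (prodWeight_mem fun _ => hpm).1 x
      set f := I.unc.support (empirical (MLMCDraw.first (⟨n, x⟩ : MLMCDraw S N))) V - σ
      set u := I.unc.support (empirical x) V - σ
      set v := I.unc.support (empirical (MLMCDraw.even (⟨n, x⟩ : MLMCDraw S N))) V - σ
      set w := I.unc.support (empirical (MLMCDraw.odd (⟨n, x⟩ : MLMCDraw S N))) V - σ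
      have e : (mlmcSampler I N).est s a ⟨n, x⟩ V - σ = f + (u - 1 / 2 * (v + w)) / l := by
        simp only [mlmcSampler, f, u, v, w]
        ring
      have h4 : (f + (u - 1 / 2 * (v + w)) / l) ^ 2 ≤
          2 * f ^ 2 + 2 / l ^ 2 * (2 * u ^ 2 + (v ^ 2 + w ^ 2)) := by
        have h5 : (f + (u - 1 / 2 * (v + w)) / l) ^ 2 ≤
            2 * f ^ 2 + 2 * ((u - 1 / 2 * (v + w)) / l) ^ 2 := by
          nlinarith [sq_nonneg (f - (u - 1 / 2 * (v + w)) / l)]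
        have h6 : (u - 1 / 2 * (v + w)) ^ 2 ≤ 2 * u ^ 2 + (v ^ 2 + w ^ 2) := by
          nlinarith [sq_nonneg (u + 1 / 2 * (v + w)), sq_nonneg (v - w)]
        have h7 := mul_le_mul_of_nonneg_left h6 (show 0 ≤ 2 / l ^ 2 by positivity)
        have e2 : 2 * ((u - 1 / 2 * (v + w)) / l) ^ 2 =
            2 / l ^ 2 * (u - 1 / 2 * (v + w)) ^ 2 := by
          rw [div_pow]
          ring
        linarith
      rw [e]
      refine (mul_le_mul_of_nonneg_left h4 hw).trans (le_of_eq (by ring))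
    have hsum := Finset.sum_le_sum fun x (_ : x ∈ Finset.univ) => hpt x
    rw [Finset.sum_add_distrib, ← Finset.mul_sum, ← Finset.mul_sum, Finset.sum_add_distrib,
      ← Finset.mul_sum, Finset.sum_add_distrib, h1, h2, h3] at hsum
    have hq : (0 : ℝ) < 2 ^ (n : ℕ) := by positivity
    have hsum2 : ∑ x : Fin (2 ^ ((n : ℕ) + 1)) → S,
        prodWeight (fun _ => p) x * ((mlmcSampler I N).est s a ⟨n, x⟩ V - σ) ^ 2 ≤
        2 * B + 2 / l ^ 2 * (3 * (B / 2 ^ (n : ℕ))) := by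
      refine hsum.trans ?_
      have m1' : ∑ x : Fin 1 → S, prodWeight (fun _ => p) x *
          (I.unc.support (empirical x) V - σ) ^ 2 ≤ B := by simpa using m1
      have m2' : ∑ x : Fin (2 ^ (n : ℕ)) → S, prodWeight (fun _ => p) x *
          (I.unc.support (empirical x) V - σ) ^ 2 ≤ B / 2 ^ (n : ℕ) := by simpa using m2
      have m3' : ∑ x : Fin (2 ^ ((n : ℕ) + 1)) → S, prodWeight (fun _ => p) x *
          (I.unc.support (empirical x) V - σ) ^ 2 ≤ 1 / 2 * (B / 2 ^ (n : ℕ)) := by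
        refine m3.trans (le_of_eq ?_)
        push_cast
        rw [← hB, pow_succ]
        field_simp
      refine add_le_add (by linarith) (mul_le_mul_of_nonneg_left ?_ (by positivity))
      linarith
    refine (mul_le_mul_of_nonneg_left hsum2 hl0.le).trans ?_
    have hinv := inv_levelProb_le (Nat.lt_succ_iff.1 n.2)
    rw [← hl] at hinv
    have e3 : l * (2 * B + 2 / l ^ 2 * (3 * (B / 2 ^ (n : ℕ)))) =
        l * (2 * B) + 6 * B / 2 ^ (n : ℕ) * l⁻¹ := by
      field_simp
      ring
    rw [e3]
    have h8 : 6 * B / 2 ^ (n : ℕ) * l⁻¹ ≤ 6 * B / 2 ^ (n : ℕ) * 2 ^ ((n : ℕ) + 1) :=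
      mul_le_mul_of_nonneg_left hinv (by positivity)
    have e4 : 6 * B / 2 ^ (n : ℕ) * 2 ^ ((n : ℕ) + 1) = 12 * B := by
      rw [pow_succ]
      field_simp
      ring
    linarith
  refine (Finset.sum_le_sum fun n _ => hlev n).trans ?_
  rw [Finset.sum_add_distrib, ← Finset.sum_mul, sum_levelProb]
  simp only [Finset.sum_const, Finset.card_univ, Fintype.card_fin, nsmul_eq_mul, Nat.cast_add,
    Nat.cast_one]
  have : (0 : ℝ) ≤ N := Nat.cast_nonneg N
  nlinarith

/-- The variance is at most the mean square error about any other point. The factor `Fintype.card S`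
arises from bounding the squared span of the noise by four times the sum of its squares; `1456 = 4 *
364`. -/
lemma mlmcSampler_isUnbiased [Nonempty S] (h : I.Admissible) (hU : I.unc.IsTVOrWasserstein)
    (N : ℕ) : (mlmcSampler I N).IsUnbiased I
      (fun s a V => empiricalSupport I.unc (2 ^ (N + 1)) (I.nominal s a) V)
      (1456 * (Fintype.card S * (N + 1))) := by
  set τ : S → A → (S → ℝ) → ℝ :=
    fun s a V => empiricalSupport I.unc (2 ^ (N + 1)) (I.nominal s a) V with hτ
  have hw := mlmcSampler_weight_mem (I := I) h N
  have hJ := Sampler.jointWeight_mem hw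
  refine ⟨hw, mlmc_mean h N, fun V => ?_⟩
  have hvar : ∀ s a, ∑ ξ, (mlmcSampler I N).weight s a ξ *
      ((mlmcSampler I N).est s a ξ V - τ s a V) ^ 2 ≤ 364 * (N + 1) * spanSeminorm V ^ 2 := by
    intro s a
    have h1 := weighted_variance (hw s a) (fun ξ => (mlmcSampler I N).est s a ξ V) (I.sigma s a V)
    rw [mlmc_mean h N s a V] at h1
    have h2 := mlmc_mse h hU N s a V
    rw [h1] at h2
    linarith [sq_nonneg (empiricalSupport I.unc (2 ^ (N + 1)) (I.nominal s a) V - I.sigma s a V)]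
  have hnoise : ∀ s, ∑ ξ, (mlmcSampler I N).jointWeight ξ *
      (mlmcSampler I N).noise I τ ξ V s ^ 2 ≤ 364 * (N + 1) * spanSeminorm V ^ 2 := by
    intro s
    have h1 : ∀ ξ : S → A → MLMCDraw S N, (mlmcSampler I N).noise I τ ξ V s ^ 2 ≤
        ∑ a, I.policy s a * ((mlmcSampler I N).est s a (ξ s a) V - τ s a V) ^ 2 :=
      fun ξ => weighted_sq_le (h.policy_mem s) _
    refine (weighted_mono hJ h1).trans ?_
    simp_rw [Finset.mul_sum]
    rw [Finset.sum_comm, ← weighted_const (h.policy_mem s) (364 * (N + 1) * spanSeminorm V ^ 2)]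
    refine Finset.sum_le_sum fun a _ => ?_
    have h2 := Sampler.sum_jointWeight_apply hw s a
      fun x => I.policy s a * ((mlmcSampler I N).est s a x V - τ s a V) ^ 2
    rw [h2]
    simp_rw [mul_left_comm _ (I.policy s a)]
    rw [← Finset.mul_sum]
    exact mul_le_mul_of_nonneg_left (hvar s a) ((h.policy_mem s).1 a)
  have hsp : ∀ w : S → ℝ, spanSeminorm w ^ 2 ≤ 4 * ∑ s, w s ^ 2 := by
    intro w
    have h1 : spanSeminorm w ≤ 2 * √(∑ s, w s ^ 2) := spanSeminorm_le fun s t => by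
      have h2 : ∀ s, |w s| ≤ √(∑ s, w s ^ 2) := fun s =>
        Real.abs_le_sqrt (Finset.single_le_sum (f := fun s => w s ^ 2)
          (fun s _ => sq_nonneg _) (Finset.mem_univ s))
      linarith [(abs_le.1 (h2 s)).2, (abs_le.1 (h2 t)).1]
    refine (pow_le_pow_left₀ (spanSeminorm_nonneg w) h1 2).trans (le_of_eq ?_)
    rw [mul_pow, Real.sq_sqrt (Finset.sum_nonneg fun s _ => sq_nonneg _)]
    norm_num
  refine (weighted_mono hJ fun ξ => hsp _).trans ?_
  simp_rw [Finset.mul_sum]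
  rw [Finset.sum_comm]
  have h3 : ∀ s, ∑ ξ, (mlmcSampler I N).jointWeight ξ *
      (4 * (mlmcSampler I N).noise I τ ξ V s ^ 2) ≤ 4 * (364 * (N + 1) * spanSeminorm V ^ 2) := by
    intro s
    simp_rw [mul_left_comm _ (4 : ℝ)]
    rw [← Finset.mul_sum]
    exact mul_le_mul_of_nonneg_left (hnoise s) (by norm_num)
  refine (Finset.sum_le_sum fun s _ => h3 s).trans (le_of_eq ?_)
  rw [Finset.sum_const, Finset.card_univ, nsmul_eq_mul]
  ring

end MLMC

/-! ### Finite-time bounds for the two estimators -/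

namespace RobustTD

variable {S A : Type*} [Fintype S] [Fintype A] [DecidableEq S] [DecidableEq A]
  {I : RobustMDP S A} {D : AnalysisData S}

/-- The finite-time bound for contamination sets. -/
lemma meanSqError_contamination_le (h : I.Admissible) (hD : D.Valid I) {s₀ : S} {V : S → ℝ}
    (hV : I.IsAnchoredRobustValue s₀ V) {δ : ℝ} (hU : I.unc = UncertaintySet.contamination δ)
    {K : ℝ} (hK : max (10 ^ 7 * D.κ ^ 2 * D.Λ / D.α₂ ^ 2) 3 ≤ K) (β : ℕ → ℝ) (V₀ : S → ℝ) (T : ℕ) :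
    meanSqError I (contaminationSampler I δ) s₀ (stepSize D.α₂ K) β V₀ T V ≤
      10 ^ 7 * D.κ ^ 2 * (D.cu / D.cl * (K ^ 2 / (T + K) ^ 2) * ‖V₀ - V‖ ^ 2
        + D.Λ * I.tMix ^ 2 / ((T + K) * D.α₂ ^ 2)) := by
  have : Nonempty S := ⟨s₀⟩
  have hα := hD.α₂_pos
  have hcl := hD.cl_pos
  have hcu := hD.cu_pos
  have hΛ := hD.Λ_pos
  have hK3 : 3 ≤ K := (le_max_right _ _).trans hK
  have hTK : (0 : ℝ) < T + K := by positivity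
  have hKb : 72 * D.κ ^ 2 * D.Λ * 4 / D.α₂ ^ 2 ≤ K := by
    refine le_trans ?_ ((le_max_left _ _).trans hK)
    refine div_le_div_of_nonneg_right ?_ (sq_nonneg _)
    have : 0 ≤ D.κ ^ 2 * D.Λ := by positivity
    linarith
  -- The one-sample estimator has no bias, so the two operators agree.
  have hb : spanSeminorm (I.envelopeBellman I.sigma 0 V - I.bellman 0 V) ≤ 0 := by
    have e : I.envelopeBellman I.sigma 0 V - I.bellman 0 V = fun _ => 0 := sub_self _
    rw [e, spanSeminorm_const]
  refine (meanSqError_le h h.sigma_isEnvelopeFamily hD (contaminationSampler_isUnbiased h hU)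
    (by norm_num) hV hb hK3 hKb β V₀ T).trans ?_
  have h1 : 0 ≤ D.κ ^ 2 * (D.cu / D.cl * (K ^ 2 / (T + K) ^ 2) * ‖V₀ - V‖ ^ 2) := by positivity
  have h2 : 0 ≤ D.κ ^ 2 * (D.Λ * I.tMix ^ 2 / ((T + K) * D.α₂ ^ 2)) := by positivity
  have e : D.κ ^ 2 * (288 * (D.cu / D.cl) * (K ^ 2 / (T + K) ^ 2) * ‖V₀ - V‖ ^ 2 +
        576 * D.Λ * 4 * I.tMix ^ 2 / (D.α₂ ^ 2 * (T + K)) +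
        74 * (D.cu / D.cl) * 0 ^ 2 / (1 - D.γ) ^ 2) =
      288 * (D.κ ^ 2 * (D.cu / D.cl * (K ^ 2 / (T + K) ^ 2) * ‖V₀ - V‖ ^ 2)) +
      2304 * (D.κ ^ 2 * (D.Λ * I.tMix ^ 2 / ((T + K) * D.α₂ ^ 2))) := by ring
  rw [e, mul_assoc, mul_add]
  linarith

/-- The finite-time bound for total variation and Wasserstein sets. -/
lemma meanSqError_mlmc_le (h : I.Admissible) (hD : D.Valid I) {s₀ : S} {V : S → ℝ}
    (hV : I.IsAnchoredRobustValue s₀ V) (hU : I.unc.IsTVOrWasserstein) (N : ℕ)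
    {K : ℝ} (hK : max (10 ^ 7 * D.κ ^ 2 * D.Λ * (Fintype.card S * (N + 1)) / D.α₂ ^ 2) 3 ≤ K)
    (β : ℕ → ℝ) (V₀ : S → ℝ) (T : ℕ) :
    meanSqError I (mlmcSampler I N) s₀ (stepSize D.α₂ K) β V₀ T V ≤
      10 ^ 7 * D.κ ^ 2 * (D.cu / D.cl * (K ^ 2 / (T + K) ^ 2) * ‖V₀ - V‖ ^ 2
        + D.Λ * (Fintype.card S * (N + 1)) * I.tMix ^ 2 / ((T + K) * D.α₂ ^ 2)
        + D.cu / D.cl * Real.sqrt (Fintype.card S) * 2 ^ (-(N : ℝ) / 2)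
          * I.tMix ^ 2 / (1 - D.γ) ^ 2) := by
  have : Nonempty S := ⟨s₀⟩
  have hα := hD.α₂_pos
  have hcl := hD.cl_pos
  have hcu := hD.cu_pos
  have hΛ := hD.Λ_pos
  have hγ : 0 < 1 - D.γ := by linarith [hD.γ_mem.2]
  have hK3 : 3 ≤ K := (le_max_right _ _).trans hK
  have hTK : (0 : ℝ) < T + K := by positivity
  have hS1 : (1 : ℝ) ≤ Fintype.card S := by exact_mod_cast Fintype.card_pos
  have hN0 : (0 : ℝ) ≤ N := Nat.cast_nonneg N
  set G : ℝ := Fintype.card S * (N + 1) with hG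
  have hG1 : 1 ≤ G := one_le_mul_of_one_le_of_one_le hS1 (by linarith)
  have hKb : 72 * D.κ ^ 2 * D.Λ * (1456 * G) / D.α₂ ^ 2 ≤ K := by
    refine le_trans ?_ ((le_max_left _ _).trans hK)
    refine div_le_div_of_nonneg_right ?_ (sq_nonneg _)
    have : 0 ≤ D.κ ^ 2 * D.Λ * G := by positivity
    linarith
  have hk : (2 : ℕ) ^ (N + 1) ≠ 0 := by positivity
  have hb := spanSeminorm_empiricalSupport_sub_le h hU hk V
  refine (meanSqError_le h (mlmc_isEnvelopeFamily h hU hk) hD (mlmcSampler_isUnbiased h hU N)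
    (by linarith) hV hb hK3 hKb β V₀ T).trans ?_
  -- The actual squared bias is of order `2 ^ (-N)` and free of the dimension; it is weakened to the
  -- stated form. The `100` is `5 ^ 2` times `2 ^ 2` from the span bound.
  have hbsq : (5 * spanSeminorm V / √((2 ^ (N + 1) : ℕ) : ℝ)) ^ 2 ≤
      100 * (√(Fintype.card S) * 2 ^ (-(N : ℝ) / 2) * I.tMix ^ 2) := by
    have h1 := pow_le_pow_left₀ (spanSeminorm_nonneg V) (RobustMDP.spanSeminorm_anchored_le h hV) 2
    have h2 : ((2 : ℝ) ^ (N + 1))⁻¹ ≤ 2 ^ (-(N : ℝ) / 2) := by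
      rw [← Real.rpow_natCast, ← Real.rpow_neg (by norm_num)]
      refine Real.rpow_le_rpow_of_exponent_le (by norm_num) ?_
      push_cast
      linarith
    have h3 : 1 ≤ √(Fintype.card S : ℝ) := Real.one_le_sqrt.2 hS1
    rw [div_pow, Real.sq_sqrt (by positivity), mul_pow, div_eq_mul_inv]
    push_cast
    have h4 : (2 : ℝ) ^ (-(N : ℝ) / 2) ≤ √(Fintype.card S) * 2 ^ (-(N : ℝ) / 2) :=
      le_mul_of_one_le_left (by positivity) h3
    calc (5 : ℝ) ^ 2 * spanSeminorm V ^ 2 * (2 ^ (N + 1))⁻¹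
        ≤ 5 ^ 2 * (2 * I.tMix) ^ 2 * (√(Fintype.card S) * 2 ^ (-(N : ℝ) / 2)) :=
          mul_le_mul (by linarith) (h2.trans h4) (by positivity) (by positivity)
      _ = _ := by ring
  set Y : ℝ := √(Fintype.card S) * 2 ^ (-(N : ℝ) / 2) * I.tMix ^ 2 with hY
  have hY0 : 0 ≤ Y := by positivity
  have h1 : 0 ≤ D.κ ^ 2 * (D.cu / D.cl * (K ^ 2 / (T + K) ^ 2) * ‖V₀ - V‖ ^ 2) := by positivity
  have h2 : 0 ≤ D.κ ^ 2 * (D.Λ * G * I.tMix ^ 2 / ((T + K) * D.α₂ ^ 2)) := by positivity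
  have h3 : 0 ≤ D.κ ^ 2 * (D.cu / D.cl * Y / (1 - D.γ) ^ 2) := by positivity
  have h4 : D.κ ^ 2 * (74 * (D.cu / D.cl) * (5 * spanSeminorm V / √((2 ^ (N + 1) : ℕ) : ℝ)) ^ 2 /
      (1 - D.γ) ^ 2) ≤ 7400 * (D.κ ^ 2 * (D.cu / D.cl * Y / (1 - D.γ) ^ 2)) := by
    calc _ ≤ D.κ ^ 2 * (74 * (D.cu / D.cl) * (100 * Y) / (1 - D.γ) ^ 2) := by gcongr
      _ = _ := by ring
  have e1 : D.κ ^ 2 * (576 * D.Λ * (1456 * G) * I.tMix ^ 2 / (D.α₂ ^ 2 * (T + K))) =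
      838656 * (D.κ ^ 2 * (D.Λ * G * I.tMix ^ 2 / ((T + K) * D.α₂ ^ 2))) := by ring
  have e2 : D.cu / D.cl * √(Fintype.card S) * 2 ^ (-(N : ℝ) / 2) * I.tMix ^ 2 / (1 - D.γ) ^ 2 =
      D.cu / D.cl * Y / (1 - D.γ) ^ 2 := by
    rw [hY]
    ring
  have e3 : D.κ ^ 2 * (288 * (D.cu / D.cl) * (K ^ 2 / (T + K) ^ 2) * ‖V₀ - V‖ ^ 2) =
      288 * (D.κ ^ 2 * (D.cu / D.cl * (K ^ 2 / (T + K) ^ 2) * ‖V₀ - V‖ ^ 2)) := by ring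
  have e4 : 10 ^ 7 * D.κ ^ 2 * (D.cu / D.cl * (K ^ 2 / (T + K) ^ 2) * ‖V₀ - V‖ ^ 2 +
        D.Λ * G * I.tMix ^ 2 / ((T + K) * D.α₂ ^ 2) + D.cu / D.cl * Y / (1 - D.γ) ^ 2) =
      10 ^ 7 * (D.κ ^ 2 * (D.cu / D.cl * (K ^ 2 / (T + K) ^ 2) * ‖V₀ - V‖ ^ 2)) +
      10 ^ 7 * (D.κ ^ 2 * (D.Λ * G * I.tMix ^ 2 / ((T + K) * D.α₂ ^ 2))) +
      10 ^ 7 * (D.κ ^ 2 * (D.cu / D.cl * Y / (1 - D.γ) ^ 2)) := by ring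
  rw [e2, e4, ← hG]
  refine le_trans (le_of_eq (mul_add _ _ _)) ?_
  rw [mul_add (D.κ ^ 2), e1, e3]
  linarith only [h1, h2, h3, h4]

/-! ### The expected number of samples -/

variable {Ξ : Type*} [Fintype Ξ] {E : Sampler S A Ξ}

lemma expectation_second (hE : ∀ s a, E.weight s a ∈ stdSimplex ℝ Ξ) (T : ℕ)
    (f : (Fin T → S → A → Ξ) → ℝ) :
    expectation E T (fun ω => f ω.2) = ∑ ω, prodWeight (fun _ : Fin T => E.jointWeight) ω * f ω := by
  rw [← expectation_first hE T f]
  unfold expectation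
  rw [← (Equiv.prodComm _ _).sum_comp]
  refine Finset.sum_congr rfl fun ω _ => ?_
  simp only [runWeight, Equiv.prodComm_apply, Prod.fst_swap, Prod.snd_swap]
  simp_rw [mul_comm (E.weight _ _ (ω.2 _ _ _))]

lemma expectedSamples_eq (hE : ∀ s a, E.weight s a ∈ stdSimplex ℝ Ξ) {c : ℝ}
    (hc : ∀ s a, ∑ ξ, E.weight s a ξ * E.cost ξ = c) (T : ℕ) :
    expectedSamples E T = 2 * T * (Fintype.card S * Fintype.card A) * c := by
  have hJ := Sampler.jointWeight_mem hE
  have hphase : ∑ ω, prodWeight (fun _ : Fin T => E.jointWeight) ω *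
      ∑ t, ∑ s, ∑ a, (E.cost (ω t s a) : ℝ) = T * (Fintype.card S * Fintype.card A) * c := by
    simp_rw [Finset.mul_sum]
    rw [Finset.sum_comm]
    have h1 : ∀ t : Fin T, ∑ ω, ∑ s, ∑ a, prodWeight (fun _ : Fin T => E.jointWeight) ω *
        (E.cost (ω t s a) : ℝ) = Fintype.card S * (Fintype.card A * c) := by
      intro t
      rw [Finset.sum_comm]
      have h2 : ∀ s : S, ∑ ω, ∑ a, prodWeight (fun _ : Fin T => E.jointWeight) ω *
          (E.cost (ω t s a) : ℝ) = Fintype.card A * c := by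
        intro s
        rw [Finset.sum_comm]
        have h3 : ∀ a : A, ∑ ω, prodWeight (fun _ : Fin T => E.jointWeight) ω *
            (E.cost (ω t s a) : ℝ) = c := by
          intro a
          rw [sum_prodWeight_apply (fun _ => hJ.2) t fun ξ => (E.cost (ξ s a) : ℝ),
            Sampler.sum_jointWeight_apply hE s a fun x => (E.cost x : ℝ), hc]
        rw [Finset.sum_congr rfl fun a _ => h3 a, Finset.sum_const, Finset.card_univ, nsmul_eq_mul]
      rw [Finset.sum_congr rfl fun s _ => h2 s, Finset.sum_const, Finset.card_univ, nsmul_eq_mul]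
    rw [Finset.sum_congr rfl fun t _ => h1 t, Finset.sum_const, Finset.card_univ, nsmul_eq_mul,
      Fintype.card_fin]
    ring
  have h1 := expectation_first hE T fun ω => ∑ t, ∑ s, ∑ a, (E.cost (ω t s a) : ℝ)
  have h2 := expectation_second hE T fun ω => ∑ t, ∑ s, ∑ a, (E.cost (ω t s a) : ℝ)
  rw [hphase] at h1 h2
  have e : expectedSamples E T =
      expectation E T (fun ω => ∑ t, ∑ s, ∑ a, (E.cost (ω.1 t s a) : ℝ)) +
      expectation E T (fun ω => ∑ t, ∑ s, ∑ a, (E.cost (ω.2 t s a) : ℝ)) := by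
    simp only [expectedSamples, expectation, samples, Finset.sum_add_distrib, mul_add]
  rw [e, h1, h2]
  ring

lemma expectedSamples_contamination (h : I.Admissible) (δ : ℝ) (T : ℕ) :
    expectedSamples (contaminationSampler I δ) T =
      2 * T * (Fintype.card S * Fintype.card A) * 1 := by
  refine expectedSamples_eq (E := contaminationSampler I δ) h.nominal_mem (fun s a => ?_) T
  simp only [contaminationSampler, Nat.cast_one, mul_one]
  exact (h.nominal_mem s a).2

/-- Each level below the truncation contributes `2 ^ -(n + 1) * 2 ^ (n + 1) = 1` expected sample and
the last one contributes two. -/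
lemma expectedSamples_mlmc (h : I.Admissible) (N T : ℕ) :
    expectedSamples (mlmcSampler I N) T = 2 * T * (Fintype.card S * Fintype.card A) * (N + 2) := by
  refine expectedSamples_eq (mlmcSampler_weight_mem h N) (fun s a => ?_) T
  rw [sum_mlmc]
  have h1 : ∀ n : Fin (N + 1), levelProb N n * ∑ x : Fin (2 ^ ((n : ℕ) + 1)) → S,
      prodWeight (fun _ => I.nominal s a) x * ((mlmcSampler I N).cost ⟨n, x⟩ : ℝ) =
      levelProb N n * 2 ^ ((n : ℕ) + 1) := by
    intro n
    have := weighted_const (prodWeight_mem fun _ : Fin (2 ^ ((n : ℕ) + 1)) => h.nominal_mem s a)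
      (2 ^ ((n : ℕ) + 1) : ℝ)
    simp only [mlmcSampler, Nat.cast_pow, Nat.cast_ofNat]
    rw [this]
  rw [Finset.sum_congr rfl fun n _ => h1 n,
    Fin.sum_univ_eq_sum_range (fun n => levelProb N n * 2 ^ (n + 1)), Finset.sum_range_succ]
  have h2 : ∀ n ∈ Finset.range N, levelProb N n * 2 ^ (n + 1) = 1 := fun n hn => by
    simp [levelProb, Finset.mem_range.1 hn]
  rw [Finset.sum_congr rfl h2]
  simp [levelProb, pow_succ]

end RobustTD

/-! ### The state space is small if the constants of the analysis are bounded -/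

namespace AnalysisData.Valid

variable {S A : Type*} [Fintype S] [Fintype A] [DecidableEq S] {D : AnalysisData S}
  {I : RobustMDP S A}

/-- Each sign is chosen so that the first-order term of the smoothness inequality is not positive;
every summand then adds at most its second-order term. -/
lemma exists_signs (h : D.Valid I) (x : ℕ → S → ℝ) {c : ℝ} (hx : ∀ i, D.L / 2 * D.s (x i) ^ 2 ≤ c)
    (n : ℕ) : ∃ e : ℕ → ℝ, (∀ i, e i = 1 ∨ e i = -1) ∧
      D.M (∑ i ∈ Finset.range n, e i • x i) ≤ n * c := by
  induction n with
  | zero => exact ⟨fun _ => 1, fun _ => Or.inl rfl, by simp [AnalysisData.M]⟩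
  | succ n ih =>
    obtain ⟨e, he, hM⟩ := ih
    set y := ∑ i ∈ Finset.range n, e i • x i with hy
    have key : ∃ a : ℝ, (a = 1 ∨ a = -1) ∧ D.M (y + a • x n) ≤ D.M y + c := by
      have hs : ∀ a : ℝ, (a = 1 ∨ a = -1) →
          D.M (y + a • x n) ≤ D.M y + a * fderiv ℝ D.M y (x n) + c := by
        intro a ha
        have h1 := h.smooth y (y + a • x n)
        rw [add_sub_cancel_left, map_smul, map_smul_eq_mul, mul_pow, Real.norm_eq_abs, sq_abs,
          smul_eq_mul] at h1
        have h2 : a ^ 2 = 1 := by rcases ha with rfl | rfl <;> norm_num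
        rw [h2, one_mul] at h1
        linarith [hx n]
      rcases le_total (fderiv ℝ D.M y (x n)) 0 with hd | hd
      · exact ⟨1, Or.inl rfl, by linarith [hs 1 (Or.inl rfl)]⟩
      · exact ⟨-1, Or.inr rfl, by linarith [hs (-1) (Or.inr rfl)]⟩
    obtain ⟨a, ha, haM⟩ := key
    refine ⟨Function.update e n a, fun i => ?_, ?_⟩
    · rcases eq_or_ne i n with rfl | hi
      · simpa using ha
      · simpa [Function.update_of_ne hi] using he i
    · rw [Finset.sum_range_succ, Function.update_self]
      have e1 : ∑ i ∈ Finset.range n, Function.update e n a i • x i = y :=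
        Finset.sum_congr rfl fun i hi => by
          rw [Function.update_of_ne (Finset.mem_range.1 hi).ne]
      rw [e1]
      push_cast
      linarith

/-- Smooth approximations of the span semi-norm on a large state space are expensive. -/
lemma le_of_two_pow_le_card (h : D.Valid I) {n : ℕ} (hn : 2 ^ n ≤ Fintype.card S) :
    (n : ℝ) ≤ D.Λ * D.κ ^ 2 := by
  rcases Nat.eq_zero_or_pos n with rfl | hn0
  · have := h.Λ_pos
    simp only [Nat.cast_zero]
    positivity
  have hL := h.L_pos
  have hcP := h.cP_pos
  have hcu := h.cu_pos
  -- With `2 ^ n` states all sign patterns are realized, and `x i` reads off the `i`-th sign.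
  obtain ⟨φ⟩ : Nonempty ((Fin n → Bool) ↪ S) :=
    Function.Embedding.nonempty_of_card_le (by simpa using hn)
  have : Nonempty S := ⟨φ fun _ => true⟩
  set x : ℕ → S → ℝ := fun i s =>
    if hi : i < n then (if Function.invFun φ s ⟨i, hi⟩ then 1 else -1) else 0 with hx
  have hxφ : ∀ (b : Fin n → Bool) (i : ℕ) (hi : i < n), x i (φ b) = if b ⟨i, hi⟩ then 1 else -1 := by
    intro b i hi
    simp only [hx, hi, dif_pos, Function.leftInverse_invFun φ.injective b]
  have hspan : ∀ i, spanSeminorm (x i) ≤ 2 := fun i => by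
    have hb : ∀ s, |x i s| ≤ 1 := fun s => by
      simp only [hx]
      split_ifs <;> simp
    exact spanSeminorm_le fun s t => by linarith [(abs_le.1 (hb s)).2, (abs_le.1 (hb t)).1]
  have hc : ∀ i, D.L / 2 * D.s (x i) ^ 2 ≤ 2 * D.L * D.ρ ^ 2 * D.CP ^ 2 := fun i => by
    have h1 : D.s (x i) ≤ D.ρ * (D.CP * 2) := (h.s_le _).trans
      (mul_le_mul_of_nonneg_left ((h.N_le _).trans
        (mul_le_mul_of_nonneg_left (hspan i) h.CP_pos.le)) h.ρ_pos.le)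
    have h2 := mul_le_mul_of_nonneg_left (pow_le_pow_left₀ (apply_nonneg D.s _) h1 2)
      (show 0 ≤ D.L / 2 by positivity)
    linarith
  obtain ⟨e, he, hM⟩ := h.exists_signs x hc n
  set y := ∑ i ∈ Finset.range n, e i • x i with hy
  have hval : ∀ (b : Fin n → Bool) (r : ℝ), (∀ i (hi : i < n), e i * (if b ⟨i, hi⟩ then 1 else -1) = r) →
      y (φ b) = n * r := by
    intro b r hb
    rw [hy, Finset.sum_apply, Finset.sum_congr rfl (g := fun _ => r), Finset.sum_const,
      Finset.card_range, nsmul_eq_mul]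
    intro i hi
    have hi' := Finset.mem_range.1 hi
    rw [Pi.smul_apply, smul_eq_mul, hxφ b i hi', hb i hi']
  have h1 := hval (fun i => decide (e i = 1)) 1 fun i _ => by
    rcases he i with h | h <;> simp [h]
  have h2 := hval (fun i => decide (e i = -1)) (-1) fun i _ => by
    rcases he i with h | h <;> simp [h]
  -- Whatever the signs `e`, some state makes all terms `1` and another all `-1`. So `N y` grows
  -- like `n`, while `M y` is at most a multiple of `n`, which bounds `n`.
  have h3 : 2 * (n : ℝ) ≤ spanSeminorm y := by
    have := sub_le_spanSeminorm y (φ fun i => decide (e i = 1)) (φ fun i => decide (e i = -1))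
    rw [h1, h2] at this
    linarith
  have h4 : (D.cP * (2 * n)) ^ 2 ≤ D.N y ^ 2 :=
    pow_le_pow_left₀ (by positivity) ((mul_le_mul_of_nonneg_left h3 hcP.le).trans (h.le_N y)) 2
  have h5 := h.N_sq_le y
  have h6 : 2 * D.cu * D.M y ≤ 2 * D.cu * (n * (2 * D.L * D.ρ ^ 2 * D.CP ^ 2)) :=
    mul_le_mul_of_nonneg_left hM (by positivity)
  have hn1 : (0 : ℝ) < n := by exact_mod_cast hn0
  have h7 : (n : ℝ) * D.cP ^ 2 ≤ D.cu * D.ρ ^ 2 * D.L * D.CP ^ 2 := by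
    refine le_of_mul_le_mul_left ?_ (show (0 : ℝ) < 4 * n by positivity)
    nlinarith
  unfold AnalysisData.Λ AnalysisData.κ
  rw [div_pow, ← mul_div_assoc, le_div_iff₀ (by positivity)]
  exact h7

/-- It absorbs the extra factor `Fintype.card S` of the multilevel noise into a constant that
depends on `H` only. -/
lemma card_le (h : D.Valid I) {H : ℝ} (hH : D.BoundedBy H) :
    (Fintype.card S : ℝ) ≤ 2 ^ (⌊H ^ 3⌋₊ + 1) := by
  rcases isEmpty_or_nonempty S with hS | hS
  · simp
  obtain ⟨hκ, -, hΛ, -⟩ := hH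
  have h1 := h.le_of_two_pow_le_card (Nat.pow_log_le_self 2 (Fintype.card_pos (α := S)).ne')
  have h2 : D.Λ * D.κ ^ 2 ≤ H ^ 3 := by
    have h0 := h.one_le_κ
    calc D.Λ * D.κ ^ 2 ≤ H * H ^ 2 :=
          mul_le_mul hΛ (pow_le_pow_left₀ (by linarith) hκ 2) (sq_nonneg _) (by linarith)
      _ = H ^ 3 := by ring
  have h3 : Nat.log 2 (Fintype.card S) ≤ ⌊H ^ 3⌋₊ := Nat.le_floor (h1.trans h2)
  have h4 := Nat.lt_pow_succ_log_self (b := 2) (by norm_num) (Fintype.card S)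
  have h5 : Fintype.card S ≤ 2 ^ (⌊H ^ 3⌋₊ + 1) :=
    h4.le.trans (Nat.pow_le_pow_right (by norm_num) (by omega))
  exact_mod_cast h5

end AnalysisData.Valid

/-! ### Sample complexity -/

namespace RobustTD

variable {S A : Type*} [Fintype S] [Fintype A] [DecidableEq S] [DecidableEq A]
  {I : RobustMDP S A} {D : AnalysisData S}

/-- The constant in the bound `O(tMix² / ((1 - γ)² T))` on the mean square error. -/
def rateConst (H : ℝ) : ℝ := 10 ^ 7 * H ^ 2 * (9 * H ^ 3 * (3 * 10 ^ 7 * H ^ 5) + H ^ 3)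

lemma rateConst_pos {H : ℝ} (hH : 1 ≤ H) : 0 < rateConst H := by
  unfold rateConst
  positivity

lemma one_le_of_boundedBy (hD : D.Valid I) {H : ℝ} (hH : D.BoundedBy H) : 1 ≤ H :=
  hD.one_le_κ.trans hH.1

/-- The initial error also decays at the rate `1 / T`: its weight `(K / (T + K)) ^ 2` is at most `K
/ T`, and `K` is of order `G / (1 - γ) ^ 2`. -/
lemma rate_le (hD : D.Valid I) {H : ℝ} (hH : D.BoundedBy H) {t x G : ℝ} (ht : 1 ≤ t)
    (hx0 : 0 ≤ x) (hx : x ≤ 3 * H * t) (hG : 1 ≤ G) {K : ℝ}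
    (hK : K = max (10 ^ 7 * D.κ ^ 2 * D.Λ * G / D.α₂ ^ 2) 3) {T : ℝ} (hT : 0 < T) :
    10 ^ 7 * D.κ ^ 2 * (D.cu / D.cl * (K ^ 2 / (T + K) ^ 2) * x ^ 2
        + D.Λ * G * t ^ 2 / ((T + K) * D.α₂ ^ 2)) ≤
      rateConst H * (G * t ^ 2 / (1 - D.γ) ^ 2) / T := by
  have hH1 := one_le_of_boundedBy hD hH
  obtain ⟨hκ, hc, hΛ, hγα⟩ := hH
  have hα := hD.α₂_pos
  have hκ1 := hD.one_le_κ
  have hΛ0 := hD.Λ_pos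
  have hcl := hD.cl_pos
  have hcu := hD.cu_pos
  set q := 1 - D.γ with hq
  have hq0 : 0 < q := by linarith [hD.γ_mem.2]
  have hq1 : q ≤ 1 := by linarith [hD.γ_mem.1]
  have hinv : 1 / D.α₂ ^ 2 ≤ H ^ 2 / q ^ 2 := by
    have h1 : 1 / D.α₂ ≤ H / q := by
      rw [div_le_iff₀ hα] at hγα
      rw [div_le_div_iff₀ hα hq0]
      linarith
    have h2 := pow_le_pow_left₀ (by positivity) h1 2
    rwa [div_pow, div_pow, one_pow] at h2
  have hκ2 : D.κ ^ 2 ≤ H ^ 2 := pow_le_pow_left₀ (by linarith) hκ 2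
  have hK3 : 3 ≤ K := hK ▸ le_max_right _ _
  have hKB : K ≤ 3 * 10 ^ 7 * H ^ 5 * (G / q ^ 2) := by
    rw [hK]
    refine max_le ?_ ?_
    · calc 10 ^ 7 * D.κ ^ 2 * D.Λ * G / D.α₂ ^ 2
          = 10 ^ 7 * D.κ ^ 2 * D.Λ * G * (1 / D.α₂ ^ 2) := by ring
        _ ≤ 10 ^ 7 * H ^ 2 * H * G * (H ^ 2 / q ^ 2) := by gcongr
        _ = 1 * (10 ^ 7 * H ^ 5 * (G / q ^ 2)) := by ring
        _ ≤ 3 * (10 ^ 7 * H ^ 5 * (G / q ^ 2)) :=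
          mul_le_mul_of_nonneg_right (by norm_num) (by positivity)
        _ = _ := by ring
    · have h1 : 1 ≤ H ^ 5 := one_le_pow₀ hH1
      have h2 : 1 ≤ G / q ^ 2 := by
        rw [le_div_iff₀ (by positivity)]
        nlinarith
      have h3 : 1 ≤ H ^ 5 * (G / q ^ 2) := one_le_mul_of_one_le_of_one_le h1 h2
      linarith
  have hK0 : 0 < K := by linarith
  have hKT : K ^ 2 / (T + K) ^ 2 ≤ K / T := by
    rw [div_le_div_iff₀ (by positivity) hT]
    nlinarith [mul_pos hK0 hT, mul_pos (mul_pos hK0 hT) hT, mul_pos (mul_pos hK0 hK0) hK0,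
      mul_pos (mul_pos hK0 hK0) hT]
  have h1 : D.cu / D.cl * (K ^ 2 / (T + K) ^ 2) * x ^ 2 ≤
      H * (3 * 10 ^ 7 * H ^ 5 * (G / q ^ 2) / T) * (3 * H * t) ^ 2 := by
    have : K / T ≤ 3 * 10 ^ 7 * H ^ 5 * (G / q ^ 2) / T := by gcongr
    have := hKT.trans this
    gcongr
  have h2 : D.Λ * G * t ^ 2 / ((T + K) * D.α₂ ^ 2) ≤ H * G * t ^ 2 / T * (H ^ 2 / q ^ 2) := by
    calc D.Λ * G * t ^ 2 / ((T + K) * D.α₂ ^ 2)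
        = D.Λ * G * t ^ 2 / (T + K) * (1 / D.α₂ ^ 2) := by
          field_simp
      _ ≤ H * G * t ^ 2 / T * (H ^ 2 / q ^ 2) := by
          gcongr
          linarith
  calc _ ≤ 10 ^ 7 * H ^ 2 * (H * (3 * 10 ^ 7 * H ^ 5 * (G / q ^ 2) / T) * (3 * H * t) ^ 2 +
        H * G * t ^ 2 / T * (H ^ 2 / q ^ 2)) := by
        gcongr
    _ = _ := by
        unfold rateConst
        ring

lemma norm_sub_anchored_le (h : I.Admissible) {s₀ : S} {V V₀ : S → ℝ}
    (hV : I.IsAnchoredRobustValue s₀ V) {H : ℝ} (hH1 : 1 ≤ H) (hV₀ : ‖V₀‖ ≤ H) :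
    ‖V₀ - V‖ ≤ 3 * H * I.tMix := by
  have : Nonempty S := ⟨s₀⟩
  have h1 := RobustMDP.spanSeminorm_anchored_le h hV
  have h2 := norm_le_spanSeminorm hV.1
  have h3 : (1 : ℝ) ≤ I.tMix := by exact_mod_cast h.one_le_tMix
  have h4 := norm_sub_le V₀ V
  nlinarith

lemma exists_contamination_run (h : I.Admissible) (hD : D.Valid I) {H : ℝ} (hH : D.BoundedBy H)
    {s₀ : S} {V : S → ℝ} (hV : I.IsAnchoredRobustValue s₀ V) (V₀ : S → ℝ) (β : ℕ → ℝ)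
    (hV₀ : ‖V₀‖ ≤ H) {ε : ℝ} (hε : ε ∈ Set.Ioc (0 : ℝ) 1) {δ : ℝ}
    (hU : I.unc = UncertaintySet.contamination δ) :
    ∃ T : ℕ, meanSqError I (contaminationSampler I δ) s₀
        (stepSize D.α₂ (max (10 ^ 7 * D.κ ^ 2 * D.Λ / D.α₂ ^ 2) 3)) β V₀ T V ≤ ε ^ 2 ∧
      expectedSamples (contaminationSampler I δ) T ≤
        2 * (rateConst H + 1) *
          (Fintype.card S * Fintype.card A * I.tMix ^ 2 / (ε ^ 2 * (1 - D.γ) ^ 2)) := by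
  have : Nonempty S := ⟨s₀⟩
  have hH1 := one_le_of_boundedBy hD hH
  have hC := rateConst_pos hH1
  have ht : (1 : ℝ) ≤ I.tMix := by exact_mod_cast h.one_le_tMix
  have hq0 : 0 < 1 - D.γ := by linarith [hD.γ_mem.2]
  have hq1 : 1 - D.γ ≤ 1 := by linarith [hD.γ_mem.1]
  obtain ⟨hε0, hε1⟩ := hε
  set R : ℝ := I.tMix ^ 2 / (ε ^ 2 * (1 - D.γ) ^ 2) with hR
  -- A requirement of at least one lets the rounding of the run length be absorbed in the constant.
  have hR1 : 1 ≤ R := by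
    rw [hR, one_le_div (by positivity)]
    calc ε ^ 2 * (1 - D.γ) ^ 2 ≤ 1 * 1 := mul_le_mul (pow_le_one₀ hε0.le hε1)
          (pow_le_one₀ hq0.le hq1) (by positivity) zero_le_one
      _ ≤ (I.tMix : ℝ) ^ 2 := by rw [one_mul]; exact one_le_pow₀ ht
  have hCR : 0 < rateConst H * R := by positivity
  set T := ⌈rateConst H * R⌉₊ with hT
  have hT0 : (0 : ℝ) < T := by exact_mod_cast Nat.ceil_pos.2 hCR
  refine ⟨T, ?_, ?_⟩
  · refine (meanSqError_contamination_le h hD hV hU le_rfl β V₀ T).trans ?_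
    have h1 := rate_le hD hH ht (norm_nonneg _) (norm_sub_anchored_le h hV hH1 hV₀) le_rfl
      (K := max (10 ^ 7 * D.κ ^ 2 * D.Λ / D.α₂ ^ 2) 3) (by rw [mul_one]) hT0
    rw [mul_one] at h1
    refine h1.trans ?_
    rw [div_le_iff₀ hT0, one_mul]
    have h2 : rateConst H * R ≤ T := Nat.le_ceil _
    have h3 := mul_le_mul_of_nonneg_left h2 (sq_nonneg ε)
    refine le_trans (le_of_eq ?_) h3
    rw [hR]
    field_simp
  · rw [expectedSamples_contamination h]
    have h2 : (T : ℝ) ≤ (rateConst H + 1) * R := by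
      have := (Nat.ceil_lt_add_one hCR.le).le
      rw [← hT] at this
      linarith
    have h3 : (0 : ℝ) ≤ Fintype.card S * Fintype.card A := by positivity
    have h4 := mul_le_mul_of_nonneg_right h2 h3
    have e : 2 * (rateConst H + 1) *
          (Fintype.card S * Fintype.card A * I.tMix ^ 2 / (ε ^ 2 * (1 - D.γ) ^ 2)) =
        2 * ((rateConst H + 1) * R * (Fintype.card S * Fintype.card A)) := by
      rw [hR]
      ring
    rw [e]
    linarith

/-- The constant in the sample complexity of multilevel Monte Carlo estimation. -/
noncomputable def mlmcConst (H : ℝ) : ℝ :=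
  4 * (2 * rateConst H + 1) * (4 * Real.log (2 * 10 ^ 7 * H ^ 3) + 10) ^ 2 * 2 ^ (⌊H ^ 3⌋₊ + 1)

/-- The level is `2 * log₂ (c * X ^ 2)` rounded up; `log 2 ≥ 1 / 2` turns it into natural
logarithms. -/
lemma exists_truncation {c X : ℝ} (hc : 1 ≤ c) (hX : 1 ≤ X) :
    ∃ N : ℕ, c * X ^ 2 * 2 ^ (-(N : ℝ) / 2) ≤ 1 ∧
      (N : ℝ) + 1 ≤ (4 * Real.log c + 10) * (1 + Real.log X) := by
  have hlc := Real.log_nonneg hc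
  have hlX := Real.log_nonneg hX
  have hl2 : 1 / 2 ≤ Real.log 2 := by linarith [Real.log_two_gt_d9]
  have hcX : 0 < c * X ^ 2 := by positivity
  set y : ℝ := 2 * Real.log (c * X ^ 2) / Real.log 2 with hy
  have hlog : Real.log (c * X ^ 2) = Real.log c + 2 * Real.log X := by
    rw [Real.log_mul (by positivity) (by positivity), Real.log_pow]
    norm_num
  have hy0 : 0 ≤ y := by
    rw [hy, hlog]
    positivity
  refine ⟨⌈y⌉₊, ?_, ?_⟩
  · have h1 : y ≤ ⌈y⌉₊ := Nat.le_ceil y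
    rw [Real.rpow_def_of_pos two_pos]
    conv_lhs => rw [← Real.exp_log hcX]
    rw [← Real.exp_add, Real.exp_le_one_iff]
    have h2 : 2 * Real.log (c * X ^ 2) ≤ ⌈y⌉₊ * Real.log 2 := by
      rwa [hy, div_le_iff₀ (by linarith)] at h1
    linarith
  · have h1 := (Nat.ceil_lt_add_one hy0).le
    have h2 : y ≤ 4 * (Real.log c + 2 * Real.log X) := by
      rw [hy, hlog, div_le_iff₀ (by linarith)]
      nlinarith
    nlinarith [mul_nonneg hlc hlX]

lemma exists_mlmc_run (h : I.Admissible) (hD : D.Valid I) {H : ℝ} (hH : D.BoundedBy H)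
    {s₀ : S} {V : S → ℝ} (hV : I.IsAnchoredRobustValue s₀ V) (V₀ : S → ℝ) (β : ℕ → ℝ)
    (hV₀ : ‖V₀‖ ≤ H) {ε : ℝ} (hε : ε ∈ Set.Ioc (0 : ℝ) 1) (hU : I.unc.IsTVOrWasserstein) :
    ∃ T N : ℕ, meanSqError I (mlmcSampler I N) s₀ (stepSize D.α₂
        (max (10 ^ 7 * D.κ ^ 2 * D.Λ * (Fintype.card S * (N + 1)) / D.α₂ ^ 2) 3)) β V₀ T V ≤ ε ^ 2 ∧
      expectedSamples (mlmcSampler I N) T ≤ mlmcConst H *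
          (Fintype.card S * Fintype.card A * I.tMix ^ 2 / (ε ^ 2 * (1 - D.γ) ^ 2)) *
          (1 + Real.log (Real.sqrt (Fintype.card S) * I.tMix / (ε * (1 - D.γ)))) ^ 2 := by
  have : Nonempty S := ⟨s₀⟩
  have hH1 := one_le_of_boundedBy hD hH
  have hC := rateConst_pos hH1
  have ht : (1 : ℝ) ≤ I.tMix := by exact_mod_cast h.one_le_tMix
  have hS1 : (1 : ℝ) ≤ Fintype.card S := by exact_mod_cast Fintype.card_pos
  have hcard := hD.card_le hH
  set q := 1 - D.γ with hq
  have hq0 : 0 < q := by linarith [hD.γ_mem.2]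
  have hq1 : q ≤ 1 := by linarith [hD.γ_mem.1]
  obtain ⟨hε0, hε1⟩ := hε
  set n : ℝ := ((Fintype.card S : ℕ) : ℝ) with hn
  set t : ℝ := ((I.tMix : ℕ) : ℝ) with htdef
  set X := √n * t / (ε * q) with hX
  have hs1 : 1 ≤ √n := Real.one_le_sqrt.2 hS1
  have hεq : ε * q ≤ 1 := mul_le_one₀ hε1 hq0.le hq1
  have hX1 : 1 ≤ X := by
    rw [hX, one_le_div (by positivity)]
    exact hεq.trans (one_le_mul_of_one_le_of_one_le hs1 ht)
  have hH3 : 1 ≤ H ^ 3 := one_le_pow₀ hH1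
  -- The constant `2 * 10 ^ 7 * H ^ 3` makes the bias at most `ε ^ 2 / 2`; the other half is left to
  -- the `1 / T` terms.
  obtain ⟨N, hN1, hN2⟩ := exists_truncation (c := 2 * 10 ^ 7 * H ^ 3) (by linarith) hX1
  have hN0 : (0 : ℝ) ≤ N := Nat.cast_nonneg N
  set G : ℝ := n * (N + 1) with hG
  have hG1 : 1 ≤ G := one_le_mul_of_one_le_of_one_le hS1 (by linarith)
  set R : ℝ := G * t ^ 2 / (ε ^ 2 * q ^ 2) with hR
  have hR1 : 1 ≤ R := by
    rw [hR, one_le_div (by positivity), ← mul_pow]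
    calc (ε * q) ^ 2 ≤ 1 := pow_le_one₀ (by positivity) hεq
      _ ≤ G * t ^ 2 := one_le_mul_of_one_le_of_one_le hG1 (one_le_pow₀ ht)
  have hCR : 0 < 2 * rateConst H * R := by positivity
  set T := ⌈2 * rateConst H * R⌉₊ with hT
  have hT0 : (0 : ℝ) < T := by exact_mod_cast Nat.ceil_pos.2 hCR
  refine ⟨T, N, ?_, ?_⟩
  · set K := max (10 ^ 7 * D.κ ^ 2 * D.Λ * G / D.α₂ ^ 2) 3 with hK
    refine (meanSqError_mlmc_le h hD hV hU N (K := K) le_rfl β V₀ T).trans ?_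
    have h1 := rate_le hD hH ht (norm_nonneg _) (norm_sub_anchored_le h hV hH1 hV₀) hG1 hK hT0
    have h2 : rateConst H * (G * t ^ 2 / q ^ 2) / T ≤ ε ^ 2 / 2 := by
      rw [div_le_iff₀ hT0]
      have h2 : 2 * rateConst H * R ≤ T := Nat.le_ceil _
      have h3 := mul_le_mul_of_nonneg_left h2 (show 0 ≤ ε ^ 2 / 2 by positivity)
      refine le_trans (le_of_eq ?_) h3
      rw [hR]
      field_simp
    have h3 : 10 ^ 7 * D.κ ^ 2 * (D.cu / D.cl * √n * 2 ^ (-(N : ℝ) / 2) * t ^ 2 / q ^ 2) ≤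
        ε ^ 2 / 2 := by
      obtain ⟨hκ, hc, -, -⟩ := hH
      have hκ1 := hD.one_le_κ
      have hcl := hD.cl_pos
      have hcu := hD.cu_pos
      -- `X ^ 2` contains `n`, so the root in the bias bound is enlarged to `n`.
      have h4 : √n ≤ √n * √n := le_mul_of_one_le_left (by positivity) hs1
      calc 10 ^ 7 * D.κ ^ 2 * (D.cu / D.cl * √n * 2 ^ (-(N : ℝ) / 2) * t ^ 2 / q ^ 2)
          ≤ 10 ^ 7 * H ^ 2 * (H * (√n * √n) * 2 ^ (-(N : ℝ) / 2) * t ^ 2 / q ^ 2) := by gcongr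
        _ = ε ^ 2 / 2 * (2 * 10 ^ 7 * H ^ 3 * X ^ 2 * 2 ^ (-(N : ℝ) / 2)) := by
            rw [hX]
            field_simp
        _ ≤ ε ^ 2 / 2 * 1 := mul_le_mul_of_nonneg_left hN1 (by positivity)
        _ = _ := mul_one _
    rw [mul_add (10 ^ 7 * D.κ ^ 2)]
    linarith
  · rw [expectedSamples_mlmc h]
    have h2 : (T : ℝ) ≤ (2 * rateConst H + 1) * R := by
      have := (Nat.ceil_lt_add_one hCR.le).le
      rw [← hT] at this
      linarith
    set c := 4 * Real.log (2 * 10 ^ 7 * H ^ 3) + 10 with hc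
    set l := 1 + Real.log X with hl
    have hA : (0 : ℝ) ≤ Fintype.card A := Nat.cast_nonneg _
    have h5 : ((N : ℝ) + 1) ^ 2 ≤ (c * l) ^ 2 := pow_le_pow_left₀ (by linarith) hN2 2
    calc 2 * (T : ℝ) * (n * Fintype.card A) * (N + 2)
        ≤ 2 * ((2 * rateConst H + 1) * R) * (n * Fintype.card A) * (2 * (N + 1)) := by
          gcongr
          linarith
      _ = 4 * (2 * rateConst H + 1) * (n * Fintype.card A * t ^ 2 / (ε ^ 2 * q ^ 2)) *
            ((N + 1) ^ 2 * n) := by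
          rw [hR, hG]
          ring
      -- One factor `N + 1` comes from the noise and one from the cost of a draw, whence the squared
      -- logarithm; the surplus `n` is replaced by its bound `card_le`.
      _ ≤ 4 * (2 * rateConst H + 1) * (n * Fintype.card A * t ^ 2 / (ε ^ 2 * q ^ 2)) *
            ((c * l) ^ 2 * 2 ^ (⌊H ^ 3⌋₊ + 1)) := by
          gcongr
      _ = _ := by
          unfold mlmcConst
          rw [← hc]
          ring

end RobustTD

/-! ### The two-point method for sequential estimators -/

section TwoPoint

variable {X Z : Type*} [Fintype X] [Fintype Z]

/-- The expectation of a function of some coordinates depends on the laws of these only. -/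
lemma sum_prodWeight_congr {ι : Type*} [Fintype ι] [DecidableEq ι] {w w' : ι → X → ℝ}
    (hw : ∀ i, w i ∈ stdSimplex ℝ X) (hw' : ∀ i, w' i ∈ stdSimplex ℝ X) {J : ι → Prop}
    (hJ : ∀ i, J i → w i = w' i) {f : (ι → X) → ℝ} (hf : ∀ x y, (∀ i, J i → x i = y i) → f x = f y) :
    ∑ x, prodWeight w x * f x = ∑ x, prodWeight w' x * f x := by
  classical
  -- An empty `X` carries no distribution, so then `ι` is empty; otherwise a default point `a` fills
  -- the coordinates that `f` ignores.
  rcases isEmpty_or_nonempty X with hX | ⟨⟨a⟩⟩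
  · rcases isEmpty_or_nonempty ι with hι | ⟨⟨i⟩⟩
    · have : w = w' := Subsingleton.elim _ _
      rw [this]
    · have := (hw i).2
      simp at this
  · set F : ({i // J i} → X) → ℝ := fun y => f fun i => if h : J i then y ⟨i, h⟩ else a with hF
    have e : ∀ x, f x = F (x ∘ Subtype.val) := fun x => by
      refine hf _ _ fun i hi => ?_
      simp [hi]
    simp_rw [e]
    rw [sum_prodWeight_comp (fun i => (hw i).2) Subtype.val_injective,
      sum_prodWeight_comp (fun i => (hw' i).2) Subtype.val_injective]
    have : (fun j : {i // J i} => w j) = fun j : {i // J i} => w' j := funext fun j => hJ j j.2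
    rw [this]

/-- The second moment of the likelihood ratio on the first `m` of `n` rounds. -/
lemma sum_likelihood_sq_le {r₀ r₁ : X → ℝ} (h₀ : r₀ ∈ stdSimplex ℝ X) (hpos : ∀ a, 0 < r₀ a)
    {b : ℝ} (hb1 : 1 ≤ b) (hb : ∑ a, r₁ a ^ 2 / r₀ a ≤ b) (n m : ℕ) :
    ∑ x, prodWeight (fun _ : Fin n => r₀) x *
      (∏ i : Fin n, if (i : ℕ) < m then r₁ (x i) / r₀ (x i) else 1) ^ 2 ≤ b ^ m := by
  classical
  have hb' : 0 ≤ ∑ a, r₁ a ^ 2 / r₀ a :=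
    Finset.sum_nonneg fun a _ => div_nonneg (sq_nonneg _) (hpos a).le
  have e : ∀ x : Fin n → X, prodWeight (fun _ : Fin n => r₀) x *
      (∏ i : Fin n, if (i : ℕ) < m then r₁ (x i) / r₀ (x i) else 1) ^ 2 =
      ∏ i : Fin n, if (i : ℕ) < m then r₁ (x i) ^ 2 / r₀ (x i) else r₀ (x i) := fun x => by
    rw [prodWeight, ← Finset.prod_pow, ← Finset.prod_mul_distrib]
    refine Finset.prod_congr rfl fun i _ => ?_
    have := (hpos (x i)).ne'
    split_ifs
    · field_simp
    · rw [one_pow, mul_one]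
  simp_rw [e]
  have h1 := Finset.prod_univ_sum (fun _ : Fin n => (Finset.univ : Finset X))
    (fun i a => if (i : ℕ) < m then r₁ a ^ 2 / r₀ a else r₀ a)
  rw [Fintype.piFinset_univ] at h1
  rw [← h1]
  have h2 : ∀ i : Fin n, (∑ a, if (i : ℕ) < m then r₁ a ^ 2 / r₀ a else r₀ a) ≤
      if (i : ℕ) < m then b else 1 := fun i => by
    split_ifs
    · exact hb
    · exact h₀.2.le
  refine (Finset.prod_le_prod (fun i _ => ?_) fun i _ => h2 i).trans ?_
  · split_ifs
    · exact hb'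
    · exact Finset.sum_nonneg fun a _ => h₀.1 a
  · rw [Finset.prod_ite, Finset.prod_const_one, mul_one, Finset.prod_const]
    refine pow_le_pow_right₀ hb1 ?_
    calc _ = ((Finset.univ.filter fun i : Fin n => (i : ℕ) < m).map Fin.valEmbedding).card :=
          (Finset.card_map _).symm
      _ ≤ (Finset.range m).card := Finset.card_le_card fun i hi => by
          simp only [Finset.mem_map, Finset.mem_filter, Finset.mem_univ, true_and] at hi
          obtain ⟨j, hj, rfl⟩ := hi
          exact Finset.mem_range.2 hj
      _ = m := Finset.card_range m

/-- Change of measure for a function of the seed and the first `m` rounds. -/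
lemma sq_expectation_le {r₀ r₁ : X → ℝ} (h₀ : r₀ ∈ stdSimplex ℝ X) (h₁ : r₁ ∈ stdSimplex ℝ X)
    (hpos : ∀ a, 0 < r₀ a) {b : ℝ} (hb1 : 1 ≤ b) (hb : ∑ a, r₁ a ^ 2 / r₀ a ≤ b) {n m : ℕ}
    {w : Z → ℝ} (hw : w ∈ stdSimplex ℝ Z) {f : Z → (Fin n → X) → ℝ} (hf0 : ∀ z x, 0 ≤ f z x)
    (hf1 : ∀ z x, f z x ≤ 1)
    (hf : ∀ z x y, (∀ i : Fin n, (i : ℕ) < m → x i = y i) → f z x = f z y) :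
    (∑ z, w z * ∑ x, prodWeight (fun _ : Fin n => r₁) x * f z x) ^ 2 ≤
      b ^ m * ∑ z, w z * ∑ x, prodWeight (fun _ : Fin n => r₀) x * f z x := by
  refine (weighted_sq_le hw _).trans ?_
  rw [Finset.mul_sum]
  refine Finset.sum_le_sum fun z _ => ?_
  rw [mul_left_comm]
  refine mul_le_mul_of_nonneg_left ?_ (hw.1 z)
  set L : (Fin n → X) → ℝ := fun x => ∏ i : Fin n, if (i : ℕ) < m then r₁ (x i) / r₀ (x i) else 1
    with hL
  have hW₀ : prodWeight (fun _ : Fin n => r₀) ∈ stdSimplex ℝ (Fin n → X) := prodWeight_mem fun _ => h₀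
  -- As `f z` ignores the rounds from `m` on, their law may be changed to `r₀`; the likelihood ratio
  -- then has only `m` factors.
  have e1 : ∑ x, prodWeight (fun _ : Fin n => r₁) x * f z x =
      ∑ x, prodWeight (fun _ : Fin n => r₀) x * (L x * f z x) := by
    rw [sum_prodWeight_congr (w' := fun i : Fin n => if (i : ℕ) < m then r₁ else r₀)
      (J := fun i : Fin n => (i : ℕ) < m) (fun _ => h₁) (fun i => by split_ifs <;> assumption)
      (fun i hi => by rw [if_pos hi]) (hf z)]
    refine Finset.sum_congr rfl fun x _ => ?_
    rw [← mul_assoc]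
    congr 1
    simp only [prodWeight, hL]
    rw [← Finset.prod_mul_distrib]
    refine Finset.prod_congr rfl fun i _ => ?_
    have := (hpos (x i)).ne'
    split_ifs
    · field_simp
    · rw [mul_one]
  rw [e1]
  refine (weighted_cauchy_schwarz hW₀ L (f z)).trans ?_
  refine mul_le_mul (sum_likelihood_sq_le h₀ hpos hb1 hb n m) ?_ ?_ (by positivity)
  · exact weighted_mono hW₀ fun x => by nlinarith [hf0 z x, hf1 z x]
  · exact weighted_nonneg hW₀ fun x => sq_nonneg _

end TwoPoint

/-! ### The two-state example -/

/-- The distribution on two points with mass `p` at `0`. -/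
def bernoulliDist (p : ℝ) (s : Fin 2) : ℝ := if s = 0 then p else 1 - p

lemma bernoulliDist_mem {p : ℝ} (hp : p ∈ Set.Icc (0 : ℝ) 1) :
    bernoulliDist p ∈ stdSimplex ℝ (Fin 2) := by
  refine ⟨fun s => ?_, by simp [bernoulliDist]⟩
  unfold bernoulliDist
  split_ifs
  · exact hp.1
  · linarith [hp.2]

lemma bernoulliMDP_nominal (U : UncertaintySet (Fin 2)) (p : ℝ) (s : Fin 2) (a : Unit) :
    (bernoulliMDP U p).nominal s a = bernoulliDist (if s = 0 then p else 1 / 2) := by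
  funext s'
  fin_cases s <;> fin_cases s' <;> simp [bernoulliMDP, bernoulliDist]
  norm_num

lemma bernoulliDist_dotProduct (p : ℝ) (V : Fin 2 → ℝ) :
    bernoulliDist p ⬝ᵥ V = V 1 + p * (V 0 - V 1) := by
  simp [bernoulliDist, dotProduct, Fin.sum_univ_two]
  ring

/-- The adversary spends the whole budget on moving mass `r / c 0 1` from the better state `0` to
state `1`; `hrp` says that this much is available. -/
lemma transportSupport_bernoulliDist {c : Fin 2 → Fin 2 → ℝ} {r p : ℝ} (hc0 : ∀ x y, 0 ≤ c x y)
    (hc : ∀ x, c x x = 0) (hc1 : 0 < c 0 1) (hr : 0 ≤ r) (hrp : r / c 0 1 ≤ p) (hp : p ≤ 1)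
    {V : Fin 2 → ℝ} (hV : V 1 ≤ V 0) :
    transportSupport c r (bernoulliDist p) V = V 1 + (p - r / c 0 1) * (V 0 - V 1) := by
  have ht : 0 ≤ r / c 0 1 := by positivity
  have hpm := bernoulliDist_mem (p := p) ⟨by linarith, hp⟩
  refine le_antisymm ?_ ?_
  · rw [← bernoulliDist_dotProduct]
    refine transportSupport_le ⟨fun x y => if x = 0 then (if y = 0 then p - r / c 0 1 else r / c 0 1)
      else (if y = 0 then 0 else 1 - p), ⟨fun x y => ?_, fun x => ?_, fun y => ?_⟩, ?_⟩ V
    · beta_reduce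
      split_ifs <;> linarith
    · fin_cases x <;> simp [bernoulliDist]
    · fin_cases y <;> simp [bernoulliDist]
      ring
    · simp [Fin.sum_univ_two, hc]
      rw [div_mul_cancel₀ _ hc1.ne']
  · obtain ⟨q, ⟨μ, ⟨hμ0, hμ1, hμ2⟩, hcost⟩, e⟩ := exists_transportSupport_eq hc hr hpm V
    rw [← e]
    simp only [Fin.sum_univ_two, hc, mul_zero, zero_add, add_zero] at hcost
    have a0 := hμ1 0
    have a1 := hμ1 1
    have b0 := hμ2 0
    have b1 := hμ2 1
    simp only [Fin.sum_univ_two, bernoulliDist, if_true, one_ne_zero, if_false] at a0 a1 b0 b1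
    have h1 : μ 0 1 ≤ r / c 0 1 := by
      rw [le_div_iff₀ hc1]
      have := mul_nonneg (hμ0 1 0) (hc0 1 0)
      linarith
    have h2 : q ⬝ᵥ V = V 1 + q 0 * (V 0 - V 1) := by
      rw [dotProduct, Fin.sum_univ_two]
      have : q 1 = 1 - q 0 := by linarith
      rw [this]
      ring
    rw [h2]
    have h3 : p - r / c 0 1 ≤ q 0 := by linarith [hμ0 1 0]
    have := mul_le_mul_of_nonneg_right h3 (sub_nonneg.2 hV)
    linarith

lemma bernoulliMDP_chain (U : UncertaintySet (Fin 2)) (p : ℝ) (s s' : Fin 2) :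
    (bernoulliMDP U p).chain (bernoulliMDP U p).nominal s s' =
      bernoulliDist (if s = 0 then p else 1 / 2) s' := by
  rw [← bernoulliMDP_nominal U p s ()]
  simp [RobustMDP.chain, bernoulliMDP]

lemma bernoulliMDP_admissible {U : UncertaintySet (Fin 2)} {p : ℝ} (hp : p ∈ Set.Ioo (0 : ℝ) 1)
    (hU : U.RadiusCondition ((bernoulliMDP U p).chain (bernoulliMDP U p).nominal)) :
    (bernoulliMDP U p).Admissible := by
  have hpos : ∀ s s', 0 < (bernoulliMDP U p).chain (bernoulliMDP U p).nominal s s' := fun s s' => by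
    rw [bernoulliMDP_chain]
    obtain ⟨h0, h1⟩ := hp
    fin_cases s <;> fin_cases s' <;> simp [bernoulliDist] <;> norm_num <;> linarith
  refine ⟨fun s a => ?_, fun s a => ?_, fun s => ?_, ?_, ?_, hU⟩
  · rw [bernoulliMDP_nominal]
    refine bernoulliDist_mem ?_
    split_ifs
    · exact ⟨hp.1.le, hp.2.le⟩
    · constructor <;> norm_num
  · fin_cases s <;> simp [bernoulliMDP]
  · exact ⟨fun _ => by simp [bernoulliMDP], by simp [bernoulliMDP]⟩
  · exact Matrix.IsPrimitive.isIrreducible ⟨fun i j => (hpos i j).le, 1, one_pos,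
      fun i j => by rw [pow_one]; exact hpos i j⟩
  · intro i k hk
    exact Nat.dvd_one.1 (hk 1 one_pos (by rw [pow_one]; exact hpos i i))

/-- The support function is affine in the nominal probability near `1 / 2`. -/
lemma exists_support_affine {U : UncertaintySet (Fin 2)} (h : (bernoulliMDP U (1 / 2)).Admissible) :
    ∃ a b Δ₀ : ℝ, 0 < a ∧ a ≤ 1 ∧ 0 < Δ₀ ∧ Δ₀ ≤ 1 / 4 ∧ ∀ p ∈ Set.Icc (1 / 2 : ℝ) (1 / 2 + Δ₀),
      U.RadiusCondition ((bernoulliMDP U p).chain (bernoulliMDP U p).nominal) ∧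
      ∀ V : Fin 2 → ℝ, V 1 ≤ V 0 →
        U.support (bernoulliDist p) V = V 1 + (a * p - b) * (V 0 - V 1) := by
  have hM : (bernoulliMDP U (1 / 2)).chain (bernoulliMDP U (1 / 2)).nominal ∈
      rowStochastic ℝ (Fin 2) := h.chain_mem fun s a =>
    UncertaintySet.self_mem_ball h.proper (h.nominal_mem s a)
  set M := (bernoulliMDP U (1 / 2)).chain (bernoulliMDP U (1 / 2)).nominal with hMdef
  have hrow : ∀ k : ℕ, (M ^ k) 0 0 + (M ^ k) 0 1 = 1 := fun k => by
    have := sum_row_of_mem_rowStochastic (pow_mem hM k) 0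
    rwa [Fin.sum_univ_two] at this
  have hentry : ∀ {p η : ℝ}, p ∈ Set.Icc (1 / 2 : ℝ) (1 / 2 + η) → 0 ≤ η → ∀ s s',
      1 / 2 - η ≤ (bernoulliMDP U p).chain (bernoulliMDP U p).nominal s s' := by
    intro p η hp hη s s'
    rw [bernoulliMDP_chain]
    obtain ⟨h0, h1⟩ := hp
    fin_cases s <;> fin_cases s' <;> simp [bernoulliDist] <;> norm_num <;> linarith
  have hrad := h.radius
  have hprop := h.proper
  cases U with
  | contamination δ =>
    obtain ⟨h0, h1⟩ := hprop
    refine ⟨1 - δ, 0, 1 / 4, by linarith, by linarith, by norm_num, le_rfl, fun p hp => ⟨⟨h0, h1⟩,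
      fun V hV => ?_⟩⟩
    rw [contamination_support_eq h0 h1 (bernoulliDist_mem ⟨by linarith [hp.1], by linarith [hp.2]⟩),
      bernoulliDist_dotProduct]
    have : ⨅ x, V x = V 1 := le_antisymm (iInf_finite_le V 1) (le_ciInf fun x => by
      fin_cases x
      · exact hV
      · exact le_rfl)
    rw [this]
    ring
  | totalVariation δ =>
    obtain ⟨h0, k, hk, -, hb⟩ := hrad
    have hk1 : (1 : ℝ) ≤ k := by exact_mod_cast hk
    -- Both entries of a row of `M ^ k` exceed `δ`, and they sum to one.
    have hδ : δ < 1 / 2 := by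
      have hb' : ∀ j, δ < (M ^ k) 0 j := fun j => by
        have h1 := hb 0 j
        rw [lt_div_iff₀ (by linarith)] at h1
        nlinarith
      linarith [hb' 0, hb' 1, hrow k]
    -- With half of the gap as range of `p`, all one-step entries still exceed `δ`, so the radius
    -- condition holds with `k = 1`.
    refine ⟨1, δ, (1 / 2 - δ) / 2, one_pos, le_rfl, by linarith, by linarith, fun p hp =>
      ⟨⟨h0, 1, le_rfl, fun i j => ?_, fun i j => ?_⟩, fun V hV => ?_⟩⟩
    · rw [pow_one]
      linarith [hentry hp (by linarith) i j]
    · rw [pow_one, Nat.cast_one, div_one]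
      linarith [hentry hp (by linarith) i j]
    · have h2 := transportSupport_bernoulliDist (c := fun x y : Fin 2 => if x = y then 0 else 1)
        (r := δ) (p := p) (fun x y => by positivity) (by simp) (by simp) h0
        (by simp; linarith [hp.1]) (by linarith [hp.2]) hV
      have h3 := totalVariation_ball_eq δ
        (bernoulliDist_mem (p := p) ⟨by linarith [hp.1], by linarith [hp.2]⟩)
      unfold UncertaintySet.support
      rw [h3]
      refine h2.trans ?_
      simp
  | wasserstein m l δ =>
    obtain ⟨hl, h0, k, hk, -, hb⟩ := hrad
    have hk1 : (1 : ℝ) ≤ k := by exact_mod_cast hk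
    set d := m.dist 0 1 with hd
    have hd0 : 0 < d := (@dist_pos _ m 0 1).2 (by norm_num)
    have hdc : m.dist 1 0 = d := @dist_comm _ m.toPseudoMetricSpace 1 0
    have hδ : 2 * δ < d := by
      have hb' : ∀ j, δ < d * (M ^ k) 0 j := fun j => by
        have h1 := hb 0 1 (by norm_num) 0 j
        rw [lt_div_iff₀ (by linarith), ← hd] at h1
        exact lt_of_le_of_lt (le_mul_of_one_le_right h0 hk1) h1
      have h1 : d * (M ^ k) 0 0 + d * (M ^ k) 0 1 = d := by rw [← mul_add, hrow, mul_one]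
      linarith [hb' 0, hb' 1]
    have hδd : δ / d < 1 / 2 := by
      rw [div_lt_iff₀ hd0]
      linarith
    have hδd0 : 0 ≤ δ / d := by positivity
    -- The mass moved is at most `δ / d < 1 / 2`, hence no more than what state `0` receives.
    have hpow : δ ^ l / d ^ l ≤ δ / d := by
      rw [← Real.div_rpow h0 hd0.le]
      exact Real.rpow_le_self_of_le_one hδd0 (by linarith) hl
    refine ⟨1, δ ^ l / d ^ l, (1 / 2 - δ / d) / 2, one_pos, le_rfl, by linarith, by linarith,
      fun p hp => ⟨⟨hl, h0, 1, le_rfl, fun i j => ?_, fun x y hxy i j => ?_⟩, fun V hV => ?_⟩⟩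
    · rw [pow_one]
      linarith [hentry hp (by linarith) i j]
    · have hxy' : m.dist x y = d := by
        fin_cases x <;> fin_cases y
        · exact absurd rfl hxy
        · rfl
        · exact hdc
        · exact absurd rfl hxy
      rw [pow_one, Nat.cast_one, div_one, hxy', ← div_lt_iff₀' hd0]
      linarith [hentry hp (by linarith) i j]
    · have hself : ∀ x, m.dist x x = 0 := @dist_self _ m.toPseudoMetricSpace
      have hnn : ∀ x y, 0 ≤ m.dist x y := fun x y => @dist_nonneg _ m.toPseudoMetricSpace x y
      have h2 := transportSupport_bernoulliDist (c := fun x y : Fin 2 => m.dist x y ^ l)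
        (r := δ ^ l) (p := p) (fun x y => Real.rpow_nonneg (hnn x y) l)
        (fun x => by simp only [hself]; exact Real.zero_rpow (by linarith))
        (Real.rpow_pos_of_pos hd0 l) (Real.rpow_nonneg h0 l)
        (by change δ ^ l / d ^ l ≤ p; linarith [hp.1]) (by linarith [hp.2]) hV
      have h3 := wasserstein_ball_eq m hl h0
        (bernoulliDist_mem (p := p) ⟨by linarith [hp.1], by linarith [hp.2]⟩)
      unfold UncertaintySet.support
      rw [h3]
      refine h2.trans ?_
      rw [one_mul]

/-- The anchored robust value function of the two-state example. -/
noncomputable def bernoulliValue (a : ℝ) (s₀ : Fin 2) (p : ℝ) (s : Fin 2) : ℝ :=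
  (if s = 0 then 1 / (1 - a * (p - 1 / 2)) else 0) -
    (if s₀ = 0 then 1 / (1 - a * (p - 1 / 2)) else 0)

/-- Subtracting the two Bellman equations cancels `b` and the gain and leaves `d = 1 + a * (p - 1 /
2) * d` for `d = V 0 - V 1`. -/
lemma bernoulliValue_isAnchored {U : UncertaintySet (Fin 2)} {a b p : ℝ}
    (h : (bernoulliMDP U p).Admissible) (s₀ : Fin 2) (hap : a * (p - 1 / 2) < 1)
    (hσ : ∀ V : Fin 2 → ℝ, V 1 ≤ V 0 →
      U.support (bernoulliDist p) V = V 1 + (a * p - b) * (V 0 - V 1))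
    (hσ' : ∀ V : Fin 2 → ℝ, V 1 ≤ V 0 →
      U.support (bernoulliDist (1 / 2)) V = V 1 + (a * (1 / 2) - b) * (V 0 - V 1)) :
    (bernoulliMDP U p).IsAnchoredRobustValue s₀ (bernoulliValue a s₀ p) := by
  set d := 1 / (1 - a * (p - 1 / 2)) with hd
  have hd0 : 0 < d := by
    rw [hd]
    exact one_div_pos.2 (by linarith)
  have hde : d * (1 - a * (p - 1 / 2)) = 1 := by
    rw [hd]
    exact one_div_mul_cancel (by linarith)
  set V := bernoulliValue a s₀ p with hV
  have hdiff : V 0 - V 1 = d := by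
    simp [hV, bernoulliValue, hd]
  have hle : V 1 ≤ V 0 := by linarith
  refine RobustMDP.isAnchoredRobustValue_of_fixedPoint (g := (a * (1 / 2) - b) * d) h ?_ ?_
  · fin_cases s₀ <;> simp [hV, bernoulliValue]
  · have h0 : (bernoulliMDP U p).sigma 0 () V = V 1 + (a * p - b) * d := by
      rw [RobustMDP.sigma, bernoulliMDP_nominal, if_pos rfl, ← hdiff]
      exact hσ V hle
    have h1 : (bernoulliMDP U p).sigma 1 () V = V 1 + (a * (1 / 2) - b) * d := by
      rw [RobustMDP.sigma, bernoulliMDP_nominal, if_neg (by norm_num), ← hdiff]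
      exact hσ' V hle
    funext s
    have hs : (bernoulliMDP U p).bellman ((a * (1 / 2) - b) * d) V s =
        (if s = 0 then 1 else 0) - (a * (1 / 2) - b) * d + (bernoulliMDP U p).sigma s () V := by
      simp [RobustMDP.bellman, bernoulliMDP]
    rw [hs]
    fin_cases s
    · simp only [Fin.zero_eta, if_true, h0]
      linarith
    · simp only [Fin.mk_one, h1]
      norm_num

/-- At the state that is not the anchor the value is `d` or `-d`, and `1 / (1 - a * Δ) - 1 ≥ a * Δ`.
-/
lemma norm_bernoulliValue_sub {a : ℝ} (s₀ : Fin 2) {Δ : ℝ} (ha : 0 ≤ a) (hΔ : 0 ≤ Δ)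
    (haΔ : a * Δ < 1) : a * Δ ≤ ‖bernoulliValue a s₀ (1 / 2 + Δ) - bernoulliValue a s₀ (1 / 2)‖ := by
  have h1 : a * Δ ≤ 1 / (1 - a * Δ) - 1 := by
    have : 0 ≤ a * Δ := mul_nonneg ha hΔ
    rw [le_sub_iff_add_le, le_div_iff₀ (by linarith)]
    nlinarith
  have h2 : ∀ s, |(bernoulliValue a s₀ (1 / 2 + Δ) - bernoulliValue a s₀ (1 / 2)) s| ≤
      ‖bernoulliValue a s₀ (1 / 2 + Δ) - bernoulliValue a s₀ (1 / 2)‖ :=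
    fun s => norm_le_pi_norm (bernoulliValue a s₀ (1 / 2 + Δ) - bernoulliValue a s₀ (1 / 2)) s
  fin_cases s₀
  · refine le_trans ?_ (h2 1)
    simp [bernoulliValue]
    rw [← one_div, ← abs_neg]
    exact h1.trans (le_trans (le_of_eq (by ring)) (le_abs_self _))
  · refine le_trans ?_ (h2 0)
    simp [bernoulliValue]
    rw [← one_div]
    exact h1.trans (le_abs_self _)

/-! ### The lower bound -/

lemma sum_prodWeight {ι X : Type*} [Fintype ι] [Fintype X] [DecidableEq ι] (w : ι → X → ℝ) :
    ∑ x, prodWeight w x = ∏ i, ∑ a, w i a := by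
  have := Finset.prod_univ_sum (fun _ : ι => (Finset.univ : Finset X)) w
  rw [Fintype.piFinset_univ] at this
  exact this.symm

namespace RobustMDP

variable {S A : Type*} [Fintype S] [Fintype A] [DecidableEq S] [DecidableEq A]

/-- The law of one round of samples of the nominal kernel. -/
noncomputable def roundWeight (I : RobustMDP S A) : (S → A → S) → ℝ :=
  prodWeight fun s => prodWeight (I.nominal s)

lemma roundWeight_mem {I : RobustMDP S A} (h : I.Admissible) :
    I.roundWeight ∈ stdSimplex ℝ (S → A → S) :=
  prodWeight_mem fun s => prodWeight_mem (h.nominal_mem s)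

lemma dataExpectation_eq {Z : Type*} [Fintype Z] (I : RobustMDP S A) (w : Z → ℝ) (n : ℕ)
    (f : Z → (Fin n → S → A → S) → ℝ) :
    dataExpectation I w n f =
      ∑ z, w z * ∑ x, prodWeight (fun _ : Fin n => I.roundWeight) x * f z x := by
  unfold dataExpectation
  refine Finset.sum_congr rfl fun z _ => ?_
  rw [Finset.mul_sum]
  refine Finset.sum_congr rfl fun x _ => ?_
  rw [mul_assoc]
  rfl

end RobustMDP

/-- Only the sample from state `0` depends on `p`; that from state `1` contributes the factor one.
-/
lemma sum_roundWeight_sq_div (U : UncertaintySet (Fin 2)) (Δ : ℝ) :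
    ∑ y, (bernoulliMDP U (1 / 2 + Δ)).roundWeight y ^ 2 / (bernoulliMDP U (1 / 2)).roundWeight y =
      1 + 4 * Δ ^ 2 := by
  have e : ∀ y, (bernoulliMDP U (1 / 2 + Δ)).roundWeight y ^ 2 /
      (bernoulliMDP U (1 / 2)).roundWeight y = prodWeight (fun s => prodWeight fun a x =>
        (bernoulliMDP U (1 / 2 + Δ)).nominal s a x ^ 2 / (bernoulliMDP U (1 / 2)).nominal s a x) y :=
    fun y => by
      simp only [RobustMDP.roundWeight, prodWeight, Finset.prod_pow, Finset.prod_div_distrib]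
  simp_rw [e, sum_prodWeight]
  simp [Fin.prod_univ_two, Fin.sum_univ_two, bernoulliMDP_nominal, bernoulliDist]
  ring

lemma roundWeight_pos (U : UncertaintySet (Fin 2)) (y : Fin 2 → Unit → Fin 2) :
    0 < (bernoulliMDP U (1 / 2)).roundWeight y := by
  simp only [RobustMDP.roundWeight, prodWeight]
  refine Finset.prod_pos fun s _ => Finset.prod_pos fun a _ => ?_
  rw [bernoulliMDP_nominal]
  simp only [bernoulliDist, ite_self]
  split_ifs <;> norm_num

lemma dataExpectation_mono {S A Z : Type*} [Fintype S] [Fintype A] [DecidableEq S] [DecidableEq A]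
    [Fintype Z] {I : RobustMDP S A} (h : I.Admissible) {w : Z → ℝ} (hw : w ∈ stdSimplex ℝ Z) {n : ℕ}
    {f g : Z → (Fin n → S → A → S) → ℝ} (hfg : ∀ z x, f z x ≤ g z x) :
    dataExpectation I w n f ≤ dataExpectation I w n g := by
  rw [RobustMDP.dataExpectation_eq, RobustMDP.dataExpectation_eq]
  exact weighted_mono hw fun z => weighted_mono
    (prodWeight_mem fun _ => RobustMDP.roundWeight_mem h) (hfg z)

lemma dataExpectation_linear {S A Z : Type*} [Fintype S] [Fintype A] [DecidableEq S] [DecidableEq A]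
    [Fintype Z] (I : RobustMDP S A) (w : Z → ℝ) (n : ℕ) (f g : Z → (Fin n → S → A → S) → ℝ)
    (c d : ℝ) : dataExpectation I w n (fun z x => c * f z x + d * g z x) =
      c * dataExpectation I w n f + d * dataExpectation I w n g := by
  unfold dataExpectation
  simp_rw [Finset.mul_sum, ← Finset.sum_add_distrib]
  refine Finset.sum_congr rfl fun z _ => Finset.sum_congr rfl fun x _ => by ring

lemma dataExpectation_const {S A Z : Type*} [Fintype S] [Fintype A] [DecidableEq S] [DecidableEq A]
    [Fintype Z] {I : RobustMDP S A} (h : I.Admissible) {w : Z → ℝ} (hw : w ∈ stdSimplex ℝ Z)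
    (n : ℕ) (c : ℝ) : dataExpectation I w n (fun _ _ => c) = c := by
  rw [RobustMDP.dataExpectation_eq]
  simp_rw [weighted_const (prodWeight_mem fun _ : Fin n => RobustMDP.roundWeight_mem h)]
  exact weighted_const hw c

/-- Estimation with accuracy `ε` takes of the order of `1 / ε ^ 2` rounds. -/
lemma exists_round_lower_bound (U : UncertaintySet (Fin 2))
    (h : (bernoulliMDP U (1 / 2)).Admissible) :
    ∃ c ε₀ : ℝ, 0 < c ∧ 0 < ε₀ ∧
      ∀ (s₀ : Fin 2) (ε : ℝ), 0 < ε → ε ≤ ε₀ →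
      ∀ (Z : Type) [Fintype Z] (w : Z → ℝ), w ∈ stdSimplex ℝ Z →
      ∀ (n : ℕ) (F : SequentialEstimator (Fin 2) Unit Z n),
        (∀ p ∈ Set.Ioo (0 : ℝ) 1, (bernoulliMDP U p).Admissible →
          ∀ V, (bernoulliMDP U p).IsAnchoredRobustValue s₀ V →
            dataExpectation (bernoulliMDP U p) w n (fun z x => ‖F.est z x - V‖ ^ 2) ≤ ε ^ 2) →
        ∃ p ∈ Set.Ioo (0 : ℝ) 1, (bernoulliMDP U p).Admissible ∧
          c / ε ^ 2 ≤ dataExpectation (bernoulliMDP U p) w n (fun z x => (F.rounds z x : ℝ)) := by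
  classical
  obtain ⟨a, b, Δ₀, ha0, ha1, hΔ₀, hΔ₀', hU⟩ := exists_support_affine h
  -- The number `2048` makes `y * (4 * Δ ^ 2) = 1` for the values of `y` and `Δ` below, so the
  -- likelihood ratio has second moment at most `exp 1`; `ε ≤ a * Δ₀ / 8` ensures `Δ ≤ Δ₀`.
  refine ⟨a ^ 2 / 2048, a * Δ₀ / 8, by positivity, by positivity, ?_⟩
  intro s₀ ε hε hεε Z _ w hw n F hF
  -- The two value functions are then at least `8 * ε` apart, so no estimate is within `4 * ε` of
  -- both.
  set Δ := 8 * ε / a with hΔ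
  have haΔ : a * Δ = 8 * ε := by
    rw [hΔ]
    field_simp
  have hΔ0 : 0 < Δ := by positivity
  have hΔ1 : Δ ≤ Δ₀ := by
    rw [hΔ, div_le_iff₀ ha0]
    linarith
  have hmem0 : (1 / 2 : ℝ) ∈ Set.Icc (1 / 2 : ℝ) (1 / 2 + Δ₀) := ⟨le_rfl, by linarith⟩
  have hmem1 : (1 / 2 + Δ : ℝ) ∈ Set.Icc (1 / 2 : ℝ) (1 / 2 + Δ₀) := ⟨by linarith, by linarith⟩
  have hp0 : (1 / 2 : ℝ) ∈ Set.Ioo (0 : ℝ) 1 := by constructor <;> norm_num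
  have hp1 : (1 / 2 + Δ : ℝ) ∈ Set.Ioo (0 : ℝ) 1 := ⟨by linarith, by linarith⟩
  have h1 := bernoulliMDP_admissible hp1 (hU _ hmem1).1
  refine ⟨1 / 2, hp0, h, ?_⟩
  by_contra! hlt
  have haΔ1 : a * Δ < 1 := by nlinarith
  have hE0 := hF _ hp0 h _ (bernoulliValue_isAnchored h s₀ (by norm_num) (hU _ hmem0).2
    (hU _ hmem0).2)
  have hE1 := hF _ hp1 h1 _ (bernoulliValue_isAnchored h1 s₀ (by rwa [add_sub_cancel_left])
    (hU _ hmem1).2 (hU _ hmem0).2)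
  have hsep := norm_bernoulliValue_sub s₀ ha0.le hΔ0.le haΔ1
  rw [haΔ] at hsep
  set V₀ := bernoulliValue a s₀ (1 / 2) with hV₀
  set V₁ := bernoulliValue a s₀ (1 / 2 + Δ) with hV₁
  -- Eight times the supposed bound on the mean number of rounds: by Markov's inequality it is
  -- reached with probability at most `1 / 8`.
  set y : ℝ := 8 * (a ^ 2 / 2048 / ε ^ 2) with hy
  have hy0 : 0 < y := by positivity
  set m := ⌊y⌋₊ with hm
  set f : Z → (Fin n → Fin 2 → Unit → Fin 2) → ℝ := fun z x =>
    if ‖F.est z x - V₀‖ < 4 * ε ∧ F.rounds z x ≤ m then 0 else 1 with hf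
  have hf0 : ∀ z x, 0 ≤ f z x := fun z x => by
    simp only [hf]
    split_ifs <;> norm_num
  have hf1 : ∀ z x, f z x ≤ 1 := fun z x => by
    simp only [hf]
    split_ifs <;> norm_num
  -- the test depends on the first rounds only
  have hdep : ∀ z x x', (∀ i : Fin n, (i : ℕ) < m → x i = x' i) → f z x = f z x' := by
    intro z x x' hxx
    have key : ∀ x x' : Fin n → Fin 2 → Unit → Fin 2, (∀ i : Fin n, (i : ℕ) < m → x i = x' i) →
        (‖F.est z x - V₀‖ < 4 * ε ∧ F.rounds z x ≤ m) →
        (‖F.est z x' - V₀‖ < 4 * ε ∧ F.rounds z x' ≤ m) := by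
      rintro x x' hxx ⟨h2, h3⟩
      obtain ⟨e1, e2⟩ := F.nonanticipating z x x' fun i hi => hxx i (hi.trans_le h3)
      rw [e1, e2]
      exact ⟨h2, h3⟩
    simp only [hf]
    exact if_congr ⟨key x x' hxx, key x' x fun i hi => (hxx i hi).symm⟩ rfl rfl
  -- the test rarely rejects the truth
  have hP0 : dataExpectation (bernoulliMDP U (1 / 2)) w n f ≤ 3 / 16 := by
    have hpt : ∀ z x, f z x ≤ 1 / (16 * ε ^ 2) * ‖F.est z x - V₀‖ ^ 2 + 1 / y * F.rounds z x := by
      intro z x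
      have n1 : 0 ≤ 1 / (16 * ε ^ 2) * ‖F.est z x - V₀‖ ^ 2 := by positivity
      have n2 : 0 ≤ 1 / y * (F.rounds z x : ℝ) := by positivity
      simp only [hf]
      split_ifs with hc
      · linarith
      · rw [not_and_or, not_lt, not_le] at hc
        rcases hc with hc | hc
        · have h2 := pow_le_pow_left₀ (by positivity) hc 2
          have h3 : 1 ≤ 1 / (16 * ε ^ 2) * ‖F.est z x - V₀‖ ^ 2 := by
            rw [one_div_mul_eq_div, le_div_iff₀ (by positivity)]
            linarith
          linarith
        · have h2 : y ≤ F.rounds z x := (Nat.lt_of_floor_lt hc).le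
          have h3 : 1 ≤ 1 / y * (F.rounds z x : ℝ) := by
            rw [one_div_mul_eq_div, le_div_iff₀ hy0]
            linarith
          linarith
    refine (dataExpectation_mono h hw hpt).trans ?_
    rw [dataExpectation_linear]
    have h2 : 1 / (16 * ε ^ 2) * dataExpectation (bernoulliMDP U (1 / 2)) w n
        (fun z x => ‖F.est z x - V₀‖ ^ 2) ≤ 1 / 16 := by
      refine (mul_le_mul_of_nonneg_left hE0 (by positivity)).trans (le_of_eq ?_)
      field_simp
    have h3 : 1 / y * dataExpectation (bernoulliMDP U (1 / 2)) w n
        (fun z x => (F.rounds z x : ℝ)) ≤ 1 / 8 := by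
      refine (mul_le_mul_of_nonneg_left hlt.le (by positivity)).trans (le_of_eq ?_)
      rw [hy]
      field_simp
    linarith
  -- the test mostly rejects the alternative
  have hP1 : 15 / 16 ≤ dataExpectation (bernoulliMDP U (1 / 2 + Δ)) w n f := by
    have hpt : ∀ z x, 1 ≤ 1 * f z x + 1 / (16 * ε ^ 2) * ‖F.est z x - V₁‖ ^ 2 := by
      intro z x
      have n1 : 0 ≤ 1 / (16 * ε ^ 2) * ‖F.est z x - V₁‖ ^ 2 := by positivity
      simp only [hf]
      split_ifs with hc
      · have h2 : 4 * ε ≤ ‖F.est z x - V₁‖ := by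
          have h3 := norm_sub_le_norm_sub_add_norm_sub V₁ (F.est z x) V₀
          rw [norm_sub_rev V₁ (F.est z x)] at h3
          linarith [hc.1]
        have h4 := pow_le_pow_left₀ (by positivity) h2 2
        have h3 : 1 ≤ 1 / (16 * ε ^ 2) * ‖F.est z x - V₁‖ ^ 2 := by
          rw [one_div_mul_eq_div, le_div_iff₀ (by positivity)]
          linarith
        linarith
      · linarith
    have h2 := dataExpectation_mono h1 hw hpt
    rw [dataExpectation_const h1 hw, dataExpectation_linear] at h2
    have h3 : 1 / (16 * ε ^ 2) * dataExpectation (bernoulliMDP U (1 / 2 + Δ)) w n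
        (fun z x => ‖F.est z x - V₁‖ ^ 2) ≤ 1 / 16 := by
      refine (mul_le_mul_of_nonneg_left hE1 (by positivity)).trans (le_of_eq ?_)
      field_simp
    linarith
  have hcs := sq_expectation_le (RobustMDP.roundWeight_mem h) (RobustMDP.roundWeight_mem h1)
    (roundWeight_pos U) (b := 1 + 4 * Δ ^ 2) (by nlinarith [sq_nonneg Δ])
    (sum_roundWeight_sq_div U Δ).le hw hf0 hf1 hdep
  rw [← RobustMDP.dataExpectation_eq, ← RobustMDP.dataExpectation_eq] at hcs
  have hpow : (1 + 4 * Δ ^ 2) ^ m ≤ Real.exp 1 := by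
    have h2 : 1 + 4 * Δ ^ 2 ≤ Real.exp (4 * Δ ^ 2) := by
      linarith [Real.add_one_le_exp (4 * Δ ^ 2)]
    refine (pow_le_pow_left₀ (by positivity) h2 m).trans ?_
    rw [← Real.exp_nat_mul, Real.exp_le_exp]
    have h3 : (m : ℝ) ≤ y := Nat.floor_le hy0.le
    refine (mul_le_mul_of_nonneg_right h3 (by positivity)).trans (le_of_eq ?_)
    rw [hy, hΔ]
    field_simp
    norm_num
  -- The contradiction is `(15 / 16) ^ 2 > exp 1 * (3 / 16)`.
  have h2 := pow_le_pow_left₀ (by norm_num) hP1 2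
  have h3 : (1 + 4 * Δ ^ 2) ^ m * dataExpectation (bernoulliMDP U (1 / 2)) w n f ≤
      Real.exp 1 * (3 / 16) :=
    mul_le_mul hpow hP0 (by
      rw [← dataExpectation_const h hw n 0]
      exact dataExpectation_mono h hw hf0) (Real.exp_pos 1).le
  have h4 := Real.exp_one_lt_d9
  norm_num at h2
  linarith

/-! ### Assembly of the theorem -/

theorem theorem7 :
    -- the constant `C₀` is absolute
    (∃ C₀ : ℝ, 1 ≤ C₀ ∧
      -- well-posedness, contraction, and finite-time bounds
      (∀ (S : Type u) (A : Type v) [Fintype S] [Fintype A] [DecidableEq S] [DecidableEq A]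
        (I : RobustMDP S A) (s₀ : S), I.Admissible →
        BddAbove I.mixingTimes ∧
        (∃! V : S → ℝ, I.IsAnchoredRobustValue s₀ V) ∧
        (∀ V, I.IsAnchoredRobustValue s₀ V →
          ∃ g, I.IsRobustAverageReward g ∧ ∀ s, V s = I.bellman g V s) ∧
        RobustMDP.jointSpectralRadius I.fluctuations < 1 ∧
        (∀ α ∈ Set.Ioo (RobustMDP.jointSpectralRadius I.fluctuations) 1,
          ∀ ε ∈ Set.Ioo 0 (1 - α), ∃ D : AnalysisData S, D.Valid I ∧
            (∀ x, D.N x = I.robustSeminorm α ε x) ∧ D.γ = α + ε ∧ (1 - D.γ) / 2 ≤ D.α₂) ∧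
        ∀ D : AnalysisData S, D.Valid I →
          (∀ (g : ℝ) (V₁ V₂ : S → ℝ),
            D.N (I.bellman g V₁ - I.bellman g V₂) ≤ D.γ * D.N (V₁ - V₂)) ∧
          ∀ V, I.IsAnchoredRobustValue s₀ V →
          ∀ (V₀ : S → ℝ) (β : ℕ → ℝ) (T : ℕ) (K : ℝ),
            (∀ δ, I.unc = UncertaintySet.contamination δ →
              max (C₀ * D.κ ^ 2 * D.Λ / D.α₂ ^ 2) 3 ≤ K →
              RobustTD.meanSqError I (contaminationSampler I δ) s₀
                  (RobustTD.stepSize D.α₂ K) β V₀ T V ≤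
                C₀ * D.κ ^ 2 * (D.cu / D.cl * (K ^ 2 / (T + K) ^ 2) * ‖V₀ - V‖ ^ 2
                  + D.Λ * I.tMix ^ 2 / ((T + K) * D.α₂ ^ 2))) ∧
            (I.unc.IsTVOrWasserstein → ∀ Nmax : ℕ,
              max (C₀ * D.κ ^ 2 * D.Λ * (Fintype.card S * (Nmax + 1)) / D.α₂ ^ 2) 3 ≤ K →
              RobustTD.meanSqError I (mlmcSampler I Nmax) s₀
                  (RobustTD.stepSize D.α₂ K) β V₀ T V ≤
                C₀ * D.κ ^ 2 * (D.cu / D.cl * (K ^ 2 / (T + K) ^ 2) * ‖V₀ - V‖ ^ 2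
                  + D.Λ * (Fintype.card S * (Nmax + 1)) * I.tMix ^ 2 / ((T + K) * D.α₂ ^ 2)
                  + D.cu / D.cl * Real.sqrt (Fintype.card S) * 2 ^ (-(Nmax : ℝ) / 2)
                    * I.tMix ^ 2 / (1 - D.γ) ^ 2))) ∧
      -- sample complexity; the constant `C` depends only on `H`
      (∀ H : ℝ, ∃ C : ℝ, 0 < C ∧
        ∀ (S : Type u) (A : Type v) [Fintype S] [Fintype A] [DecidableEq S] [DecidableEq A]
          (I : RobustMDP S A) (s₀ : S), I.Admissible →
        ∀ D : AnalysisData S, D.Valid I → D.BoundedBy H →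
        ∀ V, I.IsAnchoredRobustValue s₀ V →
        ∀ (V₀ : S → ℝ) (β : ℕ → ℝ), ‖V₀‖ ≤ H →
        ∀ ε ∈ Set.Ioc (0 : ℝ) 1,
          (∀ δ, I.unc = UncertaintySet.contamination δ →
            ∃ T : ℕ,
              RobustTD.meanSqError I (contaminationSampler I δ) s₀
                (RobustTD.stepSize D.α₂ (max (C₀ * D.κ ^ 2 * D.Λ / D.α₂ ^ 2) 3)) β V₀ T V
                ≤ ε ^ 2 ∧
              RobustTD.expectedSamples (contaminationSampler I δ) T ≤
                C * (Fintype.card S * Fintype.card A * I.tMix ^ 2 / (ε ^ 2 * (1 - D.γ) ^ 2))) ∧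
          (I.unc.IsTVOrWasserstein →
            ∃ T Nmax : ℕ,
              RobustTD.meanSqError I (mlmcSampler I Nmax) s₀
                (RobustTD.stepSize D.α₂
                  (max (C₀ * D.κ ^ 2 * D.Λ * (Fintype.card S * (Nmax + 1)) / D.α₂ ^ 2) 3))
                β V₀ T V ≤ ε ^ 2 ∧
              RobustTD.expectedSamples (mlmcSampler I Nmax) T ≤
                C * (Fintype.card S * Fintype.card A * I.tMix ^ 2 / (ε ^ 2 * (1 - D.γ) ^ 2)) *
                  (1 + Real.log (Real.sqrt (Fintype.card S) * I.tMix / (ε * (1 - D.γ)))) ^ 2))) ∧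
    -- order-optimality in `ε`
    (∀ U : UncertaintySet (Fin 2), (bernoulliMDP U (1 / 2)).Admissible →
      ∃ c ε₀ : ℝ, 0 < c ∧ 0 < ε₀ ∧
      ∀ (s₀ : Fin 2) (ε : ℝ), 0 < ε → ε ≤ ε₀ →
      ∀ (Z : Type) [Fintype Z] (w : Z → ℝ), w ∈ stdSimplex ℝ Z →
      ∀ (n : ℕ) (F : SequentialEstimator (Fin 2) Unit Z n),
        (∀ p ∈ Set.Ioo (0 : ℝ) 1, (bernoulliMDP U p).Admissible →
          ∀ V, (bernoulliMDP U p).IsAnchoredRobustValue s₀ V →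
            dataExpectation (bernoulliMDP U p) w n (fun z x => ‖F.est z x - V‖ ^ 2) ≤ ε ^ 2) →
        ∃ p ∈ Set.Ioo (0 : ℝ) 1, (bernoulliMDP U p).Admissible ∧
          c / ε ^ 2 ≤ dataExpectation (bernoulliMDP U p) w n (fun z x => (F.rounds z x : ℝ))) := by
  -- A round number above all constants that occur, the largest being `576 * 1456`.
  refine ⟨⟨10 ^ 7, by norm_num, ?_, ?_⟩, exists_round_lower_bound⟩
  · intro S A _ _ _ _ I s₀ h
    have : Nonempty S := ⟨s₀⟩
    refine ⟨h.bddAbove_mixingTimes_and.1, RobustMDP.existsUnique_isAnchoredRobustValue h s₀,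
      fun V hV => ?_, h.jointSpectralRadius_lt_one, fun α hα ε hε => h.exists_analysisData hα hε,
      fun D hD => ⟨fun g V₁ V₂ =>
        RobustMDP.envelopeBellman_contraction h h.sigma_isEnvelopeFamily hD g V₁ V₂,
      fun V hV V₀ β T K => ⟨fun δ hU hK =>
        RobustTD.meanSqError_contamination_le h hD hV hU hK β V₀ T,
      fun hU N hK => RobustTD.meanSqError_mlmc_le h hD hV hU N hK β V₀ T⟩⟩⟩
    obtain ⟨g, hg, hfix⟩ := RobustMDP.fixedPoint_of_isAnchoredRobustValue h hV
    exact ⟨g, hg, fun s => congrFun hfix s⟩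
  · intro H
    by_cases hH1 : 1 ≤ H
    · have hr := RobustTD.rateConst_pos hH1
      refine ⟨max (2 * (RobustTD.rateConst H + 1)) (RobustTD.mlmcConst H),
        lt_max_of_lt_left (by positivity), ?_⟩
      intro S A _ _ _ _ I s₀ h D hD hH V hV V₀ β hV₀ ε hε
      have hγ : 0 < 1 - D.γ := by linarith [hD.γ_mem.2]
      refine ⟨fun δ hU => ?_, fun hU => ?_⟩
      · obtain ⟨T, h1, h2⟩ := RobustTD.exists_contamination_run h hD hH hV V₀ β hV₀ hε hU
        exact ⟨T, h1, h2.trans (mul_le_mul_of_nonneg_right (le_max_left _ _) (by positivity))⟩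
      · obtain ⟨T, N, h1, h2⟩ := RobustTD.exists_mlmc_run h hD hH hV V₀ β hV₀ hε hU
        exact ⟨T, N, h1, h2.trans (mul_le_mul_of_nonneg_right (mul_le_mul_of_nonneg_right
          (le_max_right _ _) (by positivity)) (sq_nonneg _))⟩
    -- For `H < 1` no analysis data qualify, because `κ ≥ 1`.
    · refine ⟨1, one_pos, ?_⟩
      intro S A _ _ _ _ I s₀ h D hD hH
      exact absurd (RobustTD.one_le_of_boundedBy hD hH) hH1
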